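/- \textbf{Setting.} The (scalar-free) qutrit ZX-calculus is the self-dual strict compact closed PROP generated by green spiders $Z^{(n,m)}(\alpha,\beta)$, red spiders $X^{(n,m)}(\alpha,\beta)$ ($n,m\in\mathbb N$, $\alpha,\beta\in\mathbb R/2\pi\mathbb Z$), the Hadamard node $H$, swap, identity wire, empty diagram, cap and cup. Put $\omega=e^{2\pi i/3}$, $|h_j\rangle=\sum_{k}\omega^{jk}|k\rangle$ ($j=0,1,2$), $H^\dagger:=H\circ H\circ H$, and $\theta_0=1,\ \theta_1=e^{i\alpha},\ \theta_2=e^{i\beta}$. The standard interpretation $\llbracket\cdot\rrbracket$ is the monoidal functor to matrices over $\mathbb C$ with $$\llbracket Z^{(n,m)}(\alpha,\beta)\rrbracket=\sum_j\theta_j|j\rangle^{\otimes m}\langle j|^{\otimes n},\qquad \llbracket X^{(n,m)}(\alpha,\beta)\rrbracket=\sum_j\theta_j|h_j\rangle^{\otimes m}\langle h_j|^{\otimes n},\qquad \llbracket H\rrbracket=\sum_{j,k}\omega^{jk}|j\rangle\langle k|,$$ swap, wire, empty diagram, cap $\sum_j|jj\rangle$ and cup $\sum_j\langle jj|$ being interpreted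 as usual. Below, $0,1,2$ in a phase denote the angles $0,2\pi/3,4\pi/3$, and spiders without phases have phases $(0,0)$. Besides the structural equations, the rules are (each with its upside-down version where this is listed): \begin{itemize} \item (S1) two green spiders joined by at least one wire fuse and their phases add; legs of a green spider may be interchanged; (S2) $Z^{(1,1)}$ is the wire; (S3) $Z^{(0,2)}$ is the cap and $Z^{(2,0)}$ is the cup. \item (B1) $Z^{(1,2)}\circ X^{(0,1)}=X^{(0,1)}\otimes X^{(0,1)}$ and $X^{(1,0)}\circ Z^{(2,1)}=X^{(1,0)}\otimes X^{(1,0)}$; (B2) $Z^{(1,2)}\circ X^{(2,1)}=(X^{(2,1)}\otimes X^{(2,1)})\circ(1\otimes\sigma\otimes1)\circ(Z^{(1,2)}\otimes Z^{(1,2)})$, and the same with the directions reversed. \item (K1) for $x=X^{(1,1)}(k,2k)$, $k\in\mathbb Z_3$: $Z^{(1,2)}\circ x=(x\otimes x)\circ Z^{(1,2)}$ and $x\circ Z^{(2,1)}=Z^{(2,1)}\circ(x\otimes x)$; (K2) $X^{(1,1)}(1,2)\circ Z^{(1,1)}(\alpha,\beta)=Z^{(1,1)}(\beta-\alpha,-\alpha)\circ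 X^{(1,1)}(1,2)$ and $X^{(1,1)}(2,1)\circ Z^{(1,1)}(\alpha,\beta)=Z^{(1,1)}(-\beta,\alpha-\beta)\circ X^{(1,1)}(2,1)$. \item (H1) $H^\dagger\circ H$ is the wire; (P1) $H\circ H=H^\dagger\circ H^\dagger$; (EU) $H=Z^{(1,1)}(2,2)\circ X^{(1,1)}(2,2)\circ Z^{(1,1)}(2,2)$; (H2) $X^{(n,m)}(\alpha,\beta)=H^{\otimes m}\circ Z^{(n,m)}(\alpha,\beta)\circ (H^\dagger)^{\otimes n}$; (H2$'$) $X^{(n,m)}(\beta,\alpha)=(H^\dagger)^{\otimes m}\circ Z^{(n,m)}(\alpha,\beta)\circ H^{\otimes n}$. \item Non-zero scalars are ignored: if $s\otimes D=t\otimes E$ for diagrams $s,t:0\to0$ with $\llbracket s\rrbracket\ne0\ne\llbracket t\rrbracket$, then $D=E$. \end{itemize} A diagram $D$ \emph{can be rewritten} into $E$ if $D=E$ follows from these rules. \textbf{Definitions.} A \emph{stabilizer diagram} is a diagram all of whose phase angles are integer multiples of $2\pi/3$; a \emph{stabilizer state diagram} is a stabilizer diagram $D:0\to n$ with $\llbracket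 D\rrbracket\neq0$. For a $\mathbb Z_3$-weighted graph on $n$ vertices, with symmetric, zero-diagonal adjacency matrix $\Gamma$, the \emph{graph state diagram} is obtained from one green node $Z^{(0,1)}$ for each vertex by attaching, for every pair $u<v$ with $\Gamma_{uv}\ne 0$, an edge joining the output wires of $u$ and $v$: a green node on each of the two wires, connected by an $H$ node if $\Gamma_{uv}=1$ and by an $H^\dagger$ node if $\Gamma_{uv}=2$ (by (S1), all green nodes on the wire of $v$ fuse to a single green node with one output). A \emph{GS-LC diagram} is a graph state diagram with a single-qutrit Clifford diagram (a composite of Hadamard nodes and green and red phase nodes with angles in $\frac{2\pi}3\mathbb Z$), called a vertex operator, applied to each output. A \emph{reduced GS-LC diagram} is a GS-LC diagram such that 1. every vertex operator belongs to $$\mathcal R=\{Z^{(1,1)}(a,b): a,b\in\mathbb Z_3\}\ \cup\ \{X^{(1,1)}(p,p)\circ Z^{(1,1)}(p+m,p+2m): p\in\{1,2\},\ m\in\mathbb Z_3\};$$ 2. no two adjacent vertices (that is, $\Gamma_{uv}\neq0$) both have vertex operators containing a red node. \textbf{Theorem.} In the qutrit ZX-calculus, every stabilizer state diagram can be rewritten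 into a GS-LC diagram, and this can further be rewritten into a reduced GS-LC diagram. -/

import Mathlib

/-! ### Diagrams -/

/-- Terms denoting qutrit ZX-diagrams with `n` inputs and `m` outputs (read from top to bottom).
`Z n m α β` is the green spider, `X n m α β` the red spider; phases are angles modulo `2π`. -/
inductive ZX : ℕ → ℕ → Type
  | Z (n m : ℕ) (α β : Real.Angle) : ZX n m
  | X (n m : ℕ) (α β : Real.Angle) : ZX n m
  | H : ZX 1 1
  | swap : ZX 2 2
  | wire : ZX 1 1
  | empty : ZX 0 0
  | cap : ZX 0 2
  | cup : ZX 2 0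
  | comp {n m k : ℕ} (A : ZX n m) (B : ZX m k) : ZX n k
  | tensor {n m n' m' : ℕ} (A : ZX n m) (B : ZX n' m') : ZX (n + n') (m + m')

namespace ZX

/-- `A ⨾ B`: the diagram `A` placed above `B` (so first `A`, then `B`). -/
infixl:65 " ⨾ " => ZX.comp

/-- `A ⊠ B`: the diagram `A` placed to the left of `B`. -/
infixl:75 " ⊠ " => ZX.tensor

/-- Transport of a diagram along equalities of the numbers of inputs and outputs. -/
def cast {n m n' m' : ℕ} (hn : n = n') (hm : m = m') (D : ZX n m) : ZX n' m' :=
  hm ▸ hn ▸ D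

/-- `n` parallel wires. -/
def wires : (n : ℕ) → ZX n n
  | 0 => empty
  | n + 1 => wires n ⊠ wire

/-- `U 0 ⊗ U 1 ⊗ ⋯ ⊗ U (n - 1)` for diagrams with one input and one output. -/
def parallel : (n : ℕ) → (Fin n → ZX 1 1) → ZX n n
  | 0, _ => empty
  | n + 1, U => parallel n (fun i => U i.castSucc) ⊠ U (Fin.last n)

/-- The last two of `n + 2` parallel wires are swapped. -/
def swapLast (n : ℕ) : ZX (n + 2) (n + 2) :=
  @tensor n n 2 2 (wires n) swap

/-- The two middle ones of four parallel wires are swapped. -/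
def swapMid : ZX 4 4 :=
  @tensor 3 3 1 1 (@tensor 1 1 2 2 wire swap) wire

/-- The rightmost wire crosses `n` wires and becomes the leftmost one. -/
def crossing : (n : ℕ) → ZX (n + 1) (1 + n)
  | 0 => wire
  | n + 1 => swapLast n ⨾ @tensor (n + 1) (1 + n) 1 1 (crossing n) wire

/-- The Hadamard dagger node, a shorthand for three Hadamard nodes. -/
def Hdag : ZX 1 1 := H ⨾ H ⨾ H

/-- The angle `2πk/3`, for `k ∈ {0, 1, 2}` modulo `3`. -/
noncomputable def third (k : ZMod 3) : Real.Angle :=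
  ((2 * Real.pi / 3 * (k.val : ℝ) : ℝ) : Real.Angle)

/-! ### Standard interpretation -/

/-- The primitive cube root of unity `exp (2πi/3)`. -/
noncomputable def ω : ℂ := Complex.exp (2 * Real.pi * Complex.I / 3)

/-- The three coefficients `1, e^{iα}, e^{iβ}` of a spider. -/
noncomputable def phase (α β : Real.Angle) : Fin 3 → ℂ :=
  ![1, (α.toCircle : ℂ), (β.toCircle : ℂ)]

/-- The standard interpretation as a matrix from `(ℂ³)^{⊗ n}` to `(ℂ³)^{⊗ m}`, in computational
bases: rows are indexed by output strings `o`, columns by input strings `i`. The red spider is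
`∑ⱼ phase j • |hⱼ⟩^{⊗ m} ⟨hⱼ|^{⊗ n}` with `|hⱼ⟩ = ∑ₖ ω^{jk} |k⟩`. -/
noncomputable def interp : {n m : ℕ} → ZX n m → Matrix (Fin m → Fin 3) (Fin n → Fin 3) ℂ
  | _, _, Z _ _ α β => .of fun o i =>
      ∑ j : Fin 3, phase α β j * (if (∀ k, o k = j) ∧ (∀ k, i k = j) then 1 else 0)
  | _, _, X _ _ α β => .of fun o i =>
      ∑ j : Fin 3, phase α β j *
        ((∏ k, ω ^ (j.val * (o k).val)) * ∏ k, star ω ^ (j.val * (i k).val))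
  | _, _, H => .of fun o i => ω ^ ((o 0).val * (i 0).val)
  | _, _, swap => .of fun o i => if o 0 = i 1 ∧ o 1 = i 0 then 1 else 0
  | _, _, wire => 1
  | _, _, empty => 1
  | _, _, cap => .of fun o _ => if o 0 = o 1 then 1 else 0
  | _, _, cup => .of fun _ i => if i 0 = i 1 then 1 else 0
  | _, _, comp A B => interp B * interp A
  | _, _, @tensor n m n' m' A B => .of fun o i =>
      interp A (fun k => o (Fin.castAdd m' k)) (fun k => i (Fin.castAdd n' k)) *
        interp B (fun k => o (Fin.natAdd m k)) (fun k => i (Fin.natAdd n k))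

/-! ### The calculus -/

/-- `ZXEq D₁ D₂`: `D₁` can be rewritten into `D₂` by the rules of the scalar-free qutrit
ZX-calculus, i.e. the congruence generated by the axioms of a self-dual strict compact closed
category on the natural numbers, the non-structural rules, and the scalar rule. -/
inductive ZXEq : {n m : ℕ} → ZX n m → ZX n m → Prop
  -- congruence
  | refl {n m} (D : ZX n m) : ZXEq D D
  | symm {n m} {D E : ZX n m} : ZXEq D E → ZXEq E D
  | trans {n m} {D E F : ZX n m} : ZXEq D E → ZXEq E F → ZXEq D F
  | comp_congr {n m k} {A A' : ZX n m} {B B' : ZX m k} :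
      ZXEq A A' → ZXEq B B' → ZXEq (A ⨾ B) (A' ⨾ B')
  | tensor_congr {n m n' m'} {A A' : ZX n m} {B B' : ZX n' m'} :
      ZXEq A A' → ZXEq B B' → ZXEq (A ⊠ B) (A' ⊠ B')
  -- strict monoidal category
  | wires_comp {n m} (D : ZX n m) : ZXEq (wires n ⨾ D) D
  | comp_wires {n m} (D : ZX n m) : ZXEq (D ⨾ wires m) D
  | comp_assoc {n m k l} (A : ZX n m) (B : ZX m k) (C : ZX k l) :
      ZXEq (A ⨾ B ⨾ C) (A ⨾ (B ⨾ C))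
  | empty_tensor {n m} (D : ZX n m) :
      ZXEq (cast (Nat.zero_add n) (Nat.zero_add m) (empty ⊠ D)) D
  | tensor_empty {n m} (D : ZX n m) : ZXEq (D ⊠ empty) D
  | tensor_assoc {n₁ m₁ n₂ m₂ n₃ m₃} (A : ZX n₁ m₁) (B : ZX n₂ m₂) (C : ZX n₃ m₃) :
      ZXEq (cast (Nat.add_assoc n₁ n₂ n₃) (Nat.add_assoc m₁ m₂ m₃) (A ⊠ B ⊠ C)) (A ⊠ (B ⊠ C))
  | interchange {n m k n' m' k'} (A : ZX n m) (B : ZX m k) (A' : ZX n' m') (B' : ZX m' k') :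
      ZXEq ((A ⨾ B) ⊠ (A' ⨾ B')) ((A ⊠ A') ⨾ (B ⊠ B'))
  -- symmetry and self-dual compact structure
  | swap_swap : ZXEq (swap ⨾ swap) (wires 2)
  | slide {n m} (D : ZX n m) : ZXEq ((D ⊠ wire) ⨾ crossing m) (crossing n ⨾ (wire ⊠ D))
  | cap_swap : ZXEq (cap ⨾ swap) cap
  | swap_cup : ZXEq (swap ⨾ cup) cup
  | snake_left : ZXEq (@tensor 0 2 1 1 cap wire ⨾ @tensor 1 1 2 0 wire cup) wire
  | snake_right : ZXEq (@tensor 1 1 0 2 wire cap ⨾ @tensor 2 0 1 1 cup wire) wire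
  -- spider rules: fusion along `k + 1 ≥ 1` wires; the legs of a spider may be interchanged
  | S1 (n m n' m' k : ℕ) (α β γ δ : Real.Angle) :
      ZXEq ((Z n (m + (k + 1)) α β ⊠ wires n') ⨾
          cast (Nat.add_assoc m (k + 1) n').symm rfl (wires m ⊠ Z ((k + 1) + n') m' γ δ))
        (Z (n + n') (m + m') (α + γ) (β + δ))
  | S1_out (n m m' : ℕ) (α β : Real.Angle) :
      ZXEq (Z n (m + 2 + m') α β ⨾ (wires m ⊠ swap ⊠ wires m')) (Z n (m + 2 + m') α β)
  | S1_in (n n' m : ℕ) (α β : Real.Angle) :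
      ZXEq ((wires n ⊠ swap ⊠ wires n') ⨾ Z (n + 2 + n') m α β) (Z (n + 2 + n') m α β)
  | S2 : ZXEq (Z 1 1 0 0) wire
  | S3_cap : ZXEq (Z 0 2 0 0) cap
  | S3_cup : ZXEq (Z 2 0 0 0) cup
  -- copy rule and bialgebra rule, with their upside-down versions
  | B1 : ZXEq (X 0 1 0 0 ⨾ Z 1 2 0 0) (X 0 1 0 0 ⊠ X 0 1 0 0)
  | B1_flip : ZXEq (Z 2 1 0 0 ⨾ X 1 0 0 0) (X 1 0 0 0 ⊠ X 1 0 0 0)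
  | B2 : ZXEq (X 2 1 0 0 ⨾ Z 1 2 0 0)
      ((Z 1 2 0 0 ⊠ Z 1 2 0 0) ⨾ swapMid ⨾ (X 2 1 0 0 ⊠ X 2 1 0 0))
  | B2_flip : ZXEq (Z 2 1 0 0 ⨾ X 1 2 0 0)
      ((X 1 2 0 0 ⊠ X 1 2 0 0) ⨾ swapMid ⨾ (Z 2 1 0 0 ⊠ Z 2 1 0 0))
  -- red nodes with phases `(k, 2k)` are copied by green nodes and move through green phases
  | K1 (k : ZMod 3) : ZXEq (X 1 1 (third k) (third (2 * k)) ⨾ Z 1 2 0 0)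
      (Z 1 2 0 0 ⨾ (X 1 1 (third k) (third (2 * k)) ⊠ X 1 1 (third k) (third (2 * k))))
  | K1_flip (k : ZMod 3) : ZXEq (Z 2 1 0 0 ⨾ X 1 1 (third k) (third (2 * k)))
      ((X 1 1 (third k) (third (2 * k)) ⊠ X 1 1 (third k) (third (2 * k))) ⨾ Z 2 1 0 0)
  | K2_one (α β : Real.Angle) : ZXEq (Z 1 1 α β ⨾ X 1 1 (third 1) (third 2))
      (X 1 1 (third 1) (third 2) ⨾ Z 1 1 (β - α) (-α))
  | K2_two (α β : Real.Angle) : ZXEq (Z 1 1 α β ⨾ X 1 1 (third 2) (third 1))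
      (X 1 1 (third 2) (third 1) ⨾ Z 1 1 (-β) (α - β))
  -- Hadamard nodes: inverse, Euler decomposition, colour change
  | H1 : ZXEq (H ⨾ Hdag) wire
  | EU : ZXEq H (Z 1 1 (third 2) (third 2) ⨾ X 1 1 (third 2) (third 2) ⨾
      Z 1 1 (third 2) (third 2))
  | H2 (n m : ℕ) (α β : Real.Angle) : ZXEq (X n m α β)
      (parallel n (fun _ => Hdag) ⨾ Z n m α β ⨾ parallel m (fun _ => H))
  | H2' (n m : ℕ) (α β : Real.Angle) : ZXEq (X n m β α)
      (parallel n (fun _ => H) ⨾ Z n m α β ⨾ parallel m (fun _ => Hdag))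
  | P1 : ZXEq (H ⨾ H) (Hdag ⨾ Hdag)
  -- non-zero scalars are ignored
  | scalar {n m} {D E : ZX n m} (s t : ZX 0 0) :
      interp s ≠ 0 → interp t ≠ 0 → ZXEq (s ⊠ D) (t ⊠ E) → ZXEq D E

/-! ### Stabilizer diagrams, graph states, GS-LC diagrams -/

/-- An integer multiple of `2π/3`, modulo `2π`. -/
def IsThird (α : Real.Angle) : Prop :=
  ∃ k : ℤ, α = ((2 * Real.pi / 3 * (k : ℝ) : ℝ) : Real.Angle)

/-- A stabilizer diagram: all phase angles are integer multiples of `2π/3`. -/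
def IsStabilizer : {n m : ℕ} → ZX n m → Prop
  | _, _, Z _ _ α β => IsThird α ∧ IsThird β
  | _, _, X _ _ α β => IsThird α ∧ IsThird β
  | _, _, comp A B => IsStabilizer A ∧ IsStabilizer B
  | _, _, tensor A B => IsStabilizer A ∧ IsStabilizer B
  | _, _, _ => True

/-- The diagram contains a red node. -/
def HasRed : {n m : ℕ} → ZX n m → Prop
  | _, _, X _ _ _ _ => True
  | _, _, comp A B => HasRed A ∨ HasRed B
  | _, _, tensor A B => HasRed A ∨ HasRed B
  | _, _, _ => False

/-- Adjacency matrices of `ℤ₃`-weighted graphs: symmetric with zero diagonal. -/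
def IsAdjacency {n : ℕ} (Γ : Matrix (Fin n) (Fin n) (ZMod 3)) : Prop :=
  Γ.IsSymm ∧ ∀ v, Γ v v = 0

/-- Two parallel wires joined by an edge of weight `w`: a green node on each of them, connected by
an `H` node if `w = 1` and by an `H†` node if `w = 2` (there is no edge if `w = 0`). -/
noncomputable def edge (w : ZMod 3) : ZX 2 2 :=
  if w = 0 then wires 2
  else @tensor 1 2 1 1 (Z 1 2 0 0) wire ⨾ (wire ⊠ (if w = 1 then H else Hdag) ⊠ wire) ⨾
    @tensor 1 1 2 1 wire (Z 2 1 0 0)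

/-- On `n + 1` wires, the last wire is joined to wire `i` by an edge of weight `w i`, for every
`i < n`. -/
noncomputable def joinLast : (n : ℕ) → (Fin n → ZMod 3) → ZX (n + 1) (n + 1)
  | 0, _ => wire
  | n + 1, w =>
      @tensor n n 2 2 (wires n) (edge (w (Fin.last n))) ⨾ swapLast n ⨾
        @tensor (n + 1) (n + 1) 1 1 (joinLast n (fun i => w i.castSucc)) wire ⨾ swapLast n

/-- The graph state diagram of the weighted graph `Γ`: a green node with one output for every
vertex, and an edge of weight `Γ u v` between the wires of `u` and `v` for all `u < v`. -/
noncomputable def graphState : (n : ℕ) → Matrix (Fin n) (Fin n) (ZMod 3) → ZX 0 n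
  | 0, _ => empty
  | n + 1, Γ =>
      (graphState n (Γ.submatrix Fin.castSucc Fin.castSucc) ⊠ Z 0 1 0 0) ⨾
        joinLast n (fun i => Γ i.castSucc (Fin.last n))

/-- Diagrams of single-qutrit Clifford operators: composites of Hadamard nodes and of green and red
phase nodes whose angles are integer multiples of `2π/3`. -/
inductive IsLocalClifford : ZX 1 1 → Prop
  | wire : IsLocalClifford wire
  | H : IsLocalClifford H
  | Z {α β : Real.Angle} : IsThird α → IsThird β → IsLocalClifford (Z 1 1 α β)
  | X {α β : Real.Angle} : IsThird α → IsThird β → IsLocalClifford (X 1 1 α β)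
  | comp {A B : ZX 1 1} : IsLocalClifford A → IsLocalClifford B → IsLocalClifford (A ⨾ B)

/-- The set `R` of reduced vertex operators: the nine green nodes with phases `(a, b)`, and the six
diagrams with a green node with phases `(p + m, p + 2m)` followed by a red node with phases
`(p, p)`, where `p ≠ 0`; the numbers `0, 1, 2` stand for the angles `0, 2π/3, 4π/3`. -/
def reducedOperators : Set (ZX 1 1) :=
  {U | (∃ a b : ZMod 3, U = Z 1 1 (third a) (third b)) ∨
    ∃ p m : ZMod 3, p ≠ 0 ∧
      U = Z 1 1 (third (p + m)) (third (p + 2 * m)) ⨾ X 1 1 (third p) (third p)}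

/-- The graph state diagram of `Γ` with the diagram `U v` applied to the output of `v`. -/
noncomputable def gslc {n : ℕ} (Γ : Matrix (Fin n) (Fin n) (ZMod 3)) (U : Fin n → ZX 1 1) : ZX 0 n :=
  graphState n Γ ⨾ parallel n U

/-- GS-LC diagrams: graph states with single-qutrit Clifford operators on the outputs. -/
def IsGSLC {n : ℕ} (D : ZX 0 n) : Prop :=
  ∃ Γ U, IsAdjacency Γ ∧ (∀ v, IsLocalClifford (U v)) ∧ D = gslc Γ U

/-- Reduced GS-LC diagrams: all vertex operators belong to `R`, and no two adjacent vertices both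
have vertex operators containing a red node. -/
def IsReducedGSLC {n : ℕ} (D : ZX 0 n) : Prop :=
  ∃ Γ U, IsAdjacency Γ ∧ (∀ v, IsLocalClifford (U v)) ∧
    (∀ v, U v ∈ reducedOperators) ∧
    (∀ u v, Γ u v ≠ 0 → ¬ (HasRed (U u) ∧ HasRed (U v))) ∧
    D = gslc Γ U

end ZX

/-!
The proof works with diagrams modulo rewriting: `Q n m` is the set of classes of diagrams with `n`
inputs and `m` outputs. The classes in `Q n n` form a monoid, in which the wires can be permuted by
`P` (`genX_inj` is the coherence of the symmetric groups). Hence there are operations `op1 i f` and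
`op2 i j f` that apply a small diagram to chosen wires, and most of the proof is a computation in
the monoids `Q m m` with edges `C i j f`, green spiders `D i j` and resets `B i`.

*Relations between edges.* The bialgebra rule becomes a relation `D_mul_B_mul_CX` for controlled
shifts `CX`. Applied to a cap it yields the inverse of an edge in terms of the transpose of the
Hadamard node (`edge_relation`). A conjugate of a green phase therefore commutes with edges
(`commute_edge`), and so with green phases; a computation in groups (`had_transpose_group`) deduces
that the Hadamard node is its own transpose (`isTr_had`), and that edges through `H` and `H†` are
inverse to each other (`C_had_mul_C_hdag`).

*Local complementation.* A diagonal operation, a product of edges and green phases, is a quadratic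
phase over `ZMod 3`. Red phases pass through edges and linear phases at the cost of controlled
shifts and diagonal operations (`xx_mul_C`, `CY_mul_C_self`, `xx_mul_lz`), and shifts do not affect
the uniform state. So a red phase on a wire is absorbed by a diagonal state whose quadratic part
vanishes at that wire (`xx_smul_mem`). This is local complementation.

*Reduction.* `CliffState m` consists of the diagonal states with local Clifford operations on their
wires. Local complementation brings every local operation to the form `1` or `zt r r * had`
(`exists_isH_par`), then removes Hadamard nodes until no two of them are adjacent and none carries a
quadratic phase (`exists_independent`), and equalises their green phases (`exists_uniform`). The
result is a reduced GS-LC diagram (`exists_reduced`).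

*Closure.* It remains to see that a stabilizer state diagram is in `CliffState`. The set `Stab` of
these states, together with the diagrams of vanishing interpretation, is closed under deletion of a
wire (`drop_mem`), cups (`join_mem`), caps (`cap_mem`), green spiders with three legs (`ghz_mem`)
and permutations (`P_smul_mem`), hence under all stabilizer diagrams (`pres_of_isStabilizer`). The
zero case is needed in the induction, because deletion of a wire may produce zero. It is excluded at
the end by soundness: rewriting changes interpretations only by non-zero factors (`ZXEq.prop`), so
that a diagram equal to one of vanishing interpretation has vanishing interpretation as well.

A reduced GS-LC diagram is in particular a GS-LC diagram, and the same diagram serves for both steps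
of the theorem.
-/

namespace ZX

/-! ### Diagrams modulo rewriting -/

theorem zxEq_equivalence (n m : ℕ) : Equivalence (@ZXEq n m) :=
  ⟨ZXEq.refl, ZXEq.symm, ZXEq.trans⟩

/-- Diagrams with `n` inputs and `m` outputs up to rewriting. -/
def Q (n m : ℕ) : Type := Quotient (⟨@ZXEq n m, zxEq_equivalence n m⟩ : Setoid (ZX n m))

/-- The class of a diagram. -/
def q {n m : ℕ} (D : ZX n m) : Q n m := Quotient.mk _ D

theorem q_eq {n m : ℕ} {D E : ZX n m} : q D = q E ↔ ZXEq D E := Quotient.eq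

theorem sound {n m : ℕ} {D E : ZX n m} (h : ZXEq D E) : q D = q E := q_eq.2 h

theorem q_surj {n m : ℕ} (A : Q n m) : ∃ D, q D = A := Quotient.exists_rep A

/-- Composition of classes, in the order of the diagrams. -/
def Q.comp {n m k : ℕ} (A : Q n m) (B : Q m k) : Q n k :=
  Quotient.map₂ ZX.comp (fun _ _ h _ _ h' => ZXEq.comp_congr h h') A B

/-- Juxtaposition of classes. -/
def Q.tens {n m n' m' : ℕ} (A : Q n m) (B : Q n' m') : Q (n + n') (m + m') :=
  Quotient.map₂ ZX.tensor (fun _ _ h _ _ h' => ZXEq.tensor_congr h h') A B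

/-- First `A`, then `B`. -/
infixl:65 " ⟫ " => Q.comp

/-- `A` to the left of `B`. -/
infixl:75 " ◎ " => Q.tens

theorem q_comp {n m k : ℕ} (A : ZX n m) (B : ZX m k) : q (A ⨾ B) = q A ⟫ q B := rfl

theorem q_tens {n m n' m' : ℕ} (A : ZX n m) (B : ZX n' m') : q (A ⊠ B) = q A ◎ q B := rfl

theorem comp_assoc {n m k l : ℕ} (A : Q n m) (B : Q m k) (C : Q k l) :
    A ⟫ B ⟫ C = A ⟫ (B ⟫ C) := by
  obtain ⟨A, rfl⟩ := q_surj A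
  obtain ⟨B, rfl⟩ := q_surj B
  obtain ⟨C, rfl⟩ := q_surj C
  exact sound (ZXEq.comp_assoc A B C)

/-- Diagrams with as many inputs as outputs form a monoid. The product is written in the order of
operators: in `a * b` the diagram `b` comes first. -/
instance {n : ℕ} : Monoid (Q n n) where
  mul a b := b ⟫ a
  one := q (wires n)
  mul_assoc a b c := (comp_assoc c b a).symm
  one_mul a := by
    obtain ⟨A, rfl⟩ := q_surj a
    exact sound (ZXEq.comp_wires A)
  mul_one a := by
    obtain ⟨A, rfl⟩ := q_surj a
    exact sound (ZXEq.wires_comp A)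

theorem mul_def {n : ℕ} (a b : Q n n) : a * b = b ⟫ a := rfl

@[simp] theorem one_comp {n m : ℕ} (A : Q n m) : 1 ⟫ A = A := by
  obtain ⟨A, rfl⟩ := q_surj A
  exact sound (ZXEq.wires_comp A)

@[simp] theorem comp_one {n m : ℕ} (A : Q n m) : A ⟫ 1 = A := by
  obtain ⟨A, rfl⟩ := q_surj A
  exact sound (ZXEq.comp_wires A)

theorem interchange {n m k n' m' k' : ℕ} (A : Q n m) (B : Q m k) (A' : Q n' m') (B' : Q m' k') :
    (A ⟫ B) ◎ (A' ⟫ B') = (A ◎ A') ⟫ (B ◎ B') := by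
  obtain ⟨A, rfl⟩ := q_surj A
  obtain ⟨B, rfl⟩ := q_surj B
  obtain ⟨A', rfl⟩ := q_surj A'
  obtain ⟨B', rfl⟩ := q_surj B'
  exact sound (ZXEq.interchange A B A' B')

theorem heq_q_cast {n m n' m' : ℕ} (hn : n = n') (hm : m = m') (D : ZX n m) :
    HEq (q (cast hn hm D)) (q D) := by
  subst hn hm
  rfl

theorem tens_assoc {n₁ m₁ n₂ m₂ n₃ m₃ : ℕ} (A : Q n₁ m₁) (B : Q n₂ m₂) (C : Q n₃ m₃) :
    HEq (A ◎ B ◎ C) (A ◎ (B ◎ C)) := by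
  obtain ⟨A, rfl⟩ := q_surj A
  obtain ⟨B, rfl⟩ := q_surj B
  obtain ⟨C, rfl⟩ := q_surj C
  have h := sound (ZXEq.tensor_assoc A B C)
  exact (heq_q_cast _ _ _).symm.trans (heq_of_eq h)

@[simp] theorem tens_zero {n m : ℕ} (A : Q n m) : A ◎ (1 : Q 0 0) = A := by
  obtain ⟨A, rfl⟩ := q_surj A
  exact sound (ZXEq.tensor_empty A)

theorem zero_tens {n m : ℕ} (A : Q n m) : HEq ((1 : Q 0 0) ◎ A) A := by
  obtain ⟨A, rfl⟩ := q_surj A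
  have h := sound (ZXEq.empty_tensor A)
  exact (heq_q_cast _ _ _).symm.trans (heq_of_eq h)

theorem heq_tens {n m n' m' k l k' l' : ℕ} {A : Q n m} {A' : Q n' m'} {B : Q k l} {B' : Q k' l'}
    (hn : n = n') (hm : m = m') (hk : k = k') (hl : l = l') (h : HEq A A') (h' : HEq B B') :
    HEq (A ◎ B) (A' ◎ B') := by
  subst hn hm hk hl
  cases h
  cases h'
  rfl

theorem heq_comp {n m k n' m' k' : ℕ} {A : Q n m} {A' : Q n' m'} {B : Q m k} {B' : Q m' k'}
    (hn : n = n') (hm : m = m') (hk : k = k') (h : HEq A A') (h' : HEq B B') :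
    HEq (A ⟫ B) (A' ⟫ B') := by
  subst hn hm hk
  cases h
  cases h'
  rfl

theorem heq_one {n n' : ℕ} (h : n = n') : HEq (1 : Q n n) (1 : Q n' n') := by
  subst h
  rfl

theorem q_wire : q wire = 1 :=
  (eq_of_heq (zero_tens (q wire)) : (1 : Q 0 0) ◎ q wire = q wire).symm

theorem one_succ (n : ℕ) : (1 : Q (n + 1) (n + 1)) = (1 : Q n n) ◎ (1 : Q 1 1) := by
  rw [← q_wire]
  rfl

@[simp] theorem one_tens_one (n m : ℕ) : (1 : Q n n) ◎ (1 : Q m m) = 1 := by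
  induction m with
  | zero => exact tens_zero _
  | succ m ih =>
    rw [one_succ m]
    have h : (1 : Q n n) ◎ (1 : Q m m) ◎ (1 : Q 1 1) = (1 : Q n n) ◎ ((1 : Q m m) ◎ (1 : Q 1 1)) :=
      eq_of_heq (tens_assoc _ _ _)
    rw [← h, ih]
    exact (one_succ (n + m)).symm

theorem tens_eq_left {n m n' m' : ℕ} (A : Q n m) (B : Q n' m') :
    A ◎ B = (A ◎ (1 : Q n' n')) ⟫ ((1 : Q m m) ◎ B) := by
  rw [← interchange, comp_one, one_comp]

theorem tens_eq_right {n m n' m' : ℕ} (A : Q n m) (B : Q n' m') :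
    A ◎ B = ((1 : Q n n) ◎ B) ⟫ (A ◎ (1 : Q m' m')) := by
  rw [← interchange, comp_one, one_comp]

theorem comp_tens_one {n m k : ℕ} (l : ℕ) (A : Q n m) (B : Q m k) :
    (A ⟫ B) ◎ (1 : Q l l) = (A ◎ (1 : Q l l)) ⟫ (B ◎ (1 : Q l l)) := by
  rw [← interchange, comp_one]

theorem one_tens_comp {n m k : ℕ} (l : ℕ) (A : Q n m) (B : Q m k) :
    (1 : Q l l) ◎ (A ⟫ B) = ((1 : Q l l) ◎ A) ⟫ ((1 : Q l l) ◎ B) := by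
  rw [← interchange, comp_one]

/-- `a ↦ a ⊗ 1` with one more wire on the right. -/
def ext {n : ℕ} : Q n n →* Q (n + 1) (n + 1) where
  toFun a := a ◎ (1 : Q 1 1)
  map_one' := one_tens_one n 1
  map_mul' a b := comp_tens_one 1 b a

theorem ext_def {n : ℕ} (a : Q n n) : ext a = a ◎ (1 : Q 1 1) := rfl

/-- `g ↦ 1 ⊗ g` with `n` more wires on the left. -/
def lft (n : ℕ) {k : ℕ} : Q k k →* Q (n + k) (n + k) where
  toFun a := (1 : Q n n) ◎ a
  map_one' := one_tens_one n k
  map_mul' a b := one_tens_comp n b a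

theorem lft_def (n : ℕ) {k : ℕ} (a : Q k k) : lft n a = (1 : Q n n) ◎ a := rfl

/-- Nested extension on the left. -/
theorem lft_lft (n m : ℕ) {k : ℕ} (a : Q k k) : HEq (lft n (lft m a)) (lft (n + m) a) := by
  have h := tens_assoc (1 : Q n n) (1 : Q m m) a
  rw [one_tens_one] at h
  exact h.symm

theorem scalar_slide (s : ZX 0 0) : q s ◎ (1 : Q 1 1) = (1 : Q 1 1) ◎ q s := by
  have h := sound (ZXEq.slide s)
  rw [q_comp, q_comp, q_tens, q_tens] at h
  have h0 : q (crossing 0) = 1 := q_wire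
  have h1 : q s ◎ q wire ⟫ 1 = q s ◎ q wire := comp_one _
  rw [h0, q_wire] at h
  rw [q_wire] at h1
  exact h1.symm.trans (h.trans (one_comp _))

theorem scalar_slide_n (s : ZX 0 0) (m : ℕ) :
    HEq (q s ◎ (1 : Q m m)) ((1 : Q m m) ◎ q s) := by
  induction m with
  | zero =>
    refine (heq_of_eq (tens_zero _)).trans ?_
    exact (zero_tens (q s)).symm
  | succ m ih =>
    rw [one_succ m]
    refine (tens_assoc (q s) (1 : Q m m) (1 : Q 1 1)).symm.trans ?_
    refine (heq_tens (Nat.zero_add m) (Nat.zero_add m) rfl rfl ih HEq.rfl).trans ?_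
    refine (tens_assoc (1 : Q m m) (q s) (1 : Q 1 1)).trans ?_
    rw [scalar_slide]
    exact (tens_assoc _ _ _).symm

/-- Non-zero scalars on the right may be dropped. -/
theorem one_tens_scalar (s : ZX 0 0) (hs : interp s ≠ 0) (m : ℕ) :
    (1 : Q m m) ◎ q s = (1 : Q (m + 0) (m + 0)) := by
  have he : interp (empty : ZX 0 0) ≠ 0 := by
    intro h
    have := congrFun (congrFun h (fun i => i.elim0)) (fun i => i.elim0)
    simp [interp] at this
  have h1 : HEq (q s ◎ (1 : Q m m)) (q empty ◎ ((1 : Q m m) ◎ q s)) :=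
    (scalar_slide_n s m).trans (zero_tens _).symm
  have h2 : q s ◎ q (wires m) = q empty ◎ q (wires m ⊠ s) := eq_of_heq h1
  exact (sound (ZXEq.scalar s empty hs he (q_eq.1 h2))).symm

theorem drop_right {n m : ℕ} (A : Q n m) (s : ZX 0 0) (hs : interp s ≠ 0) :
    A ◎ q s = A := by
  rw [tens_eq_left, one_tens_scalar s hs]
  exact (comp_one _).trans (tens_zero A)

theorem drop_left {n m : ℕ} (A : Q n m) (s : ZX 0 0) (hs : interp s ≠ 0) :
    HEq (q s ◎ A) A := by
  rw [tens_eq_left]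
  have h : HEq (q s ◎ (1 : Q n n)) (1 : Q n n) :=
    (scalar_slide_n s n).trans (heq_of_eq (one_tens_scalar s hs n))
  have := heq_comp (Nat.zero_add n) (Nat.zero_add n) (Nat.zero_add m) h (zero_tens A)
  exact this.trans (heq_of_eq (one_comp A))

/-! ### Permutations of wires -/

/-- The crossing of the last two of `n + 2` wires. -/
def sw (n : ℕ) : Q (n + 2) (n + 2) := lft n (q swap)

theorem sw_mul_self (n : ℕ) : sw n * sw n = 1 := by
  have h : q swap * q swap = 1 := sound ZXEq.swap_swap
  rw [sw, ← map_mul, h, map_one]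

theorem ext_lft (n : ℕ) {k : ℕ} (a : Q k k) : ext (lft n a) = lft n (ext a) :=
  eq_of_heq (tens_assoc (1 : Q n n) a (1 : Q 1 1))

theorem lft_succ (n : ℕ) {k : ℕ} (a : Q k k) :
    HEq (lft (n + 1) a) (lft n (lft 1 a)) := (lft_lft n 1 a).symm

/-- Operations on disjoint sets of wires commute. -/
theorem tens_commute {n k : ℕ} (a : Q n n) (b : Q k k) :
    (a ◎ (1 : Q k k)) * lft n b = lft n b * (a ◎ (1 : Q k k)) := by
  rw [mul_def, mul_def, lft_def, ← tens_eq_left, ← tens_eq_right]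

theorem ext_ext {n : ℕ} (a : Q n n) : ext (ext a) = a ◎ (1 : Q 2 2) := by
  have h : a ◎ (1 : Q 1 1) ◎ (1 : Q 1 1) = a ◎ ((1 : Q 1 1) ◎ (1 : Q 1 1)) :=
    eq_of_heq (tens_assoc _ _ _)
  rw [one_tens_one] at h
  exact h

theorem ext_ext_ext {n : ℕ} (a : Q n n) : ext (ext (ext a)) = a ◎ (1 : Q 3 3) := by
  rw [ext_ext]
  have h : a ◎ (1 : Q 1 1) ◎ (1 : Q 2 2) = a ◎ ((1 : Q 1 1) ◎ (1 : Q 2 2)) :=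
    eq_of_heq (tens_assoc _ _ _)
  rw [one_tens_one] at h
  exact h

theorem ext_ext_mul_sw {n : ℕ} (a : Q n n) : ext (ext a) * sw n = sw n * ext (ext a) := by
  rw [ext_ext]
  exact tens_commute a (q swap)

theorem crossing_one : q (crossing 1) = q swap := by
  have h : (q (crossing 1) : Q 2 2) =
      Q.comp (n := 2) (m := 2) (k := 2) (lft 0 (q swap)) (q wire ◎ q wire) := rfl
  rw [h, q_wire, one_tens_one, comp_one]
  exact eq_of_heq (zero_tens (q swap))

theorem crossing_two : (q (crossing 2) : Q 3 3) = lft 1 (q swap) ⟫ ext (q swap) := by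
  have h : (q (crossing 2) : Q 3 3) = Q.comp (n := 3) (m := 3) (k := 3) (lft 1 (q swap))
      (Q.tens (n := 2) (m := 2) (q (crossing 1)) (q wire)) := rfl
  rw [h, crossing_one, q_wire]
  rfl

/-- Sliding a diagram with two inputs and two outputs past a wire. -/
theorem slide_two (a : Q 2 2) :
    ext (q swap) * lft 1 (q swap) * ext a = lft 1 a * ext (q swap) * lft 1 (q swap) := by
  obtain ⟨D, rfl⟩ := q_surj a
  have h := sound (ZXEq.slide D)
  have h' : ext (q D) ⟫ (q (crossing 2) : Q 3 3) = (q (crossing 2) : Q 3 3) ⟫ lft 1 (q D) := by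
    rw [q_comp, q_comp, q_tens, q_tens, q_wire] at h
    exact h
  rw [crossing_two] at h'
  exact h'.trans (by rw [comp_assoc]; rfl)

/-- Sliding a diagram with one input and one output past a wire. -/
theorem slide_one (a : Q 1 1) : q swap * ext a = lft 1 a * q swap := by
  obtain ⟨D, rfl⟩ := q_surj a
  have h := sound (ZXEq.slide D)
  have h' : ext (q D) ⟫ (q (crossing 1) : Q 2 2) = (q (crossing 1) : Q 2 2) ⟫ lft 1 (q D) := by
    rw [q_comp, q_comp, q_tens, q_tens, q_wire] at h
    exact h
  rw [crossing_one] at h'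
  exact h'

theorem sw_braid (n : ℕ) :
    sw (n + 1) * ext (sw n) * sw (n + 1) = ext (sw n) * sw (n + 1) * ext (sw n) := by
  have h1 : sw (n + 1) = lft n (lft 1 (q swap)) := eq_of_heq (lft_succ n (q swap))
  rw [h1, sw, ext_lft, ← map_mul, ← map_mul, ← map_mul, ← map_mul]
  exact congrArg (lft n) (slide_two (q swap)).symm

/-- A permutation of `n` letters as a permutation of `n + 1` letters fixing the last one. -/
def extP {n : ℕ} : Equiv.Perm (Fin n) →* Equiv.Perm (Fin (n + 1)) where
  toFun σ := finSuccEquivLast.trans ((Equiv.optionCongr σ).trans finSuccEquivLast.symm)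
  map_one' := by
    ext i
    refine Fin.lastCases ?_ (fun j => ?_) i <;> simp
  map_mul' σ τ := by
    ext i
    refine Fin.lastCases ?_ (fun j => ?_) i <;> simp

@[simp] theorem extP_castSucc {n : ℕ} (σ : Equiv.Perm (Fin n)) (i : Fin n) :
    extP σ i.castSucc = (σ i).castSucc := by simp [extP]

@[simp] theorem extP_last {n : ℕ} (σ : Equiv.Perm (Fin n)) :
    extP σ (Fin.last n) = Fin.last n := by simp [extP]

theorem extP_injective {n : ℕ} : Function.Injective (@extP n) := by
  intro σ τ h
  ext i
  have := congrArg (fun f => f i.castSucc) h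
  simpa using congrArg Fin.val this

/-- The transposition of the last two of `n + 2` letters. -/
def topP (n : ℕ) : Equiv.Perm (Fin (n + 2)) := Equiv.swap (Fin.last n).castSucc (Fin.last (n + 1))

theorem topP_last (n : ℕ) : topP n (Fin.last (n + 1)) = (Fin.last n).castSucc := by simp [topP]

theorem topP_castSucc_last (n : ℕ) : topP n (Fin.last n).castSucc = Fin.last (n + 1) := by
  simp [topP]

theorem topP_castSucc_castSucc (n : ℕ) (i : Fin n) :
    topP n i.castSucc.castSucc = i.castSucc.castSucc := by
  refine Equiv.swap_apply_of_ne_of_ne ?_ ?_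
  · simp [Fin.ext_iff]
    omega
  · simp [Fin.ext_iff]
    omega

theorem fin_cases_two {n : ℕ} {p : Fin (n + 2) → Prop} (h1 : p (Fin.last (n + 1)))
    (h2 : p (Fin.last n).castSucc) (h3 : ∀ i : Fin n, p i.castSucc.castSucc) (i : Fin (n + 2)) :
    p i :=
  Fin.lastCases h1 (fun j => Fin.lastCases h2 (fun k => h3 k) j) i

theorem topP_mul_self (n : ℕ) : topP n * topP n = 1 := Equiv.swap_mul_self _ _

theorem extP_extP_mul_topP {n : ℕ} (σ : Equiv.Perm (Fin n)) :
    extP (extP σ) * topP n = topP n * extP (extP σ) := by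
  refine Equiv.ext (fin_cases_two ?_ ?_ fun i => ?_) <;>
    simp [topP_last, topP_castSucc_last, topP_castSucc_castSucc]

theorem topP_braid (n : ℕ) :
    topP (n + 1) * extP (topP n) * topP (n + 1) =
      extP (topP n) * topP (n + 1) * extP (topP n) := by
  refine Equiv.ext (fin_cases_two ?_ ?_ fun i => ?_)
  · simp [topP_last, topP_castSucc_castSucc]
  · simp [topP_last, topP_castSucc_last, topP_castSucc_castSucc]
  · refine Fin.lastCases ?_ (fun i => ?_) i <;>
      simp [topP_castSucc_last, topP_castSucc_castSucc]

/-- Pairs of a permutation and a diagram supposed to realise it. -/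
abbrev PQ (n : ℕ) := Equiv.Perm (Fin n) × Q n n

/-- One more letter and one more wire. -/
def extX {n : ℕ} : PQ n →* PQ (n + 1) := MonoidHom.prodMap extP ext

/-- The transposition of the last two letters with the crossing of the last two wires. -/
def topX (n : ℕ) : PQ (n + 2) := (topP n, sw n)

theorem topX_mul_self (n : ℕ) : topX n * topX n = 1 :=
  Prod.ext (topP_mul_self n) (sw_mul_self n)

theorem extX_extX_mul_topX {n : ℕ} (a : PQ n) :
    extX (extX a) * topX n = topX n * extX (extX a) :=
  Prod.ext (extP_extP_mul_topP a.1) (ext_ext_mul_sw a.2)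

theorem topX_braid (n : ℕ) :
    topX (n + 1) * extX (topX n) * topX (n + 1) =
      extX (topX n) * topX (n + 1) * extX (topX n) :=
  Prod.ext (topP_braid n) (sw_braid n)

/-- The last letter is sent to `i`, the order of the others being kept. -/
def insX : (n : ℕ) → Fin (n + 1) → PQ (n + 1)
  | 0, _ => 1
  | n + 1, i => Fin.lastCases 1 (fun j => extX (insX n j) * topX n) i

@[simp] theorem insX_last (n : ℕ) : insX n (Fin.last n) = 1 := by
  cases n <;> simp [insX]

theorem insX_castSucc (n : ℕ) (i : Fin (n + 1)) :
    insX (n + 1) i.castSucc = extX (insX n i) * topX n := by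
  simp [insX]

theorem insX_apply_last : (n : ℕ) → (i : Fin (n + 1)) → (insX n i).1 (Fin.last n) = i
  | 0, i => by
    exact Subsingleton.elim (α := Fin 1) _ _
  | n + 1, i => by
    refine Fin.lastCases ?_ (fun j => ?_) i
    · simp
    · rw [insX_castSucc]
      change extP (insX n j).1 (topP n (Fin.last (n + 1))) = _
      rw [topP_last, extP_castSucc, insX_apply_last n j]

/-- Moving two letters one after the other to given places is independent of the order up to the
crossing of the two. -/
theorem insX_exchange : (n : ℕ) → (i : Fin (n + 2)) → (j : Fin (n + 1)) →
    ∃ i' j', insX (n + 1) i * extX (insX n j) * topX n = insX (n + 1) i' * extX (insX n j')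
  | n, i, j => by
    refine Fin.lastCases (motive := fun i => ∃ i' j',
      insX (n + 1) i * extX (insX n j) * topX n = insX (n + 1) i' * extX (insX n j')) ?_ ?_ i
    · refine ⟨j.castSucc, Fin.last n, ?_⟩
      rw [insX_last, one_mul, insX_castSucc, insX_last, map_one, mul_one]
    · intro i0
      refine Fin.lastCases (motive := fun j => ∃ i' j', insX (n + 1) i0.castSucc *
        extX (insX n j) * topX n = insX (n + 1) i' * extX (insX n j')) ?_ ?_ j
      · refine ⟨Fin.last (n + 1), i0, ?_⟩
        rw [insX_last, insX_castSucc, insX_last, map_one, mul_one, mul_assoc, topX_mul_self,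
          mul_one, one_mul]
      · match n with
        | 0 => exact fun j => j.elim0
        | n + 1 =>
          intro j0
          obtain ⟨i1, j1, h⟩ := insX_exchange n i0 j0
          refine ⟨i1.castSucc, j1.castSucc, ?_⟩
          rw [insX_castSucc, insX_castSucc, insX_castSucc, insX_castSucc]
          have h' := congrArg extX h
          simp only [map_mul] at h' ⊢
          calc _ = extX (insX (n + 1) i0) * (topX (n + 1) * extX (extX (insX n j0))) *
                extX (topX n) * topX (n + 1) := by simp only [mul_assoc]
            _ = extX (insX (n + 1) i0) * extX (extX (insX n j0)) *
                (topX (n + 1) * extX (topX n) * topX (n + 1)) := by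
              rw [← extX_extX_mul_topX]
              simp only [mul_assoc]
            _ = (extX (insX (n + 1) i0) * extX (extX (insX n j0)) * extX (topX n)) *
                topX (n + 1) * extX (topX n) := by
              rw [topX_braid]
              simp only [mul_assoc]
            _ = extX (insX (n + 1) i1) * (extX (extX (insX n j1)) * topX (n + 1)) *
                extX (topX n) := by
              rw [h']
              simp only [mul_assoc]
            _ = _ := by
              rw [extX_extX_mul_topX]
              simp only [mul_assoc]

/-- Generators of the permutations of wires: crossings of adjacent wires. -/
inductive IsGen : (n : ℕ) → PQ n → Prop
  | top (n : ℕ) : IsGen (n + 2) (topX n)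
  | ext {n : ℕ} {a : PQ n} : IsGen n a → IsGen (n + 1) (extX a)

/-- All pairs generated by crossings. -/
def genX (n : ℕ) : Submonoid (PQ n) := Submonoid.closure {a | IsGen n a}

theorem extX_mem {n : ℕ} {a : PQ n} (h : a ∈ genX n) : extX a ∈ genX (n + 1) := by
  induction h using Submonoid.closure_induction with
  | mem a h => exact Submonoid.subset_closure h.ext
  | one => rw [map_one]; exact one_mem _
  | mul a b _ _ ha hb => rw [map_mul]; exact mul_mem ha hb

theorem insX_mem : (n : ℕ) → (i : Fin (n + 1)) → insX n i ∈ genX (n + 1)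
  | 0, _ => one_mem _
  | n + 1, i => by
    refine Fin.lastCases ?_ (fun j => ?_) i
    · rw [insX_last]
      exact one_mem _
    · rw [insX_castSucc]
      exact mul_mem (extX_mem (insX_mem n j)) (Submonoid.subset_closure (IsGen.top n))

theorem genX_zero {a : PQ 0} (h : a ∈ genX 0) : a = 1 := by
  induction h using Submonoid.closure_induction with
  | mem a h => cases h
  | one => rfl
  | mul a b _ _ ha hb => rw [ha, hb, mul_one]

/-- Normal form: a product of generators inserts the last letter somewhere after a permutation of
the other letters. -/
theorem genX_succ {n : ℕ} {a : PQ (n + 1)} (h : a ∈ genX (n + 1)) :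
    ∃ i, ∃ b ∈ genX n, a = insX n i * extX b := by
  induction n with
  | zero =>
    refine ⟨Fin.last 0, 1, one_mem _, ?_⟩
    rw [insX_last, map_one, mul_one]
    induction h using Submonoid.closure_induction with
    | mem a h =>
      cases h with
      | ext h => cases h
    | one => rfl
    | mul a b _ _ ha hb => rw [ha, hb, mul_one]
  | succ n ih =>
    induction h using Submonoid.closure_induction_right with
    | one => exact ⟨Fin.last _, 1, one_mem _, by rw [insX_last, map_one, mul_one]⟩
    | mul_right a _ y hy hx =>
      obtain ⟨i, b, hb, rfl⟩ := hx
      cases hy with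
      | top =>
        obtain ⟨j, c, hc, rfl⟩ := ih hb
        obtain ⟨i', j', h⟩ := insX_exchange n i j
        refine ⟨i', insX n j' * extX c, mul_mem (insX_mem n j') (extX_mem hc), ?_⟩
        rw [map_mul, map_mul, mul_assoc, mul_assoc, extX_extX_mul_topX, ← mul_assoc, ← mul_assoc, h,
          mul_assoc]
      | ext h =>
        exact ⟨i, _, mul_mem hb (Submonoid.subset_closure h), by rw [map_mul, mul_assoc]⟩

/-- Coherence of the symmetric groups: a diagram built from crossings is determined by its
permutation. By the normal form `genX_succ`, the insertion can be read off the permutation. -/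
theorem genX_inj : (n : ℕ) → {a b : PQ n} → a ∈ genX n → b ∈ genX n → a.1 = b.1 → a = b
  | 0, a, b, ha, hb, _ => by rw [genX_zero ha, genX_zero hb]
  | n + 1, a, b, ha, hb, h => by
    obtain ⟨i, a', ha', rfl⟩ := genX_succ ha
    obtain ⟨j, b', hb', rfl⟩ := genX_succ hb
    have hl := congrArg (fun σ => σ (Fin.last n)) h
    change (insX n i).1 (extP a'.1 (Fin.last n)) = (insX n j).1 (extP b'.1 (Fin.last n)) at hl
    rw [extP_last, extP_last, insX_apply_last, insX_apply_last] at hl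
    subst hl
    have h2 : extP a'.1 = extP b'.1 := mul_left_cancel h
    rw [genX_inj n ha' hb' (extP_injective h2)]

theorem exists_extP {n : ℕ} {τ : Equiv.Perm (Fin (n + 1))} (hl : τ (Fin.last n) = Fin.last n) :
    ∃ ρ : Equiv.Perm (Fin n), extP ρ = τ := by
  set κ := finSuccEquivLast.symm.trans (τ.trans finSuccEquivLast) with hκ
  have hn : κ none = none := by simp [hκ, hl]
  refine ⟨Equiv.removeNone κ, ?_⟩
  have h1 : Equiv.optionCongr (Equiv.removeNone κ) = κ := by
    ext1 x
    cases x with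
    | none => rw [Equiv.optionCongr_apply, Option.map_none, hn]
    | some a =>
      have hs : ∃ y, κ (some a) = some y := by
        rw [← Option.ne_none_iff_exists']
        intro h
        exact absurd (κ.injective (h.trans hn.symm)) (by simp)
      rw [Equiv.optionCongr_apply, Option.map_some, Equiv.removeNone_some κ hs]
  change finSuccEquivLast.trans ((Equiv.optionCongr (Equiv.removeNone κ)).trans
    finSuccEquivLast.symm) = τ
  rw [h1, hκ]
  ext i
  simp

theorem genX_surj : (n : ℕ) → (σ : Equiv.Perm (Fin n)) → ∃ a ∈ genX n, a.1 = σ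
  | 0, σ => ⟨1, one_mem _, Subsingleton.elim _ _⟩
  | n + 1, σ => by
    set τ := (insX n (σ (Fin.last n))).1⁻¹ * σ with hτ
    have hl : τ (Fin.last n) = Fin.last n := by
      rw [hτ, Equiv.Perm.mul_apply, Equiv.Perm.inv_eq_iff_eq, insX_apply_last]
    obtain ⟨ρ, hρ⟩ := exists_extP hl
    obtain ⟨a, ha, rfl⟩ := genX_surj n ρ
    refine ⟨insX n (σ (Fin.last n)) * extX a, mul_mem (insX_mem _ _) (extX_mem ha), ?_⟩
    change (insX n (σ (Fin.last n))).1 * extP a.1 = σ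
    rw [hρ, hτ, mul_inv_cancel_left]

/-- The diagram realising a permutation: the wire at place `i` is led to place `σ i`. -/
noncomputable def P {n : ℕ} : Equiv.Perm (Fin n) →* Q n n where
  toFun σ := (genX_surj n σ).choose.2
  map_one' := by
    have h := (genX_surj n 1).choose_spec
    exact congrArg Prod.snd (genX_inj n h.1 (one_mem _) h.2)
  map_mul' σ τ := by
    have h := (genX_surj n (σ * τ)).choose_spec
    have h1 := (genX_surj n σ).choose_spec
    have h2 := (genX_surj n τ).choose_spec
    refine congrArg Prod.snd (genX_inj n h.1 (mul_mem h1.1 h2.1) ?_)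
    rw [h.2, Prod.fst_mul, h1.2, h2.2]

theorem P_mem {n : ℕ} (σ : Equiv.Perm (Fin n)) : (σ, P σ) ∈ genX n := by
  have h := (genX_surj n σ).choose_spec
  have h2 : (genX_surj n σ).choose = (σ, P σ) := Prod.ext h.2 rfl
  rw [← h2]
  exact h.1

theorem P_eq {n : ℕ} {σ : Equiv.Perm (Fin n)} {a : Q n n} (h : (σ, a) ∈ genX n) : P σ = a :=
  congrArg Prod.snd (genX_inj n (P_mem σ) h rfl)

theorem P_extP {n : ℕ} (σ : Equiv.Perm (Fin n)) : P (extP σ) = ext (P σ) :=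
  P_eq (extX_mem (P_mem σ))

theorem P_topP (n : ℕ) : P (topP n) = sw n :=
  P_eq (Submonoid.subset_closure (IsGen.top n))

theorem P_mul_inv {n : ℕ} (σ : Equiv.Perm (Fin n)) : P σ * P σ⁻¹ = 1 := by
  rw [← map_mul, mul_inv_cancel, map_one]

theorem P_inv_mul {n : ℕ} (σ : Equiv.Perm (Fin n)) : P σ⁻¹ * P σ = 1 := by
  rw [← map_mul, inv_mul_cancel, map_one]

/-! ### Operations at given places -/

theorem mul_P_inv_left {n : ℕ} (σ : Equiv.Perm (Fin n)) (a : Q n n) : P σ⁻¹ * (P σ * a) = a := by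
  rw [← mul_assoc, P_inv_mul, one_mul]

/-- Conjugation by a permutation of the wires. -/
noncomputable def conjP {n : ℕ} (σ : Equiv.Perm (Fin n)) : Q n n →* Q n n where
  toFun a := P σ * a * P σ⁻¹
  map_one' := by rw [mul_one, P_mul_inv]
  map_mul' a b := by
    rw [mul_assoc, mul_assoc, mul_assoc, mul_assoc, mul_assoc, mul_P_inv_left]

theorem conjP_def {n : ℕ} (σ : Equiv.Perm (Fin n)) (a : Q n n) :
    conjP σ a = P σ * a * P σ⁻¹ := rfl

theorem P_mul {n : ℕ} (σ : Equiv.Perm (Fin n)) (a : Q n n) : P σ * a = conjP σ a * P σ := by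
  rw [conjP_def, mul_assoc, mul_assoc, P_inv_mul, mul_one]

theorem conjP_mul {n : ℕ} (σ τ : Equiv.Perm (Fin n)) (a : Q n n) :
    conjP (σ * τ) a = conjP σ (conjP τ a) := by
  rw [conjP_def, conjP_def, conjP_def, mul_inv_rev, map_mul P, map_mul P]
  simp only [mul_assoc]

theorem conjP_of_commute {n : ℕ} {σ : Equiv.Perm (Fin n)} {a : Q n n}
    (h : P σ * a = a * P σ) : conjP σ a = a := by
  rw [conjP_def, h, mul_assoc, P_mul_inv, mul_one]

theorem ext_conjP {n : ℕ} (σ : Equiv.Perm (Fin n)) (a : Q n n) :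
    ext (conjP σ a) = conjP (extP σ) (ext a) := by
  rw [conjP_def, conjP_def, map_mul, map_mul, P_extP, ← map_inv extP, P_extP]

theorem conjP_eq_of_conjP {n : ℕ} {σ τ : Equiv.Perm (Fin n)} {a : Q n n}
    (h : conjP (τ⁻¹ * σ) a = a) : conjP σ a = conjP τ a := by
  conv_lhs => rw [← mul_inv_cancel_left τ σ]
  rw [conjP_mul, h]

/-- A permutation with two prescribed values. -/
theorem exists_perm_two {n : ℕ} {i j : Fin (n + 2)} (h : i ≠ j) :
    ∃ σ : Equiv.Perm (Fin (n + 2)), σ (Fin.last n).castSucc = i ∧ σ (Fin.last (n + 1)) = j := by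
  have hne : (Fin.last n).castSucc ≠ Fin.last (n + 1) := (Fin.castSucc_lt_last _).ne
  refine ⟨Equiv.swap j (Fin.last (n + 1)) *
    Equiv.swap (Equiv.swap j (Fin.last (n + 1)) i) (Fin.last n).castSucc, ?_, ?_⟩
  · simp
  · rw [Equiv.Perm.mul_apply, Equiv.swap_apply_of_ne_of_ne _ hne.symm, Equiv.swap_apply_right]
    intro h'
    rw [eq_comm, Equiv.swap_apply_eq_iff, Equiv.swap_apply_right] at h'
    exact h h'

/-- A permutation sending the last two letters to `i` and `j`. -/
noncomputable def pairPerm {n : ℕ} (i j : Fin (n + 2)) : Equiv.Perm (Fin (n + 2)) :=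
  open Classical in if h : i = j then 1 else (exists_perm_two h).choose

theorem pairPerm_spec {n : ℕ} {i j : Fin (n + 2)} (h : i ≠ j) :
    pairPerm i j (Fin.last n).castSucc = i ∧ pairPerm i j (Fin.last (n + 1)) = j := by
  rw [pairPerm, dif_neg h]
  exact (exists_perm_two h).choose_spec

/-- The diagram `a` applied to wire `i`. -/
noncomputable def op1 : {m : ℕ} → (i : Fin m) → Q 1 1 →* Q m m
  | 0, i => i.elim0
  | n + 1, i => (conjP (Equiv.swap i (Fin.last n))).comp (lft n)

/-- The diagram `a` applied to the wires `i` and `j` (only meaningful for `i ≠ j`). -/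
noncomputable def op2 : {m : ℕ} → (i j : Fin m) → Q 2 2 →* Q m m
  | 0, i, _ => i.elim0
  | 1, _, _ => 1
  | n + 2, i, j => (conjP (pairPerm i j)).comp (lft n)

theorem op1_eq {n : ℕ} (σ : Equiv.Perm (Fin (n + 1))) (a : Q 1 1) :
    op1 (σ (Fin.last n)) a = conjP σ (lft n a) := by
  change conjP (Equiv.swap (σ (Fin.last n)) (Fin.last n)) (lft n a) = _
  refine conjP_eq_of_conjP ?_
  obtain ⟨ρ, hρ⟩ := exists_extP (n := n)
    (τ := σ⁻¹ * Equiv.swap (σ (Fin.last n)) (Fin.last n)) (by simp)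
  refine conjP_of_commute ?_
  rw [← hρ, P_extP]
  exact tens_commute _ _

theorem op2_eq {n : ℕ} (σ : Equiv.Perm (Fin (n + 2))) (a : Q 2 2) :
    op2 (σ (Fin.last n).castSucc) (σ (Fin.last (n + 1))) a = conjP σ (lft n a) := by
  have hne : (Fin.last n).castSucc ≠ Fin.last (n + 1) := (Fin.castSucc_lt_last _).ne
  have hs := pairPerm_spec (σ.injective.ne hne)
  change conjP (pairPerm _ _) (lft n a) = _
  refine conjP_eq_of_conjP ?_
  obtain ⟨ρ, hρ⟩ := exists_extP (n := n + 1)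
    (τ := σ⁻¹ * pairPerm (σ (Fin.last n).castSucc) (σ (Fin.last (n + 1)))) (by
      rw [Equiv.Perm.mul_apply, hs.2]; simp)
  obtain ⟨ρ', hρ'⟩ := exists_extP (n := n) (τ := ρ) (by
    refine Fin.castSucc_injective _ ?_
    rw [← extP_castSucc, hρ, Equiv.Perm.mul_apply, hs.1]; simp)
  refine conjP_of_commute ?_
  rw [← hρ, P_extP, ← hρ', P_extP, ext_ext]
  exact tens_commute _ _

theorem op1_last {n : ℕ} (a : Q 1 1) : op1 (Fin.last n) a = lft n a := by
  have h := op1_eq (1 : Equiv.Perm (Fin (n + 1))) a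
  rw [conjP_of_commute (by rw [map_one, one_mul, mul_one])] at h
  exact h

theorem op2_last {n : ℕ} (a : Q 2 2) :
    op2 (Fin.last n).castSucc (Fin.last (n + 1)) a = lft n a := by
  have h := op2_eq (1 : Equiv.Perm (Fin (n + 2))) a
  rw [conjP_of_commute (by rw [map_one, one_mul, mul_one])] at h
  exact h

theorem conjP_op1 {m : ℕ} (σ : Equiv.Perm (Fin m)) (i : Fin m) (a : Q 1 1) :
    conjP σ (op1 i a) = op1 (σ i) a := by
  cases m with
  | zero => exact i.elim0
  | succ n =>
    have h1 := op1_eq (Equiv.swap i (Fin.last n)) a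
    have h2 := op1_eq (σ * Equiv.swap i (Fin.last n)) a
    rw [conjP_mul, ← h1] at h2
    simpa using h2.symm

theorem conjP_op2 {m : ℕ} (σ : Equiv.Perm (Fin m)) {i j : Fin m} (h : i ≠ j) (a : Q 2 2) :
    conjP σ (op2 i j a) = op2 (σ i) (σ j) a := by
  match m with
  | 0 => exact i.elim0
  | 1 => exact absurd (Subsingleton.elim (α := Fin 1) i j) h
  | n + 2 =>
    have hs := pairPerm_spec h
    have h1 := op2_eq (pairPerm i j) a
    have h2 := op2_eq (σ * pairPerm i j) a
    rw [conjP_mul, ← h1] at h2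
    simpa [hs] using h2.symm

theorem op1_ext {m : ℕ} (i : Fin m) (a : Q 1 1) : ext (op1 i a) = op1 i.castSucc a := by
  cases m with
  | zero => exact i.elim0
  | succ n =>
    have h1 : ext a = q swap * (lft 1 a * q swap) := by
      have h : q swap * q swap = 1 := sound ZXEq.swap_swap
      rw [← slide_one, ← mul_assoc, h, one_mul]
    obtain ⟨σ, hσ⟩ : ∃ σ : Equiv.Perm (Fin (n + 1)), σ (Fin.last n) = i :=
      ⟨Equiv.swap i (Fin.last n), Equiv.swap_apply_right _ _⟩
    subst hσ
    rw [op1_eq, ext_conjP, ext_lft, h1, map_mul (lft n), map_mul (lft n), ← mul_assoc]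
    have h2 : sw n * lft (n + 1) a * sw n = conjP (topP n) (lft (n + 1) a) := by
      rw [conjP_def, P_topP, topP, Equiv.swap_inv]
      exact congrArg _ (P_topP n).symm
    have h3 : lft n (lft 1 a) = lft (n + 1) a := eq_of_heq (lft_lft n 1 a)
    rw [h3]
    change conjP (extP σ) (sw n * lft (n + 1) a * sw n) = _
    rw [h2, ← conjP_mul, ← op1_eq, Equiv.Perm.mul_apply, topP_last, extP_castSucc]

/-- Adding an idle wire is compatible with the placement of operations; the idle wire is slid past
`a`. -/
theorem op2_ext {m : ℕ} {i j : Fin m} (h : i ≠ j) (a : Q 2 2) :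
    ext (op2 i j a) = op2 i.castSucc j.castSucc a := by
  match m with
  | 0 => exact i.elim0
  | 1 => exact absurd (Subsingleton.elim (α := Fin 1) i j) h
  | n + 2 =>
    have hσσ : q swap * q swap = 1 := sound ZXEq.swap_swap
    have h1 : ext a = lft 1 (q swap) * ext (q swap) * lft 1 a *
        (ext (q swap) * lft 1 (q swap)) := by
      have e1 : ext (q swap) * ext (q swap) = 1 := by rw [← map_mul, hσσ, map_one]
      have e2 : lft 1 (q swap) * lft 1 (q swap) = 1 := by rw [← map_mul, hσσ, map_one]
      have h := slide_two a
      calc ext a = lft 1 (q swap) * (ext (q swap) * ext (q swap)) * lft 1 (q swap) * ext a := by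
            rw [e1, mul_one, e2, one_mul]
        _ = lft 1 (q swap) * ext (q swap) * (ext (q swap) * lft 1 (q swap) * ext a) := by
            simp only [mul_assoc]
        _ = _ := by rw [h]; simp only [mul_assoc]
    obtain ⟨σ, hi, hj⟩ := exists_perm_two h
    subst hi hj
    rw [op2_eq, ext_conjP, ext_lft, h1]
    have hP : P (topP (n + 1) * extP (topP n)) = lft n (lft 1 (q swap) * ext (q swap)) := by
      rw [map_mul, P_topP, P_extP, P_topP, map_mul, ← ext_lft]
      exact congrArg (· * _) (eq_of_heq (lft_lft n 1 (q swap))).symm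
    have hP' : P (topP (n + 1) * extP (topP n))⁻¹ = lft n (ext (q swap) * lft 1 (q swap)) := by
      rw [mul_inv_rev, ← map_inv extP, topP, topP, Equiv.swap_inv, Equiv.swap_inv]
      change P (extP (topP n) * topP (n + 1)) = _
      rw [map_mul, P_topP, P_extP, P_topP, map_mul, ← ext_lft]
      exact congrArg (_ * ·) (eq_of_heq (lft_lft n 1 (q swap))).symm
    have h3 : lft n (lft 1 a) = lft (n + 1) a := eq_of_heq (lft_lft n 1 a)
    rw [map_mul (lft n), map_mul (lft n), h3]
    have h2 : lft n (lft 1 (q swap) * ext (q swap)) * lft (n + 1) a *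
        lft n (ext (q swap) * lft 1 (q swap)) =
        conjP (topP (n + 1) * extP (topP n)) (lft (n + 1) a) := by
      rw [conjP_def, hP, hP']
    refine (congrArg _ h2).trans ?_
    rw [← conjP_mul, ← op2_eq]
    simp [topP_last, topP_castSucc_castSucc]

theorem op1_commute_op1 {m : ℕ} {i j : Fin m} (h : i ≠ j) (a b : Q 1 1) :
    Commute (op1 i a) (op1 j b) := by
  match m with
  | 0 => exact i.elim0
  | 1 => exact absurd (Subsingleton.elim (α := Fin 1) i j) h
  | n + 2 =>
    obtain ⟨σ, hi, hj⟩ := exists_perm_two h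
    subst hi hj
    rw [← conjP_op1, ← conjP_op1]
    refine Commute.map ?_ _
    rw [← op1_ext, op1_last b]
    exact tens_commute _ _

/-- Any `k` distinct letters are the images of the last `k` letters under some permutation. -/
theorem exists_perm {n k : ℕ} (v : Fin k → Fin (n + k)) (hv : Function.Injective v) :
    ∃ σ : Equiv.Perm (Fin (n + k)), ∀ j, σ (Fin.natAdd n j) = v j := by
  have := Equiv.Perm.isMultiplyPretransitive (Fin (n + k)) k
  obtain ⟨σ, hσ⟩ := MulAction.exists_smul_eq (Equiv.Perm (Fin (n + k)))
    (⟨Fin.natAdd n, Fin.natAdd_injective k n⟩ : Fin k ↪ Fin (n + k)) ⟨v, hv⟩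
  refine ⟨σ, fun j => ?_⟩
  have := congrArg (fun f => f j) hσ
  exact this

theorem exists_perm_three {n : ℕ} {i j k : Fin (n + 3)} (hij : i ≠ j) (hik : i ≠ k) (hjk : j ≠ k) :
    ∃ σ : Equiv.Perm (Fin (n + 3)), σ (Fin.last n).castSucc.castSucc = i ∧
      σ (Fin.last (n + 1)).castSucc = j ∧ σ (Fin.last (n + 2)) = k := by
  obtain ⟨σ, hσ⟩ := exists_perm (n := n) ![i, j, k] (by
    intro a b h
    fin_cases a <;> fin_cases b <;> simp_all)
  exact ⟨σ, hσ 0, hσ 1, hσ 2⟩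

theorem exists_perm_four {n : ℕ} {i j k l : Fin (n + 4)} (hij : i ≠ j) (hik : i ≠ k) (hil : i ≠ l)
    (hjk : j ≠ k) (hjl : j ≠ l) (hkl : k ≠ l) :
    ∃ σ : Equiv.Perm (Fin (n + 4)), σ (Fin.last n).castSucc.castSucc.castSucc = i ∧
      σ (Fin.last (n + 1)).castSucc.castSucc = j ∧ σ (Fin.last (n + 2)).castSucc = k ∧
      σ (Fin.last (n + 3)) = l := by
  obtain ⟨σ, hσ⟩ := exists_perm (n := n) ![i, j, k, l] (by
    intro a b h
    fin_cases a <;> fin_cases b <;> simp_all)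
  exact ⟨σ, hσ 0, hσ 1, hσ 2, hσ 3⟩

theorem castSucc_ne_last' {n : ℕ} (i : Fin n) : i.castSucc ≠ Fin.last n :=
  (Fin.castSucc_lt_last i).ne

theorem op1_commute_op2 {m : ℕ} {i j k : Fin m} (hij : i ≠ j) (hik : i ≠ k) (hjk : j ≠ k)
    (a : Q 1 1) (b : Q 2 2) : Commute (op1 i a) (op2 j k b) := by
  obtain ⟨n, rfl⟩ : ∃ n, m = n + 3 := ⟨m - 3, by omega⟩
  obtain ⟨σ, hi, hj, hk⟩ := exists_perm_three hij hik hjk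
  subst hi hj hk
  rw [← conjP_op1, ← conjP_op2 _ (castSucc_ne_last' _)]
  refine Commute.map ?_ _
  rw [← op1_ext, ← op1_ext, op2_last b, ext_ext]
  exact tens_commute _ _

theorem op2_commute_op2 {m : ℕ} {i j k l : Fin m} (hij : i ≠ j) (hik : i ≠ k) (hil : i ≠ l)
    (hjk : j ≠ k) (hjl : j ≠ l) (hkl : k ≠ l) (a b : Q 2 2) :
    Commute (op2 i j a) (op2 k l b) := by
  obtain ⟨n, rfl⟩ : ∃ n, m = n + 4 := ⟨m - 4, by omega⟩
  obtain ⟨σ, hi, hj, hk, hl⟩ := exists_perm_four hij hik hil hjk hjl hkl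
  subst hi hj hk hl
  have hne : (Fin.last n).castSucc ≠ Fin.last (n + 1) := castSucc_ne_last' _
  rw [← conjP_op2 _ (castSucc_ne_last' _),
    ← conjP_op2 _ (fun h => hne (Fin.castSucc_injective _ (Fin.castSucc_injective _ h)))]
  refine Commute.map ?_ _
  rw [← op2_ext (fun h => hne (Fin.castSucc_injective _ h)), ← op2_ext hne, op2_last b, ext_ext]
  exact tens_commute _ _

theorem op2_fst {m : ℕ} {i j : Fin m} (h : i ≠ j) (a : Q 1 1) : op2 i j (ext a) = op1 i a := by
  match m with
  | 0 => exact i.elim0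
  | 1 => exact absurd (Subsingleton.elim (α := Fin 1) i j) h
  | n + 2 =>
    obtain ⟨σ, hi, hj⟩ := exists_perm_two h
    subst hi hj
    rw [← conjP_op1, ← conjP_op2 _ (castSucc_ne_last' _), ← op1_ext, op2_last, op1_last, ext_lft]

theorem op2_snd {m : ℕ} {i j : Fin m} (h : i ≠ j) (a : Q 1 1) : op2 i j (lft 1 a) = op1 j a := by
  match m with
  | 0 => exact i.elim0
  | 1 => exact absurd (Subsingleton.elim (α := Fin 1) i j) h
  | n + 2 =>
    obtain ⟨σ, hi, hj⟩ := exists_perm_two h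
    subst hi hj
    rw [← conjP_op1, ← conjP_op2 _ (castSucc_ne_last' _), op2_last, op1_last]
    exact congrArg _ (eq_of_heq (lft_lft n 1 a))

theorem op2_swap {m : ℕ} {i j : Fin m} (h : i ≠ j) : op2 i j (q swap) = P (Equiv.swap i j) := by
  match m with
  | 0 => exact i.elim0
  | 1 => exact absurd (Subsingleton.elim (α := Fin 1) i j) h
  | n + 2 =>
    obtain ⟨σ, hi, hj⟩ := exists_perm_two h
    subst hi hj
    rw [← conjP_op2 _ (castSucc_ne_last' _), op2_last]
    change conjP σ (sw n) = _
    rw [← P_topP, conjP_def, ← map_mul, ← map_mul, topP, Equiv.swap_apply_apply]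

/-- The two wires may be listed in the other order. -/
theorem op2_symm {m : ℕ} {i j : Fin m} (h : i ≠ j) (a : Q 2 2) :
    op2 i j (q swap * a * q swap) = op2 j i a := by
  rw [map_mul, map_mul, op2_swap h]
  have h1 := conjP_op2 (Equiv.swap i j) h a
  rw [conjP_def, Equiv.swap_inv, Equiv.swap_apply_left, Equiv.swap_apply_right] at h1
  exact h1

/-- Relations between diagrams on three wires hold at any three places. -/
theorem exists_op3 {m : ℕ} {i j k : Fin m} (hij : i ≠ j) (hik : i ≠ k) (hjk : j ≠ k) :
    ∃ Φ : Q 3 3 →* Q m m, (∀ a, Φ (ext a) = op2 i j a) ∧ ∀ a, Φ (lft 1 a) = op2 j k a := by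
  obtain ⟨n, rfl⟩ : ∃ n, m = n + 3 := ⟨m - 3, by omega⟩
  obtain ⟨σ, hi, hj, hk⟩ := exists_perm_three hij hik hjk
  subst hi hj hk
  have hne : (Fin.last n).castSucc ≠ Fin.last (n + 1) := castSucc_ne_last' _
  refine ⟨(conjP σ).comp (lft n), fun a => ?_, fun a => ?_⟩
  · rw [← conjP_op2 _ (fun h => hne (Fin.castSucc_injective _ h)), ← op2_ext hne, op2_last]
    exact congrArg (conjP σ) (ext_lft n a).symm
  · rw [← conjP_op2 _ (castSucc_ne_last' _), op2_last]
    exact congrArg (conjP σ) (eq_of_heq (lft_lft n 1 a))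

/-- Relations between diagrams on four wires hold at any four places. -/
theorem exists_op4 {m : ℕ} {i j k l : Fin m} (hij : i ≠ j) (hik : i ≠ k) (hil : i ≠ l)
    (hjk : j ≠ k) (hjl : j ≠ l) (hkl : k ≠ l) :
    ∃ Φ : Q 4 4 →* Q m m, (∀ a, Φ (ext (ext a)) = op2 i j a) ∧
      (∀ a, Φ (ext (lft 1 a)) = op2 j k a) ∧ ∀ a, Φ (lft 2 a) = op2 k l a := by
  obtain ⟨n, rfl⟩ : ∃ n, m = n + 4 := ⟨m - 4, by omega⟩
  obtain ⟨σ, hi, hj, hk, hl⟩ := exists_perm_four hij hik hil hjk hjl hkl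
  subst hi hj hk hl
  have hne : (Fin.last n).castSucc ≠ Fin.last (n + 1) := castSucc_ne_last' _
  have hne' : (Fin.last (n + 1)).castSucc ≠ Fin.last (n + 2) := castSucc_ne_last' _
  refine ⟨(conjP σ).comp (lft n), fun a => ?_, fun a => ?_, fun a => ?_⟩
  · rw [← conjP_op2 _ (fun h => hne (Fin.castSucc_injective _ (Fin.castSucc_injective _ h))),
      ← op2_ext (fun h => hne (Fin.castSucc_injective _ h)), ← op2_ext hne, op2_last]
    exact congrArg (conjP σ) ((congrArg ext (ext_lft n a)).trans (ext_lft n _)).symm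
  · rw [← conjP_op2 _ (fun h => hne' (Fin.castSucc_injective _ h)), ← op2_ext hne', op2_last]
    have h : lft (n + 1) a = lft n (lft 1 a) := (eq_of_heq (lft_lft n 1 a)).symm
    rw [h]
    exact congrArg (conjP σ) (ext_lft n _).symm
  · rw [← conjP_op2 _ (castSucc_ne_last' _), op2_last]
    exact congrArg (conjP σ) (eq_of_heq (lft_lft n 2 a))

/-! ### Green spiders on one, two and three wires -/

/-- The green phase node. -/
noncomputable def zph (α β : Real.Angle) : Q 1 1 := q (Z 1 1 α β)

/-- The green spider with two inputs and two outputs. -/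
noncomputable def spi : Q 2 2 := q (Z 2 2 0 0)

/-- The green state with one output. -/
noncomputable def gst : Q 0 1 := q (Z 0 1 0 0)

/-- The green effect with one input. -/
noncomputable def gef : Q 1 0 := q (Z 1 0 0 0)

/-- The green copy spider. -/
noncomputable def cpy : Q 1 2 := q (Z 1 2 0 0)

/-- The green merge spider. -/
noncomputable def mrg : Q 2 1 := q (Z 2 1 0 0)

/-- A wire is cut and restarted with the green state. -/
noncomputable def rst : Q 1 1 := gef ⟫ gst

theorem zph_mul (α β γ δ : Real.Angle) : zph α β * zph γ δ = zph (α + γ) (β + δ) := by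
  have h := sound (ZXEq.S1 1 0 0 1 0 γ δ α β)
  have h1 : Q.comp (n := 1) (m := 1) (k := 1) (q (Z 1 1 γ δ) ◎ (1 : Q 0 0))
      ((1 : Q 0 0) ◎ q (Z 1 1 α β)) = q (Z 1 1 (γ + α) (δ + β)) := h
  rw [tens_zero] at h1
  rw [add_comm α, add_comm β]
  refine Eq.trans ?_ h1
  exact congrArg (q (Z 1 1 γ δ) ⟫ ·) (eq_of_heq (zero_tens (q (Z 1 1 α β)))).symm

@[simp] theorem zph_zero : zph 0 0 = 1 := (sound ZXEq.S2).trans q_wire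

theorem zph_commute (α β γ δ : Real.Angle) : Commute (zph α β) (zph γ δ) := by
  rw [Commute, SemiconjBy, zph_mul, zph_mul, add_comm α, add_comm β]

theorem swap_mul_spider (α β : Real.Angle) : q swap * q (Z 2 2 α β) = q (Z 2 2 α β) := by
  have h := sound (ZXEq.S1_out 2 0 0 α β)
  have h1 : q (Z 2 2 α β) ⟫ ((1 : Q 0 0) ◎ q swap ◎ (1 : Q 0 0)) = q (Z 2 2 α β) := h
  rw [tens_zero] at h1
  refine Eq.trans ?_ h1
  exact congrArg (q (Z 2 2 α β) ⟫ ·) (eq_of_heq (zero_tens (q swap))).symm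

theorem spider_mul_swap (α β : Real.Angle) : q (Z 2 2 α β) * q swap = q (Z 2 2 α β) := by
  have h := sound (ZXEq.S1_in 0 0 2 α β)
  have h1 : ((1 : Q 0 0) ◎ q swap ◎ (1 : Q 0 0)) ⟫ q (Z 2 2 α β) = q (Z 2 2 α β) := h
  rw [tens_zero] at h1
  refine Eq.trans ?_ h1
  exact congrArg (· ⟫ q (Z 2 2 α β)) (eq_of_heq (zero_tens (q swap))).symm

theorem lft_spi_mul_ext_spi : lft 1 spi * ext spi = q (Z 3 3 0 0) := by
  have h := sound (ZXEq.S1 2 1 1 2 0 0 0 0 0)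
  simp only [add_zero] at h
  have h1 : Q.comp (n := 3) (m := 3) (k := 3) (spi ◎ (1 : Q 1 1)) ((1 : Q 1 1) ◎ spi) =
    q (Z 3 3 0 0) := h
  exact h1

theorem ext_swap_mul_spider : ext (q swap) * q (Z 3 3 0 0) = q (Z 3 3 0 0) := by
  have h := sound (ZXEq.S1_out 3 0 1 0 0)
  have h1 : q (Z 3 3 0 0) ⟫ ((1 : Q 0 0) ◎ q swap ◎ (1 : Q 1 1)) = q (Z 3 3 0 0) := h
  refine Eq.trans ?_ h1
  exact congrArg (fun x : Q 2 2 => q (Z 3 3 0 0) ⟫ (x ◎ (1 : Q 1 1)))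
    (eq_of_heq (zero_tens (q swap))).symm

theorem spider_mul_lft_swap : q (Z 3 3 0 0) * lft 1 (q swap) = q (Z 3 3 0 0) := by
  have h := sound (ZXEq.S1_in 1 0 3 0 0)
  have h1 : ((1 : Q 1 1) ◎ q swap ◎ (1 : Q 0 0)) ⟫ q (Z 3 3 0 0) = q (Z 3 3 0 0) := h
  rw [tens_zero] at h1
  exact h1

theorem spi_mul_ext_zph (α β : Real.Angle) : spi * ext (zph α β) = q (Z 2 2 α β) := by
  have h := sound (ZXEq.S1 1 0 1 2 0 α β 0 0)
  simp only [add_zero] at h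
  have h1 : Q.comp (n := 2) (m := 2) (k := 2) (ext (zph α β)) ((1 : Q 0 0) ◎ spi) =
      q (Z 2 2 α β) := h
  refine Eq.trans ?_ h1
  exact congrArg (ext (zph α β) ⟫ ·) (eq_of_heq (zero_tens spi)).symm

theorem lft_zph_mul_spi (α β : Real.Angle) : lft 1 (zph α β) * spi = q (Z 2 2 α β) := by
  have h := sound (ZXEq.S1 2 1 0 1 0 0 0 α β)
  simp only [zero_add] at h
  have h1 : (spi ◎ (1 : Q 0 0)) ⟫ lft 1 (zph α β) = q (Z 2 2 α β) := h
  rw [tens_zero] at h1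
  exact h1

theorem gst_tens_comp_swap : (gst ◎ (1 : Q 1 1)) ⟫ q swap = (1 : Q 1 1) ◎ gst := by
  have h := sound (ZXEq.slide (Z 0 1 0 0))
  have h1 : (gst ◎ q wire) ⟫ (q (crossing 1) : Q 2 2) = q wire ⟫ (q wire ◎ gst) := h
  rw [crossing_one, q_wire] at h1
  exact h1.trans (one_comp _)

theorem swap_comp_gef : q swap ⟫ ((1 : Q 1 1) ◎ gef) = gef ◎ (1 : Q 1 1) := by
  have h := sound (ZXEq.slide (Z 1 0 0 0))
  have h1 : (gef ◎ q wire) ⟫ q wire = (q (crossing 1) : Q 2 2) ⟫ (q wire ◎ gef) := h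
  rw [crossing_one, q_wire] at h1
  exact h1.symm.trans (comp_one _)

theorem gst_comp_spi : (gst ◎ (1 : Q 1 1)) ⟫ spi = cpy := by
  have h := sound (ZXEq.S1 0 0 1 2 0 0 0 0 0)
  simp only [zero_add] at h
  have h1 : Q.comp (n := 1) (m := 2) (k := 2) (gst ◎ (1 : Q 1 1)) ((1 : Q 0 0) ◎ spi) = cpy := h
  refine Eq.trans ?_ h1
  exact congrArg ((gst ◎ (1 : Q 1 1)) ⟫ ·) (eq_of_heq (zero_tens spi)).symm

theorem tens_gst_comp_spi : ((1 : Q 1 1) ◎ gst) ⟫ spi = cpy := by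
  rw [← gst_tens_comp_swap, comp_assoc]
  exact (congrArg (_ ⟫ ·) (spider_mul_swap 0 0)).trans gst_comp_spi

theorem spi_comp_tens_gef : spi ⟫ ((1 : Q 1 1) ◎ gef) = mrg := by
  have h := sound (ZXEq.S1 2 1 0 0 0 0 0 0 0)
  simp only [zero_add] at h
  have h1 : Q.comp (n := 2) (m := 2) (k := 1) (spi ◎ (1 : Q 0 0)) ((1 : Q 1 1) ◎ gef) = mrg := h
  rw [tens_zero] at h1
  exact h1

theorem spi_comp_gef : spi ⟫ (gef ◎ (1 : Q 1 1)) = mrg := by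
  rw [← swap_comp_gef, ← comp_assoc]
  exact (congrArg (· ⟫ _) (swap_mul_spider 0 0)).trans spi_comp_tens_gef

theorem cpy_comp_tens_gef : cpy ⟫ ((1 : Q 1 1) ◎ gef) = 1 := by
  have h := sound (ZXEq.S1 1 1 0 0 0 0 0 0 0)
  simp only [zero_add] at h
  have h1 : Q.comp (n := 1) (m := 2) (k := 1) (cpy ◎ (1 : Q 0 0)) ((1 : Q 1 1) ◎ gef) =
    zph 0 0 := h
  rw [tens_zero, zph_zero] at h1
  exact h1

theorem gst_comp_cpy : gst ⟫ cpy = q cap := by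
  have h := sound (ZXEq.S1 0 0 0 2 0 0 0 0 0)
  simp only [zero_add] at h
  have h1 : Q.comp (n := 0) (m := 1) (k := 2) (gst ◎ (1 : Q 0 0)) ((1 : Q 0 0) ◎ cpy) =
      q (Z 0 2 0 0) := h
  rw [tens_zero, sound ZXEq.S3_cap] at h1
  refine Eq.trans ?_ h1
  exact congrArg (gst ⟫ ·) (eq_of_heq (zero_tens cpy)).symm

theorem mrg_comp_gef : mrg ⟫ gef = q cup := by
  have h := sound (ZXEq.S1 2 0 0 0 0 0 0 0 0)
  simp only [zero_add] at h
  have h1 : Q.comp (n := 2) (m := 1) (k := 0) (mrg ◎ (1 : Q 0 0)) ((1 : Q 0 0) ◎ gef) =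
      q (Z 2 0 0 0) := h
  rw [tens_zero, sound ZXEq.S3_cup] at h1
  refine Eq.trans ?_ h1
  exact congrArg (mrg ⟫ ·) (eq_of_heq (zero_tens gef)).symm

/-! ### Hadamard nodes and edges -/

/-- The Hadamard node. -/
noncomputable def had : Q 1 1 := q H

/-- The Hadamard dagger node. -/
noncomputable def hdag : Q 1 1 := q Hdag

/-- The node of `H²`, which negates the basis label. -/
noncomputable def neg : Q 1 1 := had * had

theorem hdag_eq : hdag = had * had * had := by
  rw [mul_assoc]
  rfl

theorem hdag_mul_had : hdag * had = 1 := (sound ZXEq.H1).trans q_wire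

theorem had_mul_hdag : had * hdag = 1 := by
  have h := hdag_mul_had
  rw [hdag_eq] at h ⊢
  simpa only [mul_assoc] using h

theorem neg_mul_neg : neg * neg = 1 := by
  have h := had_mul_hdag
  rw [hdag_eq] at h
  simpa only [neg, mul_assoc] using h

theorem had_mul_neg : had * neg = hdag := by
  rw [hdag_eq, neg, mul_assoc]

theorem neg_mul_had : neg * had = hdag := by
  rw [hdag_eq, neg]

theorem hdag_mul_hdag : hdag * hdag = neg := (sound ZXEq.P1).symm

theorem q_parallel_one (U : Fin 1 → ZX 1 1) : q (parallel 1 U) = q (U 0) :=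
  eq_of_heq (zero_tens (q (U 0)))

theorem q_parallel_two (U : Fin 2 → ZX 1 1) : q (parallel 2 U) = q (U 0) ◎ q (U 1) := by
  have h : q (parallel 2 U) = q (parallel 1 (fun i => U i.castSucc)) ◎ q (U 1) := rfl
  rw [h, q_parallel_one]
  rfl

/-- The red phase node. -/
noncomputable def xph (α β : Real.Angle) : Q 1 1 := q (X 1 1 α β)

theorem xph_eq (α β : Real.Angle) : xph α β = had * zph α β * hdag := by
  have h := sound (ZXEq.H2 1 1 α β)
  rw [q_comp, q_comp, q_parallel_one, q_parallel_one, comp_assoc] at h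
  rw [mul_assoc]
  exact h.trans (comp_assoc _ _ _).symm

theorem xph_eq' (α β : Real.Angle) : xph β α = hdag * zph α β * had := by
  have h := sound (ZXEq.H2' 1 1 α β)
  rw [q_comp, q_comp, q_parallel_one, q_parallel_one, comp_assoc] at h
  rw [mul_assoc]
  exact h.trans (comp_assoc _ _ _).symm

/-- The red state with one output. -/
noncomputable def rdst : Q 0 1 := q (X 0 1 0 0)

/-- The red effect with one input. -/
noncomputable def rdef : Q 1 0 := q (X 1 0 0 0)

theorem rdst_eq : rdst = gst ⟫ had := by
  have h := sound (ZXEq.H2 0 1 0 0)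
  rw [q_comp, q_comp, q_parallel_one] at h
  refine h.trans ?_
  exact congrArg (· ⟫ had) (one_comp gst)

theorem rdst_eq' : rdst = gst ⟫ hdag := by
  have h := sound (ZXEq.H2' 0 1 0 0)
  rw [q_comp, q_comp, q_parallel_one] at h
  refine h.trans ?_
  exact congrArg (· ⟫ hdag) (one_comp gst)

theorem rdef_eq : rdef = hdag ⟫ gef := by
  have h := sound (ZXEq.H2 1 0 0 0)
  rw [q_comp, q_comp, q_parallel_one] at h
  exact h.trans (comp_one _)

theorem rdef_eq' : rdef = had ⟫ gef := by
  have h := sound (ZXEq.H2' 1 0 0 0)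
  rw [q_comp, q_comp, q_parallel_one] at h
  exact h.trans (comp_one _)

/-- The red merge spider with one input kept as a fresh green state. -/
noncomputable def rmg : Q 2 2 := q (X 2 1 0 0) ⟫ (gst ◎ (1 : Q 1 1))

theorem red_merge_eq : q (X 2 1 0 0) = (hdag ◎ hdag) ⟫ mrg ⟫ had := by
  have h := sound (ZXEq.H2 2 1 0 0)
  rw [q_comp, q_comp, q_parallel_one, q_parallel_two] at h
  exact h

theorem gst_comp_neg : gst ⟫ neg = gst := by
  have h := rdst_eq.symm.trans rdst_eq'
  have h2 := congrArg (· ⟫ had) h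
  rw [comp_assoc, comp_assoc] at h2
  have h3 : hdag ⟫ had = 1 := had_mul_hdag
  rw [h3, comp_one] at h2
  exact h2

theorem neg_comp_gef : neg ⟫ gef = gef := by
  have h := rdef_eq.symm.trans rdef_eq'
  have h2 := congrArg (had ⟫ ·) h
  simp only [← comp_assoc] at h2
  have h3 : had ⟫ hdag = 1 := hdag_mul_had
  rw [h3, one_comp] at h2
  exact h2.symm

theorem neg_mul_rst : neg * rst = rst := by
  rw [mul_def, rst, comp_assoc, gst_comp_neg]

theorem rst_mul_neg : rst * neg = rst := by
  rw [mul_def, rst, ← comp_assoc, neg_comp_gef]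

/-- An edge carrying a diagram: green nodes on two wires, connected through `f`. -/
noncomputable def edg (f : Q 1 1) : Q 2 2 :=
  Q.comp (n := 2) (m := 3) (k := 2) (Q.comp (n := 2) (m := 3) (k := 3) (cpy ◎ (1 : Q 1 1))
    ((1 : Q 1 1) ◎ f ◎ (1 : Q 1 1))) ((1 : Q 1 1) ◎ mrg)

theorem q_edge (w : ZMod 3) :
    q (edge w) = if w = 0 then 1 else edg (if w = 1 then had else hdag) := by
  unfold edge
  split_ifs with h h'
  · rfl
  · rw [q_comp, q_comp, q_tens, q_tens, q_tens, q_tens, q_wire]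
    rfl
  · rw [q_comp, q_comp, q_tens, q_tens, q_tens, q_tens, q_wire]
    rfl

/-- A wire carrying a fresh green state is inserted in the middle. -/
theorem mid_insert (a : Q 2 2) :
    Q.comp (n := 3) (m := 2) (k := 3) (Q.comp (n := 3) (m := 2) (k := 2)
      ((1 : Q 1 1) ◎ gef ◎ (1 : Q 1 1)) a) ((1 : Q 1 1) ◎ gst ◎ (1 : Q 1 1)) =
    lft 1 (q swap) * (ext a * lft 2 rst) * lft 1 (q swap) := by
  have h1 : Q.tens (n := 2) (m := 1) ((1 : Q 1 1) ◎ gef) (1 : Q 1 1) =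
      Q.comp (n := 3) (m := 3) (k := 2) (lft 1 (q swap)) ((1 : Q 2 2) ◎ gef) := by
    have e : (1 : Q 1 1) ◎ ((1 : Q 1 1) ◎ gef) = (1 : Q 2 2) ◎ gef := by
      rw [← one_tens_one 1 1]
      exact (eq_of_heq (tens_assoc (1 : Q 1 1) (1 : Q 1 1) gef)).symm
    rw [← e]
    refine (eq_of_heq (tens_assoc (1 : Q 1 1) gef (1 : Q 1 1))).trans ?_
    rw [← swap_comp_gef]
    exact one_tens_comp 1 (q swap) ((1 : Q 1 1) ◎ gef)
  have h2 : Q.tens (n := 1) (m := 2) ((1 : Q 1 1) ◎ gst) (1 : Q 1 1) =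
      Q.comp (n := 2) (m := 3) (k := 3) ((1 : Q 2 2) ◎ gst) (lft 1 (q swap)) := by
    have e : (1 : Q 1 1) ◎ ((1 : Q 1 1) ◎ gst) = (1 : Q 2 2) ◎ gst := by
      rw [← one_tens_one 1 1]
      exact (eq_of_heq (tens_assoc (1 : Q 1 1) (1 : Q 1 1) gst)).symm
    rw [← e]
    refine (eq_of_heq (tens_assoc (1 : Q 1 1) gst (1 : Q 1 1))).trans ?_
    have hσ : q swap ⟫ q swap = 1 := sound ZXEq.swap_swap
    have e3 : gst ◎ (1 : Q 1 1) = ((1 : Q 1 1) ◎ gst) ⟫ q swap := by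
      rw [← gst_tens_comp_swap, comp_assoc, hσ]
      exact (comp_one _).symm
    rw [e3]
    exact one_tens_comp 1 ((1 : Q 1 1) ◎ gst) (q swap)
  have h3 : Q.comp (n := 3) (m := 2) (k := 3) (Q.comp (n := 3) (m := 2) (k := 2)
      ((1 : Q 2 2) ◎ gef) a) ((1 : Q 2 2) ◎ gst) = ext a * lft 2 rst := by
    have e1 : Q.comp (n := 2) (m := 2) (k := 3) a ((1 : Q 2 2) ◎ gst) =
        Q.comp (n := 2) (m := 3) (k := 3) ((1 : Q 2 2) ◎ gst) (ext a) := by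
      have := (tens_eq_left a gst).symm.trans (tens_eq_right a gst)
      rw [tens_zero] at this
      exact this
    rw [comp_assoc, e1, ← comp_assoc]
    refine congrArg (· ⟫ ext a) ?_
    exact (one_tens_comp 2 gef gst).symm
  rw [← h3]
  refine (congrArg₂ (fun x y => Q.comp (n := 3) (m := 2) (k := 3)
    (Q.comp (n := 3) (m := 2) (k := 2) x a) y) h1 h2).trans ?_
  simp only [mul_def, comp_assoc]

/-- An edge is obtained by joining both wires to a wire in between. -/
theorem edg_eq (f : Q 1 1) :
    lft 1 (q swap) * (ext (edg f) * lft 2 rst) * lft 1 (q swap) =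
      lft 1 (ext rst) * lft 1 spi * lft 1 (ext f) * ext spi * lft 1 (ext rst) := by
  rw [← mid_insert]
  have h1 : Q.tens (n := 1) (m := 2) cpy (1 : Q 1 1) =
      Q.comp (n := 2) (m := 3) (k := 3) ((1 : Q 1 1) ◎ gst ◎ (1 : Q 1 1)) (ext spi) := by
    rw [← tens_gst_comp_spi]
    exact comp_tens_one 1 ((1 : Q 1 1) ◎ gst) spi
  have h2 : (1 : Q 1 1) ◎ mrg =
      Q.comp (n := 3) (m := 3) (k := 2) (lft 1 spi) ((1 : Q 1 1) ◎ gef ◎ (1 : Q 1 1)) := by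
    rw [← spi_comp_gef]
    refine (one_tens_comp 1 spi (gef ◎ (1 : Q 1 1))).trans ?_
    exact congrArg (lft 1 spi ⟫ ·) (eq_of_heq (tens_assoc (1 : Q 1 1) gef (1 : Q 1 1))).symm
  have h3 : Q.comp (n := 3) (m := 2) (k := 3) ((1 : Q 1 1) ◎ gef ◎ (1 : Q 1 1))
      ((1 : Q 1 1) ◎ gst ◎ (1 : Q 1 1)) = lft 1 (ext rst) := by
    refine (comp_tens_one 1 ((1 : Q 1 1) ◎ gef) ((1 : Q 1 1) ◎ gst)).symm.trans ?_
    rw [← ext_lft, ext_def, lft_def, rst]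
    exact congrArg (fun x : Q 2 2 => x ◎ (1 : Q 1 1)) (one_tens_comp 1 gef gst).symm
  have h4 : (1 : Q 1 1) ◎ f ◎ (1 : Q 1 1) = lft 1 (ext f) := by
    rw [← ext_lft]
    rfl
  rw [edg, ← h3]
  refine (congrArg₂ (fun x y => Q.comp (n := 3) (m := 2) (k := 3)
    (Q.comp (n := 3) (m := 2) (k := 2) ((1 : Q 1 1) ◎ gef ◎ (1 : Q 1 1))
    (Q.comp (n := 2) (m := 3) (k := 2) (Q.comp (n := 2) (m := 3) (k := 3) x
    ((1 : Q 1 1) ◎ f ◎ (1 : Q 1 1))) y)) ((1 : Q 1 1) ◎ gst ◎ (1 : Q 1 1))) h1 h2).trans ?_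
  rw [h4]
  simp only [mul_def, comp_assoc]

/-! ### Transposition -/

/-- `f'` is the transpose of `f`: they agree on the two ends of a cap. -/
def IsTr (f f' : Q 1 1) : Prop := q cap ⟫ (f ◎ (1 : Q 1 1)) = q cap ⟫ ((1 : Q 1 1) ◎ f')

theorem cap_snake : Q.comp (n := 1) (m := 3) (k := 1) (q cap ◎ (1 : Q 1 1))
    ((1 : Q 1 1) ◎ q cup) = 1 := by
  have h := sound ZXEq.snake_left
  rw [q_comp, q_tens, q_tens, q_wire] at h
  exact h

theorem cap_snake' : Q.comp (n := 1) (m := 3) (k := 1) ((1 : Q 1 1) ◎ q cap)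
    (q cup ◎ (1 : Q 1 1)) = 1 := by
  have h := sound ZXEq.snake_right
  rw [q_comp, q_tens, q_tens, q_wire] at h
  exact h

/-- The transpose is obtained by bending the wires of `f` with a cup and a cap. -/
theorem exists_isTr (f : Q 1 1) : ∃ f', IsTr f f' := by
  set A : Q 1 3 := (1 : Q 1 1) ◎ q cap with hA
  set F : Q 3 3 := (1 : Q 1 1) ◎ f ◎ (1 : Q 1 1) with hF
  set B : Q 3 1 := q cup ◎ (1 : Q 1 1) with hB
  refine ⟨A ⟫ F ⟫ B, ?_⟩
  have e1 : (1 : Q 1 1) ◎ (A ⟫ F ⟫ B) = Q.comp (n := 2) (m := 4) (k := 2)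
      (Q.comp (n := 2) (m := 4) (k := 4) ((1 : Q 1 1) ◎ A) ((1 : Q 1 1) ◎ F))
      ((1 : Q 1 1) ◎ B) := by
    rw [one_tens_comp, one_tens_comp]
  have e2 : (1 : Q 1 1) ◎ A = (1 : Q 2 2) ◎ q cap := by
    rw [← one_tens_one 1 1]
    exact (eq_of_heq (tens_assoc (1 : Q 1 1) (1 : Q 1 1) (q cap))).symm
  have e3 : q cap ⟫ ((1 : Q 2 2) ◎ q cap) =
      Q.comp (n := 0) (m := 2) (k := 4) (q cap) (q cap ◎ (1 : Q 2 2)) := by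
    refine Eq.trans ?_ ((tens_eq_left (q cap) (q cap)).symm.trans (tens_eq_right (q cap) (q cap)))
      |>.trans ?_
    · exact congrArg (· ⟫ ((1 : Q 2 2) ◎ q cap)) (tens_zero (q cap)).symm
    · exact congrArg (fun x : Q 0 2 => Q.comp (n := 0) (m := 2) (k := 4) x (q cap ◎ (1 : Q 2 2)))
        (eq_of_heq (zero_tens (q cap)))
  have e4 : (1 : Q 1 1) ◎ F = (1 : Q 2 2) ◎ (f ◎ (1 : Q 1 1)) := by
    rw [hF, ← one_tens_one 1 1]
    refine Eq.trans ?_ (eq_of_heq (tens_assoc (1 : Q 1 1) (1 : Q 1 1) (f ◎ (1 : Q 1 1)))).symm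
    exact congrArg ((1 : Q 1 1) ◎ ·) (eq_of_heq (tens_assoc (1 : Q 1 1) f (1 : Q 1 1)))
  have e5 : Q.comp (n := 2) (m := 4) (k := 4) (q cap ◎ (1 : Q 2 2))
      ((1 : Q 2 2) ◎ (f ◎ (1 : Q 1 1))) = Q.comp (n := 2) (m := 2) (k := 4) (f ◎ (1 : Q 1 1))
      (q cap ◎ (1 : Q 2 2)) := by
    refine ((tens_eq_left (q cap) (f ◎ (1 : Q 1 1))).symm.trans
      (tens_eq_right (q cap) (f ◎ (1 : Q 1 1)))).trans ?_
    exact congrArg (fun x : Q 2 2 => Q.comp (n := 2) (m := 2) (k := 4) x (q cap ◎ (1 : Q 2 2)))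
      (eq_of_heq (zero_tens (f ◎ (1 : Q 1 1))))
  have e6 : Q.comp (n := 2) (m := 4) (k := 2) (q cap ◎ (1 : Q 2 2)) ((1 : Q 1 1) ◎ B) = 1 := by
    have h1 : q cap ◎ (1 : Q 2 2) = Q.tens (n := 1) (m := 3) (q cap ◎ (1 : Q 1 1)) (1 : Q 1 1) := by
      rw [← one_tens_one 1 1]
      exact (eq_of_heq (tens_assoc (q cap) (1 : Q 1 1) (1 : Q 1 1))).symm
    have h2 : (1 : Q 1 1) ◎ B = Q.tens (n := 3) (m := 1) ((1 : Q 1 1) ◎ q cup) (1 : Q 1 1) :=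
      (eq_of_heq (tens_assoc (1 : Q 1 1) (q cup) (1 : Q 1 1))).symm
    refine (congrArg₂ (fun x y => Q.comp (n := 2) (m := 4) (k := 2) x y) h1 h2).trans ?_
    refine (comp_tens_one 1 (n := 1) (m := 3) (k := 1) (q cap ◎ (1 : Q 1 1))
      ((1 : Q 1 1) ◎ q cup)).symm.trans ?_
    rw [cap_snake]
    exact one_tens_one 1 1
  unfold IsTr
  rw [e1, e2, e4, ← comp_assoc, ← comp_assoc, e3, comp_assoc (q cap), e5, ← comp_assoc,
    comp_assoc, e6, comp_one]

/-- A diagram is determined by its action on one end of a cap, by the snake equation. -/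
theorem isTr_cancel {f f' : Q 1 1}
    (h : q cap ⟫ ((1 : Q 1 1) ◎ f) = q cap ⟫ ((1 : Q 1 1) ◎ f')) : f = f' := by
  have key : ∀ f : Q 1 1, Q.comp (n := 1) (m := 3) (k := 1)
      ((1 : Q 1 1) ◎ (q cap ⟫ ((1 : Q 1 1) ◎ f))) (q cup ◎ (1 : Q 1 1)) = f := by
    intro f
    have e1 : (1 : Q 1 1) ◎ (q cap ⟫ ((1 : Q 1 1) ◎ f)) =
        Q.comp (n := 1) (m := 3) (k := 3) ((1 : Q 1 1) ◎ q cap) (lft 2 f) := by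
      refine (one_tens_comp 1 (q cap) ((1 : Q 1 1) ◎ f)).trans ?_
      exact congrArg (_ ⟫ ·) (eq_of_heq (lft_lft 1 1 f))
    have e2 : Q.comp (n := 3) (m := 3) (k := 1) (lft 2 f) (q cup ◎ (1 : Q 1 1)) =
        Q.comp (n := 3) (m := 1) (k := 1) (q cup ◎ (1 : Q 1 1)) f := by
      have e := (tens_eq_right (q cup) f).symm.trans (tens_eq_left (q cup) f)
      refine e.trans ?_
      exact congrArg ((q cup ◎ (1 : Q 1 1)) ⟫ ·) (eq_of_heq (zero_tens f))
    rw [e1, comp_assoc, e2, ← comp_assoc, cap_snake', one_comp]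
  rw [← key f, h, key f']

theorem IsTr.unique {f f' f'' : Q 1 1} (h : IsTr f f') (h' : IsTr f f'') : f' = f'' :=
  isTr_cancel (h.symm.trans h')

theorem IsTr.mul {f f' g g' : Q 1 1} (h : IsTr f f') (h' : IsTr g g') :
    IsTr (g * f) (f' * g') := by
  unfold IsTr at *
  have e1 : (g * f) ◎ (1 : Q 1 1) = (f ◎ (1 : Q 1 1)) ⟫ (g ◎ (1 : Q 1 1)) := comp_tens_one 1 f g
  have e2 : (1 : Q 1 1) ◎ (f' * g') = ((1 : Q 1 1) ◎ g') ⟫ ((1 : Q 1 1) ◎ f') :=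
    one_tens_comp 1 g' f'
  rw [e1, e2, ← comp_assoc, h, ← comp_assoc, ← h', comp_assoc, comp_assoc]
  refine congrArg (q cap ⟫ ·) ?_
  exact (tens_eq_right g f').symm.trans (tens_eq_left g f')

theorem ext_zph_mul_spi (α β : Real.Angle) : ext (zph α β) * spi = q (Z 2 2 α β) := by
  have hσ : q swap * q swap = 1 := sound ZXEq.swap_swap
  have hs : q swap * spi = spi := swap_mul_spider 0 0
  calc ext (zph α β) * spi = q swap * (q swap * ext (zph α β)) * spi := by
        rw [← mul_assoc, hσ, one_mul]
    _ = q swap * (lft 1 (zph α β) * (q swap * spi)) := by rw [slide_one]; simp only [mul_assoc]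
    _ = _ := by rw [hs, lft_zph_mul_spi, swap_mul_spider]

theorem gst_gst_comp_spi : (gst ◎ gst) ⟫ spi = q cap := by
  have e : gst ◎ gst = gst ⟫ (gst ◎ (1 : Q 1 1)) := by
    refine (tens_eq_right gst gst).trans ?_
    exact congrArg (· ⟫ (gst ◎ (1 : Q 1 1))) (eq_of_heq (zero_tens gst))
  rw [e, comp_assoc]
  have h : (gst ◎ (1 : Q 1 1)) ⟫ spi = cpy := gst_comp_spi
  exact (congrArg (gst ⟫ ·) h).trans gst_comp_cpy

theorem isTr_zph (α β : Real.Angle) : IsTr (zph α β) (zph α β) := by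
  unfold IsTr
  rw [← gst_gst_comp_spi, comp_assoc, comp_assoc]
  refine congrArg (_ ⟫ ·) ?_
  exact (ext_zph_mul_spi α β).trans (lft_zph_mul_spi α β).symm

theorem IsTr.symm {f f' : Q 1 1} (h : IsTr f f') : IsTr f' f := by
  unfold IsTr at *
  have hs : q cap ⟫ q swap = q cap := sound ZXEq.cap_swap
  have e := congrArg (· ⟫ q swap) h
  simp only [comp_assoc] at e
  have e1 : (f ◎ (1 : Q 1 1)) ⟫ q swap = q swap ⟫ ((1 : Q 1 1) ◎ f) := slide_one f
  have hσ : q swap * q swap = 1 := sound ZXEq.swap_swap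
  have e2 : ((1 : Q 1 1) ◎ f') ⟫ q swap = q swap ⟫ (f' ◎ (1 : Q 1 1)) := by
    have := slide_one f'
    have h3 : q swap * lft 1 f' = ext f' * q swap := by
      calc q swap * lft 1 f' = q swap * (lft 1 f' * q swap) * q swap := by
            rw [mul_assoc, mul_assoc, hσ, mul_one]
        _ = _ := by rw [← this, ← mul_assoc, hσ, one_mul]
    exact h3
  rw [e1, e2, ← comp_assoc, ← comp_assoc, hs] at e
  exact e.symm

/-- Both colour change rules compute the red cap; their comparison is the symmetry of `neg`. -/
theorem isTr_neg : IsTr neg neg := by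
  unfold IsTr
  have h1 := sound (ZXEq.H2 0 2 0 0)
  have h2 := sound (ZXEq.H2' 0 2 0 0)
  rw [q_comp, q_comp, q_parallel_two, sound ZXEq.S3_cap] at h1 h2
  have h : q cap ⟫ (had ◎ had) = q cap ⟫ (hdag ◎ hdag) := by
    have h' := h1.symm.trans h2
    have e : q (parallel 0 fun _ => Hdag) ⟫ q cap = q cap := one_comp _
    have e' : q (parallel 0 fun _ => H) ⟫ q cap = q cap := one_comp _
    rw [e, e'] at h'
    exact h'
  have h3 := congrArg (· ⟫ (had ◎ hdag)) h
  simp only [comp_assoc] at h3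
  have e1 : (had ◎ had) ⟫ (had ◎ hdag) = neg ◎ (1 : Q 1 1) := by
    refine (interchange had had had hdag).symm.trans ?_
    exact congrArg (neg ◎ ·) hdag_mul_had
  have e2 : (hdag ◎ hdag) ⟫ (had ◎ hdag) = (1 : Q 1 1) ◎ neg := by
    refine (interchange hdag had hdag hdag).symm.trans ?_
    exact congrArg₂ (· ◎ ·) had_mul_hdag hdag_mul_hdag
  rw [e1, e2] at h3
  exact h3

/-- A cap, preceded by closing both wires. -/
theorem spi_mul_rst_rst : spi * (ext rst * lft 1 rst) = (gef ◎ gef) ⟫ q cap := by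
  have e1 : ext rst * lft 1 rst = (gef ◎ gef) ⟫ (gst ◎ gst) := by
    have e := tens_eq_right rst rst
    rw [mul_def]
    exact e.symm.trans (interchange _ _ _ _)
  rw [e1, mul_def, comp_assoc]
  exact congrArg (_ ⟫ ·) gst_gst_comp_spi

theorem IsTr.bell {f f' : Q 1 1} (h : IsTr f f') :
    ext f * (spi * (ext rst * lft 1 rst)) = lft 1 f' * (spi * (ext rst * lft 1 rst)) := by
  rw [spi_mul_rst_rst, mul_def, mul_def, comp_assoc, comp_assoc]
  exact congrArg (_ ⟫ ·) h

/-! ### Scalars, the copy rule and the bialgebra rule -/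

theorem interp_scalar_ne_zero : interp (Z 0 1 0 0 ⨾ Z 1 0 0 0) ≠ 0 := by
  intro h
  have h1 := congrFun (congrFun h (fun i => i.elim0)) (fun i => i.elim0)
  have h2 : ∀ x : Fin 3, (![1, 1, 1] : Fin 3 → ℂ) x = 1 := by
    intro x
    fin_cases x <;> rfl
  simp [interp, Matrix.mul_apply, phase, h2] at h1

/-- The scalar `gst ⟫ gef` may be dropped. -/
theorem tens_scalar {n m : ℕ} (A : Q n m) : A ◎ (gst ⟫ gef) = A :=
  drop_right A _ interp_scalar_ne_zero

theorem scalar_tens {n m : ℕ} (A : Q n m) : HEq ((gst ⟫ gef) ◎ A) A :=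
  drop_left A _ interp_scalar_ne_zero

theorem comp_scalar {n : ℕ} (A : Q n 0) : A ⟫ (gst ⟫ gef) = A := by
  have h := tens_eq_left A (gst ⟫ gef)
  rw [tens_scalar, tens_zero] at h
  exact ((congrArg (A ⟫ ·) (eq_of_heq (zero_tens (gst ⟫ gef)))).symm.trans h.symm)

theorem rst_mul_rst : rst * rst = rst := by
  have h := comp_scalar gef
  rw [mul_def, rst, ← comp_assoc, comp_assoc gef gst gef, h]

theorem tens_gst_cancel {n m : ℕ} {A B : Q n m} (h : A ◎ gst = B ◎ gst) : A = B := by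
  have key : ∀ A : Q n m, (A ◎ gst) ⟫ ((1 : Q m m) ◎ gef) = A := by
    intro A
    rw [← interchange, comp_one, tens_scalar]
  rw [← key A, h, key B]

theorem ext_mul_lft_rst {n : ℕ} (A : Q n n) :
    ext A * lft n rst = ((1 : Q n n) ◎ gef) ⟫ (A ◎ gst) := by
  have h : (A ◎ gst) = ((1 : Q n n) ◎ gst) ⟫ (A ◎ (1 : Q 1 1)) := by
    exact tens_eq_right A gst
  have h2 : lft n rst = ((1 : Q n n) ◎ gef) ⟫ ((1 : Q n n) ◎ gst) := one_tens_comp n gef gst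
  rw [h, ← comp_assoc, ← h2]
  rfl

theorem ext_mul_rst_cancel {n : ℕ} {A B : Q n n}
    (h : ext A * lft n rst = ext B * lft n rst) : A = B := by
  rw [ext_mul_lft_rst, ext_mul_lft_rst] at h
  refine tens_gst_cancel ?_
  have h1 := congrArg (((1 : Q n n) ◎ gst) ⟫ ·) h
  simp only [← comp_assoc] at h1
  have h2 : ((1 : Q n n) ◎ gst) ⟫ ((1 : Q n n) ◎ gef) = 1 := by
    rw [← one_tens_comp, tens_scalar]
  rw [h2] at h1
  exact (one_comp _).symm.trans (h1.trans (one_comp _))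

theorem rdst_comp_rdef : rdst ⟫ rdef = gst ⟫ gef := by
  rw [rdst_eq, rdef_eq', comp_assoc, ← comp_assoc had had gef]
  exact congrArg (gst ⟫ ·) neg_comp_gef

theorem rdst_comp_cpy : rdst ⟫ cpy = rdst ◎ rdst := sound ZXEq.B1

theorem mrg_comp_rdef : mrg ⟫ rdef = rdef ◎ rdef := sound ZXEq.B1_flip

theorem cpy_tens_comp_cup : Q.comp (n := 2) (m := 3) (k := 1) (cpy ◎ (1 : Q 1 1))
    ((1 : Q 1 1) ◎ q cup) = mrg := by
  have h := sound (ZXEq.S1 1 1 1 0 0 0 0 0 0)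
  simp only [zero_add] at h
  have h1 : Q.comp (n := 2) (m := 3) (k := 1) (cpy ◎ (1 : Q 1 1))
    ((1 : Q 1 1) ◎ q (Z 2 0 0 0)) = mrg := h
  rwa [sound ZXEq.S3_cup] at h1

/-- Merging with the red state amounts to a red effect followed by a red state. Since the red state
is copied by green spiders, the left side factors through some effect `t`, and bending the input
identifies `t` with the red effect. -/
theorem rdst_merge : Q.comp (n := 1) (m := 2) (k := 1) (rdst ◎ (1 : Q 1 1)) mrg =
    rdef ⟫ rdst := by
  set t : Q 1 0 := Q.comp (n := 1) (m := 2) (k := 0) (rdst ◎ (1 : Q 1 1)) (q cup) with ht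
  have e0 : Q.comp (n := 1) (m := 2) (k := 1) (rdst ◎ (1 : Q 1 1)) mrg = t ⟫ rdst := by
    have h1 : Q.comp (n := 1) (m := 2) (k := 3) (rdst ◎ (1 : Q 1 1)) (cpy ◎ (1 : Q 1 1)) =
        Q.comp (n := 1) (m := 2) (k := 3) (rdst ◎ (1 : Q 1 1))
          (rdst ◎ (1 : Q 2 2)) := by
      refine (comp_tens_one 1 rdst cpy).symm.trans ?_
      rw [rdst_comp_cpy]
      refine (eq_of_heq (tens_assoc rdst rdst (1 : Q 1 1))).trans ?_
      refine (tens_eq_right rdst (Q.tens rdst (1 : Q 1 1))).trans ?_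
      exact congrArg (fun x : Q 1 2 => Q.comp (n := 1) (m := 2) (k := 3) x (rdst ◎ (1 : Q 2 2)))
        (eq_of_heq (zero_tens (rdst ◎ (1 : Q 1 1))))
    have h2 : Q.comp (n := 2) (m := 3) (k := 1) (rdst ◎ (1 : Q 2 2)) ((1 : Q 1 1) ◎ q cup) =
        Q.comp (n := 2) (m := 0) (k := 1) (q cup) rdst := by
      refine ((tens_eq_left rdst (q cup)).symm.trans (tens_eq_right rdst (q cup))).trans ?_
      exact congrArg₂ (fun (x : Q 2 0) (y : Q 0 1) => x ⟫ y)
        (eq_of_heq (zero_tens (q cup))) (tens_zero rdst)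
    rw [← cpy_tens_comp_cup, ← comp_assoc, h1, comp_assoc, h2, ← comp_assoc]
  have e1 : t = rdef := by
    have h1 := congrArg (· ⟫ rdef) e0
    simp only [comp_assoc] at h1
    rw [mrg_comp_rdef, rdst_comp_rdef, comp_scalar] at h1
    have h2 : Q.comp (n := 1) (m := 2) (k := 0) (rdst ◎ (1 : Q 1 1)) (rdef ◎ rdef) =
        (gst ⟫ gef) ◎ rdef := by
      refine (interchange rdst rdef (1 : Q 1 1) rdef).symm.trans ?_
      rw [rdst_comp_rdef, one_comp]
    rw [← h1, h2]
    exact eq_of_heq (scalar_tens rdef)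
  rw [e0, e1]

theorem swap_comp_mrg : Q.comp (n := 2) (m := 2) (k := 1) (q swap) mrg = mrg := by
  have h : q swap ⟫ spi = spi := spider_mul_swap 0 0
  rw [← spi_comp_gef, ← comp_assoc]
  exact congrArg (fun x : Q 2 2 => Q.comp (n := 2) (m := 2) (k := 1) x (gef ◎ (1 : Q 1 1))) h

theorem tens_rdst_merge : Q.comp (n := 1) (m := 2) (k := 1) ((1 : Q 1 1) ◎ rdst) mrg =
    rdef ⟫ rdst := by
  have h := sound (ZXEq.slide (X 0 1 0 0))
  have h1 : (rdst ◎ q wire) ⟫ (q (crossing 1) : Q 2 2) = q wire ⟫ (q wire ◎ rdst) := h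
  rw [crossing_one, q_wire] at h1
  have h2 : Q.comp (n := 1) (m := 2) (k := 2) (rdst ◎ (1 : Q 1 1)) (q swap) =
      (1 : Q 1 1) ◎ rdst := h1.trans (one_comp _)
  rw [← h2, comp_assoc, swap_comp_mrg, rdst_merge]

/-- The basis state `rdst` controls nothing. -/
theorem rdst_edge : Q.comp (n := 1) (m := 2) (k := 2) ((1 : Q 1 1) ◎ rdst) (edg hdag) =
    (1 : Q 1 1) ◎ rdst := by
  have e1 : Q.comp (n := 1) (m := 2) (k := 3) ((1 : Q 1 1) ◎ rdst) (cpy ◎ (1 : Q 1 1)) =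
      Q.comp (n := 1) (m := 2) (k := 3) cpy ((1 : Q 2 2) ◎ rdst) := by
    refine (tens_eq_right cpy rdst).symm.trans ((tens_eq_left cpy rdst).trans ?_)
    rw [tens_zero]
  have e2 : Q.comp (n := 2) (m := 3) (k := 2) (Q.comp (n := 2) (m := 3) (k := 3)
      ((1 : Q 2 2) ◎ rdst) ((1 : Q 1 1) ◎ hdag ◎ (1 : Q 1 1))) ((1 : Q 1 1) ◎ mrg) =
      (1 : Q 1 1) ◎ (gef ⟫ rdst) := by
    have h1 : (1 : Q 2 2) ◎ rdst = (1 : Q 1 1) ◎ ((1 : Q 1 1) ◎ rdst) := by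
      rw [← one_tens_one 1 1]
      exact eq_of_heq (tens_assoc (1 : Q 1 1) (1 : Q 1 1) rdst)
    have h2 : (1 : Q 1 1) ◎ hdag ◎ (1 : Q 1 1) = (1 : Q 1 1) ◎ (hdag ◎ (1 : Q 1 1)) :=
      eq_of_heq (tens_assoc (1 : Q 1 1) hdag (1 : Q 1 1))
    have h3 : Q.comp (n := 1) (m := 2) (k := 2) ((1 : Q 1 1) ◎ rdst) (hdag ◎ (1 : Q 1 1)) =
        Q.comp (n := 1) (m := 1) (k := 2) hdag ((1 : Q 1 1) ◎ rdst) := by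
      refine (tens_eq_right hdag rdst).symm.trans ((tens_eq_left hdag rdst).trans ?_)
      rw [tens_zero]
    have h4 : hdag ⟫ rdef = gef := by
      rw [rdef_eq', ← comp_assoc]
      have : hdag ⟫ had = 1 := had_mul_hdag
      rw [this, one_comp]
    refine (congrArg₂ (fun x y => Q.comp (n := 2) (m := 3) (k := 2) (Q.comp (n := 2) (m := 3)
      (k := 3) x y) ((1 : Q 1 1) ◎ mrg)) h1 h2).trans ?_
    refine (congrArg (fun x : Q 2 3 => Q.comp (n := 2) (m := 3) (k := 2) x ((1 : Q 1 1) ◎ mrg))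
      (one_tens_comp 1 ((1 : Q 1 1) ◎ rdst) (hdag ◎ (1 : Q 1 1))).symm).trans ?_
    refine (one_tens_comp 1 (n := 1) (m := 2) (k := 1) (((1 : Q 1 1) ◎ rdst) ⟫
      (hdag ◎ (1 : Q 1 1))) mrg).symm.trans ?_
    refine congrArg ((1 : Q 1 1) ◎ ·) ?_
    rw [h3, comp_assoc, tens_rdst_merge, ← comp_assoc, h4]
  rw [edg, ← comp_assoc, ← comp_assoc, e1, comp_assoc, comp_assoc,
    ← comp_assoc ((1 : Q 2 2) ◎ rdst),
    e2]
  have e3 : (1 : Q 1 1) ◎ (gef ⟫ rdst) =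
      Q.comp (n := 2) (m := 1) (k := 2) ((1 : Q 1 1) ◎ gef) ((1 : Q 1 1) ◎ rdst) :=
    one_tens_comp 1 gef rdst
  rw [e3, ← comp_assoc]
  have e4 : Q.comp (n := 1) (m := 2) (k := 1) cpy ((1 : Q 1 1) ◎ gef) = 1 := cpy_comp_tens_gef
  rw [e4, one_comp]

theorem edg_mul_rdst : edg hdag * lft 1 (had * rst) = lft 1 (had * rst) := by
  have e : lft 1 (had * rst) = Q.comp (n := 2) (m := 1) (k := 2) ((1 : Q 1 1) ◎ gef)
      ((1 : Q 1 1) ◎ rdst) := by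
    have e1 : had * rst = gef ⟫ rdst := by rw [rdst_eq, ← comp_assoc]; rfl
    rw [e1]
    exact one_tens_comp 1 gef rdst
  rw [e, mul_def, comp_assoc, rdst_edge]

theorem rmg_eq : rmg = ext rst * (lft 1 had * (spi * (ext hdag * lft 1 hdag))) := by
  have e1 : ext hdag * lft 1 hdag = hdag ◎ hdag := (tens_eq_right hdag hdag).symm
  have e2 : Q.comp (n := 1) (m := 1) (k := 2) had (gst ◎ (1 : Q 1 1)) =
      Q.comp (n := 1) (m := 2) (k := 2) (gst ◎ (1 : Q 1 1)) (lft 1 had) := by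
    have := (tens_eq_right gst had).symm.trans (tens_eq_left gst had)
    refine Eq.trans ?_ this
    exact congrArg (fun x : Q 1 1 => Q.comp (n := 1) (m := 1) (k := 2) x (gst ◎ (1 : Q 1 1)))
      (eq_of_heq (zero_tens had)).symm
  have e3 : ext rst * lft 1 had = lft 1 had * ext rst := tens_commute rst had
  have e4 : ext rst = Q.comp (n := 2) (m := 1) (k := 2) (gef ◎ (1 : Q 1 1))
      (gst ◎ (1 : Q 1 1)) := comp_tens_one 1 gef gst
  rw [rmg, red_merge_eq, comp_assoc, e2, ← mul_assoc, e3, e1, ← spi_comp_gef, e4]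
  simp only [mul_def, comp_assoc]

/-- The bialgebra rule with all inputs and outputs on four wires. -/
theorem bialgebra :
    ext (ext (ext rst)) * lft 1 (lft 1 (spi * lft 1 rst) * ext rmg) =
    ext (lft 1 (q swap)) * ((ext (ext rmg) * lft 2 rmg) * ext (lft 1 (q swap))) *
      (ext (ext (spi * ext rst)) * lft 2 (spi * lft 1 rst)) := by
  set R : Q 2 1 := q (X 2 1 0 0) with hR
  set S : Q 4 4 := ext (lft 1 (q swap)) with hS
  have hB : Q.comp (n := 2) (m := 4) (k := 2) (Q.comp (n := 2) (m := 4)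
      (k := 4) (cpy ◎ cpy) S) (R ◎ R) = R ⟫ cpy := by
    refine Eq.symm ((sound ZXEq.B2).trans ?_)
    have : q swapMid = S := by
      have : q swapMid = Q.tens (n := 3) (m := 3) (q wire ◎ q swap) (q wire) := rfl
      rw [this, q_wire]
      rfl
    rw [← this]
    rfl
  set E : Q 4 2 := Q.tens (n := 2) (m := 1) (gef ◎ (1 : Q 1 1)) ((1 : Q 1 1) ◎ gef) with hE
  set G : Q 2 4 := Q.tens (n := 1) (m := 2) (gst ◎ (1 : Q 1 1)) (gst ◎ (1 : Q 1 1)) with hG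
  set A : Q 3 2 := (R ◎ gef) ⟫ cpy with hA
  have w1 : spi * ext rst = (gef ◎ (1 : Q 1 1)) ⟫ cpy := by
    have e : ext rst = Q.comp (n := 2) (m := 1) (k := 2) (gef ◎ (1 : Q 1 1))
      (gst ◎ (1 : Q 1 1)) := comp_tens_one 1 gef gst
    rw [e, mul_def, comp_assoc]
    exact congrArg ((gef ◎ (1 : Q 1 1)) ⟫ ·) gst_comp_spi
  have w2 : spi * lft 1 rst = ((1 : Q 1 1) ◎ gef) ⟫ cpy := by
    have e : lft 1 rst = Q.comp (n := 2) (m := 1) (k := 2) ((1 : Q 1 1) ◎ gef)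
      ((1 : Q 1 1) ◎ gst) := one_tens_comp 1 gef gst
    rw [e, mul_def, comp_assoc]
    exact congrArg (((1 : Q 1 1) ◎ gef) ⟫ ·) tens_gst_comp_spi
  have r1 : ext (ext (spi * ext rst)) * lft 2 (spi * lft 1 rst) =
      Q.comp (n := 4) (m := 2) (k := 4) E (cpy ◎ cpy) := by
    rw [ext_ext, mul_def]
    refine (tens_eq_right (spi * ext rst) (spi * lft 1 rst)).symm.trans ?_
    rw [w1, w2]
    exact interchange (gef ◎ (1 : Q 1 1)) cpy ((1 : Q 1 1) ◎ gef) cpy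
  have r2 : ext (ext rmg) * lft 2 rmg = Q.comp (n := 4) (m := 2) (k := 4) (R ◎ R) G := by
    rw [ext_ext, mul_def]
    refine (tens_eq_right rmg rmg).symm.trans ?_
    exact interchange R (gst ◎ (1 : Q 1 1)) R (gst ◎ (1 : Q 1 1))
  have hσ : Q.comp (n := 1) (m := 2) (k := 2) ((1 : Q 1 1) ◎ gst) (q swap) =
      gst ◎ (1 : Q 1 1) := by
    have h : q swap ⟫ q swap = 1 := sound ZXEq.swap_swap
    rw [← gst_tens_comp_swap, comp_assoc, h]
    exact comp_one _
  have r3 : Q.comp (n := 2) (m := 4) (k := 4) G S = gst ◎ (gst ◎ (1 : Q 2 2)) := by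
    have e1 : G = Q.tens (n := 1) (m := 3) (gst ◎ ((1 : Q 1 1) ◎ gst)) (1 : Q 1 1) := by
      refine (eq_of_heq (tens_assoc (gst ◎ (1 : Q 1 1)) gst (1 : Q 1 1))).symm.trans ?_
      exact congrArg (fun x : Q 1 3 => x ◎ (1 : Q 1 1))
        (eq_of_heq (tens_assoc gst (1 : Q 1 1) gst))
    have e2 : Q.comp (n := 1) (m := 3) (k := 3) (gst ◎ ((1 : Q 1 1) ◎ gst)) (lft 1 (q swap)) =
        gst ◎ (gst ◎ (1 : Q 1 1)) := by
      refine (interchange gst (1 : Q 1 1) ((1 : Q 1 1) ◎ gst) (q swap)).symm.trans ?_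
      rw [hσ, comp_one]
    rw [e1]
    refine (comp_tens_one 1 (n := 1) (m := 3) (k := 3) (gst ◎ ((1 : Q 1 1) ◎ gst))
      (lft 1 (q swap))).symm.trans ?_
    rw [e2]
    refine (eq_of_heq (tens_assoc gst (gst ◎ (1 : Q 1 1)) (1 : Q 1 1))).trans ?_
    refine congrArg (gst ◎ ·) ?_
    refine (eq_of_heq (tens_assoc gst (1 : Q 1 1) (1 : Q 1 1))).trans ?_
    rw [one_tens_one]
  have r4 : Q.comp (n := 4) (m := 1) (k := 2) (Q.comp (n := 4) (m := 2) (k := 1) E R) cpy =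
      gef ◎ A := by
    have e1 : E = gef ◎ ((1 : Q 2 2) ◎ gef) := by
      refine (eq_of_heq (tens_assoc gef (1 : Q 1 1) ((1 : Q 1 1) ◎ gef))).trans ?_
      refine congrArg (gef ◎ ·) ?_
      refine (eq_of_heq (tens_assoc (1 : Q 1 1) (1 : Q 1 1) gef)).symm.trans ?_
      rw [one_tens_one]
    have e2 : Q.comp (n := 4) (m := 2) (k := 1) E R = gef ◎ (R ◎ gef) := by
      have h := interchange gef (1 : Q 0 0) ((1 : Q 2 2) ◎ gef) R
      have h1 : R ◎ gef = Q.comp (n := 3) (m := 2) (k := 1) ((1 : Q 2 2) ◎ gef) R := by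
        refine (tens_eq_right R gef).trans ?_
        rw [tens_zero]
      rw [comp_one] at h
      rw [h1, e1]
      refine Eq.trans ?_ h.symm
      exact congrArg (fun x : Q 2 1 => Q.comp (n := 4) (m := 2) (k := 1)
        (gef ◎ ((1 : Q 2 2) ◎ gef)) x) (eq_of_heq (zero_tens R)).symm
    rw [e2]
    have h := interchange gef (1 : Q 0 0) (R ◎ gef) cpy
    rw [comp_one] at h
    refine Eq.trans ?_ h.symm
    exact congrArg (fun x : Q 1 2 => Q.comp (n := 4) (m := 1) (k := 2) (gef ◎ (R ◎ gef)) x)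
      (eq_of_heq (zero_tens cpy)).symm
  have l1 : lft 1 (spi * lft 1 rst) * ext rmg = gst ◎ A := by
    have e1 : rmg = gst ◎ R := by
      refine Eq.trans ?_ (tens_eq_right gst R).symm
      exact congrArg (fun x : Q 2 1 => Q.comp (n := 2) (m := 1) (k := 2) x (gst ◎ (1 : Q 1 1)))
        (eq_of_heq (zero_tens R)).symm
    have e2 : ext rmg = gst ◎ (R ◎ (1 : Q 1 1)) := by
      rw [e1]
      exact eq_of_heq (tens_assoc gst R (1 : Q 1 1))
    rw [e2, w2, mul_def]
    refine (interchange gst (1 : Q 1 1) (R ◎ (1 : Q 1 1)) (((1 : Q 1 1) ◎ gef) ⟫ cpy)).symm.trans ?_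
    rw [comp_one, ← comp_assoc]
    refine congrArg (fun x : Q 3 1 => gst ◎ (x ⟫ cpy)) ?_
    exact (tens_eq_left R gef).symm
  have l2 : ext (ext (ext rst)) * lft 1 (Q.tens (n := 0) (m := 1) (n' := 3) (m' := 2)
      gst A : Q 3 3) = rst ◎ (Q.tens (n := 0) (m := 1) (n' := 3) (m' := 2) gst A : Q 3 3) := by
    rw [ext_ext_ext, mul_def]
    exact (tens_eq_right rst (gst ◎ A)).symm
  have r5 : Q.comp (n := 4) (m := 2) (k := 4) (gef ◎ A) (gst ◎ (gst ◎ (1 : Q 2 2))) =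
      rst ◎ (gst ◎ A) := by
    refine (interchange gef gst A (gst ◎ (1 : Q 2 2))).symm.trans ?_
    refine congrArg (fun x : Q 3 3 => rst ◎ x) ?_
    refine Eq.trans ?_ (tens_eq_right gst A).symm
    exact congrArg (fun x : Q 3 2 => Q.comp (n := 3) (m := 2) (k := 3) x (gst ◎ (1 : Q 2 2)))
      (eq_of_heq (zero_tens A)).symm
  rw [l1, l2, r1, r2, ← r5, ← r4, ← r3]
  simp only [mul_def, comp_assoc]
  rw [← comp_assoc R cpy, ← hB]
  simp only [comp_assoc]

/-! ### Edges between any two wires -/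

theorem spi_mul_rst : spi * lft 1 rst = ((1 : Q 1 1) ◎ gef) ⟫ cpy := by
  have e : lft 1 rst = Q.comp (n := 2) (m := 1) (k := 2) ((1 : Q 1 1) ◎ gef)
    ((1 : Q 1 1) ◎ gst) := one_tens_comp 1 gef gst
  rw [e, mul_def, comp_assoc]
  exact congrArg (((1 : Q 1 1) ◎ gef) ⟫ ·) tens_gst_comp_spi

theorem cpy_comp_swap : cpy ⟫ q swap = cpy := by
  have h : spi ⟫ q swap = spi := swap_mul_spider 0 0
  rw [← gst_comp_spi, comp_assoc]
  exact congrArg _ h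

theorem cpy_comp_gef : cpy ⟫ (gef ◎ (1 : Q 1 1)) = 1 := by
  rw [← swap_comp_gef, ← comp_assoc]
  exact (congrArg (· ⟫ _) cpy_comp_swap).trans cpy_comp_tens_gef

theorem rst_mul_spi_mul_rst : ext rst * (spi * lft 1 rst) = q swap * lft 1 rst := by
  have e : lft 1 rst = Q.comp (n := 2) (m := 1) (k := 2) ((1 : Q 1 1) ◎ gef)
    ((1 : Q 1 1) ◎ gst) := one_tens_comp 1 gef gst
  have e' : ext rst = Q.comp (n := 2) (m := 1) (k := 2) (gef ◎ (1 : Q 1 1))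
    (gst ◎ (1 : Q 1 1)) := comp_tens_one 1 gef gst
  have hσ : Q.comp (n := 1) (m := 2) (k := 2) ((1 : Q 1 1) ◎ gst) (q swap) =
      gst ◎ (1 : Q 1 1) := by
    have h : q swap ⟫ q swap = 1 := sound ZXEq.swap_swap
    rw [← gst_tens_comp_swap, comp_assoc, h]
    exact comp_one _
  rw [spi_mul_rst, e', mul_def, comp_assoc, ← comp_assoc cpy]
  have h : Q.comp (n := 1) (m := 2) (k := 1) cpy (gef ◎ (1 : Q 1 1)) = 1 := cpy_comp_gef
  rw [h, one_comp, e, mul_def, comp_assoc, hσ]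

variable {m : ℕ}

/-- The green spider with two inputs and two outputs on the wires `i` and `j`. -/
noncomputable def D (i j : Fin m) : Q m m := op2 i j spi

/-- Wire `i` is cut and restarted with the green state. -/
noncomputable def B (i : Fin m) : Q m m := op1 i rst

/-- An edge through `f` from wire `i` to wire `j`. -/
noncomputable def C (i j : Fin m) (f : Q 1 1) : Q m m := op2 i j (edg f)

theorem swap_conj_spi : q swap * spi * q swap = spi := by
  have h : q swap * spi = spi := swap_mul_spider 0 0
  have h' : spi * q swap = spi := spider_mul_swap 0 0
  rw [h, h']

theorem D_symm {i j : Fin m} (h : i ≠ j) : D i j = D j i := by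
  rw [D, D, ← op2_symm h, swap_conj_spi]

theorem P_mul_op1 (σ : Equiv.Perm (Fin m)) (i : Fin m) (a : Q 1 1) :
    P σ * op1 i a = op1 (σ i) a * P σ := by
  rw [P_mul, conjP_op1]

theorem P_mul_op2 (σ : Equiv.Perm (Fin m)) {i j : Fin m} (h : i ≠ j) (a : Q 2 2) :
    P σ * op2 i j a = op2 (σ i) (σ j) a * P σ := by
  rw [P_mul, conjP_op2 _ h]

theorem swap_mul_D {i j : Fin m} (h : i ≠ j) : P (Equiv.swap i j) * D i j = D i j := by
  rw [← op2_swap h, D, ← map_mul]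
  exact congrArg _ (swap_mul_spider 0 0)

theorem D_mul_swap {i j : Fin m} (h : i ≠ j) : D i j * P (Equiv.swap i j) = D i j := by
  rw [← op2_swap h, D, ← map_mul]
  exact congrArg _ (spider_mul_swap 0 0)

theorem D_mul_left {i j k : Fin m} (hij : i ≠ j) (hik : i ≠ k) (hjk : j ≠ k) :
    D j k * D i j = D i k * D i j := by
  obtain ⟨Φ, h1, h2⟩ := exists_op3 hij hik hjk
  have e : D j k * D i j = Φ (q (Z 3 3 0 0)) := by
    rw [D, D, ← h1, ← h2, ← map_mul, lft_spi_mul_ext_spi]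
  have e2 : P (Equiv.swap i j) * (D j k * D i j) = D j k * D i j := by
    rw [e, ← op2_swap hij, ← h1, ← map_mul, ext_swap_mul_spider]
  rw [← e2, ← mul_assoc]
  have e3 : P (Equiv.swap i j) * D j k = D i k * P (Equiv.swap i j) := by
    have := P_mul_op2 (Equiv.swap i j) hjk spi
    rwa [Equiv.swap_apply_right, Equiv.swap_apply_of_ne_of_ne hik.symm hjk.symm] at this
  rw [e3, mul_assoc, swap_mul_D hij]

theorem D_mul_right {i j k : Fin m} (hij : i ≠ j) (hik : i ≠ k) (hjk : j ≠ k) :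
    D j k * D i j = D j k * D i k := by
  obtain ⟨Φ, h1, h2⟩ := exists_op3 hij hik hjk
  have e : D j k * D i j = Φ (q (Z 3 3 0 0)) := by
    rw [D, D, ← h1, ← h2, ← map_mul, lft_spi_mul_ext_spi]
  have e2 : D j k * D i j * P (Equiv.swap j k) = D j k * D i j := by
    rw [e, ← op2_swap hjk, ← h2, ← map_mul, spider_mul_lft_swap]
  rw [← e2, mul_assoc]
  have e3 : P (Equiv.swap j k) * D i k = D i j * P (Equiv.swap j k) := by
    have := P_mul_op2 (Equiv.swap j k) hik spi
    rwa [Equiv.swap_apply_right, Equiv.swap_apply_of_ne_of_ne hij hik] at this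
  rw [← e3, ← mul_assoc, D_mul_swap hjk]

theorem D_commute_aux {i j k : Fin m} (hij : i ≠ j) (hik : i ≠ k) (hjk : j ≠ k) :
    Commute (D i j) (D j k) := by
  have e2 := D_mul_right hjk hij.symm hik.symm
  have e3 := D_mul_left hjk hij.symm hik.symm
  rw [D_symm hik.symm, D_symm hij.symm] at e2
  rw [D_symm hij.symm, D_symm hik.symm] at e3
  exact e3.symm.trans (e2.trans (D_mul_left hij hik hjk).symm)

theorem D_commute {i j k l : Fin m} (hij : i ≠ j) (hkl : k ≠ l) : Commute (D i j) (D k l) := by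
  by_cases h1 : j = k
  · subst h1
    by_cases h2 : i = l
    · subst h2
      rw [D_symm hij]
    · exact D_commute_aux hij h2 hkl
  by_cases h2 : i = k
  · subst h2
    by_cases h3 : j = l
    · subst h3
      exact Commute.refl _
    · rw [D_symm hij]
      exact D_commute_aux hij.symm h3 hkl
  by_cases h3 : j = l
  · subst h3
    rw [D_symm hkl]
    exact D_commute_aux hij h2 h1
  by_cases h4 : i = l
  · subst h4
    rw [D_symm hkl, D_symm hij]
    exact D_commute_aux hij.symm h1 h2
  exact op2_commute_op2 hij h2 h4 h1 h3 hkl _ _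

/-- Wires joined by a green spider are interchangeable. -/
theorem D_mul_D {i j k : Fin m} (hij : i ≠ j) (hik : i ≠ k) (hjk : j ≠ k) :
    D i j * D i k = D i j * D j k := by
  have h := D_mul_left hij hik hjk
  rw [(D_commute hjk hij).eq, (D_commute hik hij).eq] at h
  exact h.symm

theorem D_mul_op1_zph {i j : Fin m} (h : i ≠ j) (α β : Real.Angle) :
    D i j * op1 i (zph α β) = op1 j (zph α β) * D i j := by
  rw [D, ← op2_fst h, ← op2_snd h, ← map_mul, ← map_mul, spi_mul_ext_zph, lft_zph_mul_spi]

theorem op1_zph_mul_D {i j : Fin m} (h : i ≠ j) (α β : Real.Angle) :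
    op1 i (zph α β) * D i j = op1 j (zph α β) * D i j := by
  rw [D, ← op2_fst h, ← op2_snd h, ← map_mul, ← map_mul, ext_zph_mul_spi, lft_zph_mul_spi]

theorem D_commute_zph {i j k : Fin m} (h : i ≠ j) (α β : Real.Angle) :
    Commute (D i j) (op1 k (zph α β)) := by
  by_cases h1 : k = i
  · subst h1
    exact (D_mul_op1_zph h α β).trans (op1_zph_mul_D h α β).symm
  by_cases h2 : k = j
  · subst h2
    rw [D_symm h]
    exact (D_mul_op1_zph h.symm α β).trans (op1_zph_mul_D h.symm α β).symm
  exact (op1_commute_op2 h1 h2 h _ _).symm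

theorem D_commute_op1 {i j k : Fin m} (h : i ≠ j) (hi : k ≠ i) (hj : k ≠ j) (f : Q 1 1) :
    Commute (D i j) (op1 k f) := (op1_commute_op2 hi hj h f _).symm

theorem D_commute_B {i j k : Fin m} (h : i ≠ j) (hi : k ≠ i) (hj : k ≠ j) :
    Commute (D i j) (B k) := D_commute_op1 h hi hj rst

theorem C_commute_op1 {i j k : Fin m} (h : i ≠ j) (hi : k ≠ i) (hj : k ≠ j) (f g : Q 1 1) :
    Commute (C i j f) (op1 k g) := (op1_commute_op2 hi hj h g _).symm

theorem B_mul_B (i : Fin m) : B i * B i = B i := by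
  rw [B, ← map_mul, rst_mul_rst]

theorem B_commute (i j : Fin m) : Commute (B i) (B j) := by
  by_cases h : i = j
  · subst h
    exact Commute.refl _
  · exact op1_commute_op1 h _ _

theorem B_mul_D_mul_B {i j : Fin m} (h : i ≠ j) :
    B i * (D i j * B j) = P (Equiv.swap i j) * B j := by
  rw [B, D, B, ← op2_fst h, ← op2_snd h, ← op2_swap h, ← map_mul, ← map_mul, ← map_mul,
    rst_mul_spi_mul_rst]

theorem gst_gst_comp_swap : (gst ◎ gst) ⟫ q swap = gst ◎ gst := by
  have e : gst ◎ gst = gst ⟫ (gst ◎ (1 : Q 1 1)) := by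
    refine (tens_eq_right gst gst).trans ?_
    exact congrArg (· ⟫ (gst ◎ (1 : Q 1 1))) (eq_of_heq (zero_tens gst))
  have e' : gst ◎ gst = gst ⟫ ((1 : Q 1 1) ◎ gst) := by
    refine (tens_eq_left gst gst).trans ?_
    exact congrArg (· ⟫ ((1 : Q 1 1) ◎ gst)) (tens_zero gst)
  conv_lhs => rw [e, comp_assoc]
  rw [e']
  exact congrArg (gst ⟫ ·) gst_tens_comp_swap

theorem swap_comp_gef_gef : q swap ⟫ (gef ◎ gef) = gef ◎ gef := by
  have e : gef ◎ gef = (gef ◎ (1 : Q 1 1)) ⟫ gef := by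
    refine (tens_eq_left gef gef).trans ?_
    exact congrArg ((gef ◎ (1 : Q 1 1)) ⟫ ·) (eq_of_heq (zero_tens gef))
  have e' : gef ◎ gef = ((1 : Q 1 1) ◎ gef) ⟫ gef := by
    refine (tens_eq_right gef gef).trans ?_
    exact congrArg (((1 : Q 1 1) ◎ gef) ⟫ ·) (tens_zero gef)
  conv_lhs => rw [e', ← comp_assoc]
  rw [e]
  exact congrArg (· ⟫ gef) swap_comp_gef

theorem ext_rst_mul_lft_rst : ext rst * lft 1 rst = (gef ◎ gef) ⟫ (gst ◎ gst) :=
  (tens_eq_right rst rst).symm.trans (interchange _ _ _ _)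

theorem swap_mul_B_mul_B {i j : Fin m} (h : i ≠ j) :
    P (Equiv.swap i j) * (B i * B j) = B i * B j := by
  rw [B, B, ← op2_fst h, ← op2_snd h, ← op2_swap h, ← map_mul, ← map_mul]
  refine congrArg _ ?_
  rw [ext_rst_mul_lft_rst, mul_def, comp_assoc]
  exact congrArg (_ ⟫ ·) gst_gst_comp_swap

theorem B_mul_B_mul_swap {i j : Fin m} (h : i ≠ j) :
    B i * B j * P (Equiv.swap i j) = B i * B j := by
  rw [B, B, ← op2_fst h, ← op2_snd h, ← op2_swap h, ← map_mul, ← map_mul]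
  refine congrArg _ ?_
  rw [ext_rst_mul_lft_rst, mul_def, ← comp_assoc]
  exact congrArg (· ⟫ _) swap_comp_gef_gef

/-- A leaf attached to a wire may be dropped. -/
theorem B_mul_D_mul_B_self {i j : Fin m} (h : i ≠ j) : B j * (D i j * B j) = B j := by
  rw [B, D, ← op2_snd h, ← map_mul, ← map_mul]
  refine congrArg _ ?_
  have e : lft 1 rst = Q.comp (n := 2) (m := 1) (k := 2) ((1 : Q 1 1) ◎ gef)
    ((1 : Q 1 1) ◎ gst) := one_tens_comp 1 gef gst
  rw [spi_mul_rst, mul_def, comp_assoc]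
  have h : Q.comp (n := 1) (m := 2) (k := 2) cpy (lft 1 rst) = (1 : Q 1 1) ◎ gst := by
    rw [e, ← comp_assoc]
    have h : Q.comp (n := 1) (m := 2) (k := 1) cpy ((1 : Q 1 1) ◎ gef) = 1 := cpy_comp_tens_gef
    rw [h, one_comp]
  rw [h, ← e]

/-- An edge is made with the help of a wire joined to both ends. -/
theorem C_mul_B {i j k : Fin m} (hij : i ≠ j) (hik : i ≠ k) (hjk : j ≠ k) (f : Q 1 1) :
    C i j f * B k = B k * (D j k * (op1 k f * (D i k * B k))) := by
  obtain ⟨Φ, h1, h2⟩ := exists_op3 hik hij hjk.symm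
  have h := congrArg Φ (edg_eq f)
  have h3 : lft 2 rst = lft 1 (lft 1 rst) := (eq_of_heq (lft_lft 1 1 rst)).symm
  simp only [map_mul, h1, h2, h3, op2_fst hjk.symm, op2_snd hjk.symm, op2_swap hjk.symm] at h
  have e1 := P_mul_op2 (Equiv.swap k j) hik (edg f)
  have e2 := P_mul_op1 (Equiv.swap k j) j rst
  rw [Equiv.swap_apply_left, Equiv.swap_apply_of_ne_of_ne hik hij] at e1
  rw [Equiv.swap_apply_right] at e2
  have e3 : P (Equiv.swap k j) * P (Equiv.swap k j) = 1 := by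
    rw [← map_mul, Equiv.swap_mul_self, map_one]
  rw [← mul_assoc, e1, mul_assoc, mul_assoc, ← mul_assoc (P _) (op1 j rst), e2, mul_assoc, e3,
    mul_one] at h
  rw [D_symm hjk]
  refine h.trans ?_
  simp only [mul_assoc]
  rfl

theorem ext_C {i j : Fin m} (h : i ≠ j) (f : Q 1 1) :
    ext (C i j f) = C i.castSucc j.castSucc f := op2_ext h _

theorem ext_D {i j : Fin m} (h : i ≠ j) : ext (D i j) = D i.castSucc j.castSucc := op2_ext h _

theorem B_last : B (Fin.last m) = lft m rst := op1_last rst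

/-- Two diagrams agree if they agree next to a fresh wire. -/
theorem fresh_cancel {x y : Q m m}
    (h : ext x * B (Fin.last m) = ext y * B (Fin.last m)) : x = y := by
  rw [B_last] at h
  exact ext_mul_rst_cancel h

theorem ext_commute_op1 (x : Q m m) (f : Q 1 1) : Commute (ext x) (op1 (Fin.last m) f) := by
  rw [op1_last]
  exact tens_commute x f

theorem castSucc_ne {i j : Fin m} (h : i ≠ j) : i.castSucc ≠ j.castSucc :=
  (Fin.castSucc_injective _).ne h

theorem castSucc_ne_last (i : Fin m) : i.castSucc ≠ Fin.last m := (Fin.castSucc_lt_last i).ne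

theorem C_commute {i j : Fin m} (hij : i ≠ j) {f : Q 1 1} {x : Q m m}
    (h1 : Commute (ext x) (D i.castSucc (Fin.last m)))
    (h2 : Commute (ext x) (D j.castSucc (Fin.last m))) : Commute (C i j f) x := by
  refine fresh_cancel ?_
  have hb : Commute (ext x) (B (Fin.last m)) := ext_commute_op1 x rst
  have hf : Commute (ext x) (op1 (Fin.last m) f) := ext_commute_op1 x f
  have e := C_mul_B (castSucc_ne hij) (castSucc_ne_last i) (castSucc_ne_last j) f
  have hc : Commute (ext x) (C i.castSucc j.castSucc f * B (Fin.last m)) := by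
    rw [e]
    exact hb.mul_right (h2.mul_right (hf.mul_right (h1.mul_right hb)))
  rw [map_mul, map_mul, ext_C hij, mul_assoc, hb.eq, ← mul_assoc, ← hc.eq, mul_assoc]

theorem C_commute_D {i j k l : Fin m} (hij : i ≠ j) (hkl : k ≠ l) (f : Q 1 1) :
    Commute (C i j f) (D k l) := by
  refine C_commute hij ?_ ?_ <;> rw [ext_D hkl]
  · exact D_commute (castSucc_ne hkl) (castSucc_ne_last _)
  · exact D_commute (castSucc_ne hkl) (castSucc_ne_last _)

theorem C_commute_C {i j k l : Fin m} (hij : i ≠ j) (hkl : k ≠ l) (f g : Q 1 1) :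
    Commute (C i j f) (C k l g) := by
  refine C_commute hij ?_ ?_ <;> rw [ext_C hkl]
  · exact C_commute_D (castSucc_ne hkl) (castSucc_ne_last _) g
  · exact C_commute_D (castSucc_ne hkl) (castSucc_ne_last _) g

theorem ext_op1 (i : Fin m) (f : Q 1 1) : ext (op1 i f) = op1 i.castSucc f := op1_ext i f

theorem C_commute_zph {i j k : Fin m} (hij : i ≠ j) (f : Q 1 1) (α β : Real.Angle) :
    Commute (C i j f) (op1 k (zph α β)) := by
  refine C_commute hij ?_ ?_ <;> rw [ext_op1]
  · exact (D_commute_zph (castSucc_ne_last _) α β).symm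
  · exact (D_commute_zph (castSucc_ne_last _) α β).symm

theorem ext_B (i : Fin m) : ext (B i) = B i.castSucc := ext_op1 i rst

theorem IsTr.op_bell {f f' : Q 1 1} (h : IsTr f f') {i j : Fin m} (hij : i ≠ j) :
    op1 i f * (D i j * (B i * B j)) = op1 j f' * (D i j * (B i * B j)) := by
  have e := congrArg (op2 i j) h.bell
  simp only [map_mul, op2_fst hij, op2_snd hij] at e
  exact e

/-- Both wires may be led to the wire in between as a cap. -/
theorem C_mul_B_mul_B {i j k l : Fin m} (hij : i ≠ j) (hik : i ≠ k) (hil : i ≠ l) (hjk : j ≠ k)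
    (hjl : j ≠ l) (hkl : k ≠ l) (f : Q 1 1) :
    C i j f * (B k * B l) =
      B k * B l * (D j k * D i l * (op1 k f * (D k l * (B k * B l)))) := by
  have e : B l * (D k l * D i l * B l) = D i k * B l := by
    rw [D_symm hkl, D_symm hil, D_mul_D hkl.symm hil.symm hik.symm, D_symm hik.symm,
      (D_commute hkl.symm hik).eq, D_symm hkl.symm, mul_assoc, ← mul_assoc,
      (D_commute_B hik hil.symm hkl.symm).symm.eq, mul_assoc]
    exact congrArg _ (B_mul_D_mul_B_self hkl)
  have c1 : Commute (B l) (D j k) := (D_commute_op1 hjk hjl.symm hkl.symm rst).symm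
  have c2 : Commute (B l) (op1 k f) := op1_commute_op1 hkl.symm _ _
  have c3 : Commute (op1 k f) (D i l) := (D_commute_op1 hil hik.symm hkl f).symm
  calc C i j f * (B k * B l) = B k * (D j k * (op1 k f * (D i k * B k))) * B l := by
        rw [← mul_assoc, C_mul_B hij hik hjk]
    _ = B k * (D j k * (op1 k f * (D i k * B l))) * B k := by
        simp only [mul_assoc, (B_commute k l).eq]
    _ = B k * (D j k * (op1 k f * (B l * (D i l * (D k l * B l))))) * B k := by
        rw [← e, (D_commute hkl hil).eq, mul_assoc (D i l)]
    _ = B k * (B l * (D j k * (op1 k f * (D i l * (D k l * B l))))) * B k := by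
        rw [c2.symm.left_comm, c1.symm.left_comm]
    _ = _ := by
        rw [c3.left_comm]
        simp only [mul_assoc]
        rw [(B_commute k l).left_comm, (B_commute k l).eq, (B_commute l k).left_comm]

/-- Reversing an edge transposes its label. -/
theorem C_flip {i j : Fin m} (hij : i ≠ j) {f f' : Q 1 1} (h : IsTr f f') :
    C i j f = C j i f' := by
  refine fresh_cancel (fresh_cancel ?_)
  rw [map_mul, map_mul, ext_C hij, ext_C hij.symm, ext_C (castSucc_ne hij),
    ext_C (castSucc_ne hij.symm), ext_B]
  have h1 := castSucc_ne (castSucc_ne_last (m := m) i)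
  have h2 := castSucc_ne (castSucc_ne_last (m := m) j)
  have h3 := castSucc_ne_last (Fin.last m)
  have e1 := C_mul_B_mul_B (castSucc_ne (castSucc_ne hij)) h1 (castSucc_ne_last _) h2
    (castSucc_ne_last _) h3 f
  have e2 := C_mul_B_mul_B (castSucc_ne (castSucc_ne hij.symm)) (castSucc_ne_last _) h2
    (castSucc_ne_last _) h1 h3.symm f'
  rw [h.op_bell h3] at e1
  rw [mul_assoc, mul_assoc]
  rw [(B_commute (Fin.last (m + 1)) _).eq] at e2
  refine e1.trans (Eq.trans ?_ e2.symm)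
  rw [D_symm h3.symm, (D_commute (castSucc_ne_last _) h2).eq]

variable {m : ℕ}

theorem swap_mul_self (i j : Fin m) : P (Equiv.swap i j) * P (Equiv.swap i j) = 1 := by
  rw [← map_mul, Equiv.swap_mul_self, map_one]

/-- An edge to a fresh wire. -/
theorem C_mul_B_right {i j : Fin m} (hij : i ≠ j) (f : Q 1 1) :
    C i j f * B j = op1 j f * (D i j * B j) := by
  refine fresh_cancel ?_
  simp only [map_mul, ext_C hij, ext_B, ext_D hij, ext_op1]
  set k := Fin.last m
  have hik : i.castSucc ≠ k := castSucc_ne_last i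
  have hjk : j.castSucc ≠ k := castSucc_ne_last j
  have hij := castSucc_ne hij
  generalize i.castSucc = i at *
  generalize j.castSucc = j at *
  have hf : P (Equiv.swap j k) * op1 k f = op1 j f * P (Equiv.swap j k) := by
    rw [P_mul_op1, Equiv.swap_apply_right]
  have hD : P (Equiv.swap j k) * D i k = D i j * P (Equiv.swap j k) := by
    rw [D, P_mul_op2 _ hik, Equiv.swap_apply_right, Equiv.swap_apply_of_ne_of_ne hij hik, D]
  have c1 : Commute (B j) (op1 k f) := op1_commute_op1 hjk _ _
  have c2 : Commute (D i k) (B j) := D_commute_B hik hij.symm hjk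
  have e : B k * (D j k * B j) = P (Equiv.swap j k) * B j := by
    rw [D_symm hjk, B_mul_D_mul_B hjk.symm, Equiv.swap_comm]
  calc C i j f * B j * B k = C i j f * B k * B j := by
        rw [mul_assoc, (B_commute j k).eq, mul_assoc]
    _ = B k * (D j k * (op1 k f * (B j * (D i k * B k)))) := by
        rw [C_mul_B hij hik hjk, mul_assoc, mul_assoc, mul_assoc, mul_assoc, (B_commute k j).eq,
          c2.left_comm]
    _ = (B k * (D j k * B j)) * (op1 k f * (D i k * B k)) := by
        rw [← c1.left_comm]
        simp only [mul_assoc]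
    _ = P (Equiv.swap j k) * (op1 k f * (D i k * (B j * B k))) := by
        rw [e, mul_assoc, c1.left_comm, ← c2.left_comm]
    _ = op1 j f * (D i j * (P (Equiv.swap j k) * (B j * B k))) := by
        rw [← mul_assoc, hf, mul_assoc, ← mul_assoc _ (D i k), hD, mul_assoc]
    _ = _ := by
        rw [swap_mul_B_mul_B hjk]
        simp only [mul_assoc]

/-- An edge from a discarded wire. -/
theorem B_mul_C_left {i j : Fin m} (hij : i ≠ j) (f : Q 1 1) :
    B i * C i j f = B i * (D i j * op1 i f) := by
  refine fresh_cancel ?_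
  simp only [map_mul, ext_C hij, ext_B, ext_D hij, ext_op1]
  set k := Fin.last m
  have hik : i.castSucc ≠ k := castSucc_ne_last i
  have hjk : j.castSucc ≠ k := castSucc_ne_last j
  have hij := castSucc_ne hij
  generalize i.castSucc = i at *
  generalize j.castSucc = j at *
  have hf : op1 k f * P (Equiv.swap i k) = P (Equiv.swap i k) * op1 i f := by
    rw [P_mul_op1, Equiv.swap_apply_left]
  have hD : D j k * P (Equiv.swap i k) = P (Equiv.swap i k) * D i j := by
    rw [D_symm hjk, D, D, P_mul_op2 _ hij, Equiv.swap_apply_left,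
      Equiv.swap_apply_of_ne_of_ne hij.symm hjk]
  have c1 : Commute (B i) (op1 k f) := op1_commute_op1 hik _ _
  have c2 : Commute (D j k) (B i) := D_commute_B hjk hij hik
  have c3 : Commute (B k) (op1 i f) := op1_commute_op1 hik.symm _ _
  have c4 : Commute (D i j) (B k) := D_commute_B hij hik.symm hjk.symm
  calc B i * C i j f * B k = B i * (B k * (D j k * (op1 k f * (D i k * B k)))) := by
        rw [mul_assoc, C_mul_B hij hik hjk]
    _ = B k * (D j k * (op1 k f * (B i * (D i k * B k)))) := by
        rw [(B_commute i k).left_comm, ← c2.left_comm, ← c1.left_comm]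
    _ = B k * (P (Equiv.swap i k) * B k) * (D i j * op1 i f) := by
        rw [B_mul_D_mul_B hik, ← mul_assoc (op1 k f), hf, mul_assoc, ← mul_assoc (D j k), hD,
          ← c3.eq, mul_assoc, c4.left_comm]
        simp only [mul_assoc]
    _ = B i * B k * (D i j * op1 i f) := by
        rw [B, P_mul_op1, Equiv.swap_apply_right, ← B, ← B, ← mul_assoc (B k), (B_commute k i).eq,
          B_mul_B_mul_swap hik]
    _ = _ := by
        rw [mul_assoc, c4.symm.left_comm, c3.eq]
        simp only [mul_assoc]

/-- Two consecutive edges compose. -/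
theorem B_mul_C_mul_C_mul_B {i j k : Fin m} (hij : i ≠ j) (hik : i ≠ k) (hjk : j ≠ k)
    (f g : Q 1 1) : B j * (C j k g * (C i j f * B j)) = C i k (g * f) * B j := by
  rw [C_mul_B_right hij, ← mul_assoc, B_mul_C_left hjk, C_mul_B hik hij hjk.symm, map_mul,
    D_symm hjk]
  simp only [mul_assoc]

/-- An edge may end at either of two wires joined by a green spider. -/
theorem D_mul_C {i j k : Fin m} (hij : i ≠ j) (hik : i ≠ k) (hjk : j ≠ k) (f : Q 1 1) :
    D i j * C i k f = D i j * C j k f := by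
  refine fresh_cancel ?_
  simp only [map_mul, ext_C hik, ext_C hjk, ext_D hij]
  have hil : i.castSucc ≠ Fin.last m := castSucc_ne_last i
  have hjl : j.castSucc ≠ Fin.last m := castSucc_ne_last j
  have hkl : k.castSucc ≠ Fin.last m := castSucc_ne_last k
  have hij := castSucc_ne hij
  have hik := castSucc_ne hik
  have hjk := castSucc_ne hjk
  rw [mul_assoc, mul_assoc, C_mul_B hik hil hkl, C_mul_B hjk hjl hkl]
  have c1 := D_commute_B hij hil.symm hjl.symm
  have c2 := D_commute_op1 hij hil.symm hjl.symm f
  rw [c1.left_comm, c1.left_comm, (D_commute hij hkl).left_comm, (D_commute hij hkl).left_comm,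
    c2.left_comm, c2.left_comm, ← mul_assoc (D _ _) (D _ _), D_mul_D hij hil hjl, mul_assoc]

/-! ### Negation -/

/-- Negation passes through green spiders: compare the two colour change rules for the spider with
two inputs and two outputs. -/
theorem neg_tens_neg_mul_spi : ext neg * lft 1 neg * spi = spi * (ext neg * lft 1 neg) := by
  have h1 := sound (ZXEq.H2 2 2 0 0)
  have h2 := sound (ZXEq.H2' 2 2 0 0)
  rw [q_comp, q_comp, q_parallel_two, q_parallel_two] at h1 h2
  have h : (hdag ◎ hdag) ⟫ spi ⟫ (had ◎ had) = (had ◎ had) ⟫ spi ⟫ (hdag ◎ hdag) :=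
    h1.symm.trans h2
  have h3 := congrArg (fun x => (had ◎ had) ⟫ x ⟫ (had ◎ had)) h
  simp only [comp_assoc] at h3
  have e1 : (had ◎ had) ⟫ (had ◎ had) = ext neg * lft 1 neg :=
    (interchange _ _ _ _).symm.trans (tens_eq_right neg neg)
  have e2 : (hdag ◎ hdag) ⟫ (had ◎ had) = 1 := by
    refine (interchange _ _ _ _).symm.trans ?_
    have : hdag ⟫ had = 1 := had_mul_hdag
    rw [this]
    exact one_tens_one 1 1
  have e3 : (had ◎ had) ⟫ (hdag ◎ hdag) = 1 := by
    refine (interchange _ _ _ _).symm.trans ?_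
    have : had ⟫ hdag = 1 := hdag_mul_had
    rw [this]
    exact one_tens_one 1 1
  have e4 : spi ⟫ (1 : Q (1 + 1) (1 + 1)) = spi := comp_one spi
  have e5 : (1 : Q (1 + 1) (1 + 1)) ⟫ (spi ⟫ (ext neg * lft 1 neg)) =
      spi ⟫ (ext neg * lft 1 neg) := one_comp _
  rw [e1, e2, e4, ← comp_assoc, e3, e5, ← comp_assoc, e1] at h3
  exact h3

/-- Negation of both wires commutes with the green spider. -/
theorem neg_neg_commute_D {i j : Fin m} (hij : i ≠ j) :
    Commute (op1 i neg * op1 j neg) (D i j) := by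
  have h := congrArg (op2 i j) neg_tens_neg_mul_spi
  simp only [map_mul, op2_fst hij, op2_snd hij] at h
  exact h

theorem op1_neg_mul_self (i : Fin m) : op1 i neg * op1 i neg = 1 := by
  rw [← map_mul, neg_mul_neg, map_one]

theorem neg_mul_D {i j : Fin m} (hij : i ≠ j) :
    op1 i neg * D i j * op1 i neg = op1 j neg * D i j * op1 j neg := by
  have h : op1 i neg * op1 j neg * D i j = D i j * (op1 i neg * op1 j neg) :=
    neg_neg_commute_D hij
  have c : Commute (op1 i neg) (op1 j neg) := op1_commute_op1 hij _ _
  calc op1 i neg * D i j * op1 i neg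
      = op1 j neg * op1 j neg * (op1 i neg * D i j * op1 i neg) := by
        rw [op1_neg_mul_self, one_mul]
    _ = op1 j neg * (op1 i neg * op1 j neg * D i j) * op1 i neg := by
        rw [c.eq]
        simp only [mul_assoc]
    _ = _ := by
        rw [h, c.eq]
        simp only [mul_assoc, op1_neg_mul_self, mul_one]

/-- Negating one end of an edge negates its label. -/
theorem neg_mul_C_mul_neg {i j : Fin m} (hij : i ≠ j) (f : Q 1 1) :
    op1 j neg * C i j f * op1 j neg = C i j (neg * f) := by
  refine fresh_cancel ?_
  simp only [map_mul, ext_C hij, ext_op1]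
  have hil : i.castSucc ≠ Fin.last m := castSucc_ne_last i
  have hjl : j.castSucc ≠ Fin.last m := castSucc_ne_last j
  have hij := castSucc_ne hij
  generalize i.castSucc = i at *
  generalize j.castSucc = j at *
  set l := Fin.last m
  have c1 : Commute (op1 j neg) (B l) := op1_commute_op1 hjl _ _
  have c2 : Commute (op1 j neg) (op1 l f) := op1_commute_op1 hjl _ _
  have c3 : Commute (op1 j neg) (D i l) := (D_commute_op1 hil hij.symm hjl _).symm
  have e1 : B l * op1 l neg = B l := by rw [B, ← map_mul, rst_mul_neg]
  calc op1 j neg * C i j f * op1 j neg * B l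
      = op1 j neg * (C i j f * B l) * op1 j neg := by
        rw [mul_assoc, mul_assoc, c1.eq]
        simp only [mul_assoc]
    _ = B l * ((op1 j neg * D j l * op1 j neg) * (op1 l f * (D i l * B l))) := by
        rw [C_mul_B hij hil hjl]
        simp only [mul_assoc]
        rw [← c1.eq, c3.symm.left_comm, c2.symm.left_comm, c1.left_comm]
    _ = B l * (D j l * (op1 l (neg * f) * (D i l * B l))) := by
        rw [neg_mul_D hjl, map_mul]
        simp only [← mul_assoc]
        rw [e1]
    _ = _ := (C_mul_B hij hil hjl _).symm

/-! ### Phases that are multiples of a third of a turn -/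

theorem third_eq (k : ZMod 3) : third k = k.val • (((2 * Real.pi / 3 : ℝ)) : Real.Angle) := by
  rw [third, mul_comm, ← nsmul_eq_mul, Real.Angle.coe_nsmul]

theorem mod_three_nsmul (n : ℕ) : (n % 3) • (((2 * Real.pi / 3 : ℝ)) : Real.Angle) =
    n • (((2 * Real.pi / 3 : ℝ)) : Real.Angle) := by
  have h : (3 : ℕ) • (((2 * Real.pi / 3 : ℝ)) : Real.Angle) = 0 := by
    rw [← Real.Angle.coe_nsmul, nsmul_eq_mul]
    rw [show ((3 : ℕ) : ℝ) * (2 * Real.pi / 3) = 2 * Real.pi by push_cast; ring]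
    exact Real.Angle.coe_two_pi
  conv_rhs => rw [← Nat.mod_add_div n 3, add_nsmul, mul_nsmul, h, nsmul_zero, add_zero]

theorem third_natCast (n : ℕ) : third (n : ZMod 3) =
    n • (((2 * Real.pi / 3 : ℝ)) : Real.Angle) := by
  rw [third_eq, ZMod.val_natCast, mod_three_nsmul]

theorem third_add (a b : ZMod 3) : third a + third b = third (a + b) := by
  rw [third_eq, third_eq, third_eq, ← add_nsmul, ZMod.val_add, mod_three_nsmul]

@[simp] theorem third_zero : third 0 = 0 := by
  rw [third_eq, ZMod.val_zero, zero_nsmul]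

theorem third_neg (a : ZMod 3) : third (-a) = -third a := by
  rw [eq_neg_iff_add_eq_zero, third_add, neg_add_cancel, third_zero]

theorem third_sub (a b : ZMod 3) : third a - third b = third (a - b) := by
  rw [sub_eq_add_neg, ← third_neg, third_add, ← sub_eq_add_neg]

theorem isThird_iff {α : Real.Angle} : IsThird α ↔ ∃ k : ZMod 3, α = third k := by
  constructor
  · rintro ⟨k, rfl⟩
    obtain ⟨n, hn⟩ : ∃ n : ℕ, k.emod 3 = n :=
      Int.eq_ofNat_of_zero_le (Int.emod_nonneg _ (by decide))
    refine ⟨(n : ZMod 3), ?_⟩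
    rw [third_natCast, ← Real.Angle.coe_nsmul, Real.Angle.angle_eq_iff_two_pi_dvd_sub]
    refine ⟨k / 3, ?_⟩
    have h : (k : ℝ) = n + 3 * ((k / 3 : ℤ) : ℝ) := by
      have h : k = n + 3 * (k / 3) := by
        rw [← hn]
        exact (Int.emod_add_mul_ediv k 3).symm
      exact_mod_cast h
    rw [nsmul_eq_mul]
    linear_combination (2 * Real.pi / 3) * h
  · rintro ⟨k, rfl⟩
    refine ⟨k.val, ?_⟩
    rw [third]
    norm_cast

/-- Green phase nodes with angles in thirds of a turn, sending `|1⟩` to `ω ^ a |1⟩` and `|2⟩` to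
`ω ^ b |2⟩`. -/
noncomputable def zt (a b : ZMod 3) : Q 1 1 := zph (third a) (third b)

theorem zt_mul (a b c d : ZMod 3) : zt a b * zt c d = zt (a + c) (b + d) := by
  rw [zt, zt, zph_mul, third_add, third_add, zt]

@[simp] theorem zt_zero : zt 0 0 = 1 := by
  rw [zt, third_zero, zph_zero]

/-! ### One-qutrit relations -/

theorem neg_mul_zph (α β : Real.Angle) : neg * zph α β = zph β α * neg := by
  have h := (xph_eq α β).symm.trans (xph_eq' β α)
  have h2 := congrArg (fun x => had * x * had) h
  simp only [mul_assoc, hdag_mul_had, mul_one] at h2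
  rw [← mul_assoc had hdag, had_mul_hdag, one_mul, ← mul_assoc] at h2
  exact h2

theorem neg_mul_zt (a b : ZMod 3) : neg * zt a b = zt b a * neg := neg_mul_zph _ _

/-- The green node with both phases `4π/3`. -/
noncomputable def zz : Q 1 1 := zt 2 2

/-- The red node with both phases `4π/3`. -/
noncomputable def xx : Q 1 1 := had * zz * hdag

theorem q_X_two : q (X 1 1 (third 2) (third 2)) = xx := xph_eq _ _

theorem neg_mul_zz : neg * zz = zz * neg := neg_mul_zt 2 2

theorem zz_cube : zz * (zz * zz) = 1 := by
  rw [zz, zt_mul, zt_mul, ← zt_zero]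
  rfl

theorem had_eq : had = zz * (xx * zz) := by
  have h := sound ZXEq.EU
  rw [q_comp, q_comp, q_X_two] at h
  exact h

theorem had_mul_zz : had * zz = xx * had := by
  rw [xx, mul_assoc, hdag_mul_had, mul_one]

theorem had_mul_xx : had * xx = zz * had := by
  rw [xx, ← mul_assoc, ← mul_assoc, ← neg, neg_mul_zz, mul_assoc, ← had_mul_neg, ← mul_assoc neg,
    neg_mul_had, ← had_mul_neg, mul_assoc, neg_mul_neg, mul_one]

theorem neg_mul_xx : neg * xx = xx * neg := by
  rw [neg, mul_assoc, had_mul_xx, ← mul_assoc, had_mul_zz, mul_assoc]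

theorem xx_cube : xx * (xx * xx) = 1 := by
  have h : had * (zz * (zz * zz)) = xx * (xx * xx) * had := by
    rw [← mul_assoc, had_mul_zz, mul_assoc, ← mul_assoc had, had_mul_zz, mul_assoc, had_mul_zz]
    simp only [mul_assoc]
  rw [zz_cube, mul_one] at h
  have h2 := congrArg (· * hdag) h
  simp only [mul_assoc, had_mul_hdag, mul_one] at h2
  exact h2.symm

theorem had_eq' : had = xx * (zz * xx) := by
  have h : had * had = xx * (zz * xx) * had := by
    calc had * had = had * (zz * (xx * zz)) := by rw [← had_eq]
      _ = _ := by
        rw [← mul_assoc, had_mul_zz, mul_assoc, ← mul_assoc had, had_mul_xx, mul_assoc zz,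
          had_mul_zz]
        simp only [mul_assoc]
  have h2 := congrArg (· * hdag) h
  simpa only [mul_assoc, had_mul_hdag, mul_one] using h2

theorem omega_sum : 1 + ω + ω ^ 2 = 0 := by
  have h : IsPrimitiveRoot ω 3 := by
    have := Complex.isPrimitiveRoot_exp 3 (by decide)
    rw [ω]
    exact_mod_cast this
  have := h.geom_sum_eq_zero (by decide)
  simpa [Finset.sum_range_succ] using this

theorem omega_cube : ω ^ 3 = 1 := by
  have h : IsPrimitiveRoot ω 3 := by
    have := Complex.isPrimitiveRoot_exp 3 (by decide)
    rw [ω]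
    exact_mod_cast this
  exact h.pow_eq_one

theorem interp_red_green (α β : Real.Angle) : interp (X 0 1 0 0 ⨾ Z 1 0 α β) ≠ 0 := by
  intro h
  have h1 := congrFun (congrFun h (fun i => i.elim0)) (fun i => i.elim0)
  have h4 : ω ^ 4 = ω := by
    have := omega_cube
    linear_combination ω * this
  have e : ∀ f : (Fin 1 → Fin 3) → ℂ, ∑ x, f x = ∑ j : Fin 3, f (fun _ => j) := fun f =>
    (Fintype.sum_equiv (Equiv.funUnique (Fin 1) (Fin 3)) f (fun j => f (fun _ => j))
      fun x => congrArg f (funext fun i => by rw [Subsingleton.elim i 0]; rfl))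
  have h3 := omega_sum
  simp [interp, Matrix.mul_apply, phase, e, Fin.sum_univ_three] at h1
  have h5 : (3 : ℂ) = 0 := by
    linear_combination h1 - α.toCircle * h3 - β.toCircle * (h3 + h4)
  norm_num at h5

/-- The red state is proportional to `|0⟩` and absorbs green phases. -/
theorem rdst_comp_zph (α β : Real.Angle) : rdst ⟫ zph α β = rdst := by
  have h := sound (ZXEq.S1 1 1 0 0 0 0 0 α β)
  simp only [zero_add] at h
  have h1 : Q.comp (n := 1) (m := 2) (k := 1) (cpy ◎ (1 : Q 0 0)) ((1 : Q 1 1) ◎ q (Z 1 0 α β)) =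
    zph α β := h
  rw [tens_zero] at h1
  have h2 : rdst ⟫ q (Z 1 0 α β) = q (X 0 1 0 0 ⨾ Z 1 0 α β) := rfl
  have h3 : Q.comp (n := 0) (m := 2) (k := 1) (rdst ◎ rdst)
      ((1 : Q 1 1) ◎ q (Z 1 0 α β)) = rdst := by
    refine (interchange rdst (1 : Q 1 1) rdst (q (Z 1 0 α β))).symm.trans ?_
    rw [comp_one, h2]
    exact drop_right rdst _ (interp_red_green α β)
  rw [← h1, ← comp_assoc, rdst_comp_cpy, h3]

theorem had_mul_rst : had * rst = gef ⟫ rdst := by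
  rw [rdst_eq, ← comp_assoc]
  rfl

theorem zph_mul_had_mul_rst (α β : Real.Angle) : zph α β * (had * rst) = had * rst := by
  rw [had_mul_rst, mul_def, comp_assoc, rdst_comp_zph]

theorem hdag_mul_rst : hdag * rst = had * rst := by
  rw [← had_mul_neg, mul_assoc, neg_mul_rst]

theorem xx_mul_rst : xx * rst = rst := by
  rw [xx, mul_assoc, mul_assoc, hdag_mul_rst, zz, zt, zph_mul_had_mul_rst, ← mul_assoc, ← neg,
    neg_mul_rst]

/-! ### Controlled shifts -/

variable {m : ℕ}

/-- The bialgebra rule: copying the result of an addition to a fresh wire. -/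
theorem bialgebra_op {k a b d : Fin m} (hka : k ≠ a) (hkb : k ≠ b) (hkd : k ≠ d)
    (hab : a ≠ b) (had : a ≠ d) (hbd : b ≠ d) :
    B k * (D b d * B d * op2 a b rmg) =
      op2 k b rmg * op2 a d rmg * (D k a * B k * (D b d * B d)) := by
  obtain ⟨Φ, h1, h2, h3⟩ := exists_op4 hka hkb hkd hab had hbd
  have h := congrArg Φ bialgebra
  have e2 : lft 1 (lft 1 (spi * lft 1 rst) * ext rmg) =
      lft 2 (spi * lft 1 rst) * ext (lft 1 rmg) := by
    rw [map_mul, ext_lft]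
    exact congrArg (· * _) (eq_of_heq (lft_lft 1 1 (spi * lft 1 rst)))
  rw [e2] at h
  simp only [map_mul, h1, h2, h3, op2_fst hka, op2_snd hbd, op2_swap hab] at h
  have f1 := P_mul_op2 (Equiv.swap a b) hka rmg
  have f2 := P_mul_op2 (Equiv.swap a b) hbd rmg
  rw [Equiv.swap_apply_left, Equiv.swap_apply_of_ne_of_ne hka hkb] at f1
  rw [Equiv.swap_apply_right, Equiv.swap_apply_of_ne_of_ne had.symm hbd.symm] at f2
  refine h.trans ?_
  simp only [B, D]
  rw [← mul_assoc (P _), ← mul_assoc (P _), f1, mul_assoc (op2 k b rmg), f2,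
    mul_assoc, mul_assoc, mul_assoc (op2 a d rmg), ← mul_assoc (P _) (P _),
    swap_mul_self, one_mul]
  simp only [mul_assoc]

/-- The controlled shift of wire `b` by wire `a`. -/
noncomputable def CX (a b : Fin m) : Q m m := op1 b had * (C a b hdag * op1 b hdag)

/-- Shifting the uniform state has no effect. -/
theorem CX_mul_B {a b : Fin m} (hab : a ≠ b) : CX a b * B b = B b := by
  have h := congrArg (op2 a b) edg_mul_rdst
  simp only [map_mul, op2_snd hab] at h
  have h' : C a b hdag * (op1 b had * op1 b rst) = op1 b had * op1 b rst := h
  have e1 : op1 b hdag * op1 b rst = op1 b had * op1 b rst := by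
    rw [← map_mul, ← map_mul, hdag_mul_rst]
  rw [CX, B, mul_assoc, mul_assoc, e1, h', ← mul_assoc, ← map_mul, ← neg, ← map_mul, neg_mul_rst]

/-- The controlled shift copies the control to a fresh wire `k` and adds that copy to the target
with a red spider. -/
theorem CX_mul_B_fresh {a b k : Fin m} (hab : a ≠ b) (hak : a ≠ k) (hbk : b ≠ k) :
    CX a b * B k = op2 k b rmg * (D a k * B k) := by
  have e : op2 k b rmg = B k * (op1 b had * (D k b * (op1 k hdag * op1 b hdag))) := by
    rw [rmg_eq]
    simp only [map_mul, op2_fst hbk.symm, op2_snd hbk.symm]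
    rfl
  have c1 : Commute (op1 b hdag) (B k) := op1_commute_op1 hbk _ _
  have c2 : Commute (op1 b had) (B k) := op1_commute_op1 hbk _ _
  have c3 : Commute (D a k) (op1 b hdag) := D_commute_op1 hak hab.symm hbk _
  have c4 : Commute (op1 k hdag) (op1 b hdag) := op1_commute_op1 hbk.symm _ _
  calc CX a b * B k = op1 b had * (C a b hdag * B k * op1 b hdag) := by
        rw [CX, mul_assoc, mul_assoc, c1.eq]
        simp only [mul_assoc]
    _ = B k * (op1 b had * (D b k * (op1 k hdag * (op1 b hdag * (D a k * B k))))) := by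
        rw [C_mul_B hab hak hbk]
        simp only [mul_assoc]
        rw [c2.left_comm, ← c1.eq, c3.left_comm]
    _ = _ := by
        rw [e, D_symm hbk]
        simp only [mul_assoc]

theorem ext_CX {a b : Fin m} (hab : a ≠ b) : ext (CX a b) = CX a.castSucc b.castSucc := by
  rw [CX, map_mul, map_mul, ext_op1, ext_op1, ext_C hab, CX]

theorem CX_commute_op1 {a b k : Fin m} (hab : a ≠ b) (hak : a ≠ k) (hbk : b ≠ k) (f : Q 1 1) :
    Commute (CX a b) (op1 k f) := by
  have c : ∀ g, Commute (op1 b g) (op1 k f) := fun g => op1_commute_op1 hbk g f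
  exact (c had).mul_left ((C_commute_op1 hab hak.symm hbk.symm _ f).mul_left (c hdag))

theorem CX_commute_D {a b c d : Fin m} (hab : a ≠ b) (hcd : c ≠ d) (hbc : b ≠ c) (hbd : b ≠ d) :
    Commute (CX a b) (D c d) := by
  have h : ∀ g, Commute (op1 b g) (D c d) := fun g => (D_commute_op1 hcd hbc hbd g).symm
  exact (h had).mul_left ((C_commute_D hab hcd _).mul_left (h hdag))

/-- Copying the target of a controlled shift doubles the controlled shift. -/
theorem D_mul_B_mul_CX_fresh {a b d k l : Fin m} (hab : a ≠ b) (had : a ≠ d) (hak : a ≠ k)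
    (hal : a ≠ l) (hbd : b ≠ d) (hbk : b ≠ k) (hbl : b ≠ l) (hdk : d ≠ k) (hdl : d ≠ l)
    (hkl : k ≠ l) :
    D b d * (B d * (CX a b * (B k * B l))) = CX a b * (CX a d * (D b d * (B d * (B k * B l)))) := by
  have hB := bialgebra_op hkl.symm hbl.symm hdl.symm hbk.symm hdk.symm hbd
  set M1 := op2 k b rmg
  set M2 := op2 l b rmg
  set M3 := op2 k d rmg
  have c1 : Commute (B l) (D b d) := (D_commute_B hbd hbl.symm hdl.symm).symm
  have c2 : Commute (B l) M1 := op1_commute_op2 hkl.symm hbl.symm hbk.symm _ _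
  have c3 : Commute (B l) (D a k) := (D_commute_B hak hal.symm hkl.symm).symm
  have c4 : Commute (B k) (D b d) := (D_commute_B hbd hbk.symm hdk.symm).symm
  have c5 : Commute (B d) (D a k) := (D_commute_B hak had.symm hdk).symm
  have c6 : Commute (D b d) (D a k) := D_commute hbd hak
  have c7 : Commute (D l k) (D a k) := D_commute hkl.symm hak
  have c8 : Commute (CX a d) (B l) := CX_commute_op1 had hal hdl _
  have c9 : Commute M3 (D a l) := (op2_commute_op2 hal hak had hkl.symm hdl.symm hdk.symm _ _).symm
  have c10 : Commute M3 (B l) := (op1_commute_op2 hkl.symm hdl.symm hdk.symm _ _).symm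
  have lhs : D b d * (B d * (CX a b * (B k * B l))) =
      M2 * (M3 * (D l k * (D a k * (B l * (D b d * (B d * B k)))))) := by
    calc D b d * (B d * (CX a b * (B k * B l)))
        = D b d * (B d * (M1 * (D a k * (B k * B l)))) := by
          rw [← mul_assoc (CX a b), CX_mul_B_fresh hab hak hbk]
          simp only [mul_assoc]
          rfl
      _ = B l * (D b d * B d * M1) * (D a k * (B k * B l)) := by
          conv_lhs => rw [← B_mul_B l, (B_commute k l).left_comm, ← c3.left_comm, ← c2.left_comm,
            (B_commute d l).left_comm, ← c1.left_comm]
          simp only [mul_assoc]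
      _ = _ := by
          rw [hB]
          simp only [mul_assoc]
          rw [c5.left_comm, c6.left_comm, ← c3.left_comm, (B_commute k l).eq,
            (B_commute d l).left_comm, ← c1.left_comm]
          have : B l * (B l * (D b d * (B d * B k))) = B l * (D b d * (B d * B k)) := by
            rw [← mul_assoc, B_mul_B]
          rw [c3.left_comm, this, c3.left_comm]
  rw [lhs]
  symm
  calc CX a b * (CX a d * (D b d * (B d * (B k * B l))))
      = CX a b * (B l * (CX a d * (B k * (D b d * B d)))) := by
        rw [(B_commute k l).eq, (B_commute d l).left_comm, ← c1.left_comm, c8.left_comm,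
          (B_commute d k).eq, c4.left_comm]
    _ = M2 * (D a l * B l) * (M3 * (D a k * B k) * (D b d * B d)) := by
        rw [← mul_assoc, ← mul_assoc, CX_mul_B_fresh hab hal hbl, ← CX_mul_B_fresh had hak hdk]
        simp only [mul_assoc]
        rfl
    _ = M2 * (M3 * (D a l * (D a k * (B l * (B k * (D b d * B d)))))) := by
        simp only [mul_assoc]
        rw [← c10.left_comm, ← c9.left_comm, c3.left_comm]
    _ = _ := by
        rw [c4.left_comm, (B_commute k d).eq, ← mul_assoc (D a l), ← mul_assoc (D l k),
          (D_commute hal hak).eq, D_mul_D hak hal hkl, (D_commute hak hkl).eq, D_symm hkl]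

/-- The copy of a sum is the sum of the copies: the bialgebra rule in terms of controlled shifts. -/
theorem D_mul_B_mul_CX {a b d : Fin m} (hab : a ≠ b) (had : a ≠ d) (hbd : b ≠ d) :
    D b d * (B d * CX a b) = CX a b * (CX a d * (D b d * B d)) := by
  refine fresh_cancel (fresh_cancel ?_)
  have h := D_mul_B_mul_CX_fresh (castSucc_ne (castSucc_ne hab)) (castSucc_ne (castSucc_ne had))
    (castSucc_ne (castSucc_ne_last a)) (castSucc_ne_last _) (castSucc_ne (castSucc_ne hbd))
    (castSucc_ne (castSucc_ne_last b)) (castSucc_ne_last _) (castSucc_ne (castSucc_ne_last d))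
    (castSucc_ne_last _) (castSucc_ne_last (Fin.last m))
  simp only [map_mul, ext_CX hab, ext_CX had, ext_D hbd, ext_B, ext_CX (castSucc_ne hab),
    ext_CX (castSucc_ne had), ext_D (castSucc_ne hbd), mul_assoc]
  exact h

variable {m : ℕ}

/-! ### The Hadamard node is its own transpose -/

/-- The group theory behind the symmetry of the Hadamard node. The elements `h` and `k` stand for
the node and its transpose in their Euler decompositions; `V = Y X⁻¹` has order dividing three, and
`k² = h²` makes conjugation by `z` invert `V`. As `z³ = 1`, this gives `V = V⁻¹`, which leaves only
`V = 1`. -/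
theorem had_transpose_group {G : Type*} [Group G] {z X Y h k : G} (hh : h = z * X * z)
    (hk : k = z * Y * z) (hkk : k * k = h * h) (hXY : Commute X Y)
    (hX : X ^ 3 = 1) (hY : Y ^ 3 = 1) (hz3 : z ^ 3 = 1) : h = k := by
  set V := Y * X⁻¹ with hV
  have hVX : Commute V X := (hXY.symm.mul_left (Commute.inv_left (Commute.refl X)))
  have hV3 : V ^ 3 = 1 := by
    rw [hV, (hXY.symm.inv_right).mul_pow, hY, inv_pow, hX, inv_one, one_mul]
  have hU : h⁻¹ * k = z⁻¹ * V * z := by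
    rw [hh, hk, hV, (hXY.symm.inv_right).eq]
    group
  have h1 : h * (h⁻¹ * k) * h⁻¹ = (h⁻¹ * k)⁻¹ := by
    have : k * h⁻¹ = k⁻¹ * h := by
      rw [mul_inv_eq_iff_eq_mul, mul_assoc, ← hkk, inv_mul_cancel_left]
    rw [mul_inv_cancel_left, this, mul_inv_rev, inv_inv]
  have h2 : h * z⁻¹ = z * X := by rw [hh]; group
  have h3 : z * V * z⁻¹ = z⁻¹ * V⁻¹ * z := by
    rw [hU] at h1
    have e : h * (z⁻¹ * V * z) * h⁻¹ = z * V * z⁻¹ := by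
      calc h * (z⁻¹ * V * z) * h⁻¹ = (h * z⁻¹) * V * (h * z⁻¹)⁻¹ := by group
        _ = z * (X * V) * X⁻¹ * z⁻¹ := by rw [h2]; group
        _ = _ := by rw [← hVX.eq]; group
    rw [e] at h1
    rw [h1]
    group
  have hzz : z * z = z⁻¹ := by
    rw [eq_inv_iff_mul_eq_one, mul_assoc, ← pow_two, ← pow_succ', hz3]
  have h4 : z⁻¹ * V * z = V⁻¹ := by
    calc z⁻¹ * V * z = (z * z) * V * (z * z)⁻¹ := by rw [hzz, inv_inv]
      _ = z * (z * V * z⁻¹) * z⁻¹ := by group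
      _ = _ := by rw [h3]; group
  have h5 : z⁻¹ * V⁻¹ * z = V := by
    calc z⁻¹ * V⁻¹ * z = (z⁻¹ * V * z)⁻¹ := by group
      _ = V := by rw [h4, inv_inv]
  have h6 : V = V⁻¹ := by
    calc V = (z * z * z)⁻¹ * V * (z * z * z) := by
          rw [← pow_two, ← pow_succ, hz3, inv_one, one_mul, mul_one]
      _ = z⁻¹ * (z⁻¹ * (z⁻¹ * V * z) * z) * z := by simp only [mul_inv_rev, mul_assoc]
      _ = _ := by rw [h4, h5, h4]
  have h7 : V = 1 := by
    have : V * V = 1 := by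
      conv_lhs => rw [h6]
      rw [mul_eq_one_iff_inv_eq, inv_inv]
      exact h6
    calc V = V ^ 3 := by rw [pow_succ, pow_two, this, one_mul]
      _ = 1 := hV3
  have h8 : Y = X := by rwa [hV, mul_inv_eq_one] at h7
  rw [hh, hk, h8]

/-- Two diagrams agree if they agree on one end of a fresh cap. -/
theorem bell_cancel {b : Fin m} {x y : Q m m}
    (h : ext x * (D b.castSucc (Fin.last m) * (B b.castSucc * B (Fin.last m))) =
      ext y * (D b.castSucc (Fin.last m) * (B b.castSucc * B (Fin.last m)))) : x = y := by
  have hbd' := castSucc_ne_last b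
  have h0 := congrArg ext h
  simp only [map_mul, ext_D hbd', ext_B] at h0
  set d := (Fin.last m).castSucc
  set c := Fin.last (m + 1)
  have hbd : b.castSucc.castSucc ≠ d := castSucc_ne hbd'
  have hbc : b.castSucc.castSucc ≠ c := castSucc_ne_last _
  have hdc : d ≠ c := castSucc_ne_last _
  have key : ∀ x : Q m m, B c * (B d * (D d c * (ext (ext x) *
      (D b.castSucc.castSucc d * (B b.castSucc.castSucc * B d))))) *
          P (Equiv.swap c b.castSucc.castSucc) =
      ext (ext x) * B d * B c := by
    intro x
    generalize b.castSucc.castSucc = b at *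
    have c1 : Commute (ext (ext x)) (D d c) := by
      have : D d c = lft m spi := op2_last spi
      rw [this, ext_ext]
      exact tens_commute x spi
    have c2 : Commute (ext (ext x)) (B c) := ext_commute_op1 _ _
    have c3 : Commute (ext (ext x)) (B d) := by
      have : B d = ext (B (Fin.last m)) := (ext_B _).symm
      rw [this]
      exact (ext_commute_op1 x rst).map ext
    have e1 : P (Equiv.swap c b) * B b = B c * P (Equiv.swap c b) := by
      rw [B, P_mul_op1, Equiv.swap_apply_right, B]
    have e2 : P (Equiv.swap c b) * B d = B d * P (Equiv.swap c b) := by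
      rw [B, P_mul_op1, Equiv.swap_apply_of_ne_of_ne hdc hbd.symm]
    have e3 : D d c * D b d = D b c * D b d := D_mul_left hbd hbc hdc
    have c4 : Commute (B d) (D b c) := (D_commute_B hbc hbd.symm hdc).symm
    calc _ = ext (ext x) * (B c * (B d * (D d c * D b d * (B d * B b)))) *
          P (Equiv.swap c b) := by
          rw [c1.symm.left_comm, c3.symm.left_comm, c2.symm.left_comm, (B_commute b d).eq]
          simp only [mul_assoc]
      _ = ext (ext x) * (B d * (B c * (D b c * B b))) * P (Equiv.swap c b) := by
          rw [e3, mul_assoc (D b c), c4.left_comm, ← mul_assoc (D b d), ← mul_assoc (B d) (_ * _),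
            B_mul_D_mul_B_self hbd]
          rw [← c4.left_comm, (B_commute c d).left_comm]
      _ = _ := by
          rw [D_symm hbc, B_mul_D_mul_B hbc.symm, e1]
          simp only [mul_assoc, swap_mul_self, mul_one]
  refine fresh_cancel (fresh_cancel ?_)
  rw [map_mul, map_mul, ext_B, ← key x, h0, key y]

theorem op1_one_injective {f g : Q 1 1} (h : op1 (0 : Fin 1) f = op1 (0 : Fin 1) g) : f = g := by
  have e : ∀ f : Q 1 1, op1 (0 : Fin 1) f = f := fun f =>
    (op1_last (n := 0) f).trans (eq_of_heq (zero_tens f))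
  rwa [e, e] at h

theorem isTr_one : IsTr 1 1 := by
  unfold IsTr
  rfl

theorem tr_sq {k : Q 1 1} (hk : IsTr had k) : k * k = neg := (hk.mul hk).unique isTr_neg

/-- A cap, with each of its ends shifted as `D_mul_B_mul_CX` prescribes, is unchanged. -/
theorem CX_mul_CX_mul_bell {a b d : Fin m} (hab : a ≠ b) (had : a ≠ d) (hbd : b ≠ d) :
    CX a b * (CX a d * (D b d * (B b * B d))) = D b d * (B b * B d) := by
  have h := congrArg (· * B b) (D_mul_B_mul_CX hab had hbd)
  simp only [mul_assoc] at h
  rw [CX_mul_B hab, (B_commute d b).eq] at h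
  exact h.symm

/-- A controlled shift moves through a cap. -/
theorem CX_mul_bell {k : Q 1 1} (hk : IsTr ZX.had k) {a b d : Fin m} (hab : a ≠ b) (had : a ≠ d)
    (hbd : b ≠ d) :
    CX a d * (D b d * (B b * B d)) = op1 b (k * neg) *
      (C a b hdag * (op1 b k * (D b d * (B b * B d)))) := by
  have hkd : IsTr (k * neg) hdag := by
    have h := isTr_neg.mul hk.symm
    rwa [neg_mul_had] at h
  have e1 : op1 d hdag * (D b d * (B b * B d)) = op1 b (k * neg) * (D b d * (B b * B d)) :=
    (hkd.op_bell hbd).symm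
  have e2 : op1 d ZX.had * (D b d * (B b * B d)) = op1 b k * (D b d * (B b * B d)) :=
    (hk.symm.op_bell hbd).symm
  have e3 : C a d hdag * D b d = C a b hdag * D b d := by
    rw [C_flip had hkd.symm, C_flip hab hkd.symm, (C_commute_D had.symm hbd _).eq,
      (C_commute_D hab.symm hbd _).eq, D_mul_C hbd hab.symm had.symm]
  have c1 : Commute (C a d hdag) (op1 b (k * neg)) := C_commute_op1 had hab.symm hbd _ _
  have c2 : Commute (op1 d ZX.had) (op1 b (k * neg)) := op1_commute_op1 hbd.symm _ _
  have c3 : Commute (C a b hdag) (op1 d ZX.had) := C_commute_op1 hab had.symm hbd.symm _ _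
  rw [CX, mul_assoc, mul_assoc, e1, c1.left_comm, c2.left_comm, ← mul_assoc (C a d hdag), e3,
    mul_assoc, ← c3.left_comm, e2]

/-- The inverse of an edge, in terms of the transpose `k` of the Hadamard node: in
`CX_mul_CX_mul_bell` the shift of one end of the cap is moved to the other end by `CX_mul_bell`. -/
theorem edge_relation {k : Q 1 1} (hk : IsTr had k) {a b : Fin m} (hab : a ≠ b) :
    op1 b had * (C a b hdag * (op1 b (hdag * (k * neg)) * (C a b hdag * op1 b k))) = 1 := by
  refine bell_cancel (b := b) ?_
  have h := CX_mul_CX_mul_bell (castSucc_ne hab) (castSucc_ne_last a) (castSucc_ne_last b)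
  rw [CX_mul_bell hk (castSucc_ne hab) (castSucc_ne_last a) (castSucc_ne_last b)] at h
  simp only [map_mul, ext_op1, ext_C hab, map_one, one_mul]
  refine Eq.trans ?_ h
  rw [CX]
  simp only [map_mul, mul_assoc]

/-- By `edge_relation`, conjugation by `k * had` sends an edge to its inverse. Green phases commute
with edges, hence so do their conjugates. -/
theorem commute_edge {k : Q 1 1} (hk : IsTr had k) {a b : Fin m} (hab : a ≠ b) :
    Commute (op1 b (k * had * zz * (hdag * (k * neg)))) (C a b hdag) := by
  have hkk : k * (k * neg) = 1 := by rw [← mul_assoc, tr_sq hk, neg_mul_neg]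
  have hkk' : k * neg * k = 1 := by
    rw [← tr_sq hk, mul_assoc, mul_assoc, tr_sq hk, hkk]
  set E := C a b hdag
  set s := op1 b (k * had)
  set t := op1 b (hdag * (k * neg))
  set z := op1 b zz
  have hst : s * t = 1 := by
    rw [← map_mul, mul_assoc, ← mul_assoc had, had_mul_hdag, one_mul, hkk, map_one]
  have hts : t * s = 1 := by
    rw [← map_mul, mul_assoc, ← mul_assoc _ k, hkk', one_mul, hdag_mul_had, map_one]
  have hz : z * E = E * z := (C_commute_zph hab _ _ _).symm
  have h := edge_relation hk hab
  have hl : s * E * t * E = 1 := by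
    have h2 := congrArg (fun x => op1 b k * x * op1 b (k * neg)) h
    simp only [mul_assoc, mul_one] at h2
    rw [← map_mul, hkk, map_one, mul_one, ← mul_assoc (op1 b k), ← map_mul] at h2
    simpa only [mul_assoc] using h2
  have hr : E * (t * E * s) = 1 := by
    have h2 := congrArg (fun x => t * x * s) hl
    simp only [mul_one, hts] at h2
    calc E * (t * E * s) = (t * s) * E * (t * E * s) := by rw [hts, one_mul]
      _ = 1 := by rw [← h2]; simp only [mul_assoc]
  have hlr : s * E * t = t * E * s := by
    calc s * E * t = s * E * t * (E * (t * E * s)) := by rw [hr, mul_one]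
      _ = s * E * t * E * (t * E * s) := by simp only [mul_assoc]
      _ = _ := by rw [hl, one_mul]
  have hr' : E * (s * E * t) = 1 := by rw [hlr, hr]
  have hx : op1 b (k * had * zz * (hdag * (k * neg))) = s * z * t := by
    rw [map_mul, map_mul]
  rw [hx]
  have hc : (s * z * t) * (s * E * t) = (s * E * t) * (s * z * t) := by
    calc (s * z * t) * (s * E * t) = s * (z * ((t * s) * E)) * t := by simp only [mul_assoc]
      _ = s * (E * ((t * s) * z)) * t := by rw [hts, one_mul, hz, one_mul]
      _ = _ := by simp only [mul_assoc]
  calc s * z * t * E = (E * (s * E * t)) * (s * z * t) * E := by rw [hr', one_mul]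
    _ = E * ((s * z * t) * (s * E * t)) * E := by rw [hc]; simp only [mul_assoc]
    _ = E * (s * z * t) * (s * E * t * E) := by simp only [mul_assoc]
    _ = _ := by rw [hl, mul_one]

theorem had_mul_zt_mul_rst : hdag * zt 1 1 * rst = zz * rst := by
  have e : zz * zt 1 1 = 1 := by
    rw [zz, zt_mul, ← zt_zero]
    rfl
  rw [← neg_mul_had, had_eq, mul_assoc, mul_assoc, mul_assoc, mul_assoc, ← mul_assoc zz (zt 1 1), e,
    one_mul, xx_mul_rst, ← mul_assoc, neg_mul_zz, mul_assoc, neg_mul_rst]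

/-- What commutes with an edge commutes with green phases: closing the other end of the edge with a
suitable state teleports a green phase to the wire. -/
theorem commute_of_commute_edge {f : Q 1 1}
    (hf : Commute (op1 (0 : Fin 1).castSucc f) (C (Fin.last 1) (0 : Fin 1).castSucc hdag)) :
    Commute f zz := by
  refine op1_one_injective (fresh_cancel ?_)
  rw [ext_op1, ext_op1]
  set b := (0 : Fin 1).castSucc
  set a := Fin.last 1
  have hab : a ≠ b := (castSucc_ne_last _).symm
  have e : B a * (C a b hdag * (op1 a (zt 1 1) * B a)) = op1 b zz * B a := by
    have e1 : op1 a hdag * (op1 a (zt 1 1) * B a) = op1 a zz * B a := by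
      rw [B, ← map_mul, ← map_mul, ← mul_assoc, had_mul_zt_mul_rst, map_mul]
    have cz : D a b * op1 a zz = op1 b zz * D a b := D_mul_op1_zph hab _ _
    have c : Commute (op1 b zz) (B a) := op1_commute_op1 hab.symm _ _
    rw [← mul_assoc, B_mul_C_left hab, mul_assoc, mul_assoc, e1, ← mul_assoc (D a b),
      cz, mul_assoc, ← c.left_comm, D_symm hab, B_mul_D_mul_B_self hab.symm]
  have c1 : Commute (op1 b f) (B a) := op1_commute_op1 hab.symm _ _
  have c2 : Commute (op1 b f) (op1 a (zt 1 1)) := op1_commute_op1 hab.symm _ _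
  have h : Commute (op1 b f) (B a * (C a b hdag * (op1 a (zt 1 1) * B a))) :=
    c1.mul_right (hf.mul_right (c2.mul_right c1))
  rw [e] at h
  rw [map_mul, map_mul, mul_assoc, h.eq, mul_assoc, ← c1.eq, mul_assoc]

/-- The Hadamard node equals its transpose. -/
theorem isTr_had : IsTr had had := by
  obtain ⟨k, hk⟩ := exists_isTr had
  have hkk : k * (k * neg) = 1 := by rw [← mul_assoc, tr_sq hk, neg_mul_neg]
  have hkk' : k * neg * k = 1 := by
    rw [← tr_sq hk, mul_assoc, mul_assoc, tr_sq hk, hkk]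
  have hkd : IsTr hdag (k * neg) := by
    have h := (isTr_neg.mul hk.symm)
    rw [neg_mul_had] at h
    exact h.symm
  set Y := k * neg * (zz * k) with hY
  have hzz : IsTr zz zz := isTr_zph _ _
  have hX : IsTr xx Y := by
    exact hkd.mul (hzz.mul hk)
  have hk' : k = zz * Y * zz := by
    have h := (hzz.mul hX).mul hzz
    rw [← had_eq] at h
    exact hk.unique h
  have hYc : Y * (Y * Y) = 1 := by
    have h := hX.mul (hX.mul hX)
    rw [mul_assoc, xx_cube] at h
    simpa only [mul_assoc] using h.unique isTr_one
  have hXY : xx * Y = Y * xx := by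
    have h := commute_of_commute_edge (commute_edge hk (castSucc_ne_last (0 : Fin 1)).symm)
    have h1 : k * xx * (k * neg) * zz = zz * (k * xx * (k * neg)) := by
      have e : k * had * zz * (hdag * (k * neg)) = k * xx * (k * neg) := by
        rw [xx]
        simp only [mul_assoc]
      rw [← e]
      exact h
    calc xx * Y = (k * neg * k) * xx * (k * neg * (zz * k)) := by rw [hkk', one_mul]
      _ = k * neg * (k * xx * (k * neg) * zz) * k := by simp only [mul_assoc]
      _ = k * neg * (zz * k) * xx * (k * neg * k) := by rw [h1]; simp only [mul_assoc]
      _ = _ := by rw [hkk', mul_one]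
  have hcube : ∀ {a : Q 1 1}, a * (a * a) = 1 → a * a * a = 1 := fun h => by rw [mul_assoc, h]
  have h := had_transpose_group (G := (Q 1 1)ˣ)
    (z := ⟨zz, zz * zz, zz_cube, hcube zz_cube⟩) (X := ⟨xx, xx * xx, xx_cube, hcube xx_cube⟩)
    (Y := ⟨Y, Y * Y, hYc, hcube hYc⟩) (h := ⟨had, hdag, had_mul_hdag, hdag_mul_had⟩)
    (k := ⟨k, k * neg, hkk, hkk'⟩) (Units.ext (had_eq.trans (mul_assoc _ _ _).symm))
    (Units.ext hk') (Units.ext (tr_sq hk)) (Units.ext hXY)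
    (Units.ext ?_) (Units.ext ?_) (Units.ext ?_)
  · have e : had = k := congrArg Units.val h
    exact e ▸ hk
  · exact (pow_succ _ _).trans ((congrArg (· * xx) (pow_two xx)).trans (hcube xx_cube))
  · exact (pow_succ _ _).trans ((congrArg (· * Y) (pow_two Y)).trans (hcube hYc))
  · exact (pow_succ _ _).trans ((congrArg (· * zz) (pow_two zz)).trans (hcube zz_cube))

theorem isTr_hdag : IsTr hdag hdag := by
  have h := isTr_had.mul isTr_neg
  rwa [neg_mul_had, had_mul_neg] at h

theorem C_symm {i j : Fin m} (h : i ≠ j) {f : Q 1 1} (hf : IsTr f f) : C i j f = C j i f :=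
  C_flip h hf

theorem neg_mul_hdag : neg * hdag = had := by
  rw [← neg_mul_had, ← mul_assoc, neg_mul_neg, one_mul]

/-- Edges through `H` and `H†` are inverse to each other. -/
theorem C_had_mul_C_hdag {i j : Fin m} (h : i ≠ j) : C i j had * C i j hdag = 1 := by
  have e := edge_relation isTr_had h
  have e1 : hdag * (had * neg) = neg := by rw [← mul_assoc, hdag_mul_had, one_mul]
  rw [e1] at e
  have e2 := congrArg (fun x => op1 j had * x * op1 j hdag) e
  simp only [mul_assoc, mul_one] at e2
  rw [← map_mul, had_mul_hdag, map_one, mul_one, ← mul_assoc (op1 j had), ← map_mul, ← neg] at e2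
  rw [← neg_mul_hdag, ← neg_mul_C_mul_neg h]
  simpa only [mul_assoc] using e2

variable {m : ℕ}

/-! ### Shifts -/

theorem cap_comp_gef : q cap ⟫ (gef ◎ (1 : Q 1 1)) = gst := by
  rw [← gst_comp_cpy, comp_assoc, cpy_comp_gef]
  exact comp_one gst

theorem isTr_rst : IsTr rst rst := by
  unfold IsTr
  have e1 : rst ◎ (1 : Q 1 1) = Q.comp (n := 2) (m := 1) (k := 2) (gef ◎ (1 : Q 1 1))
      (gst ◎ (1 : Q 1 1)) := comp_tens_one 1 gef gst
  have e2 : (1 : Q 1 1) ◎ rst = Q.comp (n := 2) (m := 1) (k := 2) ((1 : Q 1 1) ◎ gef)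
      ((1 : Q 1 1) ◎ gst) := one_tens_comp 1 gef gst
  have e3 : q cap ⟫ ((1 : Q 1 1) ◎ gef) = gst := by
    have hs : q cap ⟫ q swap = q cap := sound ZXEq.cap_swap
    rw [← hs, comp_assoc, swap_comp_gef, cap_comp_gef]
  rw [e1, e2, ← comp_assoc, ← comp_assoc]
  have h1 : Q.comp (n := 0) (m := 2) (k := 1) (q cap) (gef ◎ (1 : Q 1 1)) = gst := cap_comp_gef
  have h2 : Q.comp (n := 0) (m := 2) (k := 1) (q cap) ((1 : Q 1 1) ◎ gef) = gst := e3
  rw [h1, h2]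
  have f1 : gst ◎ gst = Q.comp (n := 0) (m := 1) (k := 2) gst (gst ◎ (1 : Q 1 1)) := by
    refine (tens_eq_right gst gst).trans ?_
    exact congrArg (fun x : Q 0 1 => Q.comp (n := 0) (m := 1) (k := 2) x (gst ◎ (1 : Q 1 1)))
      (eq_of_heq (zero_tens gst))
  have f2 : gst ◎ gst = Q.comp (n := 0) (m := 1) (k := 2) gst ((1 : Q 1 1) ◎ gst) := by
    refine (tens_eq_left gst gst).trans ?_
    rw [tens_zero]
  rw [← f1, f2]

theorem rst_mul_had_mul_zph (α β : Real.Angle) : rst * (had * zph α β) = rst * had := by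
  have h1 := ((isTr_rst.mul isTr_had).mul (isTr_zph α β))
  have h2 := isTr_rst.mul isTr_had
  rw [zph_mul_had_mul_rst] at h1
  rw [← mul_assoc]
  exact h1.unique h2

/-- The shift of the basis label by a multiple of `c`. -/
noncomputable def sx (c : ZMod 3) : Q 1 1 := had * zt c (2 * c) * hdag

theorem sx_mul (c d : ZMod 3) : sx c * sx d = sx (c + d) := by
  calc sx c * sx d = had * (zt c (2 * c) * ((hdag * had) * zt d (2 * d))) * hdag := by
        simp only [sx, mul_assoc]
    _ = _ := by rw [hdag_mul_had, one_mul, zt_mul, ← mul_add, sx]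

@[simp] theorem sx_zero : sx 0 = 1 := by
  rw [sx, mul_zero, zt_zero, mul_one, had_mul_hdag]

theorem sx_mul_neg (c : ZMod 3) : sx c * sx (-c) = 1 := by rw [sx_mul, add_neg_cancel, sx_zero]

theorem sx_mul_rst (c : ZMod 3) : sx c * rst = rst := by
  rw [sx, mul_assoc, mul_assoc, hdag_mul_rst, zt, zph_mul_had_mul_rst, ← mul_assoc, ← neg,
    neg_mul_rst]

theorem rst_mul_sx (c : ZMod 3) : rst * sx c = rst := by
  rw [sx, mul_assoc, ← mul_assoc had, ← mul_assoc, zt, rst_mul_had_mul_zph, mul_assoc, had_mul_hdag,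
    mul_one]

theorem rst_mul_xx : rst * xx = rst := by
  rw [xx, mul_assoc, ← mul_assoc had, ← mul_assoc, zz, zt, rst_mul_had_mul_zph, mul_assoc,
    had_mul_hdag, mul_one]

theorem sx_eq (c : ZMod 3) : sx c = xph (third c) (third (2 * c)) := (xph_eq _ _).symm

theorem mrg_comp_cpy : mrg ⟫ cpy = spi := by
  have h := sound (ZXEq.S1 2 0 0 2 0 0 0 0 0)
  simp only [zero_add] at h
  have h1 : Q.comp (n := 2) (m := 1) (k := 2) (mrg ◎ (1 : Q 0 0)) ((1 : Q 0 0) ◎ cpy) = spi := h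
  rw [tens_zero] at h1
  refine Eq.trans ?_ h1
  exact congrArg (mrg ⟫ ·) (eq_of_heq (zero_tens cpy)).symm

/-- Shifting both wires commutes with the green spider. -/
theorem sx_sx_commute_D {i j : Fin m} (h : i ≠ j) (c : ZMod 3) :
    op1 i (sx c) * op1 j (sx c) * D i j = D i j * (op1 i (sx c) * op1 j (sx c)) := by
  have h1 : sx c ⟫ cpy = cpy ⟫ (sx c ◎ sx c) := by
    rw [sx_eq]
    exact sound (ZXEq.K1 c)
  have h2 : mrg ⟫ sx c = (sx c ◎ sx c) ⟫ mrg := by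
    rw [sx_eq]
    exact sound (ZXEq.K1_flip c)
  have e1 : sx c ◎ sx c = ext (sx c) * lft 1 (sx c) := tens_eq_right _ _
  have h3 : ext (sx c) * lft 1 (sx c) * spi = spi * (ext (sx c) * lft 1 (sx c)) := by
    have e : spi ⟫ (sx c ◎ sx c) = (sx c ◎ sx c) ⟫ spi := by
      have a1 : Q.comp (n := 2) (m := 2) (k := 2) (Q.comp (n := 2) (m := 1) (k := 2) mrg cpy)
          (sx c ◎ sx c) = Q.comp (n := 2) (m := 2) (k := 2) (sx c ◎ sx c)
          (Q.comp (n := 2) (m := 1) (k := 2) mrg cpy) := by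
        rw [comp_assoc]
        have a2 : Q.comp (n := 1) (m := 2) (k := 2) cpy (sx c ◎ sx c) = sx c ⟫ cpy := h1.symm
        rw [a2, ← comp_assoc, h2, ← comp_assoc]
      rw [← mrg_comp_cpy]
      exact a1
    rw [e1] at e
    exact e
  have h4 := congrArg (op2 i j) h3
  simp only [map_mul, op2_fst h, op2_snd h] at h4
  exact h4

theorem C_mul_zph {i j : Fin m} (hij : i ≠ j) (f : Q 1 1) (α β : Real.Angle) :
    C i j (f * zph α β) = C i j f * op1 i (zph α β) := by
  refine fresh_cancel ?_
  simp only [map_mul, ext_C hij, ext_op1]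
  have hil := castSucc_ne_last i
  have hjl := castSucc_ne_last j
  have hij := castSucc_ne hij
  have c1 : Commute (op1 i.castSucc (zph α β)) (B (Fin.last m)) := op1_commute_op1 hil _ _
  rw [mul_assoc, c1.eq, ← mul_assoc, C_mul_B hij hil hjl, C_mul_B hij hil hjl, map_mul]
  simp only [mul_assoc]
  rw [← c1.eq, ← mul_assoc (op1 (Fin.last m) (zph α β)), ← op1_zph_mul_D hil,
    ← (D_commute_zph hil α β).eq]
  simp only [mul_assoc]

theorem C_zph_mul {i j : Fin m} (hij : i ≠ j) (f : Q 1 1) (α β : Real.Angle) :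
    C i j (zph α β * f) = C i j f * op1 j (zph α β) := by
  obtain ⟨f', hf⟩ := exists_isTr f
  have h : IsTr (zph α β * f) (f' * zph α β) := hf.mul (isTr_zph α β)
  rw [C_flip hij h, C_mul_zph hij.symm, C_flip hij hf]

/-- A shift of one end of an edge. -/
theorem C_mul_sx {i j : Fin m} (hij : i ≠ j) (f : Q 1 1) (c : ZMod 3) :
    C i j f * op1 j (sx c) = op1 j (sx c) * C i j (sx (-c) * f) := by
  refine fresh_cancel ?_
  simp only [map_mul, ext_C hij, ext_op1]
  have hil := castSucc_ne_last i
  have hjl := castSucc_ne_last j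
  have hij := castSucc_ne hij
  generalize i.castSucc = i at *
  generalize j.castSucc = j at *
  set l := Fin.last m
  have c1 : Commute (op1 j (sx c)) (B l) := op1_commute_op1 hjl _ _
  have c2 : Commute (op1 j (sx c)) (op1 l f) := op1_commute_op1 hjl _ _
  have c3 : Commute (op1 j (sx c)) (D i l) := (D_commute_op1 hil hij.symm hjl _).symm
  have e1 : B l * op1 l (sx c) = B l := by rw [B, ← map_mul, rst_mul_sx]
  have e2 : op1 l (sx c) * op1 l (sx (-c)) = 1 := by rw [← map_mul, sx_mul_neg, map_one]
  have e3 : D j l * op1 j (sx c) = op1 j (sx c) * op1 l (sx c) * (D j l * op1 l (sx (-c))) := by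
    rw [← mul_assoc, sx_sx_commute_D hjl]
    simp only [mul_assoc]
    rw [e2, mul_one]
  calc C i j f * op1 j (sx c) * B l
      = C i j f * B l * op1 j (sx c) := by rw [mul_assoc, c1.eq, mul_assoc]
    _ = B l * (D j l * op1 j (sx c) * (op1 l f * (D i l * B l))) := by
        rw [C_mul_B hij hil hjl]
        simp only [mul_assoc]
        rw [← c1.eq, ← c3.left_comm, ← c2.left_comm]
    _ = op1 j (sx c) * (B l * op1 l (sx c) * (D j l * (op1 l (sx (-c)) * (op1 l f *
        (D i l * B l))))) := by
        rw [e3]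
        simp only [mul_assoc]
        rw [c1.left_comm]
    _ = _ := by
        rw [e1, mul_assoc, C_mul_B hij hil hjl, map_mul]
        simp only [mul_assoc]

theorem sx_mul_C {i j : Fin m} (hij : i ≠ j) (c : ZMod 3) :
    op1 j (sx c) * C i j had = C i j had * op1 i (zt c (2 * c)) * op1 j (sx c) := by
  have h := C_mul_sx hij had c
  have e : sx (-c) * had = had * zt (-c) (2 * -c) := by
    rw [sx, mul_assoc, hdag_mul_had, mul_one]
  rw [e, zt, C_mul_zph hij, ← zt] at h
  have c1 : Commute (op1 i (zt c (2 * c))) (op1 j (sx c)) := op1_commute_op1 hij _ _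
  rw [mul_assoc, c1.eq, ← mul_assoc, h, mul_assoc, mul_assoc, ← map_mul, zt_mul, neg_add_cancel,
    ← mul_add, neg_add_cancel, mul_zero, zt_zero, map_one, mul_one]

/-! ### Controlled shifts and edges -/

/-- A controlled shift of one end of an edge. -/
theorem C_mul_CX {a b k : Fin m} (hab : a ≠ b) (hak : a ≠ k) (hbk : b ≠ k) :
    C b k hdag * CX a b = CX a b * (C a k hdag * C b k hdag) := by
  refine fresh_cancel ?_
  simp only [map_mul, ext_C hak, ext_C hbk, ext_CX hab]
  have had := castSucc_ne_last a
  have hbd := castSucc_ne_last b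
  have hkd := castSucc_ne_last k
  have hab := castSucc_ne hab
  have hak := castSucc_ne hak
  have hbk := castSucc_ne hbk
  generalize a.castSucc = a at *
  generalize b.castSucc = b at *
  generalize k.castSucc = k at *
  set d := Fin.last m
  have c1 : Commute (CX a b) (B d) := CX_commute_op1 hab had hbd _
  have c2 : Commute (op1 d hdag) (CX a b) := (CX_commute_op1 hab had hbd _).symm
  have c3 : Commute (D k d) (CX a b) := (CX_commute_D hab hkd hbk hbd).symm
  have c4 : Commute (B d) (C a k hdag) := (C_commute_op1 hak had.symm hkd.symm _ _).symm
  have e1 : op1 d hdag * CX a d = C a d hdag * op1 d hdag := by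
    rw [CX, ← mul_assoc, ← map_mul, hdag_mul_had, map_one, one_mul]
  have e2 : D k d * C a d hdag = C a k hdag * D k d := by
    rw [C_symm had isTr_hdag, C_symm hak isTr_hdag, (C_commute_D hak.symm hkd _).eq,
      D_mul_C hkd hak.symm had.symm]
  calc C b k hdag * CX a b * B d = C b k hdag * B d * CX a b := by
        rw [mul_assoc, c1.eq, mul_assoc]
    _ = B d * (D k d * (op1 d hdag * (D b d * (B d * CX a b)))) := by
        rw [C_mul_B hbk hbd hkd]
        simp only [mul_assoc]
    _ = CX a b * (B d * (D k d * C a d hdag * (op1 d hdag * (D b d * B d)))) := by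
        rw [D_mul_B_mul_CX hab had hbd, c2.left_comm, c3.left_comm, c1.symm.left_comm,
          ← mul_assoc (op1 d hdag), e1]
        simp only [mul_assoc]
    _ = CX a b * (C a k hdag * (C b k hdag * B d)) := by
        rw [e2, mul_assoc, c4.left_comm, C_mul_B hbk hbd hkd]
    _ = _ := by simp only [mul_assoc]

theorem zz_mul_inv : zz * zt 1 1 = 1 := by
  rw [zz, zt_mul, ← zt_zero]
  rfl

theorem inv_mul_zz : zt 1 1 * zz = 1 := by
  rw [zz, zt_mul, ← zt_zero]
  rfl

theorem zt_one_mul_had : had * zt 1 1 * hdag = zz * hdag * zz := by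
  have e : xx * (had * zt 1 1 * hdag) = 1 := by
    calc xx * (had * zt 1 1 * hdag) = had * (zz * ((hdag * had) * zt 1 1)) * hdag := by
          simp only [xx, mul_assoc]
      _ = 1 := by rw [hdag_mul_had, one_mul, zz_mul_inv, mul_one, had_mul_hdag]
  have h : zz * hdag * zz * xx = 1 := by
    calc zz * hdag * zz * xx = zz * hdag * (zz * (xx * zz)) * zt 1 1 := by
          simp only [mul_assoc, zz_mul_inv, mul_one]
      _ = 1 := by rw [← had_eq, mul_assoc zz, hdag_mul_had, mul_one, zz_mul_inv]
  calc had * zt 1 1 * hdag = zz * hdag * zz * xx * (had * zt 1 1 * hdag) := by rw [h, one_mul]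
    _ = _ := by rw [mul_assoc, e, mul_one]

/-- A wire between two others carrying a phase. -/
theorem B_mul_zt_mul_C_mul_C {a b d : Fin m} (hab : a ≠ b) (had : a ≠ d) (hbd : b ≠ d) :
    B d * (op1 d (zt 1 1) * (C a d hdag * (C b d hdag * B d))) =
      op1 a zz * (op1 b zz * (C a b ZX.had * B d)) := by
  have e : hdag * (zt 1 1 * hdag) = zz * (ZX.had * zz) := by
    calc hdag * (zt 1 1 * hdag) = neg * (ZX.had * zt 1 1 * hdag) := by
          rw [← neg_mul_had]
          simp only [mul_assoc]
      _ = _ := by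
          rw [zt_one_mul_had, ← mul_assoc, ← mul_assoc, neg_mul_zz, mul_assoc zz, neg_mul_hdag,
            mul_assoc]
  have e1 : op1 d (zt 1 1) * C a d hdag = C a d (zt 1 1 * hdag) := by
    rw [zt, C_zph_mul had, C_symm had isTr_hdag, (C_commute_zph had.symm _ _ _).eq]
  have e2 : B d * (op1 d (zt 1 1) * (C a d hdag * (C b d hdag * B d))) =
      B d * (C d b hdag * (C a d (zt 1 1 * hdag) * B d)) := by
    rw [C_symm hbd isTr_hdag, ← mul_assoc (op1 d _), e1, (C_commute_C had hbd.symm _ _).left_comm]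
  rw [e2, B_mul_C_mul_C_mul_B had hab hbd.symm, e, zz, zt, C_zph_mul hab, C_mul_zph hab]
  have c1 : Commute (op1 a (zph (third 2) (third 2))) (C a b ZX.had) :=
    (C_commute_zph hab _ _ _).symm
  have c2 : Commute (op1 b (zph (third 2) (third 2))) (C a b ZX.had) :=
    (C_commute_zph hab _ _ _).symm
  simp only [mul_assoc]
  rw [← c1.left_comm, ← c2.left_comm]

/-- A quadratic phase at the target, evaluated at a sum, contributes a quadratic phase at the
control and a mixed term, which is an edge. -/
theorem zz_mul_CX {a b : Fin m} (hab : a ≠ b) :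
    op1 b zz * CX a b = CX a b * (op1 a zz * (op1 b zz * C a b had)) := by
  refine fresh_cancel ?_
  simp only [map_mul, ext_C hab, ext_op1, ext_CX hab]
  have had := castSucc_ne_last a
  have hbd := castSucc_ne_last b
  have hab := castSucc_ne hab
  generalize a.castSucc = a at *
  generalize b.castSucc = b at *
  set d := Fin.last m
  -- the green phase on `b` is teleported from the fresh wire through an edge
  have e : B d * (C b d hdag * (op1 d (zt 1 1) * B d)) = op1 b zz * B d := by
    have e1 : op1 d hdag * (op1 d (zt 1 1) * B d) = op1 d zz * B d := by
      rw [B, ← map_mul, ← map_mul, ← mul_assoc, had_mul_zt_mul_rst, map_mul]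
    have cz : D d b * op1 d zz = op1 b zz * D d b := D_mul_op1_zph hbd.symm _ _
    have c : Commute (op1 b zz) (B d) := op1_commute_op1 hbd _ _
    rw [C_symm hbd isTr_hdag, ← mul_assoc, B_mul_C_left hbd.symm, mul_assoc, mul_assoc, e1,
      ← mul_assoc (D d b), cz, mul_assoc, ← c.left_comm, D_symm hbd.symm, B_mul_D_mul_B_self hbd]
  have c1 : Commute (CX a b) (B d) := CX_commute_op1 hab had hbd _
  have c2 : Commute (op1 d (zt 1 1)) (CX a b) := (CX_commute_op1 hab had hbd _).symm
  have c3 : Commute (op1 b zz) (B d) := op1_commute_op1 hbd _ _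
  have c4 : Commute (C b d hdag) (op1 d (zt 1 1)) := C_commute_zph hbd _ _ _
  have c5 : Commute (C a d hdag) (op1 d (zt 1 1)) := C_commute_zph had _ _ _
  calc op1 b zz * CX a b * B d = op1 b zz * B d * CX a b := by rw [mul_assoc, c1.eq, mul_assoc]
    _ = B d * (C b d hdag * (CX a b * (op1 d (zt 1 1) * B d))) := by
        rw [← e]
        simp only [mul_assoc]
        rw [← c1.eq, c2.left_comm]
    _ = CX a b * (B d * (op1 d (zt 1 1) * (C a d hdag * (C b d hdag * B d)))) := by
        rw [← mul_assoc (C b d hdag), C_mul_CX hab had hbd, ← c5.left_comm, ← c4.left_comm,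
          c1.left_comm]
        simp only [mul_assoc]
    _ = _ := by
        rw [B_mul_zt_mul_C_mul_C hab had hbd]
        simp only [mul_assoc]

/-! ### The inverse of a controlled shift -/

theorem C_hdag_mul_C_had {i j : Fin m} (h : i ≠ j) : C i j hdag * C i j had = 1 :=
  (C_commute_C h h _ _).eq.trans (C_had_mul_C_hdag h)

/-- The inverse of the controlled shift of wire `b` by wire `a`. -/
noncomputable def CY (a b : Fin m) : Q m m := op1 b hdag * (C a b hdag * op1 b had)

theorem CY_eq {a b : Fin m} (hab : a ≠ b) : CY a b = op1 b had * (C a b had * op1 b hdag) := by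
  have e : C a b had = op1 b neg * C a b hdag * op1 b neg := by
    rw [neg_mul_C_mul_neg hab, neg_mul_hdag]
  calc CY a b = op1 b (had * neg) * (C a b hdag * op1 b (neg * hdag)) := by
        rw [had_mul_neg, neg_mul_hdag, CY]
    _ = _ := by
        rw [e, map_mul, map_mul]
        simp only [mul_assoc]

theorem op1_had_mul_hdag (b : Fin m) : op1 b had * op1 b hdag = 1 := by
  rw [← map_mul, had_mul_hdag, map_one]

theorem op1_hdag_mul_had (b : Fin m) : op1 b hdag * op1 b had = 1 := by
  rw [← map_mul, hdag_mul_had, map_one]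

theorem CX_mul_CY {a b : Fin m} (hab : a ≠ b) : CX a b * CY a b = 1 := by
  rw [CY_eq hab, CX]
  calc _ = op1 b had * (C a b hdag * ((op1 b hdag * op1 b had) * C a b had)) * op1 b hdag := by
        simp only [mul_assoc]
    _ = 1 := by rw [op1_hdag_mul_had, one_mul, C_hdag_mul_C_had hab, mul_one, op1_had_mul_hdag]

theorem CY_mul_CX {a b : Fin m} (hab : a ≠ b) : CY a b * CX a b = 1 := by
  rw [CY_eq hab, CX]
  calc _ = op1 b had * (C a b had * ((op1 b hdag * op1 b had) * C a b hdag)) * op1 b hdag := by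
        simp only [mul_assoc]
    _ = 1 := by rw [op1_hdag_mul_had, one_mul, C_had_mul_C_hdag hab, mul_one, op1_had_mul_hdag]

theorem CY_mul_zz {a b : Fin m} (hab : a ≠ b) :
    CY a b * op1 b zz = op1 a zz * (op1 b zz * C a b had) * CY a b := by
  calc CY a b * op1 b zz = CY a b * (op1 b zz * CX a b) * CY a b := by
        rw [mul_assoc, mul_assoc, CX_mul_CY hab, mul_one]
    _ = _ := by rw [zz_mul_CX hab, ← mul_assoc, CY_mul_CX hab, one_mul]

theorem CY_mul_C {a b k : Fin m} (hab : a ≠ b) (hak : a ≠ k) (hbk : b ≠ k) :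
    CY a b * C b k had = C b k had * C a k had * CY a b := by
  have h : CY a b * C b k hdag = C a k hdag * C b k hdag * CY a b := by
    calc CY a b * C b k hdag = CY a b * (C b k hdag * CX a b) * CY a b := by
          rw [mul_assoc, mul_assoc, CX_mul_CY hab, mul_one]
      _ = _ := by rw [C_mul_CX hab hak hbk, ← mul_assoc, CY_mul_CX hab, one_mul]
  have e : C b k had * C a k had * (C a k hdag * C b k hdag) = 1 := by
    calc _ = C b k had * ((C a k had * C a k hdag) * C b k hdag) := by simp only [mul_assoc]
      _ = 1 := by rw [C_had_mul_C_hdag hak, one_mul, C_had_mul_C_hdag hbk]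
  calc CY a b * C b k had = C b k had * C a k had * (C a k hdag * C b k hdag) *
        (CY a b * C b k had) := by rw [e, one_mul]
    _ = C b k had * C a k had * (C a k hdag * C b k hdag * CY a b) * C b k had := by
        simp only [mul_assoc]
    _ = C b k had * C a k had * CY a b := by
        rw [← h, mul_assoc, mul_assoc (CY a b), C_hdag_mul_C_had hbk, mul_one]

theorem CY_commute_zph {a b k : Fin m} (hab : a ≠ b) (hkb : k ≠ b) (α β : Real.Angle) :
    Commute (CY a b) (op1 k (zph α β)) :=
  (op1_commute_op1 hkb.symm _ _).mul_left
    ((C_commute_zph hab _ _ _).mul_left (op1_commute_op1 hkb.symm _ _))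

theorem CY_commute_C {a b k l : Fin m} (hab : a ≠ b) (hkl : k ≠ l) (hkb : k ≠ b) (hlb : l ≠ b)
    (f : Q 1 1) : Commute (CY a b) (C k l f) :=
  (C_commute_op1 hkl hkb.symm hlb.symm _ _).symm.mul_left
    ((C_commute_C hab hkl _ _).mul_left (C_commute_op1 hkl hkb.symm hlb.symm _ _).symm)

theorem xx_eq : xx = hdag * (zz * had) := by
  calc xx = had * (neg * neg) * zz * hdag := by rw [neg_mul_neg, mul_one, xx]
    _ = (had * neg) * (neg * zz) * hdag := by simp only [mul_assoc]
    _ = hdag * (zz * had) := by rw [had_mul_neg, neg_mul_zz, mul_assoc, mul_assoc, neg_mul_hdag]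

theorem CY_commute_xx {a b : Fin m} (hab : a ≠ b) : Commute (CY a b) (op1 b xx) := by
  have c : Commute (C a b hdag) (op1 b zz) := C_commute_zph hab _ _ _
  have h : CY a b * op1 b xx = op1 b xx * CY a b := by
    rw [CY, xx_eq]
    simp only [map_mul]
    calc _ = op1 b hdag * (C a b hdag * ((op1 b had * op1 b hdag) * (op1 b zz * op1 b had))) := by
          simp only [mul_assoc]
      _ = op1 b hdag * (op1 b zz * ((op1 b had * op1 b hdag) * (C a b hdag * op1 b had))) := by
          rw [op1_had_mul_hdag, one_mul, one_mul, c.left_comm]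
      _ = _ := by simp only [mul_assoc]
  exact h

/-- A red phase crosses an edge at the cost of a phase and a controlled shift. This is the rule for
a green phase at the target of a controlled shift, conjugated by the Hadamard node. -/
theorem xx_mul_C {a b : Fin m} (hab : a ≠ b) :
    op1 b xx * C a b had = C a b had * (op1 a zz * CY a b) * op1 b xx := by
  have h := congrArg (fun x => op1 b had * x * op1 b hdag) (CY_mul_zz hab)
  have c1 : Commute (op1 a zz) (op1 b had) := op1_commute_op1 hab _ _
  have c2 : Commute (op1 b xx) (op1 a zz) := op1_commute_op1 hab.symm _ _
  have e1 : op1 b had * (CY a b * op1 b zz) * op1 b hdag = C a b hdag * op1 b xx := by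
    calc _ = (op1 b had * op1 b hdag) * (C a b hdag * (op1 b had * op1 b zz * op1 b hdag)) := by
          rw [CY]
          simp only [mul_assoc]
      _ = _ := by rw [op1_had_mul_hdag, one_mul, ← map_mul, ← map_mul, xx]
  have e2 : op1 b had * (op1 a zz * (op1 b zz * C a b had) * CY a b) * op1 b hdag =
      op1 a zz * (op1 b xx * (CY a b * C a b hdag)) := by
    calc _ = op1 a zz * (op1 b had * op1 b zz * (C a b had * CY a b * op1 b hdag)) := by
          simp only [mul_assoc]
          rw [c1.left_comm]
      _ = op1 a zz * (op1 b had * op1 b zz * ((op1 b hdag * op1 b had) *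
            (C a b had * (op1 b hdag * (C a b hdag * (op1 b had * op1 b hdag)))))) := by
          rw [CY, op1_hdag_mul_had, one_mul]
          simp only [mul_assoc]
      _ = op1 a zz * (op1 b xx * ((op1 b had * (C a b had * op1 b hdag)) * C a b hdag)) := by
          rw [op1_had_mul_hdag, mul_one, xx, map_mul, map_mul]
          simp only [mul_assoc]
      _ = _ := by rw [← CY_eq hab]
  rw [e1, e2] at h
  calc op1 b xx * C a b had = (C a b had * C a b hdag) * (op1 b xx * C a b had) := by
        rw [C_had_mul_C_hdag hab, one_mul]
    _ = C a b had * (C a b hdag * op1 b xx) * C a b had := by simp only [mul_assoc]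
    _ = C a b had * (op1 a zz * (op1 b xx * CY a b)) := by
        rw [h]
        simp only [mul_assoc]
        rw [C_hdag_mul_C_had hab, mul_one]
    _ = _ := by
        rw [(CY_commute_xx hab).symm.eq]
        simp only [mul_assoc]

/-- Edges have order three: conjugating `zz ^ 3 = 1` by a controlled shift gives the cube of an edge
and cubes of phases. -/
theorem C_cube {a b : Fin m} (hab : a ≠ b) : C a b had * (C a b had * C a b had) = 1 := by
  have ha : op1 a zz * (op1 a zz * op1 a zz) = 1 := by rw [← map_mul, ← map_mul, zz_cube, map_one]
  have hb : op1 b zz * (op1 b zz * op1 b zz) = 1 := by rw [← map_mul, ← map_mul, zz_cube, map_one]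
  set y := CY a b
  set c := C a b had
  have h : y * op1 b zz = op1 a zz * (op1 b zz * c) * y := CY_mul_zz hab
  have c1 : Commute (op1 a zz) (op1 b zz) := op1_commute_op1 hab _ _
  have c2 : Commute (op1 a zz) c := (C_commute_zph hab _ _ _).symm
  have c3 : Commute (op1 b zz) c := (C_commute_zph hab _ _ _).symm
  set w := op1 a zz * (op1 b zz * c) with hw
  have h3 : y * (op1 b zz * (op1 b zz * op1 b zz)) = w ^ 3 * y := by
    have h' : ∀ x, y * (op1 b zz * x) = w * (y * x) := fun x => by
      rw [← mul_assoc, h, mul_assoc]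
    rw [h', h', h, pow_succ, pow_two]
    simp only [mul_assoc]
  have h4 : w ^ 3 = c * (c * c) := by
    have e3 : ∀ x : Q m m, x ^ 3 = x * (x * x) := fun x => by rw [pow_succ, pow_two, mul_assoc]
    rw [hw, (c1.mul_right c2).mul_pow, c3.mul_pow, e3, e3, ha, hb, one_mul, one_mul, e3]
  rw [hb, mul_one, h4] at h3
  calc c * (c * c) = c * (c * c) * (y * CX a b) := by rw [CY_mul_CX hab, mul_one]
    _ = c * (c * c) * y * CX a b := (mul_assoc _ _ _).symm
    _ = 1 := by rw [← h3, CY_mul_CX hab]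

theorem C_mul_C {a b : Fin m} (hab : a ≠ b) : C a b had * C a b had = C a b hdag := by
  calc C a b had * C a b had = C a b hdag * C a b had * (C a b had * C a b had) := by
        rw [C_hdag_mul_C_had hab, one_mul]
    _ = _ := by rw [mul_assoc, C_cube hab, mul_one]

variable {m : ℕ}

/-! ### Commutation rules for local complementation -/

/-- The group-theoretic core of the passage from `xx_mul_C` to `CY_mul_C_self`: conjugation by `n`
inverts `c` and `y` and fixes `x` and `z`. -/
theorem complement_group {G : Type*} [Group G] {x c z y n : G} (h : x * c = c * (z * y) * x)
    (hc : n * c * n⁻¹ = c⁻¹) (hy : n * y * n⁻¹ = y⁻¹) (hx : n * x * n⁻¹ = x)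
    (hz : n * z * n⁻¹ = z) (hzy : Commute z y) (hzc : Commute z c) (hz3 : z ^ 3 = 1) :
    y * c = c * z⁻¹ * y := by
  have h1 : x * c⁻¹ = c⁻¹ * (z * y⁻¹) * x := by
    calc x * c⁻¹ = (n * x * n⁻¹) * (n * c * n⁻¹) := by rw [hx, hc]
      _ = n * (x * c) * n⁻¹ := by group
      _ = (n * c * n⁻¹) * ((n * z * n⁻¹) * (n * y * n⁻¹)) * (n * x * n⁻¹) := by rw [h]; group
      _ = _ := by rw [hc, hy, hx, hz]
  have h2 : c * x * c⁻¹ = z * y⁻¹ * x := by rw [mul_assoc, h1]; group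
  have h4 : z * (c * y * c⁻¹) * (z * y⁻¹) * x = x := by
    calc z * (c * y * c⁻¹) * (z * y⁻¹) * x = z * c * (y * (c⁻¹ * (z * y⁻¹ * x))) := by group
      _ = c * (z * y * x) * c⁻¹ := by rw [← h2, hzc.eq]; group
      _ = (x * c) * c⁻¹ := by rw [h]; group
      _ = x := by group
  have h5 : z * (c * y * c⁻¹) * (z * y⁻¹) = 1 := by simpa using h4
  have hzz : z⁻¹ * z⁻¹ = z := by
    rw [← mul_inv_rev, inv_eq_iff_mul_eq_one, mul_assoc, ← pow_two, ← pow_succ', hz3]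
  have h6 : c * y * c⁻¹ = z * y := by
    calc c * y * c⁻¹ = z⁻¹ * (z * (c * y * c⁻¹) * (z * y⁻¹)) * (y * z⁻¹) := by group
      _ = z⁻¹ * z⁻¹ * y := by rw [h5, mul_one, ← hzy.inv_left.eq, mul_assoc]
      _ = _ := by rw [hzz]
  calc y * c = z⁻¹ * (z * y) * c := by group
    _ = z⁻¹ * c * y := by rw [← h6]; group
    _ = _ := by rw [hzc.inv_left.eq]

theorem neg_mul_xx' : neg * xx * neg = xx := by
  rw [neg_mul_xx, mul_assoc, neg_mul_neg, mul_one]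

theorem op1_neg_mul_CY (a b : Fin m) :
    op1 b neg * CY a b * op1 b neg = CX a b := by
  have e : op1 b neg * op1 b hdag = op1 b had := by rw [← map_mul, neg_mul_hdag]
  have e' : op1 b had * op1 b neg = op1 b hdag := by rw [← map_mul, had_mul_neg]
  calc op1 b neg * CY a b * op1 b neg =
        (op1 b neg * op1 b hdag) * (C a b hdag * (op1 b had * op1 b neg)) := by
        simp only [CY, mul_assoc]
    _ = _ := by rw [e, e', CX]

/-- A controlled shift and an edge on the same two wires commute up to a phase on the control. The
two relations obtained from `xx_mul_C` and its conjugate by negation are combined in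
`complement_group`. -/
theorem CY_mul_C_self {a b : Fin m} (hab : a ≠ b) :
    CY a b * C a b had = C a b had * op1 a (zt 1 1) * CY a b := by
  have hn : op1 b neg * op1 b neg = 1 := by rw [← map_mul, neg_mul_neg, map_one]
  have hx : op1 b xx * (op1 b xx * op1 b xx) = 1 := by rw [← map_mul, ← map_mul, xx_cube, map_one]
  have hz : op1 a zz * op1 a (zt 1 1) = 1 := by rw [← map_mul, zz_mul_inv, map_one]
  have hz' : op1 a (zt 1 1) * op1 a zz = 1 := by rw [← map_mul, inv_mul_zz, map_one]
  have hz3 : op1 a zz * (op1 a zz * op1 a zz) = 1 := by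
    rw [← map_mul, ← map_mul, zz_cube, map_one]
  have h := complement_group (G := (Q m m)ˣ)
    (x := ⟨op1 b xx, op1 b xx * op1 b xx, hx, by rw [mul_assoc, hx]⟩)
    (c := ⟨C a b had, C a b hdag, C_had_mul_C_hdag hab, C_hdag_mul_C_had hab⟩)
    (z := ⟨op1 a zz, op1 a (zt 1 1), hz, hz'⟩)
    (y := ⟨CY a b, CX a b, CY_mul_CX hab, CX_mul_CY hab⟩)
    (n := ⟨op1 b neg, op1 b neg, hn, hn⟩)
    (Units.ext (xx_mul_C hab)) (Units.ext ?_) (Units.ext (op1_neg_mul_CY a b)) (Units.ext ?_)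
    (Units.ext ?_) (Units.ext (CY_commute_zph hab hab _ _).symm.eq)
    (Units.ext (C_commute_zph hab _ _ _).symm.eq) (Units.ext ?_)
  · exact congrArg Units.val h
  · exact (neg_mul_C_mul_neg hab had).trans (by rw [neg_mul_had]; rfl)
  · change op1 b neg * op1 b xx * op1 b neg = op1 b xx
    rw [← map_mul, ← map_mul, neg_mul_xx']
  · change op1 b neg * op1 a zz * op1 b neg = op1 a zz
    have c : Commute (op1 b neg) (op1 a zz) := op1_commute_op1 hab.symm _ _
    rw [c.eq, mul_assoc, hn, mul_one]
  · exact (pow_succ' _ _).trans ((congrArg (op1 a zz * ·) (pow_two (op1 a zz))).trans hz3)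

/-- The linear phase `|k⟩ ↦ ω^{ck} |k⟩`. -/
noncomputable def lz (c : ZMod 3) : Q 1 1 := zt c (2 * c)

theorem lz_mul (c d : ZMod 3) : lz c * lz d = lz (c + d) := by rw [lz, lz, zt_mul, ← mul_add, lz]

@[simp] theorem lz_zero : lz 0 = 1 := by rw [lz, mul_zero, zt_zero]

theorem neg_mul_lz (c : ZMod 3) : neg * lz c = lz (-c) * neg := by
  rw [lz, neg_mul_zt, lz]
  have e : ∀ c : ZMod 3, 2 * c = -c ∧ c = 2 * -c := by decide
  rw [(e c).1, ← (e c).2]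

theorem CY_mul_lz {a b : Fin m} (hab : a ≠ b) (c : ZMod 3) :
    CY a b * op1 b (lz c) = op1 b (lz c) * op1 a (lz c) * CY a b := by
  have e1 : op1 b had * op1 b (lz c) = op1 b (sx c) * op1 b had := by
    rw [← map_mul, ← map_mul, sx, mul_assoc _ hdag, hdag_mul_had, mul_one, lz]
  have e2 : op1 b hdag * op1 b (sx c) = op1 b (lz c) * op1 b hdag := by
    rw [← map_mul, ← map_mul, sx, ← mul_assoc, ← mul_assoc, hdag_mul_had, one_mul, lz]
  have e3 : sx (-c) * hdag = hdag * lz c := by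
    have h : had * hdag = hdag * had := had_mul_hdag.trans hdag_mul_had.symm
    calc sx (-c) * hdag = had * (lz (-c) * neg) := by
          rw [sx, mul_assoc, hdag_mul_hdag, mul_assoc, lz]
      _ = _ := by rw [← neg_mul_lz, ← mul_assoc, had_mul_neg]
  have e4 : C a b hdag * op1 b (sx c) = op1 b (sx c) * (C a b hdag * op1 a (lz c)) := by
    rw [C_mul_sx hab, e3, lz, zt, C_mul_zph hab]
  have c1 : Commute (op1 a (lz c)) (op1 b had) := op1_commute_op1 hab _ _
  have c2 : Commute (op1 a (lz c)) (op1 b hdag) := op1_commute_op1 hab _ _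
  have c3 : Commute (op1 a (lz c)) (C a b hdag) := (C_commute_zph hab _ _ _).symm
  rw [CY, mul_assoc, mul_assoc, e1, ← mul_assoc (C a b hdag), e4, mul_assoc,
    ← mul_assoc (op1 b hdag),
    e2]
  simp only [mul_assoc]
  rw [c2.left_comm, c3.left_comm]

theorem sx_one_mul_zt (a b : ZMod 3) : sx 1 * zt a b = zt (b - a) (-a) * sx 1 := by
  have h := sound (ZXEq.K2_one (third a) (third b))
  rw [third_sub, ← third_neg] at h
  have e : sx 1 = xph (third 1) (third 2) := sx_eq 1
  rw [e]
  exact h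

theorem exists_sx_mul_zt (c a b : ZMod 3) : ∃ a' b', sx c * zt a b = zt a' b' * sx c := by
  have h2 : sx 2 = sx 1 * sx 1 := by rw [sx_mul]; rfl
  have hc : c = 0 ∨ c = 1 ∨ c = 2 := by revert c; decide
  rcases hc with rfl | rfl | rfl
  · exact ⟨a, b, by rw [sx_zero, one_mul, mul_one]⟩
  · exact ⟨_, _, sx_one_mul_zt a b⟩
  · refine ⟨-a - (b - a), -(b - a), ?_⟩
    rw [h2, mul_assoc, sx_one_mul_zt, ← mul_assoc, sx_one_mul_zt, mul_assoc]

theorem sx_commute_lz (c d : ZMod 3) : Commute (sx c) (lz d) := by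
  have h2 : sx 2 = sx 1 * sx 1 := by rw [sx_mul]; rfl
  have h1 : Commute (sx 1) (lz d) := by
    have h := sx_one_mul_zt d (2 * d)
    have e : ∀ d : ZMod 3, 2 * d - d = d ∧ -d = 2 * d := by decide
    rw [(e d).1, (e d).2] at h
    exact h
  have hc : c = 0 ∨ c = 1 ∨ c = 2 := by revert c; decide
  rcases hc with rfl | rfl | rfl
  · rw [sx_zero]; exact Commute.one_left _
  · exact h1
  · rw [h2]; exact h1.mul_left h1

theorem sx_commute_xx (c : ZMod 3) : Commute (sx c) xx := by
  have h : sx c * xx = xx * sx c := by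
    calc sx c * xx = had * (zt c (2 * c) * ((hdag * had) * zz)) * hdag := by
          simp only [sx, xx, mul_assoc]
      _ = had * (zz * ((hdag * had) * zt c (2 * c))) * hdag := by
          rw [hdag_mul_had, one_mul, one_mul, zz, zt, zt, (zph_commute _ _ _ _).eq]
      _ = _ := by simp only [sx, xx, mul_assoc]
  exact h

theorem xx_mul_lz (c : ZMod 3) : xx * lz c = lz c * (sx c * xx) := by
  have h0 : sx 1 * zz = zz * lz 1 * sx 1 := by
    rw [zz, sx_one_mul_zt, lz, zt_mul]
    rfl
  -- conjugating the rule for `sx 1` by the Hadamard node exchanges shifts and phases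
  have hs : had * sx 1 = lz (-1) * had := by
    rw [sx, ← mul_assoc, ← mul_assoc, ← neg, ← lz, neg_mul_lz, mul_assoc, neg_mul_hdag]
  have hl : had * lz 1 = sx 1 * had := by
    rw [sx, mul_assoc _ hdag, hdag_mul_had, mul_one, lz]
  have h1 : lz (-1) * xx = xx * (sx 1 * lz (-1)) := by
    calc lz (-1) * xx = (lz (-1) * had) * zz * hdag := by rw [xx]; simp only [mul_assoc]
      _ = had * (sx 1 * zz) * hdag := by rw [← hs]; simp only [mul_assoc]
      _ = (had * zz) * (lz 1 * (sx 1 * hdag)) := by rw [h0]; simp only [mul_assoc]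
      _ = xx * (had * (lz 1 * (sx 1 * hdag))) := by
          rw [xx]
          simp only [mul_assoc]
          rw [← mul_assoc hdag, hdag_mul_had, one_mul]
      _ = xx * (sx 1 * ((had * sx 1) * hdag)) := by
          rw [← mul_assoc had, hl]
          simp only [mul_assoc]
      _ = _ := by rw [hs, mul_assoc (lz _), had_mul_hdag, mul_one]
  have hl1 : lz 1 * lz (-1) = 1 := by rw [lz_mul, add_neg_cancel, lz_zero]
  have hl2 : lz (-1) * lz 1 = 1 := by rw [lz_mul, neg_add_cancel, lz_zero]
  have h2 : xx * lz 1 = lz 1 * (sx 1 * xx) := by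
    calc xx * lz 1 = lz 1 * (lz (-1) * xx) * lz 1 := by
          rw [← mul_assoc (lz 1), hl1, one_mul]
      _ = lz 1 * (xx * (sx 1 * (lz (-1) * lz 1))) := by rw [h1]; simp only [mul_assoc]
      _ = _ := by rw [hl2, mul_one, (sx_commute_xx 1).eq]
  have hc : c = 0 ∨ c = 1 ∨ c = 2 := by revert c; decide
  rcases hc with rfl | rfl | rfl
  · simp only [lz_zero, sx_zero, mul_one, one_mul]
  · exact h2
  · have e1 : lz 2 = lz 1 * lz 1 := by rw [lz_mul]; rfl
    have e2 : sx 2 = sx 1 * sx 1 := by rw [sx_mul]; rfl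
    rw [e1, e2, ← mul_assoc, h2, mul_assoc, mul_assoc, h2, ← mul_assoc (sx 1),
      (sx_commute_lz 1 1).eq]
    simp only [mul_assoc]

variable {m : ℕ}

/-! ### States -/

/-- Operations act on states by composition. -/
instance : MulAction (Q m m) (Q 0 m) where
  smul a s := s ⟫ a
  one_smul s := comp_one s
  mul_smul a b s := (comp_assoc s b a).symm

theorem smul_def (a : Q m m) (s : Q 0 m) : a • s = s ⟫ a := rfl

/-- A state next to a state of one more wire. -/
noncomputable def snoc (s : Q 0 m) (t : Q 0 1) : Q 0 (m + 1) := s ◎ t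

/-- The state of `n` unconnected green nodes. -/
noncomputable def plus : (n : ℕ) → Q 0 n
  | 0 => 1
  | n + 1 => snoc (plus n) gst

theorem ext_smul_snoc (a : Q m m) (s : Q 0 m) (t : Q 0 1) : ext a • snoc s t = snoc (a • s) t := by
  have h := interchange s a t (1 : Q 1 1)
  rw [comp_one] at h
  exact h.symm

theorem op1_last_smul_snoc (f : Q 1 1) (s : Q 0 m) (t : Q 0 1) :
    op1 (Fin.last m) f • snoc s t = snoc s (t ⟫ f) := by
  have h := interchange s (1 : Q m m) t f
  rw [comp_one] at h
  rw [op1_last]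
  exact h.symm

theorem op1_smul_plus {f : Q 1 1} (hf : gst ⟫ f = gst) : {n : ℕ} → (i : Fin n) →
    op1 i f • plus n = plus n
  | 0, i => i.elim0
  | n + 1, i => by
    refine Fin.lastCases ?_ (fun i => ?_) i
    · rw [plus, op1_last_smul_snoc, hf]
    · rw [plus, ← ext_op1, ext_smul_snoc, op1_smul_plus hf i]

theorem gst_comp_rst : gst ⟫ rst = gst := by
  rw [rst, ← comp_assoc]
  have h := tens_eq_left (gst ⟫ gef) gst
  rw [tens_zero] at h
  have h2 := eq_of_heq ((heq_comp rfl rfl rfl HEq.rfl (zero_tens gst)).symm.trans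
    ((heq_of_eq h).symm.trans (scalar_tens gst)))
  exact h2

theorem gst_comp_of_mul_rst {f : Q 1 1} (hf : f * rst = rst) : gst ⟫ f = gst := by
  calc gst ⟫ f = gst ⟫ rst ⟫ f := by rw [gst_comp_rst]
    _ = gst ⟫ (f * rst) := comp_assoc _ _ _
    _ = gst := by rw [hf, gst_comp_rst]

theorem B_smul_plus (i : Fin m) : B i • plus m = plus m := op1_smul_plus gst_comp_rst i

theorem neg_smul_plus (i : Fin m) : op1 i neg • plus m = plus m := op1_smul_plus gst_comp_neg i

theorem sx_smul_plus (i : Fin m) (c : ZMod 3) : op1 i (sx c) • plus m = plus m :=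
  op1_smul_plus (gst_comp_of_mul_rst (sx_mul_rst c)) i

theorem xx_smul_plus (i : Fin m) : op1 i xx • plus m = plus m :=
  op1_smul_plus (gst_comp_of_mul_rst xx_mul_rst) i

theorem CY_smul_plus {a b : Fin m} (hab : a ≠ b) : CY a b • plus m = plus m := by
  have h : CX a b • plus m = plus m := by
    rw [← B_smul_plus b, ← mul_smul, CX_mul_B hab]
  conv_lhs => rw [← h]
  rw [← mul_smul, CY_mul_CX hab, one_smul]

/-! ### Diagonal operations -/

/-- The generators of the diagonal operations outside a set `S` of unordered pairs of wires: edges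
between different wires and phases, where the phases on wire `i` are limited to linear ones if the
pair `{i, i}` belongs to `S`. -/
inductive IsDiagGen (S : Set (Sym2 (Fin m))) : Q m m → Prop
  | edge {i j : Fin m} (h : i ≠ j) (hS : s(i, j) ∉ S) : IsDiagGen S (C i j had)
  | phase {i : Fin m} (hS : s(i, i) ∉ S) (a b : ZMod 3) : IsDiagGen S (op1 i (zt a b))
  | lin (i : Fin m) (c : ZMod 3) : IsDiagGen S (op1 i (lz c))

/-- The diagonal operations outside `S`. The quadratic part of a diagonal operation is a symmetric
matrix over `ZMod 3`, and the entries at `S` are required to vanish. -/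
noncomputable def Diag (S : Set (Sym2 (Fin m))) : Submonoid (Q m m) :=
  Submonoid.closure {x | IsDiagGen S x}

theorem IsDiagGen.mono {S S' : Set (Sym2 (Fin m))} (h : S ⊆ S') {x : Q m m}
    (hx : IsDiagGen S' x) : IsDiagGen S x := by
  cases hx with
  | edge hij hS => exact .edge hij fun h' => hS (h h')
  | phase hS a b => exact .phase (fun h' => hS (h h')) a b
  | lin i c => exact .lin i c

theorem Diag_mono {S S' : Set (Sym2 (Fin m))} (h : S ⊆ S') : Diag S' ≤ Diag S :=
  Submonoid.closure_mono fun _ hx => IsDiagGen.mono h hx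

theorem IsDiagGen.mem {S : Set (Sym2 (Fin m))} {x : Q m m} (h : IsDiagGen S x) : x ∈ Diag S :=
  Submonoid.subset_closure h

theorem IsDiagGen.commute_zt {S : Set (Sym2 (Fin m))} {x : Q m m} (h : IsDiagGen S x) (i : Fin m)
    (a b : ZMod 3) : Commute x (op1 i (zt a b)) := by
  have e : ∀ (j : Fin m) (c d : ZMod 3), Commute (op1 j (zt c d)) (op1 i (zt a b)) := by
    intro j c d
    by_cases hij : j = i
    · subst hij
      exact (zph_commute _ _ _ _).map (op1 j)
    · exact op1_commute_op1 hij _ _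
  cases h with
  | edge h hS => exact C_commute_zph h _ _ _
  | phase hS c d => exact e _ _ _
  | lin j c => exact e _ _ _

theorem IsDiagGen.commute_C {S : Set (Sym2 (Fin m))} {x : Q m m} (h : IsDiagGen S x) {i j : Fin m}
    (hij : i ≠ j) (f : Q 1 1) : Commute x (C i j f) := by
  cases h with
  | edge h hS => exact C_commute_C h hij _ _
  | phase hS c d => exact (C_commute_zph hij _ _ _).symm
  | lin j c => exact (C_commute_zph hij _ _ _).symm

theorem commute_of_gen {S : Set (Sym2 (Fin m))} {x : Q m m}
    (h : ∀ g, IsDiagGen S g → Commute x g) {d : Q m m} (hd : d ∈ Diag S) : Commute x d := by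
  induction hd using Submonoid.closure_induction with
  | mem g hg => exact h g hg
  | one => exact Commute.one_right x
  | mul a b _ _ ha hb => exact ha.mul_right hb

theorem Diag_commute_zt {S : Set (Sym2 (Fin m))} {d : Q m m} (hd : d ∈ Diag S) (i : Fin m)
    (a b : ZMod 3) : Commute d (op1 i (zt a b)) :=
  (commute_of_gen (fun _ hg => (hg.commute_zt i a b).symm) hd).symm

theorem Diag_commute_C {S : Set (Sym2 (Fin m))} {d : Q m m} (hd : d ∈ Diag S) {i j : Fin m}
    (hij : i ≠ j) (f : Q 1 1) : Commute d (C i j f) :=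
  (commute_of_gen (fun _ hg => (hg.commute_C hij f).symm) hd).symm

theorem Diag_commute {S S' : Set (Sym2 (Fin m))} {d e : Q m m} (hd : d ∈ Diag S)
    (he : e ∈ Diag S') : Commute d e := by
  refine commute_of_gen (fun g hg => ?_) he
  cases hg with
  | edge h hS => exact Diag_commute_C hd h _
  | phase hS c e => exact Diag_commute_zt hd _ _ _
  | lin j c => exact Diag_commute_zt hd _ _ _

/-- Moving `u` through a product of generators. -/
theorem exists_mul_eq_mul {M : Type*} [Monoid M] {s : Set M} {S : Submonoid M} {u : M}
    (h : ∀ g ∈ s, ∃ d ∈ S, u * g = d * u) {d : M} (hd : d ∈ Submonoid.closure s) :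
    ∃ d' ∈ S, u * d = d' * u := by
  induction hd using Submonoid.closure_induction with
  | mem g hg => exact h g hg
  | one => exact ⟨1, one_mem _, by rw [mul_one, one_mul]⟩
  | mul a b _ _ ha hb =>
    obtain ⟨a', ha', ea⟩ := ha
    obtain ⟨b', hb', eb⟩ := hb
    exact ⟨a' * b', mul_mem ha' hb', by rw [← mul_assoc, ea, mul_assoc, eb, mul_assoc]⟩

/-- Shifts normalise the diagonal operations. -/
theorem sx_mul_Diag {S : Set (Sym2 (Fin m))} (b : Fin m) (c : ZMod 3) {d : Q m m}
    (hd : d ∈ Diag S) : ∃ d' ∈ Diag S, op1 b (sx c) * d = d' * op1 b (sx c) := by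
  refine exists_mul_eq_mul (fun g hg => ?_) hd
  have key : ∀ {i : Fin m}, i ≠ b → s(i, b) ∉ S → ∃ d ∈ Diag S,
      op1 b (sx c) * C i b had = d * op1 b (sx c) := fun hib hS =>
    ⟨_, mul_mem (IsDiagGen.edge hib hS).mem (IsDiagGen.lin _ c).mem, sx_mul_C hib c⟩
  cases hg with
  | @edge i j h hS =>
    by_cases hj : j = b
    · subst hj
      exact key h hS
    by_cases hi : i = b
    · subst hi
      rw [C_symm h isTr_had]
      exact key h.symm (by rwa [Sym2.eq_swap])
    · exact ⟨_, (IsDiagGen.edge h hS).mem, (C_commute_op1 h (Ne.symm hi) (Ne.symm hj) _ _).symm.eq⟩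
  | @phase i hS x y =>
    by_cases hi : i = b
    · subst hi
      obtain ⟨x', y', e⟩ := exists_sx_mul_zt c x y
      exact ⟨_, (IsDiagGen.phase hS x' y').mem, by rw [← map_mul, e, map_mul]⟩
    · exact ⟨_, (IsDiagGen.phase hS x y).mem, (op1_commute_op1 (Ne.symm hi) _ _).eq⟩
  | lin i x =>
    refine ⟨_, (IsDiagGen.lin i x).mem, ?_⟩
    by_cases hi : i = b
    · subst hi
      exact ((sx_commute_lz c x).map (op1 i)).eq
    · exact (op1_commute_op1 (Ne.symm hi) _ _).eq

theorem C_hdag_mem {S : Set (Sym2 (Fin m))} {i j : Fin m} (h : i ≠ j) (hS : s(i, j) ∉ S) :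
    C i j hdag ∈ Diag S := by
  rw [← C_mul_C h]
  exact mul_mem (IsDiagGen.edge h hS).mem (IsDiagGen.edge h hS).mem

/-- Negations normalise the diagonal operations. -/
theorem neg_mul_Diag {S : Set (Sym2 (Fin m))} (b : Fin m) {d : Q m m}
    (hd : d ∈ Diag S) : ∃ d' ∈ Diag S, op1 b neg * d = d' * op1 b neg := by
  refine exists_mul_eq_mul (fun g hg => ?_) hd
  have key : ∀ {i : Fin m}, i ≠ b → s(i, b) ∉ S → ∃ d ∈ Diag S,
      op1 b neg * C i b had = d * op1 b neg := fun hib hS => by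
    refine ⟨_, C_hdag_mem hib hS, ?_⟩
    rw [← neg_mul_had, ← neg_mul_C_mul_neg hib, mul_assoc, op1_neg_mul_self, mul_one]
  cases hg with
  | @edge i j h hS =>
    by_cases hj : j = b
    · subst hj
      exact key h hS
    by_cases hi : i = b
    · subst hi
      rw [C_symm h isTr_had]
      exact key h.symm (by rwa [Sym2.eq_swap])
    · exact ⟨_, (IsDiagGen.edge h hS).mem, (C_commute_op1 h (Ne.symm hi) (Ne.symm hj) _ _).symm.eq⟩
  | @phase i hS x y =>
    by_cases hi : i = b
    · subst hi
      exact ⟨_, (IsDiagGen.phase hS y x).mem, by rw [← map_mul, neg_mul_zt, map_mul]⟩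
    · exact ⟨_, (IsDiagGen.phase hS x y).mem, (op1_commute_op1 (Ne.symm hi) _ _).eq⟩
  | lin i x =>
    by_cases hi : i = b
    · subst hi
      exact ⟨_, (IsDiagGen.lin i (-x)).mem, by rw [← map_mul, neg_mul_lz, map_mul]⟩
    · exact ⟨_, (IsDiagGen.lin i x).mem, (op1_commute_op1 (Ne.symm hi) _ _).eq⟩

/-! ### Local complementation -/

/-- The pairs of wires inside `T`. -/
def pairs (T : Finset (Fin m)) : Set (Sym2 (Fin m)) := {p | ∀ x ∈ p, x ∈ T}

theorem mem_pairs {T : Finset (Fin m)} {i j : Fin m} : s(i, j) ∈ pairs T ↔ i ∈ T ∧ j ∈ T := by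
  simp [pairs]

theorem mem_pairs_self {T : Finset (Fin m)} {i : Fin m} : s(i, i) ∈ pairs T ↔ i ∈ T := by
  simp [pairs]

/-- Shifts of wire `t`, possibly controlled by a wire outside `T`. -/
inductive IsShift (T : Finset (Fin m)) (t : Fin m) : Q m m → Prop
  | ctrl {k : Fin m} (hk : k ∉ T) (hkt : k ≠ t) : IsShift T t (CY k t)
  | shift (c : ZMod 3) : IsShift T t (op1 t (sx c))

theorem IsShift.smul_plus {T : Finset (Fin m)} {t : Fin m} {y : Q m m} (h : IsShift T t y) :
    y • plus m = plus m := by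
  cases h with
  | ctrl hk hkt => exact CY_smul_plus hkt
  | shift c => exact sx_smul_plus t c

/-- A shift of a wire in `T` preserves the vanishing of the quadratic part inside `T`: its control
lies outside `T`, so that the new quadratic terms involve a wire outside `T`. -/
theorem IsShift.mul_Diag {T : Finset (Fin m)} {t : Fin m} (ht : t ∈ T) {y : Q m m}
    (h : IsShift T t y) {d : Q m m} (hd : d ∈ Diag (pairs T)) :
    ∃ d' ∈ Diag (pairs T), y * d = d' * y := by
  cases h with
  | shift c => exact sx_mul_Diag t c hd
  | @ctrl k hk hkt =>
    refine exists_mul_eq_mul (fun g hg => ?_) hd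
    have key : ∀ {l : Fin m}, t ≠ l → s(t, l) ∉ pairs T → ∃ d ∈ Diag (pairs T),
        CY k t * C t l had = d * CY k t := fun {l} htl hS => by
      by_cases hkl : k = l
      · subst hkl
        refine ⟨_, mul_mem (IsDiagGen.edge hkt (by rwa [Sym2.eq_swap])).mem
          (IsDiagGen.phase (fun h => hk (mem_pairs_self.1 h)) 1 1).mem, ?_⟩
        rw [C_symm htl isTr_had, CY_mul_C_self hkt]
      · exact ⟨_, mul_mem (IsDiagGen.edge htl hS).mem
          (IsDiagGen.edge hkl (fun h => hk (mem_pairs.1 h).1)).mem, CY_mul_C hkt hkl htl⟩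
    cases hg with
    | @edge i j h hS =>
      by_cases hi : i = t
      · subst hi
        exact key h hS
      by_cases hj : j = t
      · subst hj
        rw [C_symm h isTr_had]
        exact key h.symm (by rwa [Sym2.eq_swap])
      · exact ⟨_, (IsDiagGen.edge h hS).mem, (CY_commute_C hkt h hi hj _).eq⟩
    | @phase i hS x y =>
      have hi : i ≠ t := fun h => hS (mem_pairs_self.2 (h ▸ ht))
      exact ⟨_, (IsDiagGen.phase hS x y).mem, (CY_commute_zph hkt hi _ _).eq⟩
    | lin i x =>
      by_cases hi : i = t
      · subst hi
        exact ⟨_, mul_mem (IsDiagGen.lin i x).mem (IsDiagGen.lin k x).mem, CY_mul_lz hkt x⟩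
      · exact ⟨_, (IsDiagGen.lin i x).mem, (CY_commute_zph hkt hi _ _).eq⟩

/-- The products of shifts of wire `t`. -/
noncomputable def Shift (T : Finset (Fin m)) (t : Fin m) : Submonoid (Q m m) :=
  Submonoid.closure {y | IsShift T t y}

theorem Shift_smul_plus {T : Finset (Fin m)} {t : Fin m} {y : Q m m} (h : y ∈ Shift T t) :
    y • plus m = plus m := by
  induction h using Submonoid.closure_induction with
  | mem y hy => exact hy.smul_plus
  | one => exact one_smul _ _
  | mul a b _ _ ha hb => rw [mul_smul, hb, ha]

theorem Shift_mul_Diag {T : Finset (Fin m)} {t : Fin m} (ht : t ∈ T) {y : Q m m}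
    (h : y ∈ Shift T t) {d : Q m m} (hd : d ∈ Diag (pairs T)) :
    ∃ d' ∈ Diag (pairs T), y * d = d' * y := by
  induction h using Submonoid.closure_induction generalizing d with
  | mem y hy => exact hy.mul_Diag ht hd
  | one => exact ⟨d, hd, by rw [one_mul, mul_one]⟩
  | mul a b _ _ ha hb =>
    obtain ⟨d1, hd1, e1⟩ := hb hd
    obtain ⟨d2, hd2, e2⟩ := ha hd1
    exact ⟨d2, hd2, by rw [mul_assoc, e1, ← mul_assoc, e2, mul_assoc]⟩

/-- A red phase passes through a diagonal operation, leaving shifts behind: linear phases at `t`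
become shifts, and edges at `t` become controlled shifts. -/
theorem xx_mul_Diag {T : Finset (Fin m)} {t : Fin m} (ht : t ∈ T) {d : Q m m}
    (hd : d ∈ Diag (pairs T)) :
    ∃ d' ∈ Diag (pairs T), ∃ y ∈ Shift T t, op1 t xx * d = d' * y * op1 t xx := by
  induction hd using Submonoid.closure_induction with
  | mem g hg =>
    have key : ∀ {k : Fin m}, k ≠ t → s(k, t) ∉ pairs T → ∃ d ∈ Diag (pairs T),
        ∃ y ∈ Shift T t, op1 t xx * C k t had = d * y * op1 t xx := fun {k} hkt hS => by
      have hk : k ∉ T := fun h => hS (mem_pairs.2 ⟨h, ht⟩)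
      refine ⟨_, mul_mem (IsDiagGen.edge hkt hS).mem
        (IsDiagGen.phase (fun h => hk (mem_pairs_self.1 h)) 2 2).mem, _,
        Submonoid.subset_closure (IsShift.ctrl hk hkt), ?_⟩
      rw [xx_mul_C hkt, ← mul_assoc (C k t had)]
      rfl
    have triv : Commute (op1 t xx) g → ∃ d ∈ Diag (pairs T),
        ∃ y ∈ Shift T t, op1 t xx * g = d * y * op1 t xx := fun h =>
      ⟨g, hg.mem, 1, one_mem _, by rw [mul_one, h.eq]⟩
    cases hg with
    | @edge i j h hS =>
      by_cases hj : j = t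
      · subst hj
        exact key h hS
      by_cases hi : i = t
      · subst hi
        rw [C_symm h isTr_had]
        exact key h.symm (by rwa [Sym2.eq_swap])
      · exact triv (C_commute_op1 h (Ne.symm hi) (Ne.symm hj) _ _).symm
    | @phase i hS x y =>
      have hi : i ≠ t := fun h => hS (mem_pairs_self.2 (h ▸ ht))
      exact triv (op1_commute_op1 hi.symm _ _)
    | lin i x =>
      by_cases hi : i = t
      · subst hi
        refine ⟨_, (IsDiagGen.lin i x).mem, _, Submonoid.subset_closure (IsShift.shift x), ?_⟩
        rw [← map_mul, xx_mul_lz, map_mul, map_mul, mul_assoc]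
      · exact triv (op1_commute_op1 (Ne.symm hi) _ _)
  | one => exact ⟨1, one_mem _, 1, one_mem _, by rw [mul_one, mul_one, one_mul]⟩
  | mul a b _ _ ha hb =>
    obtain ⟨a', ha', y, hy, ea⟩ := ha
    obtain ⟨b', hb', y', hy', eb⟩ := hb
    obtain ⟨b'', hb'', e⟩ := Shift_mul_Diag ht hy hb'
    refine ⟨a' * b'', mul_mem ha' hb'', y * y', mul_mem hy hy', ?_⟩
    calc op1 t xx * (a * b) = op1 t xx * a * b := (mul_assoc _ _ _).symm
      _ = a' * (y * b') * y' * op1 t xx := by rw [ea, mul_assoc, eb]; simp only [mul_assoc]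
      _ = _ := by rw [e]; simp only [mul_assoc]

/-! ### Diagonal states -/

/-- The states obtained from unconnected green nodes by diagonal operations outside `S`. -/
def DiagState (S : Set (Sym2 (Fin m))) : Set (Q 0 m) := {s | ∃ d ∈ Diag S, s = d • plus m}

theorem Diag_smul_mem {S : Set (Sym2 (Fin m))} {d : Q m m} (hd : d ∈ Diag S) {s : Q 0 m}
    (hs : s ∈ DiagState S) : d • s ∈ DiagState S := by
  obtain ⟨e, he, rfl⟩ := hs
  exact ⟨d * e, mul_mem hd he, (mul_smul _ _ _).symm⟩

theorem DiagState_mono {S S' : Set (Sym2 (Fin m))} (h : S ⊆ S') {s : Q 0 m}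
    (hs : s ∈ DiagState S') : s ∈ DiagState S := by
  obtain ⟨e, he, rfl⟩ := hs
  exact ⟨e, Diag_mono h he, rfl⟩

theorem sx_smul_mem {S : Set (Sym2 (Fin m))} (b : Fin m) (c : ZMod 3) {s : Q 0 m}
    (hs : s ∈ DiagState S) : op1 b (sx c) • s ∈ DiagState S := by
  obtain ⟨d, hd, rfl⟩ := hs
  obtain ⟨d', hd', e⟩ := sx_mul_Diag b c hd
  exact ⟨d', hd', by rw [← mul_smul, e, mul_smul, sx_smul_plus]⟩

theorem neg_smul_mem {S : Set (Sym2 (Fin m))} (b : Fin m) {s : Q 0 m}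
    (hs : s ∈ DiagState S) : op1 b neg • s ∈ DiagState S := by
  obtain ⟨d, hd, rfl⟩ := hs
  obtain ⟨d', hd', e⟩ := neg_mul_Diag b hd
  exact ⟨d', hd', by rw [← mul_smul, e, mul_smul, neg_smul_plus]⟩

/-- Local complementation: a red phase is absorbed at a wire without quadratic phase. -/
theorem xx_smul_mem {T : Finset (Fin m)} {t : Fin m} (ht : t ∈ T) {s : Q 0 m}
    (hs : s ∈ DiagState (pairs T)) : op1 t xx • s ∈ DiagState (pairs T) := by
  obtain ⟨d, hd, rfl⟩ := hs
  obtain ⟨d', hd', y, hy, e⟩ := xx_mul_Diag ht hd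
  exact ⟨d', hd', by rw [← mul_smul, e, mul_smul, xx_smul_plus, mul_smul, Shift_smul_plus hy]⟩

variable {m : ℕ}

/-! ### Local operations -/

/-- The operation `U i` on every wire `i`. -/
noncomputable def par : (n : ℕ) → (Fin n → Q 1 1) → Q n n
  | 0, _ => 1
  | n + 1, U => par n (fun i => U i.castSucc) ◎ U (Fin.last n)

theorem par_mul : (n : ℕ) → (U V : Fin n → Q 1 1) → par n U * par n V = par n (fun i => U i * V i)
  | 0, _, _ => mul_one _
  | n + 1, U, V => by
    have h := interchange (par n (fun i => V i.castSucc)) (par n (fun i => U i.castSucc))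
      (V (Fin.last n)) (U (Fin.last n))
    have e : par n (fun i => V i.castSucc) ⟫ par n (fun i => U i.castSucc) =
        par n (fun i => U i.castSucc * V i.castSucc) := par_mul n _ _
    rw [e] at h
    exact h.symm

theorem par_one : (n : ℕ) → par n (fun _ => 1) = 1
  | 0 => rfl
  | n + 1 => by rw [par, par_one n, one_tens_one]

theorem op1_eq_par (f : Q 1 1) : {n : ℕ} → (i : Fin n) →
    op1 i f = par n (Function.update (fun _ => 1) i f)
  | 0, i => i.elim0
  | n + 1, i => by
    refine Fin.lastCases ?_ (fun i => ?_) i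
    · have e : (fun i : Fin n => Function.update (fun _ => (1 : Q 1 1)) (Fin.last n) f i.castSucc) =
          fun _ => 1 := by
        funext i
        rw [Function.update_of_ne (castSucc_ne_last i)]
      rw [op1_last, par, e, par_one, Function.update_self]
      rfl
    · have e : (fun j : Fin n => Function.update (fun _ => (1 : Q 1 1)) i.castSucc f j.castSucc) =
          Function.update (fun _ => 1) i f := by
        funext j
        by_cases h : j = i
        · subst h
          rw [Function.update_self, Function.update_self]
        · rw [Function.update_of_ne h, Function.update_of_ne (castSucc_ne h)]
      rw [← ext_op1, op1_eq_par f i, par, e, Function.update_of_ne (castSucc_ne_last i).symm]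
      rfl

theorem par_update_mul_op1 (U : Fin m → Q 1 1) (i : Fin m) (f : Q 1 1) :
    par m (Function.update U i 1) * op1 i f = par m (Function.update U i f) := by
  rw [op1_eq_par, par_mul]
  congr 1
  funext j
  by_cases h : j = i
  · subst h
    simp
  · simp [h]

theorem par_eq (U : Fin m → Q 1 1) (i : Fin m) :
    par m U = par m (Function.update U i 1) * op1 i (U i) := by
  rw [par_update_mul_op1, Function.update_eq_self]

theorem op1_mul_par (U : Fin m → Q 1 1) (i : Fin m) (f : Q 1 1) :
    op1 i f * par m U = par m (Function.update U i (f * U i)) := by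
  rw [op1_eq_par, par_mul]
  congr 1
  funext j
  by_cases h : j = i
  · subst h
    simp
  · simp [h]

/-- The local Clifford operations. -/
noncomputable def Loc : Submonoid (Q 1 1) :=
  Submonoid.closure ({had} ∪ {x | ∃ a b : ZMod 3, x = zt a b})

theorem had_mem_Loc : had ∈ Loc := Submonoid.subset_closure (Or.inl rfl)

theorem zt_mem_Loc (a b : ZMod 3) : zt a b ∈ Loc := Submonoid.subset_closure (Or.inr ⟨a, b, rfl⟩)

theorem hdag_mem_Loc : hdag ∈ Loc := by
  rw [← had_mul_neg]
  exact mul_mem had_mem_Loc (mul_mem had_mem_Loc had_mem_Loc)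

/-- The normal forms of local operations on diagonal states. -/
def IsH (V : Q 1 1) : Prop := V = 1 ∨ ∃ r : ZMod 3, V = zt r r * had

theorem IsH.mem_Loc {V : Q 1 1} (h : IsH V) : V ∈ Loc := by
  rcases h with rfl | ⟨r, rfl⟩
  · exact one_mem _
  · exact mul_mem (zt_mem_Loc r r) had_mem_Loc

theorem op1_zt_mem {i : Fin m} (a b : ZMod 3) : op1 i (zt a b) ∈ Diag (∅ : Set (Sym2 (Fin m))) :=
  (IsDiagGen.phase (Set.notMem_empty _) a b).mem

theorem hdag_mul_neg : hdag * neg = had := by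
  rw [← hdag_mul_hdag, ← mul_assoc, hdag_mul_hdag, neg_mul_hdag]

theorem lz_mul_had (c : ZMod 3) : lz c * had = had * sx (-c) := by
  have h := neg_mul_lz (-c)
  rw [neg_neg] at h
  rw [sx, ← lz, ← mul_assoc, ← mul_assoc, ← neg, h, mul_assoc, neg_mul_hdag]

theorem had_mul_zz_mul_had : had * (zz * had) = zt 1 1 * (had * (zt 1 1 * neg)) := by
  have e : xx = zt 1 1 * (had * zt 1 1) := by
    calc xx = (zt 1 1 * zz) * (xx * (zz * zt 1 1)) := by
          rw [inv_mul_zz, zz_mul_inv, mul_one, one_mul]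
      _ = zt 1 1 * ((zz * (xx * zz)) * zt 1 1) := by simp only [mul_assoc]
      _ = _ := by rw [← had_eq]
  calc had * (zz * had) = had * zz * (hdag * neg) := by
        rw [mul_assoc had zz, ← hdag_mul_hdag, ← mul_assoc hdag, hdag_mul_hdag, neg_mul_hdag]
    _ = xx * neg := by rw [← mul_assoc]; rfl
    _ = _ := by rw [e]; simp only [mul_assoc]

theorem had_mul_zt_one_mul_had : had * (zt 1 1 * had) = zz * (had * zz) := by
  calc had * (zt 1 1 * had) = had * zt 1 1 * hdag * neg := by
        rw [mul_assoc, mul_assoc, ← hdag_mul_hdag, ← mul_assoc hdag, hdag_mul_hdag, neg_mul_hdag]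
    _ = zz * (hdag * (neg * zz)) := by rw [zt_one_mul_had, neg_mul_zz]; simp only [mul_assoc]
    _ = _ := by
        rw [← mul_assoc hdag, hdag_mul_neg]

theorem zmod_three (r : ZMod 3) : r = 0 ∨ r = 1 ∨ r = 2 := by revert r; decide

/-- A local operation on a diagonal state can be brought to normal form. -/
theorem exists_isH {U : Q 1 1} (hU : U ∈ Loc) (i : Fin m) {s : Q 0 m} (hs : s ∈ DiagState ∅) :
    ∃ V, IsH V ∧ ∃ s' ∈ DiagState ∅, op1 i U • s = op1 i V • s' := by
  induction hU using Submonoid.closure_induction_left with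
  | one => exact ⟨1, Or.inl rfl, s, hs, rfl⟩
  | mul_left g hg U hU ih =>
    obtain ⟨V, hV, s', hs', e⟩ := ih
    rw [map_mul, mul_smul, e]
    rcases hg with rfl | ⟨a, b, rfl⟩
    · rcases hV with rfl | ⟨r, rfl⟩
      · exact ⟨had, Or.inr ⟨0, by rw [zt_zero, one_mul]⟩, s', hs', by rw [map_one, one_smul]⟩
      · rw [← mul_smul, ← map_mul]
        have hr : r = 0 ∨ r = 1 ∨ r = 2 := zmod_three r
        rcases hr with rfl | rfl | rfl
        · refine ⟨1, Or.inl rfl, _, neg_smul_mem i hs', ?_⟩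
          rw [zt_zero, one_mul, map_one, one_smul]
          rfl
        · refine ⟨zt 2 2 * had, Or.inr ⟨2, rfl⟩, _, Diag_smul_mem (op1_zt_mem (i := i) 2 2) hs', ?_⟩
          rw [← mul_smul, ← map_mul, had_mul_zt_one_mul_had, zz, mul_assoc]
        · refine ⟨zt 1 1 * had, Or.inr ⟨1, rfl⟩, _,
            Diag_smul_mem (op1_zt_mem (i := i) 1 1) (neg_smul_mem i hs'), ?_⟩
          rw [← mul_smul, ← mul_smul, ← map_mul, ← map_mul]
          refine congrArg (op1 i · • s') (had_mul_zz_mul_had.trans ?_)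
          simp only [mul_assoc]
    · rcases hV with rfl | ⟨r, rfl⟩
      · refine ⟨1, Or.inl rfl, _, Diag_smul_mem (op1_zt_mem (i := i) a b) hs', ?_⟩
        rw [map_one, one_smul, one_smul]
      · refine ⟨zt (2 * a - b + r) (2 * a - b + r) * had, Or.inr ⟨_, rfl⟩, _,
          sx_smul_mem i (-(b - a)) hs', ?_⟩
        rw [← mul_smul, ← mul_smul, ← map_mul, ← map_mul, mul_assoc, ← lz_mul_had, ← mul_assoc,
          ← mul_assoc, lz, zt_mul, zt_mul]
        have e1 : 2 * a - b + r + (b - a) = a + r := by ring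
        have e2 : 2 * a - b + r + 2 * (b - a) = b + r := by ring
        rw [e1, e2]

/-- The operations on the wires are brought into normal form one wire at a time. -/
theorem exists_isH_par (U : Fin m → Q 1 1) (hU : ∀ i, U i ∈ Loc) {s : Q 0 m}
    (hs : s ∈ DiagState ∅) : ∃ V, (∀ i, IsH (V i)) ∧ ∃ s' ∈ DiagState ∅,
      par m U • s = par m V • s' := by
  have key : ∀ F : Finset (Fin m), ∃ V, (∀ i, V i ∈ Loc) ∧ (∀ i ∈ F, IsH (V i)) ∧
      ∃ s' ∈ DiagState ∅, par m U • s = par m V • s' := by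
    intro F
    induction F using Finset.induction_on with
    | empty => exact ⟨U, hU, fun i hi => absurd hi (Finset.notMem_empty i), s, hs, rfl⟩
    | insert j F hj ih =>
      obtain ⟨V, hV, hF, s', hs', e⟩ := ih
      obtain ⟨W, hW, s'', hs'', e'⟩ := exists_isH (hV j) j hs'
      refine ⟨Function.update V j W, fun i => ?_, fun i hi => ?_, s'', hs'', ?_⟩
      · by_cases h : i = j
        · subst h
          rw [Function.update_self]
          exact hW.mem_Loc
        · rw [Function.update_of_ne h]
          exact hV i
      · by_cases h : i = j
        · subst h
          rw [Function.update_self]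
          exact hW
        · rw [Function.update_of_ne h]
          exact hF i (Finset.mem_of_mem_insert_of_ne hi h)
      · rw [e, par_eq V j, mul_smul, e', ← mul_smul, par_update_mul_op1]
  obtain ⟨V, -, hV, h⟩ := key Finset.univ
  exact ⟨V, fun i => hV i (Finset.mem_univ i), h⟩

variable {m : ℕ}

/-! ### Entries of the quadratic part -/

/-- An edge of weight `w` between the wires `i` and `j`. -/
noncomputable def E (i j : Fin m) (w : ZMod 3) : Q m m := op2 i j (q (edge w))

@[simp] theorem E_zero (i j : Fin m) : E i j 0 = 1 := by rw [E, q_edge, if_pos rfl, map_one]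

theorem E_one (i j : Fin m) : E i j 1 = C i j had := by
  rw [E, q_edge, if_neg one_ne_zero, if_pos rfl, C]

theorem E_two (i j : Fin m) : E i j 2 = C i j hdag := by
  rw [E, q_edge, if_neg (by decide), if_neg (by decide), C]

theorem E_mul {i j : Fin m} (h : i ≠ j) (v w : ZMod 3) : E i j v * E i j w = E i j (v + w) := by
  have e1 : E i j 1 * E i j 1 = E i j 2 := by rw [E_one, E_two, C_mul_C h]
  have e2 : E i j 1 * E i j 2 = 1 := by rw [E_one, E_two, C_had_mul_C_hdag h]
  have e3 : E i j 2 * E i j 1 = 1 := by rw [E_one, E_two, C_hdag_mul_C_had h]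
  have e4 : E i j 2 * E i j 2 = E i j 1 := by
    calc E i j 2 * E i j 2 = E i j 1 * E i j 1 * E i j 2 := by rw [e1]
      _ = E i j 1 := by rw [mul_assoc, e2, mul_one]
  rcases zmod_three v with rfl | rfl | rfl <;> rcases zmod_three w with rfl | rfl | rfl
  · rw [E_zero, mul_one, add_zero, E_zero]
  · rw [E_zero, one_mul]; rfl
  · rw [E_zero, one_mul]; rfl
  · rw [E_zero, mul_one]; rfl
  · exact e1
  · exact e2.trans (E_zero i j).symm
  · rw [E_zero, mul_one]; rfl
  · exact e3.trans (E_zero i j).symm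
  · exact e4

theorem E_symm {i j : Fin m} (h : i ≠ j) (w : ZMod 3) : E i j w = E j i w := by
  rcases zmod_three w with rfl | rfl | rfl
  · rw [E_zero, E_zero]
  · rw [E_one, E_one, C_symm h isTr_had]
  · rw [E_two, E_two, C_symm h isTr_hdag]

theorem E_mem {S : Set (Sym2 (Fin m))} {i j : Fin m} (h : i ≠ j) (hS : s(i, j) ∉ S) (w : ZMod 3) :
    E i j w ∈ Diag S := by
  rcases zmod_three w with rfl | rfl | rfl
  · rw [E_zero]; exact one_mem _
  · rw [E_one]; exact (IsDiagGen.edge h hS).mem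
  · rw [E_two]; exact C_hdag_mem h hS

/-- The non-trivial parts of a diagonal operation at an unordered pair of wires. -/
inductive IsPart : Sym2 (Fin m) → Q m m → Prop
  | edge {i j : Fin m} (h : i ≠ j) {w : ZMod 3} (hw : w ≠ 0) : IsPart s(i, j) (E i j w)
  | phase (i : Fin m) {w : ZMod 3} (hw : w ≠ 0) : IsPart s(i, i) (op1 i (zt w w))

theorem exists_mul_of_gen {S : Set (Sym2 (Fin m))} {d : Q m m} {G : ZMod 3 → Q m m}
    {S' : Set (Sym2 (Fin m))} (hG0 : G 0 = 1) (hG : ∀ v w, G v * G w = G (v + w))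
    (hGc : ∀ w, ∀ e ∈ Diag S', Commute e (G w))
    (hgen : ∀ g, IsDiagGen S g → ∃ w, ∃ e ∈ Diag S', g = G w * e) (hd : d ∈ Diag S) :
    ∃ w, ∃ e ∈ Diag S', d = G w * e := by
  induction hd using Submonoid.closure_induction with
  | mem g hg => exact hgen g hg
  | one => exact ⟨0, 1, one_mem _, by rw [hG0, one_mul]⟩
  | mul a b _ _ ha hb =>
    obtain ⟨v, e, he, rfl⟩ := ha
    obtain ⟨w, e', he', rfl⟩ := hb
    refine ⟨v + w, e * e', mul_mem he he', ?_⟩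
    rw [← hG, mul_assoc, ← mul_assoc e, (hGc w e he).eq]
    simp only [mul_assoc]

theorem exists_E_mul {S : Set (Sym2 (Fin m))} {d : Q m m} (hd : d ∈ Diag S) {i j : Fin m}
    (h : i ≠ j) : ∃ w, ∃ e ∈ Diag (insert s(i, j) S), d = E i j w * e := by
  refine exists_mul_of_gen (E_zero i j) (E_mul h)
    (fun w e he => Diag_commute he (E_mem (S := ∅) h (Set.notMem_empty _) w)) (fun g hg => ?_) hd
  by_cases hg' : IsDiagGen (insert s(i, j) S) g
  · exact ⟨0, g, hg'.mem, by rw [E_zero, one_mul]⟩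
  · refine ⟨1, 1, one_mem _, ?_⟩
    rw [mul_one, E_one]
    cases hg with
    | @edge k l hkl hS =>
      have e : s(k, l) = s(i, j) := by
        by_contra e
        exact hg' (.edge hkl fun h => (Set.mem_insert_iff.1 h).elim e hS)
      rcases Sym2.eq_iff.1 e with ⟨rfl, rfl⟩ | ⟨rfl, rfl⟩
      · rfl
      · exact C_symm hkl isTr_had
    | @phase k hS a b =>
      refine absurd (.phase (fun h' => ?_) a b) hg'
      refine (Set.mem_insert_iff.1 h').elim (fun e => ?_) hS
      rcases Sym2.eq_iff.1 e with ⟨rfl, rfl⟩ | ⟨rfl, rfl⟩ <;> exact h rfl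
    | lin k c => exact absurd (.lin k c) hg'

theorem exists_zt_mul {S : Set (Sym2 (Fin m))} {d : Q m m} (hd : d ∈ Diag S) (i : Fin m) :
    ∃ w, ∃ e ∈ Diag (insert s(i, i) S), d = op1 i (zt w w) * e := by
  refine exists_mul_of_gen (G := fun w => op1 i (zt w w)) (by rw [zt_zero, map_one])
    (fun v w => by rw [← map_mul, zt_mul])
    (fun w e he => Diag_commute_zt he _ _ _) (fun g hg => ?_) hd
  by_cases hg' : IsDiagGen (insert s(i, i) S) g
  · exact ⟨0, g, hg'.mem, by rw [zt_zero, map_one, one_mul]⟩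
  · cases hg with
    | @edge k l hkl hS =>
      refine absurd (.edge hkl fun h' => ?_) hg'
      refine (Set.mem_insert_iff.1 h').elim (fun e => ?_) hS
      rcases Sym2.eq_iff.1 e with ⟨rfl, rfl⟩ | ⟨rfl, rfl⟩ <;> exact hkl rfl
    | @phase k hS a b =>
      have e : k = i := by
        by_contra e
        refine hg' (.phase (fun h => (Set.mem_insert_iff.1 h).elim (fun h => e ?_) hS) a b)
        rcases Sym2.eq_iff.1 h with ⟨h, -⟩ | ⟨h, -⟩ <;> exact h
      subst e
      refine ⟨2 * a - b, op1 k (lz (b - a)), (IsDiagGen.lin k _).mem, ?_⟩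
      have e1 : 2 * a - b + (b - a) = a := by ring
      have e2 : 2 * a - b + 2 * (b - a) = b := by ring
      rw [← map_mul, lz, zt_mul, e1, e2]
    | lin k c => exact absurd (.lin k c) hg'

theorem exists_part (p : Sym2 (Fin m)) {S : Set (Sym2 (Fin m))} {d : Q m m} (hd : d ∈ Diag S) :
    d ∈ Diag (insert p S) ∨ ∃ g, IsPart p g ∧ ∃ e ∈ Diag (insert p S), d = g * e := by
  induction p with
  | _ i j =>
    by_cases h : i = j
    · subst h
      obtain ⟨w, e, he, rfl⟩ := exists_zt_mul hd i
      by_cases hw : w = 0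
      · left
        rwa [hw, zt_zero, map_one, one_mul]
      · exact Or.inr ⟨_, .phase i hw, e, he, rfl⟩
    · obtain ⟨w, e, he, rfl⟩ := exists_E_mul hd h
      by_cases hw : w = 0
      · left
        rwa [hw, E_zero, one_mul]
      · exact Or.inr ⟨_, .edge h hw, e, he, rfl⟩

/-- Either the quadratic part of a diagonal operation vanishes on `F`, or one of its non-trivial
parts in `F` can be split off. -/
theorem mem_or_exists_part (F : Finset (Sym2 (Fin m))) {S : Set (Sym2 (Fin m))} {d : Q m m}
    (hd : d ∈ Diag S) : d ∈ Diag (S ∪ F) ∨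
      ∃ p ∈ F, ∃ g, IsPart p g ∧ ∃ e ∈ Diag (insert p S), d = g * e := by
  induction F using Finset.induction_on generalizing S with
  | empty =>
    left
    rwa [Finset.coe_empty, Set.union_empty]
  | insert p F hp ih =>
    rcases exists_part p hd with h | ⟨g, hg, e, he, rfl⟩
    · rcases ih h with h | ⟨p', hp', g, hg, e, he, rfl⟩
      · left
        rwa [Finset.coe_insert, Set.union_insert, ← Set.insert_union]
      · refine Or.inr ⟨p', Finset.mem_insert_of_mem hp', g, hg, e, Diag_mono ?_ he, rfl⟩
        exact Set.insert_subset_insert (Set.subset_insert _ _)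
    · exact Or.inr ⟨p, Finset.mem_insert_self _ _, g, hg, e, he, rfl⟩

/-! ### Removing Hadamard nodes -/

theorem had_mul_zt_one : had * zt 1 1 = zz * xx := by
  calc had * zt 1 1 = had * zt 1 1 * hdag * had := by rw [mul_assoc _ hdag, hdag_mul_had, mul_one]
    _ = _ := by rw [zt_one_mul_had, xx_eq]; simp only [mul_assoc]

theorem had_mul_zz' : had * zz = neg * (zt 1 1 * (xx * xx)) := by
  have h : had * (zt 1 1 * (xx * xx) * zt 1 1) = 1 := by
    calc had * (zt 1 1 * (xx * xx) * zt 1 1) =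
        zz * (xx * ((zz * zt 1 1) * (xx * xx))) * zt 1 1 := by
          conv_lhs => rw [had_eq]
          simp only [mul_assoc]
      _ = 1 := by rw [zz_mul_inv, one_mul, xx_cube, mul_one, zz_mul_inv]
  have h' : hdag = zt 1 1 * (xx * xx) * zt 1 1 := by
    calc hdag = hdag * (had * (zt 1 1 * (xx * xx) * zt 1 1)) := by rw [h, mul_one]
      _ = _ := by rw [← mul_assoc, hdag_mul_had, one_mul]
  calc had * zz = neg * (hdag * zz) := by rw [← mul_assoc, neg_mul_hdag]
    _ = _ := by rw [h', mul_assoc _ (zt 1 1), inv_mul_zz, mul_one]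

theorem pairs_mono {T T' : Finset (Fin m)} (h : T ⊆ T') : pairs T ⊆ pairs T' :=
  fun _ hp x hx => h (hp x hx)

/-- A Hadamard node on a wire with a quadratic phase is removed. -/
theorem had_smul_phase_mem {t : Fin m} {w : ZMod 3} (hw : w ≠ 0) (r : ZMod 3) {s : Q 0 m}
    (hs : s ∈ DiagState (pairs {t})) :
    op1 t (zt r r * had) • op1 t (zt w w) • s ∈ DiagState ∅ := by
  have ht : t ∈ ({t} : Finset (Fin m)) := Finset.mem_singleton_self t
  have h0 : ∀ {s : Q 0 m}, s ∈ DiagState (pairs {t}) → s ∈ DiagState ∅ :=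
    fun h => DiagState_mono (Set.empty_subset _) h
  rw [map_mul, mul_smul]
  refine Diag_smul_mem (op1_zt_mem r r) ?_
  rw [← mul_smul, ← map_mul]
  rcases zmod_three w with rfl | rfl | rfl
  · exact absurd rfl hw
  · rw [had_mul_zt_one, map_mul, mul_smul]
    exact Diag_smul_mem (op1_zt_mem 2 2) (h0 (xx_smul_mem ht hs))
  · have e := had_mul_zz'
    rw [zz] at e
    rw [e]
    simp only [map_mul, mul_smul]
    exact neg_smul_mem t (Diag_smul_mem (op1_zt_mem 1 1)
      (h0 (xx_smul_mem ht (xx_smul_mem ht hs))))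

/-- A controlled shift between two wires whose quadratic part vanishes stays within such operations.
-/
theorem CY_mul_Diag {a b : Fin m} (hab : a ≠ b) {d : Q m m} (hd : d ∈ Diag (pairs {a, b})) :
    ∃ d' ∈ Diag (pairs {a, b}), CY a b * d = d' * CY a b := by
  refine exists_mul_eq_mul (fun g hg => ?_) hd
  have ha : a ∈ ({a, b} : Finset (Fin m)) := by simp
  have hb : b ∈ ({a, b} : Finset (Fin m)) := by simp
  have key : ∀ {l : Fin m}, b ≠ l → s(b, l) ∉ pairs {a, b} → ∃ d ∈ Diag (pairs {a, b}),
      CY a b * C b l had = d * CY a b := fun {l} hbl hS => by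
    have hl : l ∉ ({a, b} : Finset (Fin m)) := fun h => hS (mem_pairs.2 ⟨hb, h⟩)
    have hal : a ≠ l := fun h => hl (h ▸ ha)
    exact ⟨_, mul_mem (IsDiagGen.edge hbl hS).mem
        (IsDiagGen.edge hal (fun h => hl (mem_pairs.1 h).2)).mem, CY_mul_C hab hal hbl⟩
  cases hg with
  | @edge i j h hS =>
    by_cases hi : i = b
    · subst hi
      exact key h hS
    by_cases hj : j = b
    · subst hj
      rw [C_symm h isTr_had]
      exact key h.symm (by rwa [Sym2.eq_swap])
    · exact ⟨_, (IsDiagGen.edge h hS).mem, (CY_commute_C hab h hi hj _).eq⟩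
  | @phase i hS x y =>
    have hi : i ≠ b := fun h => hS (mem_pairs_self.2 (h ▸ hb))
    exact ⟨_, (IsDiagGen.phase hS x y).mem, (CY_commute_zph hab hi _ _).eq⟩
  | lin i x =>
    by_cases hi : i = b
    · subst hi
      exact ⟨_, mul_mem (IsDiagGen.lin i x).mem (IsDiagGen.lin a x).mem, CY_mul_lz hab x⟩
    · exact ⟨_, (IsDiagGen.lin i x).mem, (CY_commute_zph hab hi _ _).eq⟩

theorem CY_smul_mem {a b : Fin m} (hab : a ≠ b) {s : Q 0 m} (hs : s ∈ DiagState (pairs {a, b})) :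
    CY a b • s ∈ DiagState (pairs {a, b}) := by
  obtain ⟨d, hd, rfl⟩ := hs
  obtain ⟨d', hd', e⟩ := CY_mul_Diag hab hd
  exact ⟨d', hd', by rw [← mul_smul, e, mul_smul, CY_smul_plus hab]⟩

/-- A red phase at one end of an edge creates a quadratic phase at the other end. -/
theorem xx_smul_edge {a b : Fin m} (hab : a ≠ b) {w : ZMod 3} (hw : w ≠ 0) {s : Q 0 m}
    (hs : s ∈ DiagState (pairs {a, b})) :
    ∃ s' ∈ DiagState (pairs {a}), op1 b xx • E a b w • s = op1 a zz • s' := by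
  have hb : b ∈ ({a, b} : Finset (Fin m)) := by simp
  have h0 : ∀ {s : Q 0 m}, s ∈ DiagState (pairs {a, b}) → s ∈ DiagState (pairs {a}) :=
    fun h => DiagState_mono (pairs_mono (by simp)) h
  have hS : s(a, b) ∉ pairs {a} := fun h => hab (Finset.mem_singleton.1 (mem_pairs.1 h).2).symm
  have cz : Commute (C a b had) (op1 a zz) := C_commute_zph hab _ _ _
  have hx := xx_smul_mem hb hs
  have e1 : op1 b xx * E a b 1 = op1 a zz * (E a b 1 * CY a b) * op1 b xx := by
    rw [E_one, xx_mul_C hab, cz.left_comm]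
  rcases zmod_three w with rfl | rfl | rfl
  · exact absurd rfl hw
  · refine ⟨_, Diag_smul_mem (E_mem hab hS 1) (h0 (CY_smul_mem hab hx)), ?_⟩
    rw [← mul_smul, e1]
    simp only [mul_smul]
  · refine ⟨_, Diag_smul_mem (E_mem hab hS 2) (h0 (CY_smul_mem hab (CY_smul_mem hab hx))), ?_⟩
    have e2 : op1 b xx * E a b 2 = op1 a zz * (E a b 2 * (CY a b * CY a b)) * op1 b xx := by
      have hz : op1 a (zt 1 1) * op1 a zz = 1 := by rw [← map_mul, inv_mul_zz, map_one]
      have cy : Commute (CY a b) (op1 a zz) := CY_commute_zph hab hab _ _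
      have h2 := CY_mul_C_self hab
      rw [E_two, ← C_mul_C hab, ← mul_assoc, xx_mul_C hab]
      calc C a b had * (op1 a zz * CY a b) * op1 b xx * C a b had =
          C a b had * (op1 a zz * (CY a b * C a b had) * (op1 a zz * CY a b)) * op1 b xx := by
            rw [mul_assoc (C a b had * _), xx_mul_C hab]
            simp only [mul_assoc]
        _ = C a b had * (op1 a zz * (C a b had * (op1 a (zt 1 1) * op1 a zz * (CY a b * CY a b)))) *
            op1 b xx := by
            rw [h2]
            simp only [mul_assoc]
            rw [cy.left_comm]
        _ = _ := by
            rw [hz, one_mul, cz.left_comm]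
            simp only [mul_assoc]
    rw [← mul_smul, e2]
    simp only [mul_smul]

theorem zt_mul_had_eq (r : ZMod 3) : zt r r * had = zt (r + 1) (r + 1) * had * xx := by
  rw [mul_assoc, had_mul_xx, ← zt_mul, mul_assoc, ← mul_assoc (zt 1 1), inv_mul_zz, one_mul]

/-- Vertex operators on a set `T` of wires that are Hadamard nodes followed by green nodes, and are
trivial on the other wires. -/
def IsHOn (T : Finset (Fin m)) (V : Fin m → Q 1 1) : Prop :=
  (∀ i ∉ T, V i = 1) ∧ ∀ i ∈ T, ∃ r : ZMod 3, V i = zt r r * had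

theorem IsHOn.erase {T : Finset (Fin m)} {V : Fin m → Q 1 1} (h : IsHOn T V) (t : Fin m) :
    IsHOn (T.erase t) (Function.update V t 1) := by
  refine ⟨fun i hi => ?_, fun i hi => ?_⟩
  · by_cases hit : i = t
    · subst hit
      rw [Function.update_self]
    · rw [Function.update_of_ne hit]
      exact h.1 i fun hT => hi (Finset.mem_erase.2 ⟨hit, hT⟩)
  · rw [Function.update_of_ne (Finset.ne_of_mem_erase hi)]
    exact h.2 i (Finset.mem_of_mem_erase hi)

/-- Hadamard nodes are removed until there are no quadratic phases on them and no edges between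
them. -/
theorem exists_independent (T : Finset (Fin m)) (V : Fin m → Q 1 1) (hV : IsHOn T V)
    {s : Q 0 m} (hs : s ∈ DiagState ∅) : ∃ T' V', IsHOn T' V' ∧ ∃ s' ∈ DiagState (pairs T'),
      par m V • s = par m V' • s' := by
  induction hn : T.card generalizing T V s with
  | zero =>
    obtain rfl := Finset.card_eq_zero.1 hn
    refine ⟨∅, V, hV, s, DiagState_mono (fun p hp => ?_) hs, rfl⟩
    induction p with
    | _ i j => exact absurd (mem_pairs.1 hp).1 (Finset.notMem_empty i)
  | succ n ih =>
    have drop : ∀ {t : Fin m} {V : Fin m → Q 1 1} {s : Q 0 m}, t ∈ T → IsHOn T V →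
        op1 t (V t) • s ∈ DiagState ∅ → ∃ T' V', IsHOn T' V' ∧ ∃ s' ∈ DiagState (pairs T'),
          par m V • s = par m V' • s' := fun {t V s} ht hV h => by
      obtain ⟨T', V', hV', s', hs', e⟩ := ih (T.erase t) _ (hV.erase t) h
        (by rw [Finset.card_erase_of_mem ht, hn]; rfl)
      exact ⟨T', V', hV', s', hs', by rw [par_eq V t, mul_smul, e]⟩
    have phase : ∀ {t : Fin m} {w : ZMod 3} {V : Fin m → Q 1 1} {s : Q 0 m}, w ≠ 0 → t ∈ T →
        IsHOn T V → s ∈ DiagState (pairs {t}) →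
        ∃ T' V', IsHOn T' V' ∧ ∃ s' ∈ DiagState (pairs T'),
          par m V • op1 t (zt w w) • s = par m V' • s' := fun {t w V s} hw ht hV h => by
      obtain ⟨r, hr⟩ := hV.2 t ht
      refine drop ht hV ?_
      rw [hr]
      exact had_smul_phase_mem hw r h
    obtain ⟨d, hd, rfl⟩ := hs
    have hp : ∀ i : Fin m, pairs {i} ⊆ {s(i, i)} := fun i p hp => by
      induction p with
      | _ k l =>
        obtain ⟨hk, hl⟩ := mem_pairs.1 hp
        rw [Finset.mem_singleton.1 hk, Finset.mem_singleton.1 hl]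
        rfl
    rcases mem_or_exists_part (T.image fun t => s(t, t)) hd with hd | ⟨p, hpT, g, hg, e, he, rfl⟩
    · rcases mem_or_exists_part T.sym2 hd with hd | ⟨p, hpT, g, hg, e, he, rfl⟩
      · refine ⟨T, V, hV, _, ⟨d, Diag_mono (fun p hp => ?_) hd, rfl⟩, rfl⟩
        exact Or.inr (Finset.mem_coe.2 (Finset.mem_sym2_iff.2 hp))
      · cases hg with
        | phase t hw =>
          rw [mul_smul]
          refine phase hw (Finset.mk_mem_sym2_iff.1 hpT).1 hV ⟨e, Diag_mono ?_ he, rfl⟩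
          exact (hp t).trans (Set.singleton_subset_iff.2 (Set.mem_insert _ _))
        | @edge i j hij w hw =>
          obtain ⟨hi, hj⟩ := Finset.mk_mem_sym2_iff.1 hpT
          have hs : e • plus m ∈ DiagState (pairs {i, j}) := by
            refine ⟨e, Diag_mono (fun p hp => ?_) he, rfl⟩
            have hT : ∀ t ∈ T, s(t, t) ∈ (T.image fun t => s(t, t)) := fun t ht =>
              Finset.mem_image_of_mem _ ht
            induction p with
            | _ k l =>
              obtain ⟨hk, hl⟩ := mem_pairs.1 hp
              simp only [Finset.mem_insert, Finset.mem_singleton] at hk hl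
              rcases hk with rfl | rfl <;> rcases hl with rfl | rfl
              · exact Or.inr (Or.inr (hT _ hi))
              · exact Or.inl rfl
              · exact Or.inl Sym2.eq_swap
              · exact Or.inr (Or.inr (hT _ hj))
          obtain ⟨s', hs', e'⟩ := xx_smul_edge hij hw hs
          obtain ⟨r, hr⟩ := hV.2 j hj
          have hV' : IsHOn T (Function.update V j (zt (r + 1) (r + 1) * had)) := by
            refine ⟨fun k hk => ?_, fun k hk => ?_⟩
            · rw [Function.update_of_ne (fun h => hk (by rwa [h]))]
              exact hV.1 k hk
            · by_cases hkj : k = j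
              · subst hkj
                exact ⟨r + 1, Function.update_self _ _ _⟩
              · rw [Function.update_of_ne hkj]
                exact hV.2 k hk
          obtain ⟨T', V', h1, s'', h2, h3⟩ := phase (w := 2) (by decide) hi hV' hs'
          refine ⟨T', V', h1, s'', h2, ?_⟩
          rw [← h3, par_eq V j, hr, zt_mul_had_eq, map_mul, ← mul_assoc, par_update_mul_op1,
            mul_smul, mul_smul, e']
          rfl
    · obtain ⟨t, ht, rfl⟩ := Finset.mem_image.1 hpT
      have he' : e • plus m ∈ DiagState (pairs {t}) :=
        ⟨e, Diag_mono ((hp t).trans (Set.singleton_subset_iff.2 (Set.mem_insert _ _))) he, rfl⟩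
      generalize hpe : s(t, t) = p at hg
      cases hg with
      | phase t' hw =>
        obtain rfl : t = t' := by
          rcases Sym2.eq_iff.1 hpe with ⟨h, -⟩ | ⟨h, -⟩ <;> exact h
        rw [mul_smul]
        exact phase hw ht hV he'
      | edge h hw =>
        rcases Sym2.eq_iff.1 hpe with ⟨rfl, rfl⟩ | ⟨rfl, rfl⟩ <;> exact absurd rfl h

variable {m : ℕ}

/-! ### Graph states -/

theorem ext_E {i j : Fin m} (h : i ≠ j) (w : ZMod 3) : ext (E i j w) = E i.castSucc j.castSucc w :=
  op2_ext h _

theorem ext_mem {d : Q m m} (hd : d ∈ Diag (∅ : Set (Sym2 (Fin m)))) :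
    ext d ∈ Diag (∅ : Set (Sym2 (Fin (m + 1)))) := by
  induction hd using Submonoid.closure_induction with
  | mem g hg =>
    cases hg with
    | edge h hS =>
      rw [ext_C h]
      exact (IsDiagGen.edge (castSucc_ne h) (Set.notMem_empty _)).mem
    | phase hS a b =>
      rw [ext_op1]
      exact op1_zt_mem a b
    | lin i c =>
      rw [ext_op1]
      exact (IsDiagGen.lin _ c).mem
  | one => rw [map_one]; exact one_mem _
  | mul a b _ _ ha hb => rw [map_mul]; exact mul_mem ha hb

theorem conjP_mem (σ : Equiv.Perm (Fin m)) {d : Q m m}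
    (hd : d ∈ Diag (∅ : Set (Sym2 (Fin m)))) : conjP σ d ∈ Diag (∅ : Set (Sym2 (Fin m))) := by
  induction hd using Submonoid.closure_induction with
  | mem g hg =>
    cases hg with
    | edge h hS =>
      rw [C, conjP_op2 σ h]
      exact (IsDiagGen.edge (σ.injective.ne h) (Set.notMem_empty _)).mem
    | phase hS a b =>
      rw [conjP_op1]
      exact op1_zt_mem a b
    | lin i c =>
      rw [conjP_op1]
      exact (IsDiagGen.lin _ c).mem
  | one => rw [map_one]; exact one_mem _
  | mul a b _ _ ha hb => rw [map_mul]; exact mul_mem ha hb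

theorem conjP_topP (n : ℕ) (a : Q (n + 2) (n + 2)) :
    conjP (topP n) a = sw n * a * sw n := by
  have h : (topP n)⁻¹ = topP n := inv_eq_of_mul_eq_one_right (topP_mul_self n)
  rw [conjP_def, h, P_topP]

theorem q_joinLast_succ (n : ℕ) (w : Fin (n + 1) → ZMod 3) : q (joinLast (n + 1) w) =
    conjP (topP n) (ext (q (joinLast n fun i => w i.castSucc))) *
      E (Fin.last n).castSucc (Fin.last (n + 1)) (w (Fin.last n)) := by
  have h : (q (joinLast (n + 1) w) : Q (n + 2) (n + 2)) =
      sw n * (ext (q (joinLast n fun i => w i.castSucc)) *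
        (sw n * lft n (q (edge (w (Fin.last n)))))) := by
    rw [ext_def, ← q_wire]
    rfl
  rw [h, conjP_topP, E, op2_last]
  simp only [mul_assoc]

theorem q_joinLast_mem : (n : ℕ) → (w : Fin n → ZMod 3) →
    q (joinLast n w) ∈ Diag (∅ : Set (Sym2 (Fin (n + 1))))
  | 0, _ => by
    have h : q (joinLast 0 fun i => i.elim0) = (1 : Q 1 1) := q_wire
    have e : ∀ w : Fin 0 → ZMod 3, q (joinLast 0 w) = (1 : Q 1 1) := fun _ => q_wire
    rw [e]
    exact one_mem _
  | n + 1, w => by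
    rw [q_joinLast_succ]
    exact mul_mem (conjP_mem _ (ext_mem (q_joinLast_mem n _)))
      (E_mem (castSucc_ne_last _) (Set.notMem_empty _) _)

/-- An edge to the last vertex changes the weight of the corresponding edge. -/
theorem E_mul_q_joinLast : {n : ℕ} → (w : Fin n → ZMod 3) → (i : Fin n) → (v : ZMod 3) →
    E i.castSucc (Fin.last n) v * q (joinLast n w) =
      q (joinLast n (Function.update w i (v + w i)))
  | 0, _, i, _ => i.elim0
  | n + 1, w, i, v => by
    have hl := castSucc_ne_last (Fin.last n)
    refine Fin.lastCases ?_ (fun i => ?_) i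
    · have e : (fun k : Fin n => Function.update w (Fin.last n) (v + w (Fin.last n)) k.castSucc) =
          fun k => w k.castSucc := by
        funext k
        rw [Function.update_of_ne (castSucc_ne_last k)]
      have c := Diag_commute (conjP_mem (topP n) (ext_mem (q_joinLast_mem n fun k => w k.castSucc)))
        (E_mem hl (Set.notMem_empty _) v)
      rw [q_joinLast_succ, q_joinLast_succ, e, Function.update_self, ← E_mul hl, c.symm.left_comm]
    · have e : (fun k : Fin n => Function.update w i.castSucc (v + w i.castSucc) k.castSucc) =
          Function.update (fun k => w k.castSucc) i (v + w i.castSucc) := by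
        funext k
        by_cases h : k = i
        · subst h
          rw [Function.update_self, Function.update_self]
        · rw [Function.update_of_ne h, Function.update_of_ne (castSucc_ne h)]
      have hE : E i.castSucc.castSucc (Fin.last (n + 1)) v =
          conjP (topP n) (ext (E i.castSucc (Fin.last n) v)) := by
        rw [ext_E (castSucc_ne_last i), E, E, conjP_op2 _ (castSucc_ne (castSucc_ne_last i)),
          topP_castSucc_castSucc, topP_castSucc_last]
      rw [q_joinLast_succ, q_joinLast_succ, e, ← E_mul_q_joinLast,
        Function.update_of_ne (castSucc_ne_last i).symm, hE, ← mul_assoc, ← map_mul, ← map_mul]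

/-- The edges of a graph. -/
noncomputable def edges : (n : ℕ) → Matrix (Fin n) (Fin n) (ZMod 3) → Q n n
  | 0, _ => 1
  | n + 1, Γ => q (joinLast n fun i => Γ i.castSucc (Fin.last n)) *
      ext (edges n (Γ.submatrix Fin.castSucc Fin.castSucc))

theorem q_graphState : (n : ℕ) → (Γ : Matrix (Fin n) (Fin n) (ZMod 3)) →
    q (graphState n Γ) = edges n Γ • plus n
  | 0, _ => (one_smul (Q 0 0) (plus 0)).symm
  | n + 1, Γ => by
    rw [edges, plus, mul_smul, ext_smul_snoc, ← q_graphState n]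
    rfl

theorem edges_mem : (n : ℕ) → (Γ : Matrix (Fin n) (Fin n) (ZMod 3)) →
    edges n Γ ∈ Diag (∅ : Set (Sym2 (Fin n)))
  | 0, _ => one_mem _
  | n + 1, _ => mul_mem (q_joinLast_mem n _) (ext_mem (edges_mem n _))

theorem edges_zero : (n : ℕ) → edges n 0 = 1
  | 0 => rfl
  | n + 1 => by
    have h : ∀ n, q (joinLast n fun _ => 0) = 1 := by
      intro n
      induction n with
      | zero => exact q_wire
      | succ n ih => rw [q_joinLast_succ, ih, map_one, map_one, one_mul, E_zero]
    have e : edges (n + 1) 0 = q (joinLast n fun _ => 0) * ext (edges n 0) := rfl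
    rw [e, h, edges_zero n, map_one, one_mul]

/-- The graph with the weight of the edge between `i` and `j` increased by `v`. -/
def addEdge (Γ : Matrix (Fin m) (Fin m) (ZMod 3)) (i j : Fin m) (v : ZMod 3) :
    Matrix (Fin m) (Fin m) (ZMod 3) :=
  .of fun k l => Γ k l + if s(k, l) = s(i, j) then v else 0

theorem addEdge_of_eq (Γ : Matrix (Fin m) (Fin m) (ZMod 3)) {i j k l : Fin m} (v : ZMod 3)
    (h : s(k, l) = s(i, j)) : addEdge Γ i j v k l = Γ k l + v := by
  rw [addEdge, Matrix.of_apply, if_pos h]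

theorem addEdge_of_ne (Γ : Matrix (Fin m) (Fin m) (ZMod 3)) {i j k l : Fin m} (v : ZMod 3)
    (h : s(k, l) ≠ s(i, j)) : addEdge Γ i j v k l = Γ k l := by
  rw [addEdge, Matrix.of_apply, if_neg h, add_zero]

/-- Adding an edge to a graph state adds its weight to the adjacency matrix. -/
theorem E_mul_edges : {n : ℕ} → (Γ : Matrix (Fin n) (Fin n) (ZMod 3)) → (i j : Fin n) → i < j →
    (v : ZMod 3) → E i j v * edges n Γ = edges n (addEdge Γ i j v)
  | 0, _, i, _, _, _ => i.elim0
  | n + 1, Γ, i, j, hij, v => by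
    have hinj : ∀ {a b c d : Fin n}, s(a.castSucc, b.castSucc) = s(c.castSucc, d.castSucc) ↔
        s(a, b) = s(c, d) := by
      intro a b c d
      simp only [Sym2.eq_iff, Fin.castSucc_inj]
    revert hij
    refine Fin.lastCases (fun hij => ?_) (fun j hij => ?_) j
    · obtain ⟨i, rfl⟩ := Fin.exists_castSucc_eq.2 hij.ne
      have e1 : (addEdge Γ i.castSucc (Fin.last n) v).submatrix Fin.castSucc Fin.castSucc =
          Γ.submatrix Fin.castSucc Fin.castSucc := by
        ext k l
        have : s(k.castSucc, l.castSucc) ≠ s(i.castSucc, Fin.last n) := by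
          rw [Ne, Sym2.eq_iff]
          rintro (⟨-, h⟩ | ⟨h, -⟩)
          · exact castSucc_ne_last _ h
          · exact castSucc_ne_last _ h
        exact addEdge_of_ne _ _ this
      have e2 : (fun k : Fin n => addEdge Γ i.castSucc (Fin.last n) v k.castSucc (Fin.last n)) =
          Function.update (fun k : Fin n => Γ k.castSucc (Fin.last n)) i
            (v + Γ i.castSucc (Fin.last n)) := by
        funext k
        by_cases h : k = i
        · subst h
          rw [addEdge_of_eq _ _ rfl, Function.update_self, add_comm]
        · have : s(k.castSucc, Fin.last n) ≠ s(i.castSucc, Fin.last n) := by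
            rw [Ne, Sym2.eq_iff]
            rintro (⟨h', -⟩ | ⟨h', -⟩)
            · exact h (Fin.castSucc_injective _ h')
            · exact castSucc_ne_last _ h'
          rw [addEdge_of_ne _ _ this, Function.update_of_ne h]
      rw [edges, edges, e1, e2, ← mul_assoc, E_mul_q_joinLast]
    · obtain ⟨i, rfl⟩ := Fin.exists_castSucc_eq.2 (hij.trans (Fin.castSucc_lt_last j)).ne
      have hij' : i < j := Fin.castSucc_lt_castSucc_iff.1 hij
      have e1 : (addEdge Γ i.castSucc j.castSucc v).submatrix Fin.castSucc Fin.castSucc =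
          addEdge (Γ.submatrix Fin.castSucc Fin.castSucc) i j v := by
        ext k l
        simp only [addEdge, Matrix.submatrix_apply, Matrix.of_apply, hinj]
      have e2 : (fun k : Fin n => addEdge Γ i.castSucc j.castSucc v k.castSucc (Fin.last n)) =
          fun k : Fin n => Γ k.castSucc (Fin.last n) := by
        funext k
        have : s(k.castSucc, Fin.last n) ≠ s(i.castSucc, j.castSucc) := by
          rw [Ne, Sym2.eq_iff]
          rintro (⟨-, h⟩ | ⟨-, h⟩)
          · exact castSucc_ne_last _ h.symm
          · exact castSucc_ne_last _ h.symm
        exact addEdge_of_ne _ _ this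
      have c := Diag_commute (E_mem hij.ne (Set.notMem_empty _) v)
        (q_joinLast_mem n fun k => Γ k.castSucc (Fin.last n))
      rw [edges, edges, e1, e2, c.left_comm, ← ext_E hij'.ne, ← map_mul, E_mul_edges _ _ _ hij']

theorem isAdjacency_addEdge {Γ : Matrix (Fin m) (Fin m) (ZMod 3)} (h : IsAdjacency Γ) {i j : Fin m}
    (hij : i ≠ j) (v : ZMod 3) : IsAdjacency (addEdge Γ i j v) := by
  refine ⟨?_, fun k => ?_⟩
  · ext k l
    rw [Matrix.transpose_apply, addEdge, Matrix.of_apply, Matrix.of_apply, h.1.apply,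
      Sym2.eq_swap (a := k) (b := l)]
  · have : s(k, k) ≠ s(i, j) := by
      rw [Ne, Sym2.eq_iff]
      rintro (⟨h1, h2⟩ | ⟨h1, h2⟩)
      · exact hij (h1.symm.trans h2)
      · exact hij (h2.symm.trans h1)
    rw [addEdge_of_ne _ _ this, h.2 k]

theorem par_succ (n : ℕ) (U : Fin (n + 1) → Q 1 1) :
    par (n + 1) U = ext (par n fun i => U i.castSucc) * op1 (Fin.last n) (U (Fin.last n)) := by
  rw [op1_last]
  exact tens_eq_right _ _

theorem par_zt_mem : {n : ℕ} → (W : Fin n → Q 1 1) → (∀ i, ∃ a b, W i = zt a b) →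
    par n W ∈ Diag (∅ : Set (Sym2 (Fin n)))
  | 0, _, _ => one_mem _
  | n + 1, W, h => by
    obtain ⟨a, b, e⟩ := h (Fin.last n)
    rw [par_succ, e]
    exact mul_mem (ext_mem (par_zt_mem _ fun i => h i.castSucc)) (op1_zt_mem a b)

/-- A diagonal operation is a product of edges and phases. -/
theorem exists_edges_mul_par {T : Finset (Fin m)} {d : Q m m} (hd : d ∈ Diag (pairs T)) :
    ∃ Γ, IsAdjacency Γ ∧ (∀ i ∈ T, ∀ j ∈ T, Γ i j = 0) ∧ ∃ W : Fin m → Q 1 1,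
      (∀ i, ∃ a b, W i = zt a b) ∧ (∀ i ∈ T, ∃ c, W i = lz c) ∧ d = edges m Γ * par m W := by
  induction hd using Submonoid.closure_induction_left with
  | one =>
    refine ⟨0, ⟨Matrix.isSymm_zero, fun _ => rfl⟩, fun _ _ _ _ => rfl, fun _ => 1,
      fun _ => ⟨0, 0, zt_zero.symm⟩, fun _ _ => ⟨0, lz_zero.symm⟩, ?_⟩
    rw [edges_zero, par_one, one_mul]
  | mul_left g hg d _ ih =>
    obtain ⟨Γ, h1, h2, W, h3, h4, rfl⟩ := ih
    have phase : ∀ (i : Fin m) (a b : ZMod 3), (i ∈ T → ∃ c, zt a b = lz c) →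
        ∃ Γ', IsAdjacency Γ' ∧ (∀ i ∈ T, ∀ j ∈ T, Γ' i j = 0) ∧ ∃ W' : Fin m → Q 1 1,
          (∀ i, ∃ a b, W' i = zt a b) ∧ (∀ i ∈ T, ∃ c, W' i = lz c) ∧
            op1 i (zt a b) * (edges m Γ * par m W) = edges m Γ' * par m W' := by
      intro i a b hi
      refine ⟨Γ, h1, h2, Function.update W i (zt a b * W i), fun j => ?_, fun j hj => ?_, ?_⟩
      · by_cases hji : j = i
        · subst hji
          obtain ⟨c, d, e⟩ := h3 j
          exact ⟨a + c, b + d, by rw [Function.update_self, e, zt_mul]⟩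
        · rw [Function.update_of_ne hji]
          exact h3 j
      · by_cases hji : j = i
        · subst hji
          obtain ⟨c, e⟩ := hi hj
          obtain ⟨c', e'⟩ := h4 j hj
          exact ⟨c + c', by rw [Function.update_self, e, e', lz_mul]⟩
        · rw [Function.update_of_ne hji]
          exact h4 j hj
      · rw [← op1_mul_par, (Diag_commute_zt (edges_mem m Γ) i a b).symm.left_comm]
    cases hg with
    | @edge i j hij hS =>
      have key : ∀ {i j : Fin m}, i < j → s(i, j) ∉ pairs T → ∃ Γ', IsAdjacency Γ' ∧
          (∀ i ∈ T, ∀ j ∈ T, Γ' i j = 0) ∧ E i j 1 * edges m Γ = edges m Γ' := by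
        intro i j hij hS
        refine ⟨_, isAdjacency_addEdge h1 hij.ne 1, fun k hk l hl => ?_, E_mul_edges Γ i j hij 1⟩
        have : s(k, l) ≠ s(i, j) := fun h => hS (h ▸ mem_pairs.2 ⟨hk, hl⟩)
        rw [addEdge_of_ne _ _ this, h2 k hk l hl]
      have key' : ∃ Γ', IsAdjacency Γ' ∧
          (∀ i ∈ T, ∀ j ∈ T, Γ' i j = 0) ∧ C i j had * edges m Γ = edges m Γ' := by
        rcases lt_or_gt_of_ne hij with h | h
        · rw [← E_one]
          exact key h hS
        · rw [← E_one, E_symm hij]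
          exact key h (by rwa [Sym2.eq_swap])
      obtain ⟨Γ', h1', h2', e⟩ := key'
      exact ⟨Γ', h1', h2', W, h3, h4, by rw [← mul_assoc, e]⟩
    | @phase i hS a b => exact phase i a b fun hi => absurd (mem_pairs_self.2 hi) hS
    | lin i c => exact phase i c (2 * c) fun _ => ⟨c, rfl⟩

/-- Local Clifford operations on diagonal states. -/
def CliffState (m : ℕ) : Set (Q 0 m) :=
  {s | ∃ U : Fin m → Q 1 1, (∀ i, U i ∈ Loc) ∧ ∃ t ∈ DiagState ∅, s = par m U • t}

theorem q_parallel : (n : ℕ) → (U : Fin n → ZX 1 1) → q (parallel n U) = par n fun i => q (U i)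
  | 0, _ => rfl
  | n + 1, U => by
    rw [par, ← q_parallel n]
    rfl

/-! ### Reduced diagrams -/

/-- All Hadamard nodes on an independent set of wires can be given the same green phase. -/
theorem exists_uniform {T : Finset (Fin m)} {V : Fin m → Q 1 1} (hV : IsHOn T V) {s : Q 0 m}
    (hs : s ∈ DiagState (pairs T)) : ∃ s' ∈ DiagState (pairs T),
      par m V • s = par m (fun i => if i ∈ T then zt 1 1 * had else 1) • s' := by
  have key : ∀ F : Finset (Fin m), F ⊆ T → ∃ V', IsHOn T V' ∧ (∀ i ∈ F, V' i = zt 1 1 * had) ∧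
      ∃ s' ∈ DiagState (pairs T), par m V • s = par m V' • s' := by
    intro F
    induction F using Finset.induction_on with
    | empty => exact fun _ => ⟨V, hV, fun i hi => absurd hi (Finset.notMem_empty i), s, hs, rfl⟩
    | insert t F ht ih =>
      intro hF
      obtain ⟨V', h1, h2, s', h3, e⟩ := ih fun i hi => hF (Finset.mem_insert_of_mem hi)
      have htT := hF (Finset.mem_insert_self t F)
      obtain ⟨r, hr⟩ := h1.2 t htT
      have hx : ∃ x : Q 1 1, zt r r * had = zt 1 1 * had * x ∧
          op1 t x • s' ∈ DiagState (pairs T) := by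
        rcases zmod_three r with rfl | rfl | rfl
        · exact ⟨xx, zt_mul_had_eq 0, xx_smul_mem htT h3⟩
        · exact ⟨1, (mul_one _).symm, by rwa [map_one, one_smul]⟩
        · refine ⟨xx * xx, ?_, ?_⟩
          · rw [zt_mul_had_eq, zt_mul_had_eq, mul_assoc]
            rfl
          · rw [map_mul, mul_smul]
            exact xx_smul_mem htT (xx_smul_mem htT h3)
      obtain ⟨x, hx1, hx2⟩ := hx
      refine ⟨Function.update V' t (zt 1 1 * had), ⟨fun k hk => ?_, fun k hk => ?_⟩,
        fun k hk => ?_, _, hx2, ?_⟩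
      · rw [Function.update_of_ne (fun h => hk (by rwa [h]))]
        exact h1.1 k hk
      · by_cases hkt : k = t
        · subst hkt
          exact ⟨1, Function.update_self _ _ _⟩
        · rw [Function.update_of_ne hkt]
          exact h1.2 k hk
      · by_cases hkt : k = t
        · subst hkt
          exact Function.update_self _ _ _
        · rw [Function.update_of_ne hkt]
          exact h2 k (Finset.mem_of_mem_insert_of_ne hk hkt)
      · rw [e, par_eq V' t, hr, hx1, map_mul, ← mul_assoc, par_update_mul_op1, mul_smul]
  obtain ⟨V', h1, h2, s', h3, e⟩ := key T (Finset.Subset.refl T)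
  refine ⟨s', h3, e.trans ?_⟩
  congr 2
  funext i
  by_cases hi : i ∈ T
  · rw [if_pos hi, h2 i hi]
  · rw [if_neg hi, h1.1 i hi]

theorem isThird_third (k : ZMod 3) : IsThird (third k) := isThird_iff.2 ⟨k, rfl⟩

/-- Every locally Clifford equivalent of a diagonal state is a reduced GS-LC diagram. -/
theorem exists_reduced {s : Q 0 m} (hs : s ∈ CliffState m) :
    ∃ R : ZX 0 m, R.IsReducedGSLC ∧ q R = s := by
  obtain ⟨U, hU, t, ht, rfl⟩ := hs
  obtain ⟨V, hV, t', ht', e⟩ := exists_isH_par U hU ht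
  classical
  have hVT : IsHOn (Finset.univ.filter fun i => V i ≠ 1) V := by
    refine ⟨fun i hi => ?_, fun i hi => ?_⟩
    · by_contra h
      exact hi (Finset.mem_filter.2 ⟨Finset.mem_univ i, h⟩)
    · exact (hV i).resolve_left (Finset.mem_filter.1 hi).2
  obtain ⟨T, V', hV', t'', ht'', e'⟩ := exists_independent _ V hVT ht'
  obtain ⟨_, ⟨d, hd, rfl⟩, e''⟩ := exists_uniform hV' ht''
  obtain ⟨Γ, h1, h2, W, h3, h4, rfl⟩ := exists_edges_mul_par hd
  choose a b hab using h3
  have h4' : ∀ i, ∃ c, i ∈ T → W i = lz c := fun i => by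
    by_cases hi : i ∈ T
    · obtain ⟨c, hc⟩ := h4 i hi
      exact ⟨c, fun _ => hc⟩
    · exact ⟨0, fun h => absurd h hi⟩
  choose c hc using h4'
  -- on `T`, the operation `zt 1 1 * had * lz (c i)` is an admissible red vertex operator with
  -- `p = 2`: the factor `zt 1 1` cancels a green node of the Euler decomposition of `had`
  set R : Fin m → ZX 1 1 := fun i => if i ∈ T then
    Z 1 1 (third (2 + c i)) (third (2 + 2 * c i)) ⨾ X 1 1 (third 2) (third 2) else
    Z 1 1 (third (a i)) (third (b i)) with hR
  have hred : ∀ i, HasRed (R i) → i ∈ T := by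
    intro i h
    by_contra hi
    simp only [hR, if_neg hi, HasRed] at h
  refine ⟨gslc Γ R, ⟨Γ, R, h1, fun i => ?_, fun i => ?_, fun i j hij h => ?_, rfl⟩, ?_⟩
  · by_cases hi : i ∈ T
    · simp only [hR, if_pos hi]
      exact .comp (.Z (isThird_third _) (isThird_third _)) (.X (isThird_third _) (isThird_third _))
    · simp only [hR, if_neg hi]
      exact .Z (isThird_third _) (isThird_third _)
  · by_cases hi : i ∈ T
    · simp only [hR, if_pos hi]
      exact Or.inr ⟨2, c i, by decide, rfl⟩
    · simp only [hR, if_neg hi]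
      exact Or.inl ⟨a i, b i, rfl⟩
  · exact hij (h2 i (hred i h.1) j (hred j h.2))
  · have hc1 := Diag_commute (edges_mem m Γ) (par_zt_mem W fun i => ⟨a i, b i, hab i⟩)
    rw [e, e', e'', hc1.eq, ← mul_smul, ← mul_assoc, par_mul, mul_smul, ← q_graphState, gslc,
      q_comp,
      q_parallel, smul_def]
    congr 2
    funext i
    by_cases hi : i ∈ T
    · have e1 : zt 1 1 * had * lz (c i) = xx * (zz * lz (c i)) := by
        rw [had_eq, ← mul_assoc, inv_mul_zz, one_mul, mul_assoc]
      have e2 : q (R i) = q (X 1 1 (third 2) (third 2)) * zt (2 + c i) (2 + 2 * c i) := by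
        simp only [hR, if_pos hi]
        rfl
      rw [if_pos hi, hc i hi, e1, e2, q_X_two, zz, lz, zt_mul]
    · have e2 : q (R i) = zt (a i) (b i) := by
        simp only [hR, if_neg hi]
        rfl
      rw [if_neg hi, one_mul, e2, hab]

variable {m : ℕ}

/-! ### Deleting a wire -/

/-- Products of local Clifford operations at single wires. -/
noncomputable def LocOps (m : ℕ) : Submonoid (Q m m) :=
  Submonoid.closure {x | ∃ i : Fin m, ∃ f ∈ Loc, x = op1 i f}

theorem op1_mem_LocOps (i : Fin m) {f : Q 1 1} (hf : f ∈ Loc) : op1 i f ∈ LocOps m :=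
  Submonoid.subset_closure ⟨i, f, hf, rfl⟩

theorem ext_mem_LocOps {u : Q m m} (hu : u ∈ LocOps m) : ext u ∈ LocOps (m + 1) := by
  induction hu using Submonoid.closure_induction with
  | mem g hg =>
    obtain ⟨i, f, hf, rfl⟩ := hg
    rw [ext_op1]
    exact op1_mem_LocOps _ hf
  | one => rw [map_one]; exact one_mem _
  | mul a b _ _ ha hb => rw [map_mul]; exact mul_mem ha hb

theorem par_mem_LocOps : {n : ℕ} → (U : Fin n → Q 1 1) → (∀ i, U i ∈ Loc) → par n U ∈ LocOps n
  | 0, _, _ => one_mem _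
  | n + 1, U, h => by
    rw [par_succ]
    exact mul_mem (ext_mem_LocOps (par_mem_LocOps _ fun i => h i.castSucc))
      (op1_mem_LocOps _ (h (Fin.last n)))

theorem LocOps_smul_mem {u : Q m m} (hu : u ∈ LocOps m) {s : Q 0 m} (hs : s ∈ CliffState m) :
    u • s ∈ CliffState m := by
  induction hu using Submonoid.closure_induction generalizing s with
  | mem g hg =>
    obtain ⟨i, f, hf, rfl⟩ := hg
    obtain ⟨U, hU, t, ht, rfl⟩ := hs
    refine ⟨Function.update U i (f * U i), fun j => ?_, t, ht, by rw [← op1_mul_par, mul_smul]⟩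
    by_cases h : j = i
    · subst h
      rw [Function.update_self]
      exact mul_mem hf (hU j)
    · rw [Function.update_of_ne h]
      exact hU j
  | one => rwa [one_smul]
  | mul a b _ _ ha hb =>
    rw [mul_smul]
    exact ha (hb hs)

theorem mem_CliffState {s : Q 0 m} :
    s ∈ CliffState m ↔ ∃ u ∈ LocOps m, ∃ t ∈ DiagState ∅, s = u • t := by
  constructor
  · rintro ⟨U, hU, t, ht, rfl⟩
    exact ⟨_, par_mem_LocOps U hU, t, ht, rfl⟩
  · rintro ⟨u, hu, t, ht, rfl⟩
    exact LocOps_smul_mem hu ⟨fun _ => 1, fun _ => one_mem _, t, ht, by rw [par_one, one_smul]⟩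

/-- Classes of diagrams with vanishing interpretation. -/
def IsZero {n m : ℕ} (A : Q n m) : Prop := ∃ D, q D = A ∧ interp D = 0

theorem IsZero.comp {n m k : ℕ} {A : Q n m} (h : IsZero A) (B : Q m k) : IsZero (A ⟫ B) := by
  obtain ⟨D, rfl, hD⟩ := h
  obtain ⟨F, rfl⟩ := q_surj B
  exact ⟨D ⨾ F, rfl, by rw [interp, hD, Matrix.mul_zero]⟩

theorem IsZero.tens_left {n m n' m' : ℕ} {A : Q n m} (h : IsZero A) (B : Q n' m') :
    IsZero (B ◎ A) := by
  obtain ⟨D, rfl, hD⟩ := h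
  obtain ⟨F, rfl⟩ := q_surj B
  refine ⟨F ⊠ D, rfl, ?_⟩
  ext o i
  simp [interp, hD]

/-- The states that the theorem is about, and zero. -/
def Stab (m : ℕ) : Set (Q 0 m) := {s | s ∈ CliffState m ∨ IsZero s}

theorem LocOps_smul_Stab {u : Q m m} (hu : u ∈ LocOps m) {s : Q 0 m} (hs : s ∈ Stab m) :
    u • s ∈ Stab m :=
  hs.imp (LocOps_smul_mem hu) fun h => h.comp u

/-- Deletion of the last wire of a state. -/
noncomputable def drop (s : Q 0 (m + 1)) : Q 0 m :=
  Q.comp (m := m + 1) (k := m) s ((1 : Q m m) ◎ gef)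

theorem drop_ext (a : Q m m) (s : Q 0 (m + 1)) : drop (ext a • s) = a • drop s := by
  have h : Q.comp (m := m + 1) (k := m) (ext a) ((1 : Q m m) ◎ gef) =
      Q.comp (m := m) ((1 : Q m m) ◎ gef) a := by
    have h1 := interchange a (1 : Q m m) (1 : Q 1 1) gef
    have h2 := interchange (1 : Q m m) a gef (1 : Q 0 0)
    rw [comp_one, one_comp] at h1
    rw [comp_one, one_comp] at h2
    rw [tens_zero a] at h2
    exact h1.symm.trans h2
  rw [drop, drop, smul_def, smul_def, comp_assoc, h, comp_assoc]

theorem rst_comp_gef : rst ⟫ gef = gef := by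
  rw [rst, comp_assoc, comp_scalar]

theorem drop_B (s : Q 0 (m + 1)) : drop (B (Fin.last m) • s) = drop s := by
  have h : Q.comp (m := m + 1) (k := m) (lft m rst) ((1 : Q m m) ◎ gef) =
      (1 : Q m m) ◎ gef := by
    have h1 := interchange (1 : Q m m) (1 : Q m m) rst gef
    rw [comp_one, rst_comp_gef] at h1
    exact h1.symm
  rw [drop, drop, smul_def, comp_assoc, B_last, h]

theorem drop_congr {f g : Q 1 1} (h : rst * f = rst * g) (s : Q 0 (m + 1)) :
    drop (op1 (Fin.last m) f • s) = drop (op1 (Fin.last m) g • s) := by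
  rw [← drop_B, ← drop_B (op1 (Fin.last m) g • s), ← mul_smul, ← mul_smul, B, ← map_mul, ← map_mul,
    h]

theorem drop_snoc (s : Q 0 m) (t : Q 0 1) : drop (snoc s t) = s ◎ (t ⟫ gef) := by
  have h := interchange s (1 : Q m m) t gef
  rw [comp_one] at h
  exact h.symm

/-- The transpose of `CX_mul_B`, proved on a cap: summing over the target undoes the shift. -/
theorem B_mul_CX {a b : Fin m} (hab : a ≠ b) : B b * CX a b = B b := by
  refine bell_cancel (b := b) ?_
  rw [map_mul, ext_CX hab, ext_B]
  have had := castSucc_ne_last a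
  have hbd := castSucc_ne_last b
  have hab := castSucc_ne hab
  generalize a.castSucc = a at *
  generalize b.castSucc = b at *
  set d := Fin.last m
  have h := D_mul_B_mul_CX hab had hbd
  have c1 : Commute (CX a b) (B d) := CX_commute_op1 hab had hbd _
  have c2 : Commute (CX a d) (B b) := CX_commute_op1 had hab hbd.symm _
  have e1 : P (Equiv.swap b d) * CX a b = CX a d * P (Equiv.swap b d) := by
    rw [CX, CX]
    simp only [mul_assoc]
    rw [← mul_assoc, P_mul_op1, mul_assoc, ← mul_assoc (P _), C, P_mul_op2 _ hab, mul_assoc,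
      P_mul_op1,
      Equiv.swap_apply_left, Equiv.swap_apply_of_ne_of_ne hab had]
    rfl
  have c3 : Commute (CX a b) (CX a d) := by
    refine (CX_commute_op1 hab had hbd _).mul_right (Commute.mul_right ?_
      (CX_commute_op1 hab had hbd _))
    exact (C_commute_op1 had hab.symm hbd _ _).symm.mul_left ((C_commute_C hab had _ _).mul_left
      (C_commute_op1 had hab.symm hbd _ _).symm)
  have h1 : CX a d * (B b * (D b d * B d)) = CX a d * (B b * (CX a b * (D b d * B d))) := by
    rw [B_mul_D_mul_B hbd, ← mul_assoc, ← e1, mul_assoc, c1.eq, ← mul_assoc,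
      ← B_mul_D_mul_B hbd, mul_assoc, mul_assoc, h, c3.left_comm, c2.left_comm]
  have h2 : B b * (D b d * B d) = B b * (CX a b * (D b d * B d)) := by
    have h3 := congrArg (CY a d * ·) h1
    rw [← mul_assoc, ← mul_assoc (CY a d), CY_mul_CX had, one_mul, one_mul] at h3
    exact h3
  rw [(B_commute b d).eq]
  have h4 := congrArg (· * B b) h2
  simp only [mul_assoc] at h4
  rw [mul_assoc]
  exact h4.symm

theorem B_mul_CY {a b : Fin m} (hab : a ≠ b) : B b * CY a b = B b := by
  conv_lhs => rw [← B_mul_CX hab]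
  rw [mul_assoc, CX_mul_CY hab, mul_one]

/-- The red effect deletes the edges at a wire. -/
theorem B_mul_had_mul_C {a b : Fin m} (hab : a ≠ b) :
    B b * (op1 b had * C a b had) = B b * op1 b had := by
  have e : op1 b had * C a b had = CY a b * op1 b had := by
    rw [CY_eq hab]
    simp only [mul_assoc]
    rw [op1_hdag_mul_had, mul_one]
  rw [e, ← mul_assoc, B_mul_CY hab]

/-- The red effect restricts a diagonal operation to the other wires. -/
theorem exists_restrict {d : Q (m + 1) (m + 1)} (hd : d ∈ Diag ∅) :
    ∃ d' ∈ Diag (∅ : Set (Sym2 (Fin m))),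
      B (Fin.last m) * (op1 (Fin.last m) had * d) =
        ext d' * (B (Fin.last m) * op1 (Fin.last m) had) := by
  have key : ∀ {d : Q (m + 1) (m + 1)} {d' : Q m m}, d = ext d' →
      B (Fin.last m) * (op1 (Fin.last m) had * d) =
        ext d' * (B (Fin.last m) * op1 (Fin.last m) had) := by
    rintro d d' rfl
    have c1 : Commute (ext d') (B (Fin.last m)) := ext_commute_op1 _ _
    have c2 : Commute (ext d') (op1 (Fin.last m) had) := ext_commute_op1 _ _
    rw [← c2.eq, ← c1.left_comm]
  have triv : ∀ {d : Q (m + 1) (m + 1)}, B (Fin.last m) * (op1 (Fin.last m) had * d) =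
      B (Fin.last m) * op1 (Fin.last m) had → ∃ d' ∈ Diag (∅ : Set (Sym2 (Fin m))),
      B (Fin.last m) * (op1 (Fin.last m) had * d) =
        ext d' * (B (Fin.last m) * op1 (Fin.last m) had) := fun h =>
    ⟨1, one_mem _, by rw [h, map_one, one_mul]⟩
  have phase : ∀ (i : Fin (m + 1)) (a b : ZMod 3), ∃ d' ∈ Diag (∅ : Set (Sym2 (Fin m))),
      B (Fin.last m) * (op1 (Fin.last m) had * op1 i (zt a b)) =
        ext d' * (B (Fin.last m) * op1 (Fin.last m) had) := by
    intro i a b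
    refine Fin.lastCases ?_ (fun i => ?_) i
    · refine triv ?_
      rw [B, ← map_mul, ← map_mul, ← map_mul, zt, rst_mul_had_mul_zph]
    · exact ⟨_, op1_zt_mem (i := i) a b, key (ext_op1 _ _).symm⟩
  induction hd using Submonoid.closure_induction with
  | mem g hg =>
    cases hg with
    | @edge i j h hS =>
      revert h
      refine Fin.lastCases (fun h => ?_) (fun j => ?_) j
      · exact triv (B_mul_had_mul_C h)
      · refine Fin.lastCases (fun h => ?_) (fun i h => ?_) i
        · rw [C_symm h isTr_had]
          exact triv (B_mul_had_mul_C h.symm)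
        · have h' : i ≠ j := fun e => h (by rw [e])
          exact ⟨_, (IsDiagGen.edge h' (Set.notMem_empty _)).mem, key (ext_C h' _).symm⟩
    | phase hS a b => exact phase _ a b
    | lin i c => exact phase i c (2 * c)
  | one => exact triv (by rw [mul_one])
  | mul a b _ _ ha hb =>
    obtain ⟨a', ha', ea⟩ := ha
    obtain ⟨b', hb', eb⟩ := hb
    refine ⟨a' * b', mul_mem ha' hb', ?_⟩
    calc _ = B (Fin.last m) * (op1 (Fin.last m) had * a) * b := by simp only [mul_assoc]
      _ = ext a' * (B (Fin.last m) * (op1 (Fin.last m) had * b)) := by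
          rw [ea]
          simp only [mul_assoc]
      _ = _ := by rw [eb, map_mul, mul_assoc]

theorem DiagState_subset {s : Q 0 m} (hs : s ∈ DiagState ∅) : s ∈ CliffState m :=
  mem_CliffState.2 ⟨1, one_mem _, s, hs, (one_smul _ s).symm⟩

theorem sum_fin_one (f : (Fin 1 → Fin 3) → ℂ) : ∑ x, f x = ∑ j : Fin 3, f (fun _ => j) :=
  Fintype.sum_equiv (Equiv.funUnique (Fin 1) (Fin 3)) f (fun j => f (fun _ => j))
    fun x => congrArg f (funext fun i => by rw [Subsingleton.elim i 0]; rfl)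

theorem interp_rdef : interp (Z 0 1 0 0 ⨾ H ⨾ Z 1 0 0 0) ≠ 0 := by
  intro h
  have h1 := congrFun (congrFun h (fun i => i.elim0)) (fun i => i.elim0)
  have h4 : 1 + ω ^ 2 + ω ^ 4 = 0 := by
    linear_combination omega_sum + ω * omega_cube
  have h3 := omega_sum
  simp [interp, Matrix.mul_apply, phase, sum_fin_one, Fin.sum_univ_three] at h1
  have h5 : (3 : ℂ) = 0 := by
    linear_combination h1 - h3 - h4
  norm_num at h5

/-- Deleting a wire behind a Hadamard node projects it to `|0⟩`, where its edges and phases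
disappear. -/
theorem drop_had_mem {s : Q 0 (m + 1)} (hs : s ∈ DiagState ∅) :
    drop (op1 (Fin.last m) had • s) ∈ CliffState m := by
  obtain ⟨d, hd, rfl⟩ := hs
  obtain ⟨d', hd', e⟩ := exists_restrict hd
  have h : drop (op1 (Fin.last m) had • plus (m + 1)) = plus m := by
    rw [plus, op1_last_smul_snoc, drop_snoc]
    exact drop_right (plus m) _ interp_rdef
  rw [← drop_B, ← mul_smul, ← mul_smul, mul_assoc, e, mul_smul, mul_smul, drop_ext, drop_B, h]
  exact DiagState_subset ⟨d', hd', rfl⟩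

theorem rst_mul_zz : rst * zz = rst * (had * (xx * xx)) := by
  calc rst * zz = rst * (xx * (zz * (xx * (xx * xx)))) := by
        rw [xx_cube, mul_one, ← mul_assoc, rst_mul_xx]
    _ = _ := by
        conv_rhs => rw [had_eq']
        simp only [mul_assoc]

theorem rst_mul_zt_one : rst * zt 1 1 = rst * (had * (neg * xx)) := by
  have h : hdag * xx = xx * xx * zt 1 1 := by
    have e : had * (xx * xx * zt 1 1 * (xx * xx)) = 1 := by
      calc had * (xx * xx * zt 1 1 * (xx * xx)) =
          xx * zz * (xx * (xx * xx)) * (zt 1 1 * (xx * xx)) := by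
            conv_lhs => rw [had_eq']
            simp only [mul_assoc]
        _ = 1 := by rw [xx_cube, mul_one, mul_assoc, ← mul_assoc zz, zz_mul_inv, one_mul, xx_cube]
    calc hdag * xx = hdag * (had * (xx * xx * zt 1 1 * (xx * xx))) * xx := by rw [e, mul_one]
      _ = (hdag * had) * (xx * xx * zt 1 1) * (xx * (xx * xx)) := by simp only [mul_assoc]
      _ = _ := by rw [hdag_mul_had, xx_cube, one_mul, mul_one]
  rw [← mul_assoc had, had_mul_neg, h, ← mul_assoc, ← mul_assoc, rst_mul_xx, rst_mul_xx]

/-- A quadratic phase in front of the green effect is exchanged for a Hadamard node and red phases,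
and the red phases are absorbed by local complementation. -/
theorem drop_phase_mem {w : ZMod 3} (hw : w ≠ 0) {s : Q 0 (m + 1)}
    (hs : s ∈ DiagState (pairs {Fin.last m})) :
    drop (op1 (Fin.last m) (zt w w) • s) ∈ CliffState m := by
  have hl : Fin.last m ∈ ({Fin.last m} : Finset (Fin (m + 1))) := Finset.mem_singleton_self _
  have hx := xx_smul_mem hl hs
  have h0 : ∀ {s : Q 0 (m + 1)}, s ∈ DiagState (pairs {Fin.last m}) → s ∈ DiagState ∅ :=
    fun h => DiagState_mono (Set.empty_subset _) h
  rcases zmod_three w with rfl | rfl | rfl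
  · exact absurd rfl hw
  · rw [drop_congr rst_mul_zt_one, map_mul, mul_smul, map_mul, mul_smul]
    exact drop_had_mem (neg_smul_mem _ (h0 hx))
  · have e := rst_mul_zz
    rw [zz] at e
    rw [drop_congr e, map_mul, mul_smul, map_mul, mul_smul]
    exact drop_had_mem (h0 (xx_smul_mem hl hx))

theorem xx_mem_Loc : xx ∈ Loc :=
  mul_mem (mul_mem had_mem_Loc (zt_mem_Loc 2 2)) hdag_mem_Loc

/-- An isolated wire factors out of a diagonal operation. -/
theorem exists_isolated {S : Set (Sym2 (Fin (m + 1)))} (hS : ∀ i, s(i, Fin.last m) ∈ S)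
    {d : Q (m + 1) (m + 1)} (hd : d ∈ Diag S) :
    ∃ d' ∈ Diag (∅ : Set (Sym2 (Fin m))), ∃ c, d = ext d' * op1 (Fin.last m) (lz c) := by
  have key : ∀ {d' : Q m m}, d' ∈ Diag (∅ : Set (Sym2 (Fin m))) →
      ∃ e' ∈ Diag (∅ : Set (Sym2 (Fin m))), ∃ c, ext d' = ext e' * op1 (Fin.last m) (lz c) :=
    fun {d'} h => ⟨d', h, 0, by rw [lz_zero, map_one, mul_one]⟩
  induction hd using Submonoid.closure_induction with
  | mem g hg =>
    cases hg with
    | @edge i j h hij =>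
      have hj : j ≠ Fin.last m := fun e => hij (e ▸ hS i)
      have hi : i ≠ Fin.last m := fun e => hij (Sym2.eq_swap ▸ e ▸ hS j)
      obtain ⟨i, rfl⟩ := Fin.exists_castSucc_eq.2 hi
      obtain ⟨j, rfl⟩ := Fin.exists_castSucc_eq.2 hj
      have h' : i ≠ j := fun e => h (by rw [e])
      rw [← ext_C h']
      exact key (IsDiagGen.edge h' (Set.notMem_empty _)).mem
    | @phase i hi a b =>
      obtain ⟨i, rfl⟩ := Fin.exists_castSucc_eq.2 (fun e => hi (e ▸ hS i) : i ≠ Fin.last m)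
      rw [← ext_op1]
      exact key (op1_zt_mem a b)
    | lin i c =>
      refine Fin.lastCases ?_ (fun i => ?_) i
      · exact ⟨1, one_mem _, c, by rw [map_one, one_mul]⟩
      · rw [← ext_op1]
        exact key (IsDiagGen.lin i c).mem
  | one => exact ⟨1, one_mem _, 0, by rw [lz_zero, map_one, map_one, one_mul]⟩
  | mul a b _ _ ha hb =>
    obtain ⟨a', ha', c, rfl⟩ := ha
    obtain ⟨b', hb', c', rfl⟩ := hb
    refine ⟨a' * b', mul_mem ha' hb', c + c', ?_⟩
    have c1 : Commute (ext b') (op1 (Fin.last m) (lz c)) := ext_commute_op1 _ _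
    rw [← lz_mul, map_mul, map_mul, mul_assoc, ← mul_assoc (op1 _ _), ← c1.eq]
    simp only [mul_assoc]

theorem toCircle_third (k : ZMod 3) : ((third k).toCircle : ℂ) = ω ^ k.val := by
  rw [third, Real.Angle.toCircle_coe, Circle.coe_exp, ω, ← Complex.exp_nat_mul]
  congr 1
  push_cast
  ring

theorem interp_lz {c : ZMod 3} (hc : c ≠ 0) :
    interp (Z 0 1 0 0 ⨾ Z 1 1 (third c) (third (2 * c)) ⨾ Z 1 0 0 0) = 0 := by
  ext o i
  have h3 := omega_sum
  rcases zmod_three c with rfl | rfl | rfl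
  · exact absurd rfl hc
  · have h1 : (1 : ZMod 3).val = 1 := rfl
    have h2 : (2 : ZMod 3).val = 2 := rfl
    simp [interp, Matrix.mul_apply, phase, sum_fin_one, Fin.sum_univ_three, toCircle_third, h1, h2]
    linear_combination h3
  · have h1 : (2 : ZMod 3).val = 2 := rfl
    have h2 : (2 * 2 : ZMod 3).val = 1 := rfl
    simp [interp, Matrix.mul_apply, phase, sum_fin_one, Fin.sum_univ_three, toCircle_third, h1, h2]
    linear_combination h3

/-- There are three cases: the wire carries a quadratic phase; it has no quadratic phase but an
edge; it is isolated, and then a non-trivial linear phase gives zero. -/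
theorem drop_DiagState {s : Q 0 (m + 1)} (hs : s ∈ DiagState ∅) : drop s ∈ Stab m := by
  obtain ⟨d, hd, rfl⟩ := hs
  set l := Fin.last m
  have hll : ∀ {S : Set (Sym2 (Fin (m + 1)))}, s(l, l) ∈ S → pairs {l} ⊆ S := fun {S} h p hp => by
    induction p with
    | _ i j =>
      obtain ⟨hi, hj⟩ := mem_pairs.1 hp
      rwa [Finset.mem_singleton.1 hi, Finset.mem_singleton.1 hj]
  obtain ⟨w, e, he, rfl⟩ := exists_zt_mul hd l
  by_cases hw : w = 0
  · rw [hw, zt_zero, map_one, one_mul]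
    set F : Finset (Sym2 (Fin (m + 1))) := Finset.univ.image fun i => s(i, l)
    rcases mem_or_exists_part F he with hd | ⟨p, hp, g, hg, e, he', rfl⟩
    · obtain ⟨d', hd', c, rfl⟩ := exists_isolated (fun i => Or.inr
        (Finset.mem_coe.2 (Finset.mem_image_of_mem _ (Finset.mem_univ i)))) hd
      rw [mul_smul, drop_ext, plus, op1_last_smul_snoc, drop_snoc]
      by_cases hc : c = 0
      · left
        rw [hc, lz_zero, comp_one, tens_scalar]
        exact DiagState_subset ⟨d', hd', rfl⟩
      · right
        have h : IsZero (gst ⟫ lz c ⟫ gef) := ⟨_, rfl, interp_lz hc⟩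
        exact (h.tens_left (plus m)).comp (n := 0) (m := m) d'
    · left
      have hlS : s(l, l) ∈ insert p (insert s(l, l) (∅ : Set (Sym2 (Fin (m + 1))))) :=
        Or.inr (Or.inl rfl)
      have edge : ∀ {i j : Fin (m + 1)} {w : ZMod 3}, i ≠ j → w ≠ 0 → s(i, j) = p → i = l →
          drop ((E i j w * e) • plus (m + 1)) ∈ CliffState m := by
        rintro i j w hij hw rfl rfl
        obtain ⟨j, rfl⟩ := Fin.exists_castSucc_eq.2 hij.symm
        obtain ⟨r, e, he1, rfl⟩ := exists_zt_mul he' j.castSucc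
        have hs : e • plus (m + 1) ∈ DiagState (pairs {l, j.castSucc}) := by
          refine ⟨e, Diag_mono (fun p hp => ?_) he1, rfl⟩
          induction p with
          | _ a b =>
            obtain ⟨ha, hb⟩ := mem_pairs.1 hp
            simp only [Finset.mem_insert, Finset.mem_singleton] at ha hb
            rcases ha with rfl | rfl <;> rcases hb with rfl | rfl
            · exact Or.inr (Or.inr (Or.inl rfl))
            · exact Or.inr (Or.inl rfl)
            · exact Or.inr (Or.inl Sym2.eq_swap)
            · exact Or.inl rfl
        obtain ⟨s', hs', e1⟩ := xx_smul_edge hij hw hs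
        have c := Diag_commute (E_mem (S := ∅) hij (Set.notMem_empty _) w)
          (op1_zt_mem (i := j.castSucc) r r)
        -- a red phase and its inverse are inserted at the other end of the edge
        have e2 : op1 j.castSucc (zt r r) = op1 j.castSucc (zt r r * (xx * xx)) *
            op1 j.castSucc xx := by
          rw [← map_mul, mul_assoc, mul_assoc, xx_cube, mul_one]
        rw [c.left_comm, e2, mul_smul, mul_smul, mul_smul, e1, ← ext_op1, drop_ext]
        exact LocOps_smul_mem (op1_mem_LocOps _ (mul_mem (zt_mem_Loc r r)
          (mul_mem xx_mem_Loc xx_mem_Loc))) (drop_phase_mem (by decide) hs')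
      obtain ⟨i, -, rfl⟩ := Finset.mem_image.1 hp
      generalize hp' : s(i, l) = p at *
      cases hg with
      | @phase t w hw =>
        obtain rfl : l = t := by
          rcases Sym2.eq_iff.1 hp' with ⟨-, h⟩ | ⟨-, h⟩ <;> exact h
        rw [mul_smul]
        exact drop_phase_mem hw ⟨e, Diag_mono (hll hlS) he', rfl⟩
      | @edge a b hab w hw =>
        rcases Sym2.eq_iff.1 hp' with ⟨-, h⟩ | ⟨-, h⟩
        · rw [E_symm hab]
          exact edge hab.symm hw Sym2.eq_swap h.symm
        · exact edge hab hw rfl h.symm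
  · left
    rw [mul_smul]
    exact drop_phase_mem hw ⟨e, Diag_mono (hll (Or.inl rfl)) he, rfl⟩

theorem rst_mul_zt_one_mul_had : rst * (zt 1 1 * had) = rst * zz := by
  rw [had_eq, ← mul_assoc (zt 1 1), inv_mul_zz, one_mul, ← mul_assoc, rst_mul_xx]

theorem rst_mul_zz_mul_had : rst * (zz * had) = rst * (zt 1 1 * neg) := by
  have h : zz * hdag = xx * xx * zt 1 1 := by
    have e : had * (zt 1 1 * (xx * xx) * zt 1 1) = 1 := by
      calc had * (zt 1 1 * (xx * xx) * zt 1 1) =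
          zz * (xx * ((zz * zt 1 1) * (xx * xx))) * zt 1 1 := by
            conv_lhs => rw [had_eq]
            simp only [mul_assoc]
        _ = 1 := by rw [zz_mul_inv, one_mul, xx_cube, mul_one, zz_mul_inv]
    calc zz * hdag = zz * (hdag * (had * (zt 1 1 * (xx * xx) * zt 1 1))) := by rw [e, mul_one]
      _ = (zz * zt 1 1) * (xx * xx * zt 1 1) := by
          rw [← mul_assoc hdag, hdag_mul_had, one_mul]
          simp only [mul_assoc]
      _ = _ := by rw [zz_mul_inv, one_mul]
  calc rst * (zz * had) = rst * (zz * hdag * neg) := by rw [mul_assoc zz, hdag_mul_neg]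
    _ = rst * xx * xx * (zt 1 1 * neg) := by rw [h]; simp only [mul_assoc]
    _ = _ := by rw [rst_mul_xx, rst_mul_xx]

/-- Deleting a wire of a locally Clifford equivalent of a diagonal state. -/
theorem drop_mem {s : Q 0 (m + 1)} (hs : s ∈ CliffState (m + 1)) : drop s ∈ Stab m := by
  obtain ⟨U, hU, t, ht, rfl⟩ := hs
  rw [par_succ, mul_smul, drop_ext]
  refine LocOps_smul_Stab (par_mem_LocOps _ fun i => hU i.castSucc) ?_
  obtain ⟨V, hV, s', hs', e⟩ := exists_isH (hU (Fin.last m)) (Fin.last m) ht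
  rw [e]
  rcases hV with rfl | ⟨r, rfl⟩
  · rw [map_one, one_smul]
    exact drop_DiagState hs'
  · rcases zmod_three r with rfl | rfl | rfl
    · rw [zt_zero, one_mul]
      exact Or.inl (drop_had_mem hs')
    · rw [drop_congr rst_mul_zt_one_mul_had]
      exact drop_DiagState (Diag_smul_mem (op1_zt_mem 2 2) hs')
    · have e' := rst_mul_zz_mul_had
      rw [zz] at e'
      rw [drop_congr e', map_mul, mul_smul]
      exact drop_DiagState (Diag_smul_mem (op1_zt_mem 1 1) (neg_smul_mem _ hs'))

variable {m : ℕ}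

/-! ### Caps and cups -/

theorem drop_Stab {s : Q 0 (m + 1)} (hs : s ∈ Stab (m + 1)) : drop s ∈ Stab m := by
  rcases hs with hs | hs
  · exact drop_mem hs
  · exact Or.inr (hs.comp _)

theorem ext_Stab {s : Q 0 m} (hs : s ∈ CliffState m) : snoc s gst ∈ CliffState (m + 1) := by
  obtain ⟨u, hu, _, ⟨d, hd, rfl⟩, rfl⟩ := mem_CliffState.1 hs
  refine mem_CliffState.2 ⟨ext u, ext_mem_LocOps hu, _, ⟨ext d, ext_mem hd, rfl⟩, ?_⟩
  rw [plus, ext_smul_snoc, ext_smul_snoc]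

theorem snoc_Stab {s : Q 0 m} (hs : s ∈ Stab m) : snoc s gst ∈ Stab (m + 1) := by
  rcases hs with hs | ⟨D, rfl, hD⟩
  · exact Or.inl (ext_Stab hs)
  · refine Or.inr ⟨D ⊠ Z 0 1 0 0, rfl, ?_⟩
    ext o i
    simp [interp, hD]

/-- The last but one wire. -/
abbrev pen (m : ℕ) : Fin (m + 2) := (Fin.last m).castSucc

/-- Two wires are joined by a cup. -/
noncomputable def join (s : Q 0 (m + 2)) : Q 0 m := drop (drop (D (pen m) (Fin.last (m + 1)) • s))

theorem join_congr {x y : Q (m + 2) (m + 2)}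
    (h : B (pen m) * (B (Fin.last (m + 1)) * (D (pen m) (Fin.last (m + 1)) * x)) =
      B (pen m) * (B (Fin.last (m + 1)) * (D (pen m) (Fin.last (m + 1)) * y))) (s : Q 0 (m + 2)) :
    join (x • s) = join (y • s) := by
  have key : ∀ t : Q 0 (m + 2), drop (drop t) =
      drop (drop ((B (pen m) * B (Fin.last (m + 1))) • t)) := by
    intro t
    have e : B (pen m) = ext (B (Fin.last m)) := (ext_B _).symm
    rw [(B_commute (pen m) _).eq, mul_smul, drop_B, e, drop_ext, drop_B]
  rw [join, join, key, key (_ • y • s), ← mul_smul, ← mul_smul, ← mul_smul, ← mul_smul]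
  simp only [mul_assoc]
  rw [h]

theorem join_ext_ext (a : Q m m) (s : Q 0 (m + 2)) : join (ext (ext a) • s) = a • join s := by
  have h : D (pen m) (Fin.last (m + 1)) * ext (ext a) =
      ext (ext a) * D (pen m) (Fin.last (m + 1)) := by
    rw [D, op2_last, ext_ext]
    exact (tens_commute a spi).symm
  rw [join, join, ← mul_smul, h, mul_smul, drop_ext, drop_ext]

theorem B_B_D_had {i j : Fin m} (h : i ≠ j) :
    B i * (B j * (D i j * op1 i had)) = B i * (B j * (D i j * op1 j had)) := by
  have e1 : B i * (D i j * op1 i had) = B i * C i j had := (B_mul_C_left h had).symm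
  have e2 : B j * (D i j * op1 j had) = B j * C i j had := by
    rw [D_symm h, ← B_mul_C_left h.symm had, C_symm h isTr_had]
  rw [e2, (B_commute i j).left_comm, e1, (B_commute j i).left_comm]

/-- Local operations are moved from one end of a cup to the other. -/
theorem exists_transpose {f : Q 1 1} (hf : f ∈ Loc) {i j : Fin m} (h : i ≠ j) :
    ∃ f' ∈ Loc, B i * (B j * (D i j * op1 i f)) = B i * (B j * (D i j * op1 j f')) := by
  induction hf using Submonoid.closure_induction_left with
  | one => exact ⟨1, one_mem _, by rw [map_one, map_one]⟩
  | mul_left g hg f _ ih =>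
    obtain ⟨f', hf', e⟩ := ih
    have hg' : g ∈ Loc := Submonoid.subset_closure hg
    refine ⟨f' * g, mul_mem hf' hg', ?_⟩
    have e1 : B i * (B j * (D i j * op1 i g)) = B i * (B j * (D i j * op1 j g)) := by
      rcases hg with rfl | ⟨a, b, rfl⟩
      · exact B_B_D_had h
      · rw [zt, D_mul_op1_zph h, ← (D_commute_zph h _ _).eq]
    have c : Commute (op1 j g) (op1 i f) := op1_commute_op1 h.symm _ _
    calc B i * (B j * (D i j * op1 i (g * f))) = B i * (B j * (D i j * op1 i g)) * op1 i f := by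
          rw [map_mul]
          simp only [mul_assoc]
      _ = B i * (B j * (D i j * op1 i f)) * op1 j g := by
          rw [e1]
          simp only [mul_assoc]
          rw [c.eq]
      _ = _ := by
          rw [e, map_mul]
          simp only [mul_assoc]

theorem xx_mul_xx : xx * xx = zz * (had * (neg * zz)) := by
  have h := had_mul_zz'
  have h1 : neg * had = hdag := neg_mul_had
  calc xx * xx = zz * (neg * neg) * (zt 1 1 * (xx * xx)) := by
        rw [neg_mul_neg, mul_one, ← mul_assoc, zz_mul_inv, one_mul]
    _ = zz * (neg * (had * zz)) := by rw [h]; simp only [mul_assoc]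
    _ = _ := by rw [← mul_assoc neg, h1, ← had_mul_neg, mul_assoc]

/-- A Hadamard node in front of a cup turns the cup into an edge followed by the deletion of both
wires. -/
theorem join_DiagState {r : ZMod 3} {s : Q 0 (m + 2)} (hs : s ∈ DiagState ∅) :
    join (op1 (Fin.last (m + 1)) (zt r r * had) • s) ∈ Stab m := by
  set i := pen m
  set j := Fin.last (m + 1)
  have hij : i ≠ j := castSucc_ne_last _
  have e : B i * (B j * (D i j * op1 j (zt r r * had))) =
      B i * (B j * (C i j had * op1 i (zt r r))) := by
    have c : Commute (op1 i (zt r r)) (op1 j had) := op1_commute_op1 hij _ _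
    have c2 : D i j * op1 j (zt r r) = D i j * op1 i (zt r r) := by
      rw [zt, D_mul_op1_zph hij, ← (D_commute_zph hij _ _).eq]
    have e2 : B j * (D i j * op1 j had) = B j * C i j had := by
      rw [D_symm hij, ← B_mul_C_left hij.symm had, C_symm hij isTr_had]
    rw [map_mul, ← mul_assoc (D i j), c2, mul_assoc, c.eq]
    calc _ = B i * ((B j * (D i j * op1 j had)) * op1 i (zt r r)) := by simp only [mul_assoc]
      _ = _ := by rw [e2]; simp only [mul_assoc]
  have key : ∀ t : Q 0 (m + 2), drop (drop t) = drop (drop ((B i * B j) • t)) := by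
    intro t
    have e : B i = ext (B (Fin.last m)) := (ext_B _).symm
    rw [(B_commute i j).eq, mul_smul, drop_B, e, drop_ext, drop_B]
  have h : join (op1 j (zt r r * had) • s) = drop (drop ((C i j had * op1 i (zt r r)) • s)) := by
    have e' : B i * B j * D (pen m) (Fin.last (m + 1)) * op1 j (zt r r * had) =
        B i * B j * (C i j had * op1 i (zt r r)) := by
      rw [mul_assoc, mul_assoc, mul_assoc]
      exact e
    rw [join, key, ← mul_smul, ← mul_smul, e', mul_smul, ← key]
  rw [h]
  exact drop_Stab (drop_mem (DiagState_subset (Diag_smul_mem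
    (mul_mem (IsDiagGen.edge hij (Set.notMem_empty _)).mem (op1_zt_mem r r)) hs)))

/-- By local operations at one of its ends, every cup is preceded by a normal form on that wire. -/
theorem join_mem {s : Q 0 (m + 2)} (hs : s ∈ CliffState (m + 2)) : join s ∈ Stab m := by
  obtain ⟨U, hU, t, ht, rfl⟩ := hs
  have hij : pen m ≠ Fin.last (m + 1) := castSucc_ne_last _
  rw [par_succ, par_succ, map_mul, ext_op1, mul_assoc, mul_smul, join_ext_ext]
  refine LocOps_smul_Stab (par_mem_LocOps _ fun i => hU _) ?_
  obtain ⟨f', hf', e⟩ := exists_transpose (hU (pen m)) hij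
  have e1 : join ((op1 (pen m) (U (pen m)) * op1 (Fin.last (m + 1)) (U (Fin.last (m + 1)))) • t) =
      join (op1 (Fin.last (m + 1)) (f' * U (Fin.last (m + 1))) • t) := by
    rw [mul_smul, join_congr e, ← mul_smul, ← map_mul]
  rw [e1]
  obtain ⟨V, hV, t', ht', e2⟩ := exists_isH (mul_mem hf' (hU _)) (Fin.last (m + 1)) ht
  rw [e2]
  rcases hV with rfl | ⟨r, rfl⟩
  · rw [map_one, one_smul]
    obtain ⟨d, hd, rfl⟩ := ht'
    set j := Fin.last (m + 1)
    obtain ⟨p, e, he, rfl⟩ := exists_zt_mul hd j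
    have hj : j ∈ ({j} : Finset (Fin (m + 2))) := Finset.mem_singleton_self _
    have hs : e • plus (m + 2) ∈ DiagState (pairs {j}) := by
      refine ⟨e, Diag_mono (fun p hp => ?_) he, rfl⟩
      induction p with
      | _ a b =>
        obtain ⟨ha, hb⟩ := mem_pairs.1 hp
        rw [Finset.mem_singleton.1 ha, Finset.mem_singleton.1 hb]
        exact Or.inl rfl
    have hx := DiagState_mono (Set.empty_subset _) (xx_smul_mem hj hs)
    -- a red phase and its inverse are inserted to create a Hadamard node on the wire
    have e3 : op1 j (zt p p) = op1 j (zt (p + 2) (p + 2) * had) *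
        (op1 j neg * (op1 j (zt 2 2) * op1 j xx)) := by
      have e4 : zt p p = zt (p + 2) (p + 2) * had * (neg * (zt 2 2 * xx)) := by
        calc zt p p = zt p p * (xx * xx * xx) := by rw [mul_assoc xx, xx_cube, mul_one]
          _ = zt p p * zz * (had * (neg * (zz * xx))) := by
              rw [xx_mul_xx]
              simp only [mul_assoc]
          _ = _ := by rw [zz, zt_mul]; simp only [mul_assoc]
      rw [← map_mul, ← map_mul, ← map_mul, ← e4]
    rw [e3, mul_assoc, mul_smul, mul_assoc, mul_assoc]
    refine join_DiagState ?_
    rw [mul_smul, mul_smul, mul_smul]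
    exact neg_smul_mem _ (Diag_smul_mem (op1_zt_mem 2 2) hx)
  · exact join_DiagState ht'

theorem D_mul_B {i j : Fin m} (h : i ≠ j) : D i j * B j = op1 j hdag * (C i j had * B j) := by
  rw [C_mul_B_right h, ← mul_assoc, op1_hdag_mul_had, one_mul]

/-- A cap next to a state. -/
theorem cap_mem {s : Q 0 m} (hs : s ∈ CliffState m) :
    D (pen m) (Fin.last (m + 1)) • snoc (snoc s gst) gst ∈ CliffState (m + 2) := by
  obtain ⟨u, hu, _, ⟨d, hd, rfl⟩, rfl⟩ := mem_CliffState.1 hs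
  have hij : pen m ≠ Fin.last (m + 1) := castSucc_ne_last _
  have h : D (pen m) (Fin.last (m + 1)) * ext (ext u) =
      ext (ext u) * D (pen m) (Fin.last (m + 1)) := by
    rw [D, op2_last, ext_ext]
    exact (tens_commute u spi).symm
  have h' : D (pen m) (Fin.last (m + 1)) * ext (ext d) =
      ext (ext d) * D (pen m) (Fin.last (m + 1)) := by
    rw [D, op2_last, ext_ext]
    exact (tens_commute d spi).symm
  have e : snoc (snoc (u • d • plus m) gst) gst = (ext (ext u) * ext (ext d)) • plus (m + 2) := by
    rw [mul_smul, plus, plus, ext_smul_snoc, ext_smul_snoc, ext_smul_snoc, ext_smul_snoc]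
  have e2 : D (pen m) (Fin.last (m + 1)) • plus (m + 2) =
      op1 (Fin.last (m + 1)) hdag • C (pen m) (Fin.last (m + 1)) had • plus (m + 2) := by
    rw [← B_smul_plus (Fin.last (m + 1)), ← mul_smul, D_mul_B hij, mul_smul, mul_smul]
  have c : Commute (ext (ext d)) (op1 (Fin.last (m + 1)) hdag) := ext_commute_op1 _ _
  rw [e, ← mul_smul, ← mul_assoc, h, mul_assoc, h', mul_smul, mul_smul, e2, ← mul_smul _ (op1 _ _),
    c.eq, mul_smul]
  refine LocOps_smul_mem (ext_mem_LocOps (ext_mem_LocOps hu)) (LocOps_smul_mem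
    (op1_mem_LocOps _ hdag_mem_Loc) (DiagState_subset ?_))
  exact Diag_smul_mem (ext_mem (ext_mem hd)) ⟨_, (IsDiagGen.edge hij (Set.notMem_empty _)).mem, rfl⟩

/-- A spider with three outputs next to a state. -/
theorem ghz_mem {s : Q 0 m} (hs : s ∈ CliffState m) :
    D (pen (m + 1)) (Fin.last (m + 2)) • ext (D (pen m) (Fin.last (m + 1))) •
      snoc (snoc (snoc s gst) gst) gst ∈ CliffState (m + 3) := by
  obtain ⟨u, hu, _, ⟨d, hd, rfl⟩, rfl⟩ := mem_CliffState.1 hs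
  have hij' : pen m ≠ Fin.last (m + 1) := castSucc_ne_last _
  have eD : ext (D (pen m) (Fin.last (m + 1))) = D (pen m).castSucc (pen (m + 1)) := ext_D hij'
  rw [eD]
  have e : snoc (snoc (snoc (u • d • plus m) gst) gst) gst =
      (ext (ext (ext u)) * ext (ext (ext d))) • plus (m + 3) := by
    rw [mul_smul, plus, plus, plus]
    simp only [ext_smul_snoc]
  have hij : (pen m).castSucc ≠ pen (m + 1) := castSucc_ne hij'
  have hik : (pen m).castSucc ≠ Fin.last (m + 2) := castSucc_ne_last _
  have hjk : pen (m + 1) ≠ Fin.last (m + 2) := castSucc_ne_last _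
  have hc : ∀ x : Q m m, Commute (ext (ext (ext x)))
      (D (pen (m + 1)) (Fin.last (m + 2)) * D (pen m).castSucc (pen (m + 1))) := by
    intro x
    have c1 : Commute (ext (ext (ext x))) (D (pen (m + 1)) (Fin.last (m + 2))) := by
      rw [D, op2_last, ext_ext]
      exact tens_commute (ext x) spi
    have c2 : Commute (ext (ext (ext x))) (D (pen m).castSucc (pen (m + 1))) := by
      have e : D (pen m).castSucc (pen (m + 1)) = ext (lft m spi) := by
        rw [← op2_last]
        exact eD.symm
      rw [e]
      refine Commute.map ?_ ext
      rw [ext_ext]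
      exact tens_commute x spi
    exact c1.mul_right c2
  have hd' : Commute (ext (ext (ext d))) (op1 (pen (m + 1)) hdag * op1 (Fin.last (m + 2)) hdag) :=
    Commute.mul_right ((ext_commute_op1 (ext d) hdag).map ext |> fun c => by rwa [ext_op1] at c)
      (ext_commute_op1 _ _)
  have hd3 : ext (ext (ext d)) ∈ Diag (∅ : Set (Sym2 (Fin (m + 3)))) :=
    ext_mem (ext_mem (ext_mem hd))
  clear eD
  generalize (pen m).castSucc = i at *
  generalize pen (m + 1) = j at *
  generalize Fin.last (m + 2) = k at *
  have e2 : (D j k * D i j) • plus (m + 3) =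
      (op1 j hdag * op1 k hdag * (C i j had * C i k had)) • plus (m + 3) := by
    have c1 : Commute (D i k) (op1 j hdag) := D_commute_op1 hik hij.symm hjk _
    have c2 : Commute (C i j had) (D i k) := C_commute_D hij hik _
    have c3 : Commute (C i j had) (op1 k hdag) := C_commute_op1 hij hik.symm hjk.symm _ _
    conv_lhs => rw [← B_smul_plus j, ← B_smul_plus k]
    conv_rhs => rw [← B_smul_plus j, ← B_smul_plus k]
    rw [← mul_smul, ← mul_smul, ← mul_smul, ← mul_smul]
    congr 1
    have c4 : Commute (D i k) (B j) := D_commute_B hik hij.symm hjk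
    have c5 : Commute (C i k had) (B j) := C_commute_op1 hik hij.symm hjk _ _
    have c6 : Commute (op1 k hdag) (B j) := op1_commute_op1 hjk.symm _ _
    calc D j k * D i j * B j * B k = D i k * (D i j * B j) * B k := by
          rw [D_mul_left hij hik hjk]
          simp only [mul_assoc]
      _ = op1 j hdag * (C i j had * (B j * (D i k * B k))) := by
          rw [D_mul_B hij]
          simp only [mul_assoc]
          rw [c1.left_comm, ← c2.left_comm, c4.left_comm]
      _ = _ := by
          rw [D_mul_B hik, ← c6.left_comm, ← c5.left_comm, c3.left_comm]
          simp only [mul_assoc]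
  rw [e, ← mul_smul, ← mul_smul, ← mul_assoc, ← (hc u).eq, mul_assoc, ← (hc d).eq, mul_smul,
    mul_smul, e2,
    ← mul_smul (ext (ext (ext d))), ← mul_assoc, hd'.eq, mul_smul, mul_smul, mul_smul]
  refine LocOps_smul_mem (ext_mem_LocOps (ext_mem_LocOps (ext_mem_LocOps hu))) ?_
  refine LocOps_smul_mem (op1_mem_LocOps _ hdag_mem_Loc) (LocOps_smul_mem
    (op1_mem_LocOps _ hdag_mem_Loc) (DiagState_subset (Diag_smul_mem hd3 ?_)))
  exact ⟨_, mul_mem (IsDiagGen.edge hij (Set.notMem_empty _)).mem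
    (IsDiagGen.edge hik (Set.notMem_empty _)).mem, rfl⟩

variable {m : ℕ}

/-! ### Closure of the stabilizer states under diagrams -/

theorem conjP_mem_LocOps (σ : Equiv.Perm (Fin m)) {u : Q m m} (hu : u ∈ LocOps m) :
    conjP σ u ∈ LocOps m := by
  induction hu using Submonoid.closure_induction with
  | mem g hg =>
    obtain ⟨i, f, hf, rfl⟩ := hg
    rw [conjP_op1]
    exact op1_mem_LocOps _ hf
  | one => rw [map_one]; exact one_mem _
  | mul a b _ _ ha hb => rw [map_mul]; exact mul_mem ha hb

theorem P_smul_plus (σ : Equiv.Perm (Fin m)) : P σ • plus m = plus m := by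
  induction σ using Equiv.Perm.swap_induction_on with
  | one => rw [map_one, one_smul]
  | swap_mul f i j hij ih =>
    rw [map_mul, mul_smul, ih]
    conv_lhs => rw [← B_smul_plus i, ← B_smul_plus j, ← mul_smul, ← mul_smul, mul_assoc,
      swap_mul_B_mul_B hij, mul_smul, B_smul_plus, B_smul_plus]

theorem P_smul_mem (σ : Equiv.Perm (Fin m)) {s : Q 0 m} (hs : s ∈ CliffState m) :
    P σ • s ∈ CliffState m := by
  obtain ⟨u, hu, _, ⟨d, hd, rfl⟩, rfl⟩ := mem_CliffState.1 hs
  rw [← mul_smul, P_mul, mul_smul, ← mul_smul (P σ), P_mul, mul_smul, P_smul_plus]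
  exact LocOps_smul_mem (conjP_mem_LocOps σ hu) (DiagState_subset ⟨_, conjP_mem σ hd, rfl⟩)

/-- Composition with the diagram preserves stabilizer states. -/
def Good {N M : ℕ} (A : Q N M) : Prop := ∀ s ∈ Stab N, s ⟫ A ∈ Stab M

theorem Good.comp {n m k : ℕ} {A : Q n m} {B : Q m k} (hA : Good A) (hB : Good B) :
    Good (A ⟫ B) := by
  intro s hs
  rw [← comp_assoc]
  exact hB _ (hA s hs)

theorem Good.of_heq {n m n' m' : ℕ} {A : Q n m} {A' : Q n' m'} (hA : Good A) (hn : n = n')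
    (hm : m = m') (h : HEq A A') : Good A' := by
  subst hn hm
  cases h
  exact hA

theorem Good.of_mem {n m : ℕ} {A : Q n m} (h : ∀ s ∈ CliffState n, s ⟫ A ∈ Stab m) : Good A := by
  rintro s (hs | hs)
  · exact h s hs
  · exact Or.inr (hs.comp A)

/-- Composition with the diagram, with any number of wires on both sides of it, preserves stabilizer
states. -/
def Pres {n m : ℕ} (A : Q n m) : Prop := ∀ r k, Good ((1 : Q r r) ◎ A ◎ (1 : Q k k))

theorem pres_one (n : ℕ) : Pres (1 : Q n n) := by
  intro r k s hs
  rw [one_tens_one, one_tens_one, comp_one]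
  exact hs

theorem Pres.comp {n m k : ℕ} {A : Q n m} {B : Q m k} (hA : Pres A) (hB : Pres B) :
    Pres (A ⟫ B) := by
  intro r k
  rw [one_tens_comp, comp_tens_one]
  exact (hA r k).comp (hB r k)

theorem Pres.tens_one {n m : ℕ} {A : Q n m} (hA : Pres A) (l : ℕ) : Pres (A ◎ (1 : Q l l)) := by
  intro r k
  refine (hA r (l + k)).of_heq (by omega) (by omega) ?_
  rw [← one_tens_one l k]
  refine (tens_assoc _ _ _).symm.trans ?_
  exact heq_tens (by omega) (by omega) rfl rfl (tens_assoc _ _ _) HEq.rfl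

theorem Pres.one_tens {n m : ℕ} {A : Q n m} (hA : Pres A) (l : ℕ) : Pres ((1 : Q l l) ◎ A) := by
  intro r k
  refine (hA (r + l) k).of_heq (by omega) (by omega) ?_
  rw [← one_tens_one r l]
  exact heq_tens (by omega) (by omega) rfl rfl (tens_assoc _ _ _) HEq.rfl

theorem Pres.tens {n m n' m' : ℕ} {A : Q n m} {B : Q n' m'} (hA : Pres A) (hB : Pres B) :
    Pres (A ◎ B) := by
  rw [tens_eq_left]
  exact (hA.tens_one _).comp (hB.one_tens _)

theorem pres_swap : Pres (q swap) := by
  intro r k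
  have h : ∃ σ : Equiv.Perm (Fin (r + 2 + k)), (1 : Q r r) ◎ q swap ◎ (1 : Q k k) = P σ := by
    induction k with
    | zero => exact ⟨topP r, (tens_zero _).trans (P_topP r).symm⟩
    | succ k ih =>
      obtain ⟨σ, h⟩ := ih
      refine ⟨extP σ, ?_⟩
      rw [P_extP, ← h, one_succ k, ext_def]
      exact (eq_of_heq (tens_assoc _ _ _)).symm
  obtain ⟨σ, h⟩ := h
  rw [h]
  exact Good.of_mem fun s hs => Or.inl (P_smul_mem σ hs)

theorem pres_crossing : (n : ℕ) → Pres (q (crossing n))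
  | 0 => by
    have h := pres_one 1
    rw [← q_wire] at h
    exact h
  | n + 1 => by
    have h := (pres_crossing n).tens_one 1
    rw [← q_wire] at h
    exact (pres_swap.one_tens n).comp h

theorem exists_crossing_inv : (n : ℕ) → ∃ R : Q (1 + n) (n + 1), Pres R ∧ q (crossing n) ⟫ R = 1
  | 0 => ⟨(1 : Q 1 1), pres_one 1, (comp_one _).trans q_wire⟩
  | n + 1 => by
    obtain ⟨R, hR, h⟩ := exists_crossing_inv n
    refine ⟨Q.comp (n := (1 + n) + 1) (m := n + 1 + 1) (k := n + 1 + 1) (R ◎ (1 : Q 1 1)) (sw n),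
      (hR.tens_one 1).comp (pres_swap.one_tens n), ?_⟩
    have e : q (crossing (n + 1)) = Q.comp (n := n + 1 + 1) (m := n + 1 + 1) (k := 1 + n + 1)
        (sw n) (q (crossing n) ◎ (1 : Q 1 1)) := by
      rw [← q_wire]
      rfl
    rw [e]
    have h1 := comp_tens_one 1 (q (crossing n)) R
    rw [h, one_tens_one] at h1
    calc _ = sw n ⟫ (Q.comp (n := n + 1 + 1) (m := 1 + n + 1) (k := n + 1 + 1)
          (q (crossing n) ◎ (1 : Q 1 1)) (R ◎ (1 : Q 1 1))) ⟫ sw n := by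
          simp only [comp_assoc]
      _ = 1 := by
          rw [← h1, comp_one]
          exact sw_mul_self n

/-- Wires on the right of a diagram may be moved to its left. -/
theorem pres_of_last {n m : ℕ} {A : Q n m} (h : ∀ r, Good ((1 : Q r r) ◎ A)) : Pres A := by
  have key : ∀ k r, Good ((1 : Q r r) ◎ A ◎ (1 : Q k k)) := by
    intro k
    induction k with
    | zero =>
      intro r
      rw [tens_zero]
      exact h r
    | succ k ih =>
      intro r
      obtain ⟨R, hR, hR'⟩ := exists_crossing_inv m
      have e : A ◎ (1 : Q 1 1) = q (crossing n) ⟫ ((1 : Q 1 1) ◎ A) ⟫ R := by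
        obtain ⟨A, rfl⟩ := q_surj A
        have hs := sound (ZXEq.slide A)
        rw [q_comp, q_comp, q_tens, q_tens, q_wire] at hs
        rw [← hs, comp_assoc, hR', comp_one]
      have e2 : Good ((1 : Q r r) ◎ (A ◎ (1 : Q 1 1)) ◎ (1 : Q k k)) := by
        rw [e, one_tens_comp, one_tens_comp, comp_tens_one, comp_tens_one]
        refine ((pres_crossing n r k).comp ?_).comp (hR r k)
        refine (ih (r + 1)).of_heq (by omega) (by omega) ?_
        rw [← one_tens_one r 1]
        exact heq_tens (by omega) (by omega) rfl rfl (tens_assoc _ _ _) HEq.rfl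
      refine e2.of_heq (by omega) (by omega) ?_
      have e3 : HEq ((1 : Q 1 1) ◎ (1 : Q k k)) (1 : Q (k + 1) (k + 1)) := by
        rw [one_tens_one]
        exact heq_one (by omega)
      refine (heq_tens (by omega) (by omega) rfl rfl (tens_assoc _ _ _).symm HEq.rfl).trans ?_
      refine (tens_assoc _ _ _).trans ?_
      exact heq_tens rfl rfl (by omega) (by omega) HEq.rfl e3
  exact fun r k => key k r

theorem pres_of_mem_Loc {f : Q 1 1} (hf : f ∈ Loc) : Pres f := by
  refine pres_of_last fun r s hs => ?_
  have h := LocOps_smul_Stab (op1_mem_LocOps (Fin.last r) hf) hs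
  rw [op1_last] at h
  exact h

theorem comp_one_tens {k : ℕ} (s : Q 0 m) (A : Q 0 k) : s ⟫ ((1 : Q m m) ◎ A) = s ◎ A := by
  have h := tens_eq_left s A
  rw [tens_zero] at h
  exact h.symm

theorem pres_gst : Pres gst := by
  refine pres_of_last fun r s hs => ?_
  have h := snoc_Stab hs
  rw [snoc, ← comp_one_tens] at h
  exact h

theorem pres_gef : Pres gef := pres_of_last fun _ _ hs => drop_Stab hs

theorem tens_comp_one_tens {k l : ℕ} (s : Q 0 m) (A : Q 0 k) (B : Q k l) :
    Q.comp (s ◎ A) ((1 : Q m m) ◎ B) = s ◎ (A ⟫ B) := by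
  have h := interchange s (1 : Q m m) A B
  rw [comp_one] at h
  exact h.symm

theorem snoc_snoc (s : Q 0 m) (x y : Q 0 1) : snoc (snoc s x) y = s ◎ (x ◎ y) :=
  eq_of_heq (tens_assoc s x y)

theorem pres_cap : Pres (q cap) := by
  refine pres_of_last fun r => Good.of_mem fun (s : Q 0 r) hs => Or.inl ?_
  have h := cap_mem hs
  rw [snoc_snoc, D, op2_last, smul_def, lft_def] at h
  have h1 := tens_comp_one_tens s (gst ◎ gst) spi
  rw [gst_gst_comp_spi] at h1
  exact Eq.mpr (congrArg (· ∈ CliffState (r + 2)) ((comp_one_tens s (q cap)).trans h1.symm)) h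

theorem pres_cup : Pres (q cup) := by
  refine pres_of_last fun r => Good.of_mem fun (s : Q 0 (r + 2)) hs => ?_
  have h := join_mem hs
  rw [join, D, op2_last, smul_def, lft_def, drop, drop, comp_assoc, comp_assoc] at h
  have e : Q.comp (n := r + 2) (m := r + 2) (k := r) ((1 : Q r r) ◎ spi)
      (Q.comp (n := r + 2) (m := r + 1) (k := r) (@Q.tens (r + 1) (r + 1) 1 0 1 gef)
        ((1 : Q r r) ◎ gef)) = (1 : Q r r) ◎ q cup := by
    have e1 : @Q.tens (r + 1) (r + 1) 1 0 1 gef = @Q.tens r r 2 1 1 ((1 : Q 1 1) ◎ gef) := by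
      rw [one_succ r]
      exact eq_of_heq (tens_assoc (1 : Q r r) (1 : Q 1 1) gef)
    rw [e1, ← mrg_comp_gef, ← spi_comp_tens_gef, one_tens_comp, one_tens_comp, comp_assoc]
  rw [e] at h
  exact h

/-- The green spider with three outputs preserves stabilizer states. -/
theorem pres_cap_comp_cpy : Pres (q cap ⟫ ((1 : Q 1 1) ◎ cpy)) := by
  refine pres_of_last fun r => Good.of_mem fun (s : Q 0 r) (hs : s ∈ CliffState r) => Or.inl ?_
  have h := ghz_mem hs
  have e1 : ext (D (pen r) (Fin.last (r + 1))) • snoc (snoc (snoc s gst) gst) gst =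
      snoc (s ◎ q cap) gst := by
    rw [ext_smul_snoc, snoc_snoc, D, op2_last, smul_def, lft_def, ← gst_gst_comp_spi]
    exact congrArg (snoc · gst) (tens_comp_one_tens s (gst ◎ gst) spi)
  have e2 : snoc (s ◎ q cap) gst = s ◎ (q cap ◎ gst) := eq_of_heq (tens_assoc _ _ _)
  have e3 : lft (r + 1) spi = (1 : Q r r) ◎ lft 1 spi := (eq_of_heq (lft_lft r 1 spi)).symm
  have e4 : (q cap ◎ gst) ⟫ lft 1 spi = q cap ⟫ ((1 : Q 1 1) ◎ cpy) := by
    have e5 : q cap ◎ gst = q cap ⟫ ((1 : Q 1 1) ◎ ((1 : Q 1 1) ◎ gst)) := by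
      rw [← comp_one_tens]
      refine congrArg (q cap ⟫ ·) ?_
      have e6 := tens_assoc (1 : Q 1 1) (1 : Q 1 1) gst
      rw [one_tens_one] at e6
      exact eq_of_heq e6
    rw [e5, comp_assoc, ← tens_gst_comp_spi, one_tens_comp]
    rfl
  have e7 := tens_comp_one_tens s (q cap ◎ gst) (lft 1 spi)
  rw [e4] at e7
  rw [e1, e2, D, op2_last, smul_def, e3] at h
  exact Eq.mpr (congrArg (· ∈ CliffState (r + 3)) ((comp_one_tens s _).trans e7.symm)) h

theorem cpy_eq : cpy = Q.comp (n := 1) (m := 4) (k := 2)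
    ((1 : Q 1 1) ◎ (q cap ⟫ ((1 : Q 1 1) ◎ cpy))) (q cup ◎ (1 : Q 2 2)) := by
  have e1 : (1 : Q 1 1) ◎ ((1 : Q 1 1) ◎ cpy) = (1 : Q 2 2) ◎ cpy := by
    have h := tens_assoc (1 : Q 1 1) (1 : Q 1 1) cpy
    rw [one_tens_one] at h
    exact (eq_of_heq h).symm
  have e2 : Q.comp (n := 3) (m := 4) (k := 2) ((1 : Q 2 2) ◎ cpy) (q cup ◎ (1 : Q 2 2)) =
      Q.comp (n := 3) (m := 1) (k := 2) (q cup ◎ (1 : Q 1 1)) cpy := by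
    refine (tens_eq_right (q cup) cpy).symm.trans ((tens_eq_left (q cup) cpy).trans ?_)
    exact congrArg (Q.comp (n := 3) (m := 1) (k := 2) (q cup ◎ (1 : Q 1 1)))
      (eq_of_heq (zero_tens cpy))
  rw [one_tens_comp, e1]
  calc cpy = Q.comp (n := 1) (m := 1) (k := 2) (Q.comp (n := 1) (m := 3) (k := 1)
        ((1 : Q 1 1) ◎ q cap) (q cup ◎ (1 : Q 1 1))) cpy := by rw [cap_snake', one_comp]
    _ = _ := by
        rw [comp_assoc, ← e2, ← comp_assoc]

theorem pres_cpy : Pres cpy := by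
  rw [cpy_eq]
  exact (pres_cap_comp_cpy.one_tens 1).comp (pres_cup.tens_one 2)

theorem pres_mrg : Pres mrg := by
  rw [← cpy_tens_comp_cup]
  exact (pres_cpy.tens_one 1).comp (pres_cup.one_tens 1)

variable {m : ℕ}

theorem pres_Z_one_zero : (n : ℕ) → Pres (q (Z n 1 0 0))
  | 0 => pres_gst
  | n + 1 => by
    have h := sound (ZXEq.S1 n 0 1 1 0 0 0 0 0)
    rw [add_zero] at h
    have h1 := ((pres_Z_one_zero n).tens_one 1).comp (pres_mrg.one_tens 0)
    exact Eq.mp (congrArg (@Pres (n + 1) 1) h) h1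

theorem pres_Z_one (n : ℕ) {α β : Real.Angle} (hα : IsThird α) (hβ : IsThird β) :
    Pres (q (Z n 1 α β)) := by
  have h := sound (ZXEq.S1 n 0 0 1 0 0 0 α β)
  rw [zero_add α, zero_add β] at h
  obtain ⟨a, rfl⟩ := isThird_iff.1 hα
  obtain ⟨b, rfl⟩ := isThird_iff.1 hβ
  have h1 := ((pres_Z_one_zero n).tens_one 0).comp ((pres_of_mem_Loc (zt_mem_Loc a b)).one_tens 0)
  exact Eq.mp (congrArg (@Pres n 1) h) h1

theorem pres_Z (n : ℕ) {α β : Real.Angle} (hα : IsThird α) (hβ : IsThird β) :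
    (m : ℕ) → Pres (q (Z n m α β))
  | 0 => by
    have h := sound (ZXEq.S1 n 0 0 0 0 α β 0 0)
    rw [add_zero α, add_zero β] at h
    have h1 := ((pres_Z_one n hα hβ).tens_one 0).comp (pres_gef.one_tens 0)
    exact Eq.mp (congrArg (@Pres n 0) h) h1
  | 1 => pres_Z_one n hα hβ
  | m + 2 => by
    have h := sound (ZXEq.S1 n m 0 2 0 α β 0 0)
    rw [add_zero α, add_zero β] at h
    have h1 := ((pres_Z n hα hβ (m + 1)).tens_one 0).comp (pres_cpy.one_tens m)
    exact Eq.mp (congrArg (@Pres n (m + 2)) h) h1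

theorem pres_parallel {A : ZX 1 1} (hA : Pres (q A)) :
    (n : ℕ) → Pres (q (parallel n fun _ => A))
  | 0 => pres_one 0
  | n + 1 => (pres_parallel hA n).tens hA

/-- Stabilizer diagrams preserve stabilizer states. -/
theorem pres_of_isStabilizer {n m : ℕ} {A : ZX n m} (hA : A.IsStabilizer) : Pres (q A) := by
  induction A with
  | Z n m α β => exact pres_Z n hA.1 hA.2 m
  | X n m α β =>
    rw [sound (ZXEq.H2 n m α β)]
    exact ((pres_parallel (pres_of_mem_Loc hdag_mem_Loc) n).comp (pres_Z n hA.1 hA.2 m)).comp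
      (pres_parallel (pres_of_mem_Loc had_mem_Loc) m)
  | H => exact pres_of_mem_Loc had_mem_Loc
  | swap => exact pres_swap
  | wire =>
    rw [q_wire]
    exact pres_one 1
  | empty => exact pres_one 0
  | cap => exact pres_cap
  | cup => exact pres_cup
  | comp A B ihA ihB => exact (ihA hA.1).comp (ihB hA.2)
  | tensor A B ihA ihB => exact (ihA hA.1).tens (ihB hA.2)

theorem one_mem_CliffState : (1 : Q 0 0) ∈ CliffState 0 :=
  DiagState_subset ⟨1, one_mem _, (one_smul _ _).symm⟩

/-- Stabilizer state diagrams are equal to stabilizer states or to diagrams with vanishing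
interpretation. -/
theorem q_mem_Stab {n : ℕ} {D : ZX 0 n} (hD : D.IsStabilizer) : q D ∈ Stab n := by
  have h : Good (q D) := by
    refine (pres_of_isStabilizer hD 0 0).of_heq (by omega) (by omega) ?_
    rw [tens_zero]
    exact zero_tens (q D)
  have h1 := h 1 (Or.inl one_mem_CliffState)
  rwa [one_comp] at h1

/-! ### Soundness: structural rules -/

theorem interp_comp_apply {n m k : ℕ} (A : ZX n m) (B : ZX m k) (o : Fin k → Fin 3)
    (i : Fin n → Fin 3) : interp (A ⨾ B) o i = ∑ w, interp B o w * interp A w i := rfl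

theorem interp_tensor_apply {n m n' m' : ℕ} (A : ZX n m) (B : ZX n' m') (o : Fin (m + m') → Fin 3)
    (i : Fin (n + n') → Fin 3) : interp (A ⊠ B) o i =
      interp A (fun k => o (Fin.castAdd m' k)) (fun k => i (Fin.castAdd n' k)) *
        interp B (fun k => o (Fin.natAdd m k)) (fun k => i (Fin.natAdd n k)) := rfl

theorem interp_tensor_append {n m n' m' : ℕ} (A : ZX n m) (B : ZX n' m') (o : Fin m → Fin 3)
    (o' : Fin m' → Fin 3) (i : Fin n → Fin 3) (i' : Fin n' → Fin 3) :
    interp (A ⊠ B) (Fin.append o o') (Fin.append i i') = interp A o i * interp B o' i' := by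
  simp only [interp_tensor_apply, Fin.append_left, Fin.append_right]

theorem exists_append {n m : ℕ} (x : Fin (n + m) → Fin 3) : ∃ u v, x = Fin.append u v :=
  ⟨_, _, (Fin.append_castAdd_natAdd (f := x)).symm⟩

theorem sum_append {n m : ℕ} (f : (Fin (n + m) → Fin 3) → ℂ) :
    ∑ w, f w = ∑ u : Fin n → Fin 3, ∑ v : Fin m → Fin 3, f (Fin.append u v) := by
  rw [← (Fin.appendEquiv n m).sum_comp, Fintype.sum_prod_type]
  rfl

theorem append_inj {n m : ℕ} {u u' : Fin n → Fin 3} {v v' : Fin m → Fin 3} :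
    Fin.append u v = Fin.append u' v' ↔ u = u' ∧ v = v' := by
  constructor
  · intro h
    exact ⟨funext fun k => by simpa using congrFun h (Fin.castAdd m k),
      funext fun k => by simpa using congrFun h (Fin.natAdd n k)⟩
  · rintro ⟨rfl, rfl⟩
    rfl

theorem interp_wires : (n : ℕ) → interp (wires n) = 1
  | 0 => rfl
  | n + 1 => by
    ext o i
    obtain ⟨u, v, rfl⟩ := exists_append o
    obtain ⟨u', v', rfl⟩ := exists_append i
    rw [wires, interp_tensor_append, interp_wires n, interp, Matrix.one_apply, Matrix.one_apply,
      Matrix.one_apply, ite_zero_mul_ite_zero, mul_one]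
    simp only [append_inj]

theorem interp_cast {n m n' m' : ℕ} (hn : n = n') (hm : m = m') (D : ZX n m) (o : Fin m' → Fin 3)
    (i : Fin n' → Fin 3) :
    interp (cast hn hm D) o i = interp D (o ∘ Fin.cast hm) (i ∘ Fin.cast hn) := by
  subst hn hm
  rfl

theorem interp_scalar_tensor {n m : ℕ} (s : ZX 0 0) (D : ZX n m) (o : Fin m → Fin 3)
    (i : Fin n → Fin 3) : interp (s ⊠ D) (o ∘ Fin.cast (Nat.zero_add m))
      (i ∘ Fin.cast (Nat.zero_add n)) = interp s Fin.elim0 Fin.elim0 * interp D o i := by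
  rw [interp_tensor_apply]
  congr 1
  · congr 1 <;> exact Subsingleton.elim _ _
  · have h : ∀ k (x : Fin k → Fin 3),
        (fun j => (x ∘ Fin.cast (Nat.zero_add k)) (Fin.natAdd 0 j)) = x := fun k x =>
      funext fun j => congrArg x (Fin.ext (by simp))
    rw [h, h]

/-- Proportional interpretations, with a non-zero factor. -/
def Proportional {n m : ℕ} (D E : ZX n m) : Prop := ∃ c : ℂ, c ≠ 0 ∧ interp D = c • interp E

theorem Proportional.of_eq {n m : ℕ} {D E : ZX n m} (h : interp D = interp E) : Proportional D E :=
  ⟨1, one_ne_zero, by rw [one_smul, h]⟩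

theorem Proportional.symm {n m : ℕ} {D E : ZX n m} (h : Proportional D E) : Proportional E D := by
  obtain ⟨c, hc, h⟩ := h
  exact ⟨c⁻¹, inv_ne_zero hc, by rw [h, smul_smul, inv_mul_cancel₀ hc, one_smul]⟩

theorem Proportional.trans {n m : ℕ} {D E F : ZX n m} (h : Proportional D E)
    (h' : Proportional E F) : Proportional D F := by
  obtain ⟨c, hc, h⟩ := h
  obtain ⟨c', hc', h'⟩ := h'
  exact ⟨c * c', mul_ne_zero hc hc', by rw [h, h', smul_smul]⟩

theorem Proportional.comp {n m k : ℕ} {A A' : ZX n m} {B B' : ZX m k} (h : Proportional A A')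
    (h' : Proportional B B') :
    Proportional (A ⨾ B) (A' ⨾ B') := by
  obtain ⟨c, hc, h⟩ := h
  obtain ⟨c', hc', h'⟩ := h'
  refine ⟨c * c', mul_ne_zero hc hc', ?_⟩
  rw [interp, interp, h, h', Matrix.smul_mul, Matrix.mul_smul, smul_smul, mul_comm]

theorem Proportional.tensor {n m n' m' : ℕ} {A A' : ZX n m} {B B' : ZX n' m'}
    (h : Proportional A A')
    (h' : Proportional B B') : Proportional (A ⊠ B) (A' ⊠ B') := by
  obtain ⟨c, hc, h⟩ := h
  obtain ⟨c', hc', h'⟩ := h'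
  refine ⟨c * c', mul_ne_zero hc hc', ?_⟩
  ext o i
  rw [Matrix.smul_apply, interp_tensor_apply, interp_tensor_apply, h, h']
  simp only [Matrix.smul_apply, smul_eq_mul]
  ring

theorem interp_empty_tensor {n m : ℕ} (D : ZX n m) :
    interp (cast (Nat.zero_add n) (Nat.zero_add m) (empty ⊠ D)) = interp D := by
  ext o i
  rw [interp_cast, interp_scalar_tensor, interp, Matrix.one_apply_eq, one_mul]

theorem interp_tensor_empty {n m : ℕ} (D : ZX n m) : interp (D ⊠ empty) = interp D := by
  ext o i
  have h : ∀ x y, interp empty x y = 1 := fun x y => by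
    rw [Subsingleton.elim x y, interp, Matrix.one_apply_eq]
  rw [interp_tensor_apply, h, mul_one]
  rfl

theorem interp_tensor_assoc {n₁ m₁ n₂ m₂ n₃ m₃ : ℕ} (A : ZX n₁ m₁) (B : ZX n₂ m₂) (C : ZX n₃ m₃) :
    interp (cast (Nat.add_assoc n₁ n₂ n₃) (Nat.add_assoc m₁ m₂ m₃) (A ⊠ B ⊠ C)) =
      interp (A ⊠ (B ⊠ C)) := by
  ext o i
  rw [interp_cast]
  simp only [interp_tensor_apply]
  rw [mul_assoc]
  have h : ∀ (a b c : ℕ) (x : Fin (a + (b + c)) → Fin 3),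
      (fun k => (x ∘ Fin.cast (Nat.add_assoc a b c)) (Fin.natAdd (a + b) k)) =
        fun k => x (Fin.natAdd a (Fin.natAdd b k)) := fun a b c x =>
    funext fun k => congrArg x (Fin.ext (by simp [add_assoc]))
  rw [h, h]
  rfl

theorem interp_interchange {n m k n' m' k' : ℕ} (A : ZX n m) (B : ZX m k) (A' : ZX n' m')
    (B' : ZX m' k') : interp ((A ⨾ B) ⊠ (A' ⨾ B')) = interp ((A ⊠ A') ⨾ (B ⊠ B')) := by
  ext o i
  obtain ⟨o, o', rfl⟩ := exists_append o
  obtain ⟨i, i', rfl⟩ := exists_append i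
  rw [interp_tensor_append, interp_comp_apply, interp_comp_apply, interp_comp_apply, sum_append,
    Finset.sum_mul_sum]
  refine Finset.sum_congr rfl fun u _ => Finset.sum_congr rfl fun v _ => ?_
  rw [interp_tensor_append, interp_tensor_append]
  ring

theorem prop_of_scalar {n m : ℕ} {D E : ZX n m} {s t : ZX 0 0} (hs : interp s ≠ 0)
    (ht : interp t ≠ 0) (h : Proportional (s ⊠ D) (t ⊠ E)) : Proportional D E := by
  have key : ∀ s : ZX 0 0, interp s ≠ 0 → interp s Fin.elim0 Fin.elim0 ≠ 0 := by
    intro s hs h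
    refine hs (Matrix.ext fun o i => ?_)
    rw [Subsingleton.elim o Fin.elim0, Subsingleton.elim i Fin.elim0, h, Matrix.zero_apply]
  have hs' := key s hs
  have ht' := key t ht
  obtain ⟨c, hc, h⟩ := h
  refine ⟨(interp s Fin.elim0 Fin.elim0)⁻¹ * (c * interp t Fin.elim0 Fin.elim0),
    mul_ne_zero (inv_ne_zero hs') (mul_ne_zero hc ht'), ?_⟩
  ext o i
  have h1 := congrFun (congrFun h (o ∘ Fin.cast (Nat.zero_add m))) (i ∘ Fin.cast (Nat.zero_add n))
  rw [Matrix.smul_apply, interp_scalar_tensor, interp_scalar_tensor, smul_eq_mul] at h1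
  rw [Matrix.smul_apply, smul_eq_mul]
  field_simp
  rw [mul_comm, h1]
  ring

/-- Diagrams without nodes are interpreted by maps of the indices. -/
def IsMap {n m : ℕ} (D : ZX n m) (e : Fin m → Fin n) : Prop :=
  ∀ o i, interp D o i = if o = i ∘ e then 1 else 0

theorem IsMap.comp {n m k : ℕ} {A : ZX n m} {B : ZX m k} {e : Fin m → Fin n} {f : Fin k → Fin m}
    (hA : IsMap A e) (hB : IsMap B f) : IsMap (A ⨾ B) (e ∘ f) := by
  intro o i
  rw [interp_comp_apply]
  simp only [hA _ i, hB o, mul_ite, mul_one, mul_zero, Finset.sum_ite_eq', Finset.mem_univ, if_true]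
  rfl

theorem IsMap.tensor {n m n' m' : ℕ} {A : ZX n m} {B : ZX n' m'} {e : Fin m → Fin n}
    {f : Fin m' → Fin n'} (hA : IsMap A e) (hB : IsMap B f) :
    IsMap (A ⊠ B) (Fin.append (Fin.castAdd n' ∘ e) (Fin.natAdd n ∘ f)) := by
  intro o i
  obtain ⟨o, o', rfl⟩ := exists_append o
  rw [interp_tensor_apply]
  simp only [Fin.append_left, Fin.append_right]
  rw [hA, hB, ite_zero_mul_ite_zero, mul_one]
  have h : i ∘ Fin.append (Fin.castAdd n' ∘ e) (Fin.natAdd n ∘ f) =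
      Fin.append (i ∘ Fin.castAdd n' ∘ e) (i ∘ Fin.natAdd n ∘ f) := by
    funext k
    refine Fin.addCases (fun k => ?_) (fun k => ?_) k <;> simp
  rw [h]
  exact if_congr append_inj.symm rfl rfl

theorem isMap_wires (n : ℕ) : IsMap (wires n) id := fun o i => by
  rw [interp_wires, Matrix.one_apply]
  rfl

theorem isMap_wire : IsMap wire id := fun o i => by
  rw [interp, Matrix.one_apply]
  rfl

theorem isMap_swap : IsMap swap ![1, 0] := fun o i => by
  refine if_congr ?_ rfl rfl
  constructor
  · rintro ⟨h0, h1⟩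
    funext k
    fin_cases k
    · exact h0
    · exact h1
  · rintro rfl
    exact ⟨rfl, rfl⟩

theorem IsMap.congr {n m : ℕ} {A : ZX n m} {e f : Fin m → Fin n} (hA : IsMap A e) (h : e = f) :
    IsMap A f := h ▸ hA

theorem isMap_crossing : (n : ℕ) →
    IsMap (crossing n) (Fin.append (fun _ : Fin 1 => Fin.last n) Fin.castSucc)
  | 0 => isMap_wire.congr (funext fun k => Subsingleton.elim _ _)
  | n + 1 => by
    have h1 : IsMap (swapLast n) _ := (isMap_wires n).tensor isMap_swap
    have h2 : IsMap (crossing (n + 1)) _ := h1.comp ((isMap_crossing n).tensor isMap_wire)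
    refine h2.congr (funext fun (k : Fin (1 + n + 1)) => ?_)
    refine Fin.addCases (fun k => ?_) (fun k => ?_) k
    · refine Fin.addCases (fun k => ?_) (fun k => ?_) k
      · have e : (Fin.castAdd 1 (Fin.castAdd n k) : Fin (1 + n + 1)) = Fin.castAdd (n + 1) k := rfl
        rw [Function.comp_apply, Fin.append_left, e, Fin.append_left, Function.comp_apply,
          Fin.append_left]
        exact Fin.append_right (Fin.castAdd 2 ∘ id) (Fin.natAdd n ∘ ![1, 0]) 0
      · have e : (Fin.castAdd 1 (Fin.natAdd 1 k) : Fin (1 + n + 1)) = Fin.natAdd 1 k.castSucc := rfl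
        rw [Function.comp_apply, Fin.append_left, e, Fin.append_right, Function.comp_apply,
          Fin.append_right]
        exact Fin.append_left (Fin.castAdd 2 ∘ id) (Fin.natAdd n ∘ ![1, 0]) k
    · have e : (Fin.natAdd (1 + n) k : Fin (1 + n + 1)) = Fin.natAdd 1 (Fin.last n) := by
        rw [Subsingleton.elim k 0]
        exact Fin.ext (by simp)
      rw [Function.comp_apply, Fin.append_right, e, Fin.append_right, Subsingleton.elim k 0]
      exact Fin.append_right (Fin.castAdd 2 ∘ id) (Fin.natAdd n ∘ ![1, 0]) 1

theorem interp_slide {n m : ℕ} (D : ZX n m) :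
    interp ((D ⊠ wire) ⨾ crossing m) = interp (crossing n ⨾ (wire ⊠ D)) := by
  ext o i
  rw [interp_comp_apply, interp_comp_apply]
  obtain ⟨a, x, rfl⟩ := exists_append o
  obtain ⟨y, b, rfl⟩ := exists_append i
  have h : ∀ (n : ℕ) (y : Fin n → Fin 3) (b : Fin 1 → Fin 3), Fin.append y b ∘
      Fin.append (fun _ : Fin 1 => Fin.last n) Fin.castSucc = Fin.append b y := by
    intro n y b
    funext k
    refine Fin.addCases (fun k => ?_) (fun k => ?_) k
    · rw [Function.comp_apply, Fin.append_left, Fin.append_left, Subsingleton.elim k 0]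
      exact Fin.append_right y b 0
    · rw [Function.comp_apply, Fin.append_right, Fin.append_right]
      exact Fin.append_left y b k
  rw [sum_append]
  simp only [isMap_crossing _ _ _, h, interp_tensor_append, mul_ite, mul_one, mul_zero, ite_mul,
    one_mul, zero_mul, append_inj, Finset.sum_ite_eq', Finset.mem_univ, if_true]
  simp only [ite_and, Finset.sum_ite_eq, Finset.mem_univ, if_true]
  ring

/-! ### Soundness: green spiders -/

/-- The coordinates of `|j⟩^{⊗ n}`. -/
noncomputable def basis {n : ℕ} (j : Fin 3) (x : Fin n → Fin 3) : ℂ :=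
  if x = fun _ => j then 1 else 0

theorem interp_Z (n m : ℕ) (α β : Real.Angle) (o : Fin m → Fin 3) (i : Fin n → Fin 3) :
    interp (Z n m α β) o i = ∑ j, phase α β j * (basis j o * basis j i) := by
  rw [interp, Matrix.of_apply]
  refine Finset.sum_congr rfl fun j _ => ?_
  rw [basis, basis, ite_zero_mul_ite_zero, mul_one]
  congr 1
  exact if_congr (by rw [funext_iff, funext_iff]) rfl rfl

theorem basis_append {n m : ℕ} (j : Fin 3) (u : Fin n → Fin 3) (v : Fin m → Fin 3) :
    basis j (Fin.append u v) = basis j u * basis j v := by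
  rw [basis, basis, basis, ite_zero_mul_ite_zero, mul_one]
  refine if_congr ?_ rfl rfl
  rw [← append_inj]
  have h : Fin.append (fun _ : Fin n => j) (fun _ : Fin m => j) = fun _ => j := by
    funext k
    refine Fin.addCases (fun k => ?_) (fun k => ?_) k <;> simp
  rw [h]

theorem sum_mul_basis {n : ℕ} (j : Fin 3) (f : (Fin n → Fin 3) → ℂ) :
    ∑ x, f x * basis j x = f fun _ => j := by
  simp only [basis, mul_ite, mul_one, mul_zero, Finset.sum_ite_eq', Finset.mem_univ, if_true]

theorem basis_const {n : ℕ} (j l : Fin 3) :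
    basis l (fun _ : Fin (n + 1) => j) = if l = j then 1 else 0 :=
  if_congr ⟨fun h => (congrFun h 0).symm, fun h => by rw [h]⟩ rfl rfl

theorem sum_basis_mul_basis {n : ℕ} (a b : Fin 3 → ℂ) :
    ∑ v : Fin (n + 1) → Fin 3, (∑ l, a l * basis l v) * (∑ j, b j * basis j v) =
      ∑ j, a j * b j := by
  simp only [Finset.mul_sum, ← mul_assoc]
  rw [Finset.sum_comm]
  refine Finset.sum_congr rfl fun j _ => ?_
  rw [sum_mul_basis]
  simp only [basis_const, mul_ite, mul_one, mul_zero, Finset.sum_ite_eq', Finset.mem_univ, if_true]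

theorem phase_add (α β γ δ : Real.Angle) (j : Fin 3) :
    phase (α + γ) (β + δ) j = phase α β j * phase γ δ j := by
  fin_cases j <;> simp [phase, Real.Angle.toCircle_add]

theorem interp_S1 (n m n' m' k : ℕ) (α β γ δ : Real.Angle) :
    interp ((Z n (m + (k + 1)) α β ⊠ wires n') ⨾
      cast (Nat.add_assoc m (k + 1) n').symm rfl (wires m ⊠ Z ((k + 1) + n') m' γ δ)) =
      interp (Z (n + n') (m + m') (α + γ) (β + δ)) := by
  ext o i
  obtain ⟨o, o', rfl⟩ := exists_append o
  obtain ⟨i, i', rfl⟩ := exists_append i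
  rw [interp_comp_apply, sum_append]
  have e1 : ∀ (u : Fin (m + (k + 1)) → Fin 3) (t : Fin n' → Fin 3),
      interp (Z n (m + (k + 1)) α β ⊠ wires n') (Fin.append u t) (Fin.append i i') =
        if t = i' then interp (Z n (m + (k + 1)) α β) u i else 0 := by
    intro u t
    rw [interp_tensor_append, interp_wires, Matrix.one_apply, mul_ite, mul_one, mul_zero]
  simp only [e1, mul_ite, mul_zero, Finset.sum_ite_eq', Finset.mem_univ, if_true]
  rw [sum_append]
  have e2 : ∀ (u : Fin m → Fin 3) (v : Fin (k + 1) → Fin 3),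
      interp (cast (Nat.add_assoc m (k + 1) n').symm rfl (wires m ⊠ Z ((k + 1) + n') m' γ δ))
        (Fin.append o o') (Fin.append (Fin.append u v) i') =
        if o = u then interp (Z ((k + 1) + n') m' γ δ) o' (Fin.append v i') else 0 := by
    intro u v
    have h : Fin.append (Fin.append u v) i' ∘ Fin.cast (Nat.add_assoc m (k + 1) n').symm =
        Fin.append u (Fin.append v i') := by
      rw [Fin.append_assoc]
      rfl
    rw [interp_cast, h]
    refine (interp_tensor_append (wires m) (Z ((k + 1) + n') m' γ δ) o o' u _).trans ?_
    rw [interp_wires, Matrix.one_apply, ite_mul, one_mul, zero_mul]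
  simp only [e2, ite_mul, zero_mul]
  rw [Finset.sum_comm]
  simp only [Finset.sum_ite_eq, Finset.mem_univ, if_true, interp_Z, basis_append]
  have h := sum_basis_mul_basis (n := k) (fun l => phase γ δ l * basis l o' * basis l i')
    (fun j => phase α β j * basis j o * basis j i)
  refine Eq.trans ?_ (h.trans ?_)
  · refine Finset.sum_congr rfl fun v _ => ?_
    congr 1 <;> refine Finset.sum_congr rfl fun j _ => ?_ <;> ring
  · refine Finset.sum_congr rfl fun j _ => ?_
    rw [phase_add]
    ring

theorem interp_comp_isMap {n m : ℕ} {e : Fin m → Fin m} (he : ∀ k, e (e k) = k) {A : ZX n m}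
    {B : ZX m m} (hB : IsMap B e) (o : Fin m → Fin 3) (i : Fin n → Fin 3) :
    interp (A ⨾ B) o i = interp A (o ∘ e) i := by
  have h : ∀ w : Fin m → Fin 3, o = w ∘ e ↔ w = o ∘ e := by
    intro w
    constructor
    · rintro rfl
      exact funext fun k => congrArg w (he k).symm
    · rintro rfl
      exact funext fun k => congrArg o (he k).symm
  rw [interp_comp_apply]
  simp only [hB _ _, h, ite_mul, one_mul, zero_mul, Finset.sum_ite_eq', Finset.mem_univ, if_true]

theorem interp_isMap_comp {n m : ℕ} {e : Fin n → Fin n} {A : ZX n m}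
    {B : ZX n n} (hB : IsMap B e) (o : Fin m → Fin 3) (i : Fin n → Fin 3) :
    interp (B ⨾ A) o i = interp A o (i ∘ e) := by
  rw [interp_comp_apply]
  simp only [hB _ _, mul_ite, mul_one, mul_zero, Finset.sum_ite_eq', Finset.mem_univ, if_true]

theorem basis_comp {n : ℕ} {e : Fin n → Fin n} (he : ∀ k, e (e k) = k) (j : Fin 3)
    (x : Fin n → Fin 3) : basis j (x ∘ e) = basis j x := by
  refine if_congr ⟨fun h => funext fun k => ?_, fun h => by rw [h]; rfl⟩ rfl rfl
  have := congrFun h (e k)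
  rwa [Function.comp_apply, he] at this

theorem exists_isMap_swap (n m : ℕ) :
    ∃ e, (∀ k, e (e k) = k) ∧ IsMap (wires n ⊠ swap ⊠ wires m) e := by
  refine ⟨_, ?_, ((isMap_wires n).tensor isMap_swap).tensor (isMap_wires m)⟩
  intro k
  refine Fin.addCases (fun k => ?_) (fun k => ?_) k
  · refine Fin.addCases (fun k => ?_) (fun k => ?_) k
    · simp
    · fin_cases k <;> simp
  · simp

theorem interp_S1_out (n m m' : ℕ) (α β : Real.Angle) :
    interp (Z n (m + 2 + m') α β ⨾ (wires m ⊠ swap ⊠ wires m')) =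
      interp (Z n (m + 2 + m') α β) := by
  obtain ⟨e, he, h⟩ := exists_isMap_swap m m'
  ext o i
  rw [interp_comp_isMap he h, interp_Z, interp_Z]
  simp only [basis_comp he]

theorem interp_S1_in (n n' m : ℕ) (α β : Real.Angle) :
    interp ((wires n ⊠ swap ⊠ wires n') ⨾ Z (n + 2 + n') m α β) =
      interp (Z (n + 2 + n') m α β) := by
  obtain ⟨e, he, h⟩ := exists_isMap_swap n n'
  ext o i
  rw [interp_isMap_comp h, interp_Z, interp_Z]
  simp only [basis_comp he]

/-! ### Soundness: diagrams with few wires -/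

theorem exists_one (x : Fin 1 → Fin 3) : ∃ a, x = fun _ => a :=
  ⟨x 0, funext fun k => by rw [Subsingleton.elim k 0]⟩

theorem exists_two (x : Fin 2 → Fin 3) : ∃ a b, x = ![a, b] :=
  ⟨x 0, x 1, funext fun k => by fin_cases k <;> rfl⟩

theorem sum_fin_two (f : (Fin 2 → Fin 3) → ℂ) : ∑ w, f w = ∑ a, ∑ b, f ![a, b] := by
  rw [← (finTwoArrowEquiv (Fin 3)).symm.sum_comp, Fintype.sum_prod_type]
  rfl

theorem sum_fin_three (f : (Fin 3 → Fin 3) → ℂ) :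
    ∑ w, f w = ∑ a, ∑ b, ∑ c, f ![a, b, c] := by
  rw [← (Fin.consEquiv fun _ : Fin 3 => Fin 3).sum_comp, Fintype.sum_prod_type]
  refine Finset.sum_congr rfl fun a _ => ?_
  rw [sum_fin_two]
  rfl

theorem sum_fin_four (f : (Fin 4 → Fin 3) → ℂ) :
    ∑ w, f w = ∑ a, ∑ b, ∑ c, ∑ d, f ![a, b, c, d] := by
  rw [← (Fin.consEquiv fun _ : Fin 4 => Fin 3).sum_comp, Fintype.sum_prod_type]
  refine Finset.sum_congr rfl fun a _ => ?_
  rw [sum_fin_three]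
  rfl

theorem interp_wire (o i : Fin 1 → Fin 3) : interp wire o i = if o 0 = i 0 then 1 else 0 := by
  rw [interp, Matrix.one_apply]
  refine if_congr ⟨fun h => congrFun h 0, fun h => funext fun k => ?_⟩ rfl rfl
  rw [Subsingleton.elim k 0, h]

theorem phase_zero (j : Fin 3) : phase 0 0 j = 1 := by
  fin_cases j <;> simp [phase]

theorem interp_S2 : interp (Z 1 1 0 0) = interp wire := by
  ext o i
  obtain ⟨a, rfl⟩ := exists_one o
  obtain ⟨b, rfl⟩ := exists_one i
  rw [interp_wire, interp_Z]
  simp only [phase_zero, basis_const, mul_ite, mul_one, mul_zero, Finset.sum_ite_eq',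
    Finset.mem_univ, if_true]
  exact if_congr eq_comm rfl rfl

theorem basis_two (j a b : Fin 3) : basis j ![a, b] = if j = a ∧ j = b then 1 else 0 := by
  refine if_congr ⟨fun h => ⟨(congrFun h 0).symm, (congrFun h 1).symm⟩, ?_⟩ rfl rfl
  rintro ⟨rfl, rfl⟩
  funext k
  fin_cases k <;> rfl

theorem basis_zero (j : Fin 3) (x : Fin 0 → Fin 3) : basis j x = 1 := if_pos (Subsingleton.elim _ _)

theorem interp_S3_cap : interp (Z 0 2 0 0) = interp cap := by
  ext o i
  obtain ⟨a, b, rfl⟩ := exists_two o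
  rw [interp_Z]
  simp only [phase_zero, basis_two, basis_zero, one_mul, mul_one, ite_and, Finset.sum_ite_eq',
    Finset.mem_univ, if_true]
  rfl

theorem interp_S3_cup : interp (Z 2 0 0 0) = interp cup := by
  ext o i
  obtain ⟨a, b, rfl⟩ := exists_two i
  rw [interp_Z]
  simp only [phase_zero, basis_two, basis_zero, one_mul, ite_and, Finset.sum_ite_eq',
    Finset.mem_univ, if_true]
  rfl

theorem interp_swap_swap : interp (swap ⨾ swap) = interp (wires 2) := by
  ext o i
  have h := (isMap_swap.comp isMap_swap).congr (f := id) (by decide) o i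
  rw [h, isMap_wires]

theorem interp_cap_swap : interp (cap ⨾ swap) = interp cap := by
  ext o i
  rw [interp_comp_isMap (by decide) isMap_swap]
  exact if_congr eq_comm rfl rfl

theorem interp_swap_cup : interp (swap ⨾ cup) = interp cup := by
  ext o i
  rw [interp_isMap_comp isMap_swap]
  exact if_congr eq_comm rfl rfl

theorem interp_cap_wire (a b c : Fin 3) (i : Fin 1 → Fin 3) :
    interp (@tensor 0 2 1 1 cap wire) ![a, b, c] i =
      (if a = b then 1 else 0) * (if c = i 0 then 1 else 0) := by
  rw [interp_tensor_apply, interp_wire]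
  rfl

theorem interp_wire_cup (a b c : Fin 3) (o : Fin 1 → Fin 3) :
    interp (@tensor 1 1 2 0 wire cup) o ![a, b, c] =
      (if o 0 = a then 1 else 0) * (if b = c then 1 else 0) := by
  rw [interp_tensor_apply, interp_wire]
  rfl

theorem interp_wire_cap (a b c : Fin 3) (i : Fin 1 → Fin 3) :
    interp (@tensor 1 1 0 2 wire cap) ![a, b, c] i =
      (if a = i 0 then 1 else 0) * (if b = c then 1 else 0) := by
  rw [interp_tensor_apply, interp_wire]
  rfl

theorem interp_cup_wire (a b c : Fin 3) (o : Fin 1 → Fin 3) :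
    interp (@tensor 2 0 1 1 cup wire) o ![a, b, c] =
      (if a = b then 1 else 0) * (if o 0 = c then 1 else 0) := by
  rw [interp_tensor_apply, interp_wire]
  rfl

theorem interp_snake_left :
    interp (@tensor 0 2 1 1 cap wire ⨾ @tensor 1 1 2 0 wire cup) = interp wire := by
  ext o i
  obtain ⟨a, rfl⟩ := exists_one o
  obtain ⟨b, rfl⟩ := exists_one i
  rw [interp_comp_apply, interp_wire, sum_fin_three]
  simp only [interp_cap_wire, interp_wire_cup, Fin.sum_univ_three]
  fin_cases a <;> fin_cases b <;> simp

theorem interp_snake_right :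
    interp (@tensor 1 1 0 2 wire cap ⨾ @tensor 2 0 1 1 cup wire) = interp wire := by
  ext o i
  obtain ⟨a, rfl⟩ := exists_one o
  obtain ⟨b, rfl⟩ := exists_one i
  rw [interp_comp_apply, interp_wire, sum_fin_three]
  simp only [interp_wire_cap, interp_cup_wire, Fin.sum_univ_three]
  fin_cases a <;> fin_cases b <;> simp

/-! ### Soundness: red spiders -/

theorem star_omega : star ω = ω ^ 2 := by
  have h : star ω * ω = 1 := by
    have h1 : ‖ω‖ = 1 := Complex.norm_eq_one_of_pow_eq_one omega_cube (by decide)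
    have h2 := Complex.conj_mul' ω
    rw [h1] at h2
    simpa using h2
  linear_combination (-(star ω)) * omega_cube + ω ^ 2 * h

theorem omega_pow (n : ℕ) : ω ^ n = ω ^ (n % 3) := pow_eq_pow_mod n omega_cube

theorem sum_omega (n : ℕ) : ∑ j : Fin 3, ω ^ (j.val * n) = if 3 ∣ n then 3 else 0 := by
  simp only [mul_comm _ n, pow_mul]
  rw [omega_pow n, Fin.sum_univ_three]
  have h : n % 3 = 0 ∨ n % 3 = 1 ∨ n % 3 = 2 := by omega
  rcases h with h | h | h
  · rw [h, if_pos (Nat.dvd_of_mod_eq_zero h)]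
    norm_num
  · rw [h, if_neg (by omega)]
    simpa using omega_sum
  · rw [h, if_neg (by omega)]
    simp
    linear_combination omega_sum + ω * omega_cube

theorem phase_third (k : ZMod 3) (j : Fin 3) :
    phase (third k) (third (2 * k)) j = ω ^ (j.val * k.val) := by
  fin_cases j
  · simp [phase]
  · simp [phase, toCircle_third]
  · have h : (2 * k).val = 2 * k.val % 3 := by
      revert k
      decide
    change ((third (2 * k)).toCircle : ℂ) = ω ^ (2 * k.val)
    rw [toCircle_third, h, ← omega_pow]

theorem interp_X_third (n m : ℕ) (k : ZMod 3) (o : Fin m → Fin 3) (i : Fin n → Fin 3) :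
    interp (X n m (third k) (third (2 * k))) o i =
      if 3 ∣ k.val + (∑ l, (o l).val + 2 * ∑ l, (i l).val) then 3 else 0 := by
  rw [← sum_omega, interp, Matrix.of_apply]
  refine Finset.sum_congr rfl fun j _ => ?_
  rw [phase_third, star_omega]
  simp only [← pow_mul]
  rw [Finset.prod_pow_eq_pow_sum, Finset.prod_pow_eq_pow_sum, ← pow_add, ← pow_add]
  congr 1
  rw [← Finset.mul_sum, ← Finset.mul_sum, ← Finset.mul_sum]
  ring

theorem interp_X (n m : ℕ) (o : Fin m → Fin 3) (i : Fin n → Fin 3) :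
    interp (X n m 0 0) o i =
      if 3 ∣ (∑ l, (o l).val + 2 * ∑ l, (i l).val) then 3 else 0 := by
  have h := interp_X_third n m 0 o i
  rw [mul_zero, third_zero, ZMod.val_zero, zero_add] at h
  exact h

theorem interp_X_zero_one (a : Fin 3) (i : Fin 0 → Fin 3) :
    interp (X 0 1 0 0) (fun _ => a) i = if a = 0 then 3 else 0 := by
  rw [interp_X]
  simp only [Finset.univ_eq_empty, Finset.sum_empty, Fin.sum_univ_one]
  have : ∀ a : Fin 3, 3 ∣ a.val + 2 * 0 ↔ a = 0 := by decide
  exact if_congr (this a) rfl rfl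

theorem interp_X_one_zero (a : Fin 3) (o : Fin 0 → Fin 3) :
    interp (X 1 0 0 0) o (fun _ => a) = if a = 0 then 3 else 0 := by
  rw [interp_X]
  simp only [Finset.univ_eq_empty, Finset.sum_empty, Fin.sum_univ_one]
  have : ∀ a : Fin 3, 3 ∣ 0 + 2 * a.val ↔ a = 0 := by decide
  exact if_congr (this a) rfl rfl

theorem interp_X_two_one (c a b : Fin 3) :
    interp (X 2 1 0 0) (fun _ => c) ![a, b] = if c = a + b then 3 else 0 := by
  rw [interp_X]
  simp only [Fin.sum_univ_two, Fin.sum_univ_one]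
  have : ∀ a b c : Fin 3, 3 ∣ c.val + 2 * (a.val + b.val) ↔ c = a + b := by decide
  exact if_congr (this a b c) rfl rfl

theorem interp_X_one_two (c a b : Fin 3) :
    interp (X 1 2 0 0) ![a, b] (fun _ => c) = if c = a + b then 3 else 0 := by
  rw [interp_X]
  simp only [Fin.sum_univ_two, Fin.sum_univ_one]
  have : ∀ a b c : Fin 3, 3 ∣ (a.val + b.val) + 2 * c.val ↔ c = a + b := by decide
  exact if_congr (this a b c) rfl rfl

theorem interp_X_one_one (k : ZMod 3) (a b : Fin 3) :
    interp (X 1 1 (third k) (third (2 * k))) (fun _ => a) (fun _ => b) =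
      if b = a + Fin.ofNat 3 k.val then 3 else 0 := by
  rw [interp_X_third]
  simp only [Fin.sum_univ_one]
  have : ∀ (k : ZMod 3) (a b : Fin 3), 3 ∣ k.val + (a.val + 2 * b.val) ↔
      b = a + Fin.ofNat 3 k.val := by
    decide
  exact if_congr (this k a b) rfl rfl

theorem interp_copy (a b c : Fin 3) :
    interp (Z 1 2 0 0) ![a, b] (fun _ => c) = if a = c ∧ b = c then 1 else 0 := by
  rw [interp_Z]
  simp only [phase_zero, basis_two, basis_const, mul_ite, mul_one, mul_zero,
    Finset.sum_ite_eq', Finset.mem_univ, if_true]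
  exact if_congr (by rw [eq_comm, @eq_comm _ c b]) rfl rfl

theorem interp_merge (a b c : Fin 3) :
    interp (Z 2 1 0 0) (fun _ => c) ![a, b] = if a = c ∧ b = c then 1 else 0 := by
  rw [interp_Z]
  simp only [phase_zero, basis_two, basis_const, one_mul, ite_mul, zero_mul,
    Finset.sum_ite_eq', Finset.mem_univ, if_true]
  exact if_congr (by rw [eq_comm, @eq_comm _ c b]) rfl rfl

theorem two_eq_append (a b : Fin 3) :
    ![a, b] = Fin.append (fun _ : Fin 1 => a) (fun _ : Fin 1 => b) := by
  funext k
  fin_cases k <;> rfl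

theorem four_eq_append (a b c d : Fin 3) : ![a, b, c, d] = Fin.append ![a, b] ![c, d] := by
  funext k
  fin_cases k <;> rfl

theorem interp_tensor_two {A B : ZX 1 1} (a b c d : Fin 3) : interp (A ⊠ B) ![a, b] ![c, d] =
    interp A (fun _ => a) (fun _ => c) * interp B (fun _ => b) (fun _ => d) := by
  rw [two_eq_append, two_eq_append]
  exact interp_tensor_append A B _ _ _ _

theorem isMap_swapMid : IsMap swapMid ![0, 2, 1, 3] :=
  ((isMap_wire.tensor isMap_swap).tensor isMap_wire).congr (by decide)

theorem four_comp (a b c d : Fin 3) : ![a, b, c, d] ∘ ![0, 2, 1, 3] = ![a, c, b, d] := by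
  funext k
  fin_cases k <;> rfl

theorem prop_B1 : Proportional (X 0 1 0 0 ⨾ Z 1 2 0 0) (X 0 1 0 0 ⊠ X 0 1 0 0) := by
  refine Proportional.symm ⟨3, by norm_num, ?_⟩
  ext o i
  obtain ⟨a, b, rfl⟩ := exists_two o
  have h : interp (X 0 1 0 0 ⊠ X 0 1 0 0) ![a, b] i =
      interp (X 0 1 0 0) (fun _ => a) Fin.elim0 * interp (X 0 1 0 0) (fun _ => b) Fin.elim0 := by
    rw [two_eq_append, Subsingleton.elim i (Fin.append Fin.elim0 Fin.elim0)]
    exact interp_tensor_append _ _ _ _ _ _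
  rw [h, Matrix.smul_apply, interp_comp_apply, sum_fin_one]
  simp only [interp_X_zero_one, interp_copy, Fin.sum_univ_three]
  fin_cases a <;> fin_cases b <;> simp

theorem prop_B1_flip : Proportional (Z 2 1 0 0 ⨾ X 1 0 0 0) (X 1 0 0 0 ⊠ X 1 0 0 0) := by
  refine Proportional.symm ⟨3, by norm_num, ?_⟩
  ext o i
  obtain ⟨a, b, rfl⟩ := exists_two i
  have h : interp (X 1 0 0 0 ⊠ X 1 0 0 0) o ![a, b] =
      interp (X 1 0 0 0) Fin.elim0 (fun _ => a) * interp (X 1 0 0 0) Fin.elim0 (fun _ => b) := by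
    rw [two_eq_append, Subsingleton.elim o (Fin.append Fin.elim0 Fin.elim0)]
    exact interp_tensor_append _ _ _ _ _ _
  rw [h, Matrix.smul_apply, interp_comp_apply, sum_fin_one]
  simp only [interp_X_one_zero, interp_merge, Fin.sum_univ_three]
  fin_cases a <;> fin_cases b <;> simp

theorem sum_sum_copy (f : Fin 3 → Fin 3 → Fin 3 → Fin 3 → ℂ) (a b : Fin 3) :
    ∑ x, ∑ y, ∑ z, ∑ w, f x y z w * ((if x = a ∧ z = a then 1 else 0) *
      (if y = b ∧ w = b then 1 else 0)) = f a b a b := by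
  rw [Finset.sum_eq_single a, Finset.sum_eq_single b, Finset.sum_eq_single a,
    Finset.sum_eq_single b]
  · simp
  all_goals simp +contextual

theorem prop_B2 : Proportional (X 2 1 0 0 ⨾ Z 1 2 0 0)
    ((Z 1 2 0 0 ⊠ Z 1 2 0 0) ⨾ swapMid ⨾ (X 2 1 0 0 ⊠ X 2 1 0 0)) := by
  refine Proportional.symm ⟨3, by norm_num, ?_⟩
  ext o i
  obtain ⟨p, q, rfl⟩ := exists_two o
  obtain ⟨a, b, rfl⟩ := exists_two i
  have h1 : ∀ x y z w, interp (Z 1 2 0 0 ⊠ Z 1 2 0 0) ![x, z, y, w] ![a, b] =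
      (if x = a ∧ z = a then 1 else 0) * (if y = b ∧ w = b then 1 else 0) := by
    intro x y z w
    rw [four_eq_append, two_eq_append a b, ← interp_copy, ← interp_copy]
    exact interp_tensor_append _ _ _ _ _ _
  have h2 : ∀ x y z w, interp (X 2 1 0 0 ⊠ X 2 1 0 0) ![p, q] ![x, y, z, w] =
      (if p = x + y then 3 else 0) * (if q = z + w then 3 else 0) := by
    intro x y z w
    rw [four_eq_append, two_eq_append p q, ← interp_X_two_one, ← interp_X_two_one]
    exact interp_tensor_append _ _ _ _ _ _
  rw [Matrix.smul_apply, interp_comp_apply, sum_fin_four]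
  simp only [interp_comp_isMap (e := ![0, 2, 1, 3]) (by decide) isMap_swapMid, four_comp, h1, h2]
  rw [sum_sum_copy (fun x y z w => (if p = x + y then 3 else 0) * (if q = z + w then 3 else 0)),
    interp_comp_apply, sum_fin_one]
  simp only [interp_copy, interp_X_two_one]
  generalize a + b = c
  simp only [Fin.sum_univ_three]
  fin_cases p <;> fin_cases q <;> fin_cases c <;> simp

theorem prop_B2_flip : Proportional (Z 2 1 0 0 ⨾ X 1 2 0 0)
    ((X 1 2 0 0 ⊠ X 1 2 0 0) ⨾ swapMid ⨾ (Z 2 1 0 0 ⊠ Z 2 1 0 0)) := by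
  refine Proportional.symm ⟨3, by norm_num, ?_⟩
  ext o i
  obtain ⟨p, q, rfl⟩ := exists_two o
  obtain ⟨a, b, rfl⟩ := exists_two i
  have h1 : ∀ x y z w, interp (Z 2 1 0 0 ⊠ Z 2 1 0 0) ![p, q] ![x, y, z, w] =
      (if x = p ∧ y = p then 1 else 0) * (if z = q ∧ w = q then 1 else 0) := by
    intro x y z w
    rw [four_eq_append, two_eq_append p q, ← interp_merge, ← interp_merge]
    exact interp_tensor_append _ _ _ _ _ _
  have h2 : ∀ x y z w, interp (X 1 2 0 0 ⊠ X 1 2 0 0) ![x, z, y, w] ![a, b] =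
      (if a = x + z then 3 else 0) * (if b = y + w then 3 else 0) := by
    intro x y z w
    rw [four_eq_append, two_eq_append a b, ← interp_X_one_two, ← interp_X_one_two]
    exact interp_tensor_append _ _ _ _ _ _
  rw [Matrix.smul_apply, interp_comp_apply, sum_fin_four]
  simp only [interp_comp_isMap (e := ![0, 2, 1, 3]) (by decide) isMap_swapMid, four_comp, h1, h2]
  have h3 := sum_sum_copy (fun x z y w => (if a = x + z then 3 else 0) *
    (if b = y + w then 3 else 0)) p q
  have h4 : ∀ x, ∑ y, ∑ z, ∑ w, ((if x = p ∧ y = p then (1 : ℂ) else 0) *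
      (if z = q ∧ w = q then 1 else 0)) * ((if a = x + z then 3 else 0) *
        (if b = y + w then 3 else 0)) =
      ∑ z, ∑ y, ∑ w, ((if a = x + z then 3 else 0) * (if b = y + w then 3 else 0)) *
        ((if x = p ∧ y = p then 1 else 0) * (if z = q ∧ w = q then 1 else 0)) := by
    intro x
    rw [Finset.sum_comm]
    simp only [mul_comm]
  simp only [h4, h3]
  rw [interp_comp_apply, sum_fin_one]
  simp only [interp_merge, interp_X_one_two]
  generalize p + q = c
  simp only [Fin.sum_univ_three]
  fin_cases a <;> fin_cases b <;> fin_cases c <;> simp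

/-! ### Soundness: phases, colour change and Hadamard nodes -/

theorem prop_K1 (k : ZMod 3) : Proportional (X 1 1 (third k) (third (2 * k)) ⨾ Z 1 2 0 0)
    (Z 1 2 0 0 ⨾ (X 1 1 (third k) (third (2 * k)) ⊠ X 1 1 (third k) (third (2 * k)))) := by
  refine Proportional.symm ⟨3, by norm_num, ?_⟩
  ext o i
  obtain ⟨p, q, rfl⟩ := exists_two o
  obtain ⟨a, rfl⟩ := exists_one i
  rw [Matrix.smul_apply, interp_comp_apply, interp_comp_apply, sum_fin_two, sum_fin_one]
  simp only [interp_tensor_two, interp_X_one_one, interp_copy]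
  generalize Fin.ofNat 3 k.val = c
  simp only [Fin.sum_univ_three]
  fin_cases p <;> fin_cases q <;> fin_cases a <;> fin_cases c <;> simp

theorem prop_K1_flip (k : ZMod 3) : Proportional (Z 2 1 0 0 ⨾ X 1 1 (third k) (third (2 * k)))
    ((X 1 1 (third k) (third (2 * k)) ⊠ X 1 1 (third k) (third (2 * k))) ⨾ Z 2 1 0 0) := by
  refine Proportional.symm ⟨3, by norm_num, ?_⟩
  ext o i
  obtain ⟨p, q, rfl⟩ := exists_two i
  obtain ⟨a, rfl⟩ := exists_one o
  rw [Matrix.smul_apply, interp_comp_apply, interp_comp_apply, sum_fin_two, sum_fin_one]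
  simp only [interp_tensor_two, interp_X_one_one, interp_merge]
  generalize Fin.ofNat 3 k.val = c
  simp only [Fin.sum_univ_three]
  fin_cases p <;> fin_cases q <;> fin_cases a <;> fin_cases c <;> simp

theorem interp_phase (α β : Real.Angle) (a b : Fin 3) :
    interp (Z 1 1 α β) (fun _ => a) (fun _ => b) = if a = b then phase α β b else 0 := by
  rw [interp_Z]
  simp only [basis_const, mul_ite, mul_one, mul_zero, Finset.sum_ite_eq', Finset.mem_univ, if_true]
  split_ifs with h h' h' <;> simp_all

theorem prop_K2_one (α β : Real.Angle) : Proportional (Z 1 1 α β ⨾ X 1 1 (third 1) (third 2))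
    (X 1 1 (third 1) (third 2) ⨾ Z 1 1 (β - α) (-α)) := by
  refine ⟨α.toCircle, α.toCircle.coe_ne_zero, ?_⟩
  ext o i
  obtain ⟨a, rfl⟩ := exists_one o
  obtain ⟨b, rfl⟩ := exists_one i
  have h : ∀ a b : Fin 3, interp (X 1 1 (third 1) (third 2)) (fun _ => a) (fun _ => b) =
      if b = a + 1 then 3 else 0 := interp_X_one_one 1
  rw [Matrix.smul_apply, interp_comp_apply, interp_comp_apply, sum_fin_one, sum_fin_one]
  simp only [h, interp_phase, Fin.sum_univ_three]
  fin_cases a <;> fin_cases b <;>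
    simp [phase, sub_eq_add_neg, Real.Angle.toCircle_add, Real.Angle.toCircle_neg] <;> field_simp

theorem prop_K2_two (α β : Real.Angle) : Proportional (Z 1 1 α β ⨾ X 1 1 (third 2) (third 1))
    (X 1 1 (third 2) (third 1) ⨾ Z 1 1 (-β) (α - β)) := by
  refine ⟨β.toCircle, β.toCircle.coe_ne_zero, ?_⟩
  ext o i
  obtain ⟨a, rfl⟩ := exists_one o
  obtain ⟨b, rfl⟩ := exists_one i
  have h : ∀ a b : Fin 3, interp (X 1 1 (third 2) (third 1)) (fun _ => a) (fun _ => b) =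
      if b = a + 2 then 3 else 0 := interp_X_one_one 2
  rw [Matrix.smul_apply, interp_comp_apply, interp_comp_apply, sum_fin_one, sum_fin_one]
  simp only [h, interp_phase, Fin.sum_univ_three]
  fin_cases a <;> fin_cases b <;>
    simp [phase, sub_eq_add_neg, Real.Angle.toCircle_add, Real.Angle.toCircle_neg] <;> field_simp

theorem interp_H (a b : Fin 3) : interp H (fun _ => a) (fun _ => b) = ω ^ (a.val * b.val) := rfl

theorem interp_H_H (a b : Fin 3) :
    interp (H ⨾ H) (fun _ => a) (fun _ => b) = if a + b = 0 then 3 else 0 := by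
  have h : ∀ a b : Fin 3, 3 ∣ a.val + b.val ↔ a + b = 0 := by decide
  rw [interp_comp_apply, sum_fin_one, ← if_congr (h a b) rfl rfl, ← sum_omega]
  refine Finset.sum_congr rfl fun j _ => ?_
  rw [interp_H, interp_H, ← pow_add]
  congr 1
  ring

theorem interp_Hdag (a b : Fin 3) :
    interp Hdag (fun _ => a) (fun _ => b) = 3 * star ω ^ (a.val * b.val) := by
  rw [Hdag, interp_comp_apply, sum_fin_one, star_omega, ← pow_mul, omega_pow (2 * _)]
  simp only [interp_H_H, interp_H, Fin.sum_univ_three]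
  fin_cases a <;> fin_cases b <;> simp <;> first | ring1 | linear_combination 3 * ω * omega_cube

theorem prop_H1 : Proportional (H ⨾ Hdag) wire := by
  refine ⟨9, by norm_num, ?_⟩
  ext o i
  obtain ⟨a, rfl⟩ := exists_one o
  obtain ⟨b, rfl⟩ := exists_one i
  have e : H ⨾ Hdag = H ⨾ (H ⨾ H ⨾ H) := rfl
  have h1 : interp (H ⨾ (H ⨾ H ⨾ H)) = interp (H ⨾ H ⨾ (H ⨾ H)) := by
    simp only [interp, Matrix.mul_assoc]
  rw [e, h1, Matrix.smul_apply, interp_wire, interp_comp_apply, sum_fin_one]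
  simp only [interp_H_H, Fin.sum_univ_three]
  fin_cases a <;> fin_cases b <;> simp <;> norm_num

theorem prop_P1 : Proportional (H ⨾ H) (Hdag ⨾ Hdag) := by
  refine Proportional.symm ⟨9, by norm_num, ?_⟩
  ext o i
  obtain ⟨a, rfl⟩ := exists_one o
  obtain ⟨b, rfl⟩ := exists_one i
  have e : Hdag ⨾ Hdag = H ⨾ H ⨾ H ⨾ (H ⨾ H ⨾ H) := rfl
  have h1 : interp (H ⨾ H ⨾ H ⨾ (H ⨾ H ⨾ H)) = interp (H ⨾ H ⨾ (H ⨾ H) ⨾ (H ⨾ H)) := by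
    simp only [interp, Matrix.mul_assoc]
  rw [e, h1, Matrix.smul_apply, interp_comp_apply, sum_fin_one]
  simp only [interp_comp_apply (H ⨾ H) (H ⨾ H), sum_fin_one, interp_H_H, Fin.sum_univ_three]
  fin_cases a <;> fin_cases b <;> simp <;> norm_num

/-- The factor `ω ^ 2 - ω` is a quadratic Gauss sum. -/
theorem prop_EU : Proportional H (Z 1 1 (third 2) (third 2) ⨾ X 1 1 (third 2) (third 2) ⨾
    Z 1 1 (third 2) (third 2)) := by
  have h3 := omega_sum
  have h4 := omega_cube
  refine Proportional.symm ⟨ω ^ 2 - ω, fun h => ?_, ?_⟩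
  · have h5 : (3 : ℂ) = 0 := by linear_combination (-(ω ^ 2) + ω) * h + (ω - 2) * h4 + h3
    norm_num at h5
  ext o i
  obtain ⟨a, rfl⟩ := exists_one o
  obtain ⟨b, rfl⟩ := exists_one i
  have hX : interp (X 1 1 (third 2) (third 2)) (fun _ => a) (fun _ => b) =
      ∑ j : Fin 3, phase (third 2) (third 2) j * (ω ^ (j.val * a.val) *
          ω ^ (2 * (j.val * b.val))) := by
    rw [interp, Matrix.of_apply]
    refine Finset.sum_congr rfl fun j _ => ?_
    simp only [Finset.univ_unique, Finset.prod_singleton, star_omega, ← pow_mul]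
  have hp : ∀ j, phase (third 2) (third 2) j = if j = 0 then 1 else ω ^ 2 := by
    intro j
    fin_cases j
    · simp [phase]
    · simp [phase, toCircle_third]
      rfl
    · simp [phase, toCircle_third]
      rfl
  have h : interp (Z 1 1 (third 2) (third 2) ⨾ X 1 1 (third 2) (third 2) ⨾
      Z 1 1 (third 2) (third 2)) (fun _ => a) (fun _ => b) = phase (third 2) (third 2) a *
        (interp (X 1 1 (third 2) (third 2)) (fun _ => a) (fun _ => b) *
          phase (third 2) (third 2) b) := by
    rw [interp_comp_apply, sum_fin_one]
    simp only [interp_comp_apply, sum_fin_one, interp_phase, ite_mul, zero_mul, mul_ite, mul_zero,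
      Finset.sum_ite_eq, Finset.sum_ite_eq', Finset.mem_univ, if_true]
  rw [h, hX, Matrix.smul_apply, interp_H, smul_eq_mul]
  simp only [hp, Fin.sum_univ_three]
  clear h hX hp
  fin_cases a <;> fin_cases b <;> simp <;> grind

theorem interp_parallel (A : ZX 1 1) : (n : ℕ) → (o i : Fin n → Fin 3) →
    interp (parallel n fun _ => A) o i = ∏ k, interp A (fun _ => o k) (fun _ => i k)
  | 0, o, i => by
    rw [Subsingleton.elim o i]
    exact Matrix.one_apply_eq i
  | n + 1, o, i => by
    rw [Fin.prod_univ_castSucc, parallel, interp_tensor_apply, interp_parallel A n]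
    congr 1
    congr 1 <;> funext k <;> rw [Subsingleton.elim k 0] <;> rfl

theorem interp_conj_spider (A B : ZX 1 1) (n m : ℕ) (α β : Real.Angle) (o : Fin m → Fin 3)
    (i : Fin n → Fin 3) :
    interp (parallel n (fun _ => A) ⨾ Z n m α β ⨾ parallel m (fun _ => B)) o i =
      ∑ j, phase α β j * ((∏ k, interp B (fun _ => o k) (fun _ => j)) *
        ∏ k, interp A (fun _ => j) (fun _ => i k)) := by
  have h1 : ∀ w, interp (parallel n (fun _ => A) ⨾ Z n m α β) w i =
      ∑ j, phase α β j * (∏ k, interp A (fun _ => j) (fun _ => i k)) * basis j w := by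
    intro w
    rw [interp_comp_apply]
    simp only [interp_Z, Finset.sum_mul]
    rw [Finset.sum_comm]
    refine Finset.sum_congr rfl fun j _ => ?_
    rw [← interp_parallel A n (fun _ => j) i,
      ← sum_mul_basis j fun x => interp (parallel n fun _ => A) x i, Finset.mul_sum,
      Finset.sum_mul]
    refine Finset.sum_congr rfl fun x _ => ?_
    ring
  rw [interp_comp_apply]
  simp only [h1, Finset.mul_sum]
  rw [Finset.sum_comm]
  refine Finset.sum_congr rfl fun j _ => ?_
  rw [← interp_parallel B m o fun _ => j,
    ← sum_mul_basis j fun x => interp (parallel m fun _ => B) o x, Finset.sum_mul, Finset.mul_sum]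
  refine Finset.sum_congr rfl fun x _ => ?_
  ring

theorem prop_H2 (n m : ℕ) (α β : Real.Angle) : Proportional (X n m α β)
    (parallel n (fun _ => Hdag) ⨾ Z n m α β ⨾ parallel m (fun _ => H)) := by
  refine Proportional.symm ⟨3 ^ n, pow_ne_zero _ (by norm_num), ?_⟩
  ext o i
  rw [interp_conj_spider, Matrix.smul_apply, interp, Matrix.of_apply, smul_eq_mul, Finset.mul_sum]
  refine Finset.sum_congr rfl fun j _ => ?_
  simp only [interp_H, interp_Hdag, Finset.prod_mul_distrib, Finset.prod_const, Finset.card_univ,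
    Fintype.card_fin]
  simp only [fun k => mul_comm (o k).val j.val]
  ring

theorem prop_H2' (n m : ℕ) (α β : Real.Angle) : Proportional (X n m β α)
    (parallel n (fun _ => H) ⨾ Z n m α β ⨾ parallel m (fun _ => Hdag)) := by
  refine Proportional.symm ⟨3 ^ m, pow_ne_zero _ (by norm_num), ?_⟩
  ext o i
  have h1 : ∀ a : Fin 3, star ω ^ (a.val * 1) = ω ^ (2 * a.val) := fun a => by
    rw [star_omega, mul_one, pow_mul]
  have h2 : ∀ a : Fin 3, star ω ^ (a.val * 2) = ω ^ (1 * a.val) := fun a => by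
    rw [star_omega, mul_comm, pow_mul, ← pow_mul ω 2 2, pow_succ ω 3, omega_cube, one_mul, one_mul]
  have h3 : ∀ a : Fin 3, star ω ^ (1 * a.val) = ω ^ (2 * a.val) := fun a => by
    rw [one_mul, ← h1, mul_one]
  have h4 : ∀ a : Fin 3, star ω ^ (2 * a.val) = ω ^ (1 * a.val) := fun a => by
    rw [mul_comm, h2]
  rw [interp_conj_spider, Matrix.smul_apply, interp, Matrix.of_apply, smul_eq_mul]
  simp only [interp_H, interp_Hdag, Finset.prod_mul_distrib, Finset.prod_const, Finset.card_univ,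
    Fintype.card_fin, Fin.sum_univ_three, Fin.val_zero, Fin.val_one, Fin.val_two, h1, h2, h3, h4]
  simp [phase]
  ring

/-! ### Soundness up to scalars -/

/-- Rewriting changes interpretations by non-zero factors only. -/
theorem ZXEq.prop {n m : ℕ} {D E : ZX n m} (h : ZXEq D E) : Proportional D E := by
  induction h with
  | refl D => exact .of_eq rfl
  | symm _ ih => exact ih.symm
  | trans _ _ ih ih' => exact ih.trans ih'
  | comp_congr _ _ ih ih' => exact ih.comp ih'
  | tensor_congr _ _ ih ih' => exact ih.tensor ih'
  | wires_comp D => exact .of_eq (by rw [interp, interp_wires, Matrix.mul_one])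
  | comp_wires D => exact .of_eq (by rw [interp, interp_wires, Matrix.one_mul])
  | comp_assoc A B C => exact .of_eq (by simp only [interp, Matrix.mul_assoc])
  | empty_tensor D => exact .of_eq (interp_empty_tensor D)
  | tensor_empty D => exact .of_eq (interp_tensor_empty D)
  | tensor_assoc A B C => exact .of_eq (interp_tensor_assoc A B C)
  | interchange A B A' B' => exact .of_eq (interp_interchange A B A' B')
  | swap_swap => exact .of_eq interp_swap_swap
  | slide D => exact .of_eq (interp_slide D)
  | cap_swap => exact .of_eq interp_cap_swap
  | swap_cup => exact .of_eq interp_swap_cup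
  | snake_left => exact .of_eq interp_snake_left
  | snake_right => exact .of_eq interp_snake_right
  | S1 n m n' m' k α β γ δ => exact .of_eq (interp_S1 n m n' m' k α β γ δ)
  | S1_out n m m' α β => exact .of_eq (interp_S1_out n m m' α β)
  | S1_in n n' m α β => exact .of_eq (interp_S1_in n n' m α β)
  | S2 => exact .of_eq interp_S2
  | S3_cap => exact .of_eq interp_S3_cap
  | S3_cup => exact .of_eq interp_S3_cup
  | B1 => exact prop_B1
  | B1_flip => exact prop_B1_flip
  | B2 => exact prop_B2
  | B2_flip => exact prop_B2_flip
  | K1 k => exact prop_K1 k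
  | K1_flip k => exact prop_K1_flip k
  | K2_one α β => exact prop_K2_one α β
  | K2_two α β => exact prop_K2_two α β
  | H1 => exact prop_H1
  | EU => exact prop_EU
  | H2 n m α β => exact prop_H2 n m α β
  | H2' n m α β => exact prop_H2' n m α β
  | P1 => exact prop_P1
  | scalar s t hs ht _ ih => exact prop_of_scalar hs ht ih

theorem IsZero.interp_eq_zero {n m : ℕ} {D : ZX n m} (h : IsZero (q D)) : interp D = 0 := by
  obtain ⟨E, hE, h0⟩ := h
  obtain ⟨c, _, hc⟩ := (q_eq.1 hE.symm).prop
  rw [hc, h0, smul_zero]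

end ZX

theorem mainTheorem8 (n : ℕ) (D : ZX 0 n) (hD : D.IsStabilizer) (hD0 : D.interp ≠ 0) :
    ∃ G R : ZX 0 n,
      G.IsGSLC ∧ ZX.ZXEq D G ∧ R.IsReducedGSLC ∧ ZX.ZXEq G R := by
  rcases ZX.q_mem_Stab hD with h | h
  · obtain ⟨R, hR, h⟩ := ZX.exists_reduced h
    obtain ⟨Γ, U, h1, h2, -, -, h3⟩ := id hR
    -- a reduced GS-LC diagram is a GS-LC diagram, so one diagram serves for both steps
    exact ⟨R, R, ⟨Γ, U, h1, h2, h3⟩, ZX.q_eq.1 h.symm, hR, ZX.ZXEq.refl R⟩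
  · exact absurd h.interp_eq_zero hD0
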